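/- Theorem (3-SUM has a $(\tilde O(n^{1.5}),\tilde O(n^2))$ pseudo-deterministic proof). An input of 3-SUM of size $n$ consists of three lists $a=(a_1,\dots,a_n)$, $b=(b_1,\dots,b_n)$, $c=(c_1,\dots,c_n)$ of integers with $O(\log n)$ bits, i.e. of absolute value less than $2^{d(\lfloor\log_2 n\rfloor+1)}$ for a fixed $d$. A solution is a triple of positions $(i,j,k)$ with $a_i+b_j+c_k=0$; the canonical solution is the lexicographically first one. Time is the number of steps of a program on a word RAM whose words have $O(\log n)$ bits, and $\tilde O(g)$ means $O(g\cdot(\log n)^{r})$ for some constant $r$. For every $d$ there are a deterministic verifier $V$ and a probabilistic prover $P$ who sends a single message, such that: 1. (Time) On every input of size $n$, $V$ runs in time $\tilde O(n^{1.5})$, whatever message it receives, and $P$ runs in expected time $\tilde O(n^2)$. 2. (Canonical completeness) If the input has a solution, then with probability $1$ the prover $P$ halts, and on its message $V$ outputs the canonical solution. 3. (Canonical soundness) If the input has a solution, then on every message $V$ outputs the canonical solution or $\bot$. 4. (Standard soundness) If the input has no solution, then on every message $V$ outputs $\bot$. Moreover, the message consists of a triple $(i,j,k)$ and three certificates, and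 there is a deterministic certificate verifier $W$ that runs in time $\tilde O(n^{1.5})$ on three lists of at most $n$ integers of the above size together with any certificate, such that some certificate is accepted by $W$ if and only if the three lists contain no zero-sum triple (one entry from each list). The verifier $V$ outputs $(i,j,k)$ if $i,j,k$ are valid positions, $a_i+b_j+c_k=0$, and $W$ accepts the three certificates for the respective prefix instances $$(a_1,\dots,a_{i-1}),\,b,\,c;\qquad (a_i),\,(b_1,\dots,b_{j-1}),\,c;\qquad (a_i),\,(b_j),\,(c_1,\dots,c_{k-1});$$ otherwise it outputs $\bot$. -/

import Mathlib

open MeasureTheory Filter Asymptotics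
open scoped ENNReal

/-! ### The word RAM

A program is a fixed finite text. It works on words of `w` bits, held in registers and in random-access
arrays of `2 ^ w` words each; a program text names finitely many registers and arrays.
Every arithmetic operation, comparison, memory access, assignment, test and coin toss takes one step. -/

namespace WordRAM

/-- The operations on words: arithmetic is modulo `2 ^ w`, division, remainder and comparison are
those of unsigned words, and a comparison returns the word `1` or `0`. -/
inductive Op
  | add | sub | mul | div | mod | lt | eq

def Op.eval {w : ℕ} : Op → BitVec w → BitVec w → BitVec w
  | .add, a, b => a + b
  | .sub, a, b => a - b
  | .mul, a, b => a * b
  | .div, a, b => a / b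
  | .mod, a, b => a % b
  | .lt, a, b => if a < b then BitVec.ofNat w 1 else BitVec.ofNat w 0
  | .eq, a, b => if a = b then BitVec.ofNat w 1 else BitVec.ofNat w 0

/-- Expressions: constants, registers, array entries, and operations. -/
inductive Expr
  | lit (c : ℕ)
  | reg (x : ℕ)
  | get (A : ℕ) (e : Expr)
  | op (o : Op) (e₁ e₂ : Expr)

/-- Programs. The instruction `toss x` puts the outcome of a fair coin toss, `0` or `1`, into
register `x`. -/
inductive Prog
  | skip
  | assign (x : ℕ) (e : Expr)
  | store (A : ℕ) (addr val : Expr)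
  | toss (x : ℕ)
  | seq (p q : Prog)
  | ite (e : Expr) (p q : Prog)
  | loop (e : Expr) (p : Prog)

/-- The program never tosses a coin. -/
def Prog.CoinFree : Prog → Prop
  | .skip => True
  | .assign _ _ => True
  | .store _ _ _ => True
  | .toss _ => False
  | .seq p q => p.CoinFree ∧ q.CoinFree
  | .ite _ p q => p.CoinFree ∧ q.CoinFree
  | .loop _ p => p.CoinFree

/-- A memory state: contents of the registers and of the arrays, and the number of coins used. -/
structure State (w : ℕ) where
  reg : ℕ → BitVec w
  mem : ℕ → BitVec w → BitVec w
  coins : ℕ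

/-- The state with the given words in registers `0, 1, …` and the given strings of words in
arrays `0, 1, …`; everything else is `0`. -/
def State.init {w : ℕ} (rs : List (BitVec w)) (as : List (List (BitVec w))) : State w where
  reg x := rs.getD x 0
  mem A i := (as.getD A []).getD i.toNat 0
  coins := 0

/-- The string formed by the first `len` entries of array `A`. -/
def State.read {w : ℕ} (s : State w) (A : ℕ) (len : BitVec w) : List (BitVec w) :=
  (List.range len.toNat).map fun i => s.mem A (BitVec.ofNat w i)

def Expr.eval {w : ℕ} (s : State w) : Expr → BitVec w
  | .lit c => BitVec.ofNat w c
  | .reg x => s.reg x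
  | .get A e => s.mem A (e.eval s)
  | .op o e₁ e₂ => o.eval (e₁.eval s) (e₂.eval s)

/-- The number of steps taken by the evaluation of an expression. -/
def Expr.cost : Expr → ℕ
  | .lit _ => 1
  | .reg _ => 1
  | .get _ e => e.cost + 1
  | .op _ e₁ e₂ => e₁.cost + e₂.cost + 1

/-- `Exec ω p s s' t`: with the coin tosses `ω`, program `p` started in state `s` halts in state
`s'` after `t` steps. -/
inductive Exec {w : ℕ} (ω : ℕ → Bool) : Prog → State w → State w → ℕ → Prop
  | skip (s : State w) : Exec ω .skip s s 1
  | assign (s : State w) (x : ℕ) (e : Expr) :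
      Exec ω (.assign x e) s { s with reg := Function.update s.reg x (e.eval s) } (e.cost + 1)
  | store (s : State w) (A : ℕ) (e v : Expr) :
      Exec ω (.store A e v) s
        { s with mem := Function.update s.mem A
                  (Function.update (s.mem A) (e.eval s) (v.eval s)) }
        (e.cost + v.cost + 1)
  | toss (s : State w) (x : ℕ) :
      Exec ω (.toss x) s
        { s with reg := Function.update s.reg x (BitVec.ofNat w (ω s.coins).toNat)
                 coins := s.coins + 1 } 1
  | seq {p q : Prog} {s s₁ s₂ : State w} {t₁ t₂ : ℕ} :
      Exec ω p s s₁ t₁ → Exec ω q s₁ s₂ t₂ → Exec ω (.seq p q) s s₂ (t₁ + t₂)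
  | ite_true {e : Expr} {p q : Prog} {s s₁ : State w} {t : ℕ} :
      e.eval s ≠ 0 → Exec ω p s s₁ t → Exec ω (.ite e p q) s s₁ (e.cost + 1 + t)
  | ite_false {e : Expr} {p q : Prog} {s s₁ : State w} {t : ℕ} :
      e.eval s = 0 → Exec ω q s s₁ t → Exec ω (.ite e p q) s s₁ (e.cost + 1 + t)
  | loop_true {e : Expr} {p : Prog} {s s₁ s₂ : State w} {t₁ t₂ : ℕ} :
      e.eval s ≠ 0 → Exec ω p s s₁ t₁ → Exec ω (.loop e p) s₁ s₂ t₂ →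
      Exec ω (.loop e p) s s₂ (e.cost + 1 + t₁ + t₂)
  | loop_false {e : Expr} {p : Prog} {s : State w} :
      e.eval s = 0 → Exec ω (.loop e p) s s (e.cost + 1)

/-- `Halts p s s' t`: the coin-free program `p` started in `s` halts in `s'` after `t` steps. -/
def Halts {w : ℕ} (p : Prog) (s s' : State w) (t : ℕ) : Prop :=
  Exec (fun _ => false) p s s' t

/-- The number of steps of `p` started in `s` with the coin tosses `ω`; `∞` if it never halts. -/
noncomputable def runTime {w : ℕ} (p : Prog) (s : State w) (ω : ℕ → Bool) : ℝ≥0∞ :=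
  ⨅ (t : ℕ) (_ : ∃ s', Exec ω p s s' t), (t : ℝ≥0∞)

/-- The law of an infinite sequence of independent fair coin tosses. -/
noncomputable def coinTosses : Measure (ℕ → Bool) :=
  Measure.infinitePi fun _ => (PMF.uniformOfFintype Bool).toMeasure

end WordRAM

/-- `f = Õ(g)`: `f` is bounded by `g` up to a constant and a power of the logarithm. -/
def IsSoftO (f g : ℕ → ℝ) : Prop :=
  ∃ k : ℕ, f =O[atTop] fun n => g n * Real.log n ^ k

/-! ### 3-SUM -/

namespace ThreeSum

open WordRAM

/-- Three lists of integers. -/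
structure Lists where
  a : List ℤ
  b : List ℤ
  c : List ℤ

/-- The number of binary digits of `n` (one digit for `n = 0`). -/
def digits (n : ℕ) : ℕ := Nat.log 2 n + 1

/-- All entries have at most `d * digits n` binary digits. -/
def Lists.Bounded (x : Lists) (n d : ℕ) : Prop :=
  ∀ u ∈ x.a ++ x.b ++ x.c, |u| < 2 ^ (d * digits n)

/-- The inputs of 3-SUM of size `n`: three lists of `n` integers with `d * digits n` bits. -/
def Lists.IsInput (x : Lists) (n d : ℕ) : Prop :=
  x.a.length = n ∧ x.b.length = n ∧ x.c.length = n ∧ x.Bounded n d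

/-- Three lists of at most `n` integers with `d * digits n` bits. -/
def Lists.IsSubInput (x : Lists) (n d : ℕ) : Prop :=
  x.a.length ≤ n ∧ x.b.length ≤ n ∧ x.c.length ≤ n ∧ x.Bounded n d

/-- The triples of positions, counted from `0`. -/
abbrev Triple := ℕ × ℕ × ℕ

/-- The search problem: the entries at the positions `y` exist and their sum is zero. -/
def IsZeroSum (x : Lists) (y : Triple) : Prop :=
  ∃ u v z : ℤ, x.a[y.1]? = some u ∧ x.b[y.2.1]? = some v ∧ x.c[y.2.2]? = some z ∧ u + v + z = 0

def Solvable (x : Lists) : Prop := ∃ y, IsZeroSum x y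

/-- `y` is strictly before `y'` lexicographically. -/
def LexBefore (y y' : Triple) : Prop :=
  y.1 < y'.1 ∨ (y.1 = y'.1 ∧ y.2.1 < y'.2.1) ∨
    (y.1 = y'.1 ∧ y.2.1 = y'.2.1 ∧ y.2.2 < y'.2.2)

/-- `y` is the lexicographically first zero-sum triple. -/
def IsLexFirst (x : Lists) (y : Triple) : Prop :=
  IsZeroSum x y ∧ ∀ y', IsZeroSum x y' → y' ≠ y → LexBefore y y'

/-- `(a_0, …, a_{i-1}), b, c`. -/
def Lists.prefix₁ (x : Lists) (y : Triple) : Lists := ⟨x.a.take y.1, x.b, x.c⟩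

/-- `(a_i), (b_0, …, b_{j-1}), c`. -/
def Lists.prefix₂ (x : Lists) (y : Triple) : Lists := ⟨x.a[y.1]?.toList, x.b.take y.2.1, x.c⟩

/-- `(a_i), (b_j), (c_0, …, c_{k-1})`. -/
def Lists.prefix₃ (x : Lists) (y : Triple) : Lists :=
  ⟨x.a[y.1]?.toList, x.b[y.2.1]?.toList, x.c.take y.2.2⟩

/-- The three lists as strings of words, each integer in two's complement. -/
def Lists.encode (w : ℕ) (x : Lists) : List (List (BitVec w)) :=
  [x.a.map (BitVec.ofInt w), x.b.map (BitVec.ofInt w), x.c.map (BitVec.ofInt w)]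

/-! #### Nondeterministic proofs that there is no solution -/

/-- The start of a certificate verifier: registers `0, …, 4` hold `n`, the lengths of the lists and
the length of the certificate `π`; arrays `0, 1, 2` hold the lists and array `3` holds `π`. -/
def certStart (w n : ℕ) (x : Lists) (π : List (BitVec w)) : State w :=
  State.init
    [BitVec.ofNat w n, BitVec.ofNat w x.a.length, BitVec.ofNat w x.b.length,
      BitVec.ofNat w x.c.length, BitVec.ofNat w π.length]
    (x.encode w ++ [π])

/-- The certificate verifier `W` accepts: it halts with a nonzero word in register `0`. -/
def CertAccepts (w : ℕ) (W : Prog) (n : ℕ) (x : Lists) (π : List (BitVec w)) : Prop :=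
  ∃ s t, Halts W (certStart w n x π) s t ∧ s.reg 0 ≠ 0

/-- `W` is the verifier, running in time `T`, of a nondeterministic proof that three lists of at
most `n` integers have no zero-sum triple. Words have `κ * digits n` bits. -/
structure IsNoSolutionProof (d κ : ℕ) (W : Prog) (T : ℕ → ℝ) : Prop where
  coinFree : W.CoinFree
  time : ∀ (n : ℕ) (x : Lists), x.IsSubInput n d →
    ∀ π : List (BitVec (κ * digits n)), π.length < 2 ^ (κ * digits n) →
      ∃ s t, Halts W (certStart _ n x π) s t ∧ (t : ℝ) ≤ T n
  complete : ∀ (n : ℕ) (x : Lists), x.IsSubInput n d → ¬ Solvable x →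
    ∃ π : List (BitVec (κ * digits n)), π.length < 2 ^ (κ * digits n) ∧ CertAccepts _ W n x π
  sound : ∀ (n : ℕ) (x : Lists), x.IsSubInput n d → Solvable x →
    ∀ π : List (BitVec (κ * digits n)), π.length < 2 ^ (κ * digits n) → ¬ CertAccepts _ W n x π

/-! #### Pseudo-deterministic proofs -/

/-- A message of the prover: three words and three strings of words. -/
structure Message (w : ℕ) where
  i : BitVec w
  j : BitVec w
  k : BitVec w
  π₁ : List (BitVec w)
  π₂ : List (BitVec w)
  π₃ : List (BitVec w)

/-- The length of each string is a word. -/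
def Message.Fits {w : ℕ} (m : Message w) : Prop :=
  m.π₁.length < 2 ^ w ∧ m.π₂.length < 2 ^ w ∧ m.π₃.length < 2 ^ w

def Message.triple {w : ℕ} (m : Message w) : Triple := (m.i.toNat, m.j.toNat, m.k.toNat)

/-- The start of the prover: register `0` holds `n` and arrays `0, 1, 2` hold the lists. -/
def proverStart (w n : ℕ) (x : Lists) : State w :=
  State.init [BitVec.ofNat w n] (x.encode w)

/-- The message in a final state of the prover: the three words are in registers `1, 2, 3`, the
lengths of the strings in registers `4, 5, 6`, and the strings in arrays `3, 4, 5`. -/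
def messageOf {w : ℕ} (s : State w) : Message w where
  i := s.reg 1
  j := s.reg 2
  k := s.reg 3
  π₁ := s.read 3 (s.reg 4)
  π₂ := s.read 4 (s.reg 5)
  π₃ := s.read 5 (s.reg 6)

/-- With coin tosses `ω`, the prover `P` halts and sends the message `m`. -/
def Sends (w : ℕ) (P : Prog) (n : ℕ) (x : Lists) (ω : ℕ → Bool) (m : Message w) : Prop :=
  ∃ s t, Exec ω P (proverStart w n x) s t ∧ messageOf s = m

/-- The start of the verifier: the input and the message, in the same places as for the prover. -/
def verifierStart (w n : ℕ) (x : Lists) (m : Message w) : State w :=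
  State.init
    [BitVec.ofNat w n, m.i, m.j, m.k, BitVec.ofNat w m.π₁.length, BitVec.ofNat w m.π₂.length,
      BitVec.ofNat w m.π₃.length]
    (x.encode w ++ [m.π₁, m.π₂, m.π₃])

/-- The output in a final state of the verifier: `none` (that is, `⊥`) if register `0` is zero, and
otherwise the triple of positions in registers `1, 2, 3`. -/
def outputOf {w : ℕ} (s : State w) : Option Triple :=
  if s.reg 0 = 0 then none else some ((s.reg 1).toNat, (s.reg 2).toNat, (s.reg 3).toNat)

/-- On input `x` and message `m`, the verifier `V` halts with output `o`. -/
def Outputs (w : ℕ) (V : Prog) (n : ℕ) (x : Lists) (m : Message w) (o : Option Triple) : Prop :=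
  ∃ s t, Halts V (verifierStart w n x m) s t ∧ outputOf s = o

/-- The coin-free verifier `V` and the probabilistic prover `P`, who sends one message, form a
`(T₁, T₂)` pseudo-deterministic proof for 3-SUM with canonical solutions `c`. Words have
`κ * digits n` bits. The verifier takes time at most `T₁ n` whatever the message is, and the prover
takes expected time at most `T₂ n`. -/
structure IsPseudoDeterministicProof (d κ : ℕ) (V P : Prog) (c : Lists → Triple)
    (T₁ T₂ : ℕ → ℝ) : Prop where
  coinFree : V.CoinFree
  verifier_time : ∀ (n : ℕ) (x : Lists), x.IsInput n d →
    ∀ m : Message (κ * digits n), m.Fits →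
      ∃ s t, Halts V (verifierStart _ n x m) s t ∧ (t : ℝ) ≤ T₁ n
  prover_time : ∀ (n : ℕ) (x : Lists), x.IsInput n d →
    ∫⁻ ω, runTime P (proverStart (κ * digits n) n x) ω ∂coinTosses ≤ ENNReal.ofReal (T₂ n)
  canonical : ∀ (n : ℕ) (x : Lists), x.IsInput n d → Solvable x → IsZeroSum x (c x)
  completeness : ∀ (n : ℕ) (x : Lists), x.IsInput n d → Solvable x →
    ∀ᵐ ω ∂coinTosses, ∃ m : Message (κ * digits n),
      Sends _ P n x ω m ∧ Outputs _ V n x m (some (c x))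
  canonical_soundness : ∀ (n : ℕ) (x : Lists), x.IsInput n d → Solvable x →
    ∀ m : Message (κ * digits n), m.Fits →
      Outputs _ V n x m (some (c x)) ∨ Outputs _ V n x m none
  soundness : ∀ (n : ℕ) (x : Lists), x.IsInput n d → ¬ Solvable x →
    ∀ m : Message (κ * digits n), m.Fits → Outputs _ V n x m none

/-- The verifier `V` accepts exactly the messages that consist of a zero-sum triple and of three
certificates, accepted by `W`, that the three prefix instances have no solution, and then it outputs
the triple. -/
def ChecksPrefixes (d κ : ℕ) (W V : Prog) : Prop :=
  ∀ (n : ℕ) (x : Lists), x.IsInput n d →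
    ∀ m : Message (κ * digits n), m.Fits → ∀ y : Triple,
      Outputs _ V n x m (some y) ↔
        y = m.triple ∧ IsZeroSum x y ∧
          CertAccepts _ W n (x.prefix₁ y) m.π₁ ∧
          CertAccepts _ W n (x.prefix₂ y) m.π₂ ∧
          CertAccepts _ W n (x.prefix₃ y) m.π₃

end ThreeSum

/-! A certificate that three lists contain no zero-sum triple is a modulus `p` of size at most
2^(3h), about n^1.5, where h is `halfDigits n`, followed by a strictly increasing list of codes of
all triples whose sum vanishes modulo `p`. The verifier counts these triples by itself and checks
that the list has exactly this length, that every listed sum vanishes modulo `p`, and that none of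
them is zero. A true zero-sum triple would be one more triple vanishing modulo `p`, so it cannot
coexist with an accepted list (`Inst.Certifies.not_isSol`).

Short certificates exist by averaging. If no triple is zero-sum and all sums have at most M bits,
every sum has at most M prime factors, while at least 2^h / (2h) primes are at most 2^h
(`two_pow_le_primeCounting`). Hence any modulus p can be multiplied by some l ≤ 2^h so that the
number of surviving triples drops by the factor 2^h / (2hM) (`Inst.exists_count_mul_le`). Three such
steps, from p = 1 and at most 2^(6h) triples, leave at most 2^(3h) (2hM)^3 triples. The prover finds
each factor by trying all l ≤ 2^h; this takes about √n counts of cost Õ(n^1.5), hence Õ(n^2) in all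
and no randomness (`run_modulusProg`). Bucketing the third list by residues then lists the surviving
triples in time O(n^2) plus terms linear in the modulus and in the length of the list.

The count has to be exact and deterministic on words. In terms of histograms of residues it is a
trilinear form ∑ A_t B_u C_(t+u), with C extended antiperiodically, that is, a form over ℤ[X]/(X^N +
1) (`total_hist`). It is evaluated in the manner of Schönhage and Nussbaumer: with Z = X^s, an
element is a polynomial of degree less than s in X over ℤ[Z]/(Z^r + 1), a ring in which a power of Z
is a root of unity and multiplication by it is a signed shift. All three arguments are transformed
forwards, and by `orthogonality` the form is merely multiplied by the length of the transform
(`sum_transform`, `total_transform`). So there is neither an inverse transform nor a division inside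
the recursion. The exponent of the block length is halved at each level while the total size
doubles, which keeps the overhead polylogarithmic (`run_levels`). Entries are only known modulo 2^w,
but the final value, the count times the accumulated factor, is below 2^w, and one division recovers
the count (`run_countProg`).

Pseudo-determinism comes from `isLexFirst_iff`: a solution is the lexicographically first one if and
only if three prefix instances have no solution. Three certificates therefore determine the output
whatever the message is. The prover finds the first solution by n^2 lookups in a directly addressed
table (`run_searchProg`).

The remaining work is program verification. `Run` is a Hoare triple with a time bound, `Frame`
records what a program leaves alone, and renaming arrays (`Run.map`) allows the same certificate
programs to run on the different prefix instances. -/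

namespace WordRAM

/-! ### Expressions -/

instance : Add Expr := ⟨.op .add⟩
instance : Sub Expr := ⟨.op .sub⟩
instance : Mul Expr := ⟨.op .mul⟩
instance : Div Expr := ⟨.op .div⟩
instance : Mod Expr := ⟨.op .mod⟩
instance (n : ℕ) : OfNat Expr n := ⟨.lit n⟩

abbrev Expr.lt (a b : Expr) : Expr := .op .lt a b
abbrev Expr.eq (a b : Expr) : Expr := .op .eq a b

variable {w : ℕ}

@[simp] theorem Expr.eval_reg (s : State w) (x : ℕ) : (Expr.reg x).eval s = s.reg x := rfl
@[simp] theorem Expr.eval_get (s : State w) (A : ℕ) (e : Expr) :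
    (Expr.get A e).eval s = s.mem A (e.eval s) := rfl
@[simp] theorem Expr.eval_add (s : State w) (a b : Expr) :
    (a + b).eval s = a.eval s + b.eval s := rfl
@[simp] theorem Expr.eval_sub (s : State w) (a b : Expr) :
    (a - b).eval s = a.eval s - b.eval s := rfl
@[simp] theorem Expr.eval_mul (s : State w) (a b : Expr) :
    (a * b).eval s = a.eval s * b.eval s := rfl
@[simp] theorem Expr.eval_div (s : State w) (a b : Expr) :
    (a / b).eval s = a.eval s / b.eval s := rfl
@[simp] theorem Expr.eval_mod (s : State w) (a b : Expr) :
    (a % b).eval s = a.eval s % b.eval s := rfl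
@[simp] theorem Expr.eval_ofNat (s : State w) (n : ℕ) [n.AtLeastTwo] :
    (OfNat.ofNat n : Expr).eval s = BitVec.ofNat w n := rfl
@[simp] theorem Expr.eval_zero (s : State w) : (0 : Expr).eval s = BitVec.ofNat w 0 := rfl
@[simp] theorem Expr.eval_one (s : State w) : (1 : Expr).eval s = BitVec.ofNat w 1 := rfl

/-- The value of an expression as a natural number. -/
def Expr.val (s : State w) (e : Expr) : ℕ := (e.eval s).toNat

/-- The content of a register as a natural number. -/
def State.rval (s : State w) (x : ℕ) : ℕ := (s.reg x).toNat

/-- The entry of an array as a natural number. -/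
def State.arr (s : State w) (A i : ℕ) : ℕ := (s.mem A (BitVec.ofNat w i)).toNat

theorem State.rval_lt (s : State w) (x : ℕ) : s.rval x < 2 ^ w := (s.reg x).isLt

theorem Expr.eval_eq (s : State w) (e : Expr) : e.eval s = BitVec.ofNat w (e.val s) := by
  simp [Expr.val]

theorem State.reg_eq (s : State w) (x : ℕ) : s.reg x = BitVec.ofNat w (s.rval x) := by
  simp [State.rval]

@[simp] theorem Expr.val_reg (s : State w) (x : ℕ) : (Expr.reg x).val s = s.rval x := rfl
@[simp] theorem Expr.val_get (s : State w) (A : ℕ) (e : Expr) :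
    (Expr.get A e).val s = s.arr A (e.val s) := by
  simp [Expr.val, State.arr]
@[simp] theorem Expr.val_div (s : State w) (a b : Expr) :
    (a / b).val s = a.val s / b.val s := by simp [Expr.val]
@[simp] theorem Expr.val_mod (s : State w) (a b : Expr) :
    (a % b).val s = a.val s % b.val s := by simp [Expr.val]
theorem Expr.val_add (s : State w) (a b : Expr) (h : a.val s + b.val s < 2 ^ w) :
    (a + b).val s = a.val s + b.val s := by
  simp only [Expr.val, Expr.eval_add, BitVec.toNat_add] at *
  exact Nat.mod_eq_of_lt h
theorem Expr.val_mul (s : State w) (a b : Expr) (h : a.val s * b.val s < 2 ^ w) :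
    (a * b).val s = a.val s * b.val s := by
  simp only [Expr.val, Expr.eval_mul, BitVec.toNat_mul] at *
  exact Nat.mod_eq_of_lt h
theorem Expr.val_sub (s : State w) (a b : Expr) (h : b.val s ≤ a.val s) :
    (a - b).val s = a.val s - b.val s := by
  simp only [Expr.val, Expr.eval_sub] at *
  exact BitVec.toNat_sub_of_le h
theorem Expr.val_lit (s : State w) (n : ℕ) (h : n < 2 ^ w) : (Expr.lit n).val s = n := by
  simp only [Expr.val, Expr.eval, BitVec.toNat_ofNat]
  exact Nat.mod_eq_of_lt h
theorem Expr.val_ofNat (s : State w) (n : ℕ) [n.AtLeastTwo] (h : n < 2 ^ w) :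
    (OfNat.ofNat n : Expr).val s = OfNat.ofNat n := Expr.val_lit s n h
@[simp] theorem Expr.val_zero (s : State w) : (0 : Expr).val s = 0 := by
  simp [Expr.val]
theorem Expr.val_one (s : State w) (hw : 1 < 2 ^ w) : (1 : Expr).val s = 1 := Expr.val_lit s 1 hw

theorem Expr.val_cmp_lt (s : State w) (a b : Expr) (hw : 1 < 2 ^ w) :
    (a.lt b).val s = if a.val s < b.val s then 1 else 0 := by
  simp only [Expr.val, Expr.eval, Op.eval, BitVec.lt_def]
  by_cases h : (a.eval s).toNat < (b.eval s).toNat <;> simp only [h, if_true, if_false] <;>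
    simp [Nat.mod_eq_of_lt hw]
theorem Expr.val_cmp_eq (s : State w) (a b : Expr) (hw : 1 < 2 ^ w) :
    (a.eq b).val s = if a.val s = b.val s then 1 else 0 := by
  simp only [Expr.val, Expr.eval, Op.eval, ← BitVec.toNat_inj]
  split_ifs <;> simp_all [Nat.mod_eq_of_lt hw]

theorem Expr.eval_eq_zero_iff (s : State w) (e : Expr) : e.eval s = 0 ↔ e.val s = 0 := by
  simp [Expr.val, ← BitVec.toNat_inj]

/-! ### States -/

def State.setReg (s : State w) (x : ℕ) (v : BitVec w) : State w :=
  { s with reg := Function.update s.reg x v }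

def State.setMem (s : State w) (A : ℕ) (a v : BitVec w) : State w :=
  { s with mem := Function.update s.mem A (Function.update (s.mem A) a v) }

@[simp] theorem State.setReg_reg (s : State w) (x y : ℕ) (v : BitVec w) :
    (s.setReg x v).reg y = if y = x then v else s.reg y := by
  simp [State.setReg, Function.update_apply]
@[simp] theorem State.setReg_mem (s : State w) (x : ℕ) (v : BitVec w) :
    (s.setReg x v).mem = s.mem := rfl
@[simp] theorem State.setReg_arr (s : State w) (x : ℕ) (v : BitVec w) (A i : ℕ) :
    (s.setReg x v).arr A i = s.arr A i := rfl
@[simp] theorem State.setReg_rval (s : State w) (x y : ℕ) (v : BitVec w) :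
    (s.setReg x v).rval y = if y = x then v.toNat else s.rval y := by
  simp only [State.rval, State.setReg_reg]; split_ifs <;> rfl
@[simp] theorem State.setMem_reg (s : State w) (A : ℕ) (a v : BitVec w) :
    (s.setMem A a v).reg = s.reg := rfl
@[simp] theorem State.setMem_rval (s : State w) (A : ℕ) (a v : BitVec w) (x : ℕ) :
    (s.setMem A a v).rval x = s.rval x := rfl
theorem State.setMem_mem (s : State w) (A B : ℕ) (a b v : BitVec w) :
    (s.setMem A a v).mem B b = if B = A ∧ b = a then v else s.mem B b := by
  by_cases h : B = A
  · subst h; simp [State.setMem, Function.update_apply]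
  · simp [State.setMem, h]
@[simp] theorem State.setMem_mem_ne (s : State w) (A B : ℕ) (a v : BitVec w) (h : B ≠ A) :
    (s.setMem A a v).mem B = s.mem B := by
  simp [State.setMem, h]

theorem ofNat_inj_of_lt {i j : ℕ} (hi : i < 2 ^ w) (hj : j < 2 ^ w) :
    BitVec.ofNat w i = BitVec.ofNat w j ↔ i = j := by
  rw [← BitVec.toNat_inj]
  simp [Nat.mod_eq_of_lt hi, Nat.mod_eq_of_lt hj]

theorem State.setMem_mem_ofNat (s : State w) (A B i j : ℕ) (v : BitVec w) (hi : i < 2 ^ w)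
    (hj : j < 2 ^ w) :
    (s.setMem A (BitVec.ofNat w i) v).mem B (BitVec.ofNat w j) =
      if B = A ∧ j = i then v else s.mem B (BitVec.ofNat w j) := by
  simp only [State.setMem_mem, ofNat_inj_of_lt hj hi]

theorem State.setMem_arr (s : State w) (A B i j : ℕ) (v : BitVec w) (hi : i < 2 ^ w)
    (hj : j < 2 ^ w) :
    (s.setMem A (BitVec.ofNat w i) v).arr B j = if B = A ∧ j = i then v.toNat else s.arr B j := by
  simp only [State.arr, State.setMem_mem_ofNat s A B i j v hi hj]
  split_ifs <;> rfl

theorem State.setMem_arr_ne (s : State w) (A B : ℕ) (a v : BitVec w) (h : B ≠ A) (j : ℕ) :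
    (s.setMem A a v).arr B j = s.arr B j := by
  simp [State.arr, h]

/-! ### Syntactic properties of programs -/

/-- The registers that a program may change. -/
def Prog.regs : Prog → List ℕ
  | .skip => []
  | .assign x _ => [x]
  | .store _ _ _ => []
  | .toss x => [x]
  | .seq p q => p.regs ++ q.regs
  | .ite _ p q => p.regs ++ q.regs
  | .loop _ p => p.regs

/-- The arrays that a program may change. -/
def Prog.arrays : Prog → List ℕ
  | .skip => []
  | .assign _ _ => []
  | .store A _ _ => [A]
  | .toss _ => []
  | .seq p q => p.arrays ++ q.arrays
  | .ite _ p q => p.arrays ++ q.arrays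
  | .loop _ p => p.arrays

/-- The states agree outside the registers `R` and the arrays `M`. -/
structure Frame (R M : List ℕ) (s s' : State w) : Prop where
  reg : ∀ x ∉ R, s'.reg x = s.reg x
  mem : ∀ A ∉ M, s'.mem A = s.mem A

theorem Frame.rval {R M : List ℕ} {s s' : State w} (h : Frame R M s s') (x : ℕ) (hx : x ∉ R) :
    s'.rval x = s.rval x := by rw [State.rval, h.reg x hx]; rfl

theorem Frame.arr {R M : List ℕ} {s s' : State w} (h : Frame R M s s') (A : ℕ) (hA : A ∉ M)
    (i : ℕ) : s'.arr A i = s.arr A i := by rw [State.arr, h.mem A hA]; rfl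

theorem Frame.refl (R M : List ℕ) (s : State w) : Frame R M s s := ⟨fun _ _ => rfl, fun _ _ => rfl⟩

theorem Frame.trans {R M : List ℕ} {s s₁ s₂ : State w} (h : Frame R M s s₁) (h' : Frame R M s₁ s₂) :
    Frame R M s s₂ :=
  ⟨fun x hx => (h'.reg x hx).trans (h.reg x hx), fun x hx => (h'.mem x hx).trans (h.mem x hx)⟩

theorem Frame.mono {R M R' M' : List ℕ} {s s' : State w} (h : Frame R M s s') (hR : R ⊆ R')
    (hM : M ⊆ M') : Frame R' M' s s' :=
  ⟨fun x hx => h.reg x fun h' => hx (hR h'), fun x hx => h.mem x fun h' => hx (hM h')⟩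

/-- Being purely syntactic, this is what carries facts about untouched registers and arrays across a
program; the side conditions are then finite list memberships. -/
theorem Exec.frame {ω : ℕ → Bool} {p : Prog} {s s' : State w} {t : ℕ} (h : Exec ω p s s' t) :
    Frame p.regs p.arrays s s' := by
  induction h with
  | skip s => exact Frame.refl _ _ _
  | assign s x e =>
    exact ⟨fun y hy => Function.update_of_ne (by simpa [Prog.regs] using hy) _ _, fun _ _ => rfl⟩
  | store s A e v =>
    exact ⟨fun _ _ => rfl, fun y hy => Function.update_of_ne (by simpa [Prog.arrays] using hy) _ _⟩
  | toss s x =>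
    exact ⟨fun y hy => Function.update_of_ne (by simpa [Prog.regs] using hy) _ _, fun _ _ => rfl⟩
  | seq _ _ ih₁ ih₂ =>
    exact (ih₁.mono (List.subset_append_left _ _) (List.subset_append_left _ _)).trans
      (ih₂.mono (List.subset_append_right _ _) (List.subset_append_right _ _))
  | ite_true _ _ ih => exact ih.mono (List.subset_append_left _ _) (List.subset_append_left _ _)
  | ite_false _ _ ih => exact ih.mono (List.subset_append_right _ _) (List.subset_append_right _ _)
  | loop_true _ _ _ ih₁ ih₂ => exact ih₁.trans ih₂
  | loop_false _ => exact Frame.refl _ _ _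

/-- Acceptance and output are existential statements about runs. Determinism turns one run with a
known final state into a statement about every run, which is what rejections need. -/
theorem Exec.det {ω : ℕ → Bool} {p : Prog} {s s₁ s₂ : State w} {t₁ t₂ : ℕ}
    (h : Exec ω p s s₁ t₁) (h' : Exec ω p s s₂ t₂) : s₁ = s₂ ∧ t₁ = t₂ := by
  induction h generalizing s₂ t₂ with
  | skip | assign | store | toss => cases h'; exact ⟨rfl, rfl⟩
  | seq _ _ ih₁ ih₂ =>
    cases h' with
    | seq a b =>
      obtain ⟨rfl, rfl⟩ := ih₁ a
      obtain ⟨rfl, rfl⟩ := ih₂ b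
      exact ⟨rfl, rfl⟩
  | ite_true he _ ih =>
    cases h' with
    | ite_true _ a => obtain ⟨rfl, rfl⟩ := ih a; exact ⟨rfl, rfl⟩
    | ite_false h0 _ => exact absurd h0 he
  | ite_false he _ ih =>
    cases h' with
    | ite_true h0 _ => exact absurd he h0
    | ite_false _ a => obtain ⟨rfl, rfl⟩ := ih a; exact ⟨rfl, rfl⟩
  | loop_true he _ _ ih₁ ih₂ =>
    cases h' with
    | loop_true _ a b =>
      obtain ⟨rfl, rfl⟩ := ih₁ a
      obtain ⟨rfl, rfl⟩ := ih₂ b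
      exact ⟨rfl, rfl⟩
    | loop_false h0 => exact absurd h0 he
  | loop_false he =>
    cases h' with
    | loop_true h0 _ _ => exact absurd he h0
    | loop_false _ => exact ⟨rfl, rfl⟩

/-! ### Runs with a time bound -/

/-- Started in `s`, the program halts after at most `T` steps in a state that satisfies `Q`. -/
def Run (ω : ℕ → Bool) (p : Prog) (s : State w) (T : ℕ) (Q : State w → Prop) : Prop :=
  ∃ s' t, Exec ω p s s' t ∧ t ≤ T ∧ Q s'

variable {ω : ℕ → Bool} {p q : Prog} {s : State w} {Q Q' : State w → Prop}

theorem Run.mono {T T' : ℕ} (h : Run ω p s T Q) (hT : T ≤ T') (hQ : ∀ s', Q s' → Q' s') :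
    Run ω p s T' Q' := by
  obtain ⟨s', t, h₁, h₂, h₃⟩ := h
  exact ⟨s', t, h₁, h₂.trans hT, hQ _ h₃⟩

theorem Run.time_mono {T T' : ℕ} (h : Run ω p s T Q) (hT : T ≤ T') : Run ω p s T' Q :=
  h.mono hT fun _ h => h

theorem Run.frame {T : ℕ} (h : Run ω p s T Q) :
    Run ω p s T fun s' => Q s' ∧ Frame p.regs p.arrays s s' := by
  obtain ⟨s', t, h₁, h₂, h₃⟩ := h
  exact ⟨s', t, h₁, h₂, h₃, h₁.frame⟩

/-- The continuation also receives the frame of the first program, so intermediate assertions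
mention only what has changed. -/
theorem Run.seq {T₁ T₂ : ℕ} {R : State w → Prop} (h : Run ω p s T₁ R)
    (h' : ∀ s₁, R s₁ → Frame p.regs p.arrays s s₁ → Run ω q s₁ T₂ Q) :
    Run ω (.seq p q) s (T₁ + T₂) Q := by
  obtain ⟨s₁, t₁, h₁, h₂, h₃⟩ := h
  obtain ⟨s₂, t₂, h₄, h₅, h₆⟩ := h' s₁ h₃ h₁.frame
  exact ⟨s₂, _, .seq h₁ h₄, Nat.add_le_add h₂ h₅, h₆⟩

theorem Run.ite {T : ℕ} {e : Expr} (ht : e.val s ≠ 0 → Run ω p s T Q)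
    (hf : e.val s = 0 → Run ω q s T Q) : Run ω (.ite e p q) s (T + e.cost + 1) Q := by
  by_cases h : e.val s = 0
  · obtain ⟨s₁, t, h₁, h₂, h₃⟩ := hf h
    exact ⟨s₁, _, .ite_false ((Expr.eval_eq_zero_iff _ _).2 h) h₁, by omega, h₃⟩
  · obtain ⟨s₁, t, h₁, h₂, h₃⟩ := ht h
    exact ⟨s₁, _, .ite_true (fun h' => h ((Expr.eval_eq_zero_iff _ _).1 h')) h₁, by omega, h₃⟩

/-- Programs without loops and coin tosses. -/
def Prog.simple : Prog → Bool
  | .skip => true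
  | .assign _ _ => true
  | .store _ _ _ => true
  | .toss _ => false
  | .seq p q => p.simple && q.simple
  | .ite _ p q => p.simple && q.simple
  | .loop _ _ => false

/-- A bound on the time of a program without loops. -/
def Prog.size : Prog → ℕ
  | .skip => 1
  | .assign _ e => e.cost + 1
  | .store _ e v => e.cost + v.cost + 1
  | .toss _ => 1
  | .seq p q => p.size + q.size
  | .ite e p q => e.cost + 1 + p.size + q.size
  | .loop e p => e.cost + 1 + p.size

/-- The final state of a program without loops. -/
def Prog.den : Prog → State w → State w
  | .skip, s => s
  | .assign x e, s => s.setReg x (e.eval s)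
  | .store A e v, s => s.setMem A (e.eval s) (v.eval s)
  | .toss _, s => s
  | .seq p q, s => q.den (p.den s)
  | .ite e p q, s => if e.val s = 0 then q.den s else p.den s
  | .loop _ _, s => s

theorem Prog.exec_den (ω : ℕ → Bool) (p : Prog) (hp : p.simple = true) (s : State w) :
    ∃ t ≤ p.size, Exec ω p s (p.den s) t := by
  induction p generalizing s with
  | skip => exact ⟨_, le_rfl, .skip s⟩
  | assign x e => exact ⟨_, le_rfl, .assign s x e⟩
  | store A e v => exact ⟨_, le_rfl, .store s A e v⟩
  | toss x => simp [Prog.simple] at hp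
  | seq p q ih₁ ih₂ =>
    simp only [Prog.simple, Bool.and_eq_true] at hp
    obtain ⟨t₁, ht₁, h₁⟩ := ih₁ hp.1 s
    obtain ⟨t₂, ht₂, h₂⟩ := ih₂ hp.2 (p.den s)
    exact ⟨_, Nat.add_le_add ht₁ ht₂, .seq h₁ h₂⟩
  | ite e p q ih₁ ih₂ =>
    simp only [Prog.simple, Bool.and_eq_true] at hp
    by_cases h : e.val s = 0
    · obtain ⟨t, ht, h₂⟩ := ih₂ hp.2 s
      have h₃ := Exec.ite_false (p := p) ((Expr.eval_eq_zero_iff _ _).2 h) h₂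
      refine ⟨_, ?_, by simpa only [Prog.den, if_pos h] using h₃⟩
      simp only [Prog.size]; omega
    · obtain ⟨t, ht, h₂⟩ := ih₁ hp.1 s
      have h₃ := Exec.ite_true (q := q) (fun h' => h ((Expr.eval_eq_zero_iff _ _).1 h')) h₂
      refine ⟨_, ?_, by simpa only [Prog.den, if_neg h] using h₃⟩
      simp only [Prog.size]; omega
  | loop e p _ => simp [Prog.simple] at hp

/-- The final state of a program without loops satisfies `Q`. -/
def Prog.Post (p : Prog) (s : State w) (Q : State w → Prop) : Prop := Q (p.den s)

theorem Run.simple (hp : p.simple = true) (hQ : p.Post s Q) : Run ω p s p.size Q := by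
  obtain ⟨t, ht, h⟩ := p.exec_den ω hp s
  exact ⟨_, t, h, ht, hQ⟩

/-- The assigned word is replaced by an arbitrary `v` with the right value, so that the description
of the state does not grow with the expressions assigned. -/
theorem Prog.Post.assign {x n : ℕ} {e : Expr} (h : e.val s = n)
    (h' : ∀ v : BitVec w, v.toNat = n → Q (s.setReg x v)) : (Prog.assign x e).Post s Q :=
  h' _ h

theorem Prog.Post.seq_assign {x n : ℕ} {e : Expr} (h : e.val s = n)
    (h' : ∀ v : BitVec w, v.toNat = n → q.Post (s.setReg x v) Q) :
    (Prog.seq (.assign x e) q).Post s Q :=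
  h' _ h

theorem Prog.Post.store {A m n : ℕ} {e e' : Expr} (h : e.val s = m) (h₁ : e'.val s = n)
    (h' : ∀ v : BitVec w, v.toNat = n → Q (s.setMem A (BitVec.ofNat w m) v)) :
    (Prog.store A e e').Post s Q := by
  have := h' _ h₁
  rwa [← h, ← Expr.eval_eq] at this

theorem Prog.Post.seq_store {A m n : ℕ} {e e' : Expr} (h : e.val s = m) (h₁ : e'.val s = n)
    (h' : ∀ v : BitVec w, v.toNat = n → q.Post (s.setMem A (BitVec.ofNat w m) v) Q) :
    (Prog.seq (.store A e e') q).Post s Q := by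
  have := h' _ h₁
  rwa [← h, ← Expr.eval_eq] at this

/-- A loop that makes `m` rounds. -/
theorem Run.loop {e : Expr} (m : ℕ) (I : ℕ → State w → Prop) (T : ℕ → ℕ) (h0 : I 0 s)
    (hstep : ∀ k < m, ∀ s₁, Frame p.regs p.arrays s s₁ → I k s₁ →
      e.val s₁ ≠ 0 ∧ Run ω p s₁ (T k) (I (k + 1)))
    (hend : ∀ s₁, Frame p.regs p.arrays s s₁ → I m s₁ → e.val s₁ = 0) :
    Run ω (.loop e p) s (∑ k ∈ Finset.range m, (T k + e.cost + 1) + e.cost + 1) (I m) := by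
  -- The induction is on the number `j` of rounds still to come, hence the invariant on entry is `I
  -- (m - j)`.
  have key : ∀ j ≤ m, ∀ s₁, Frame p.regs p.arrays s s₁ → I (m - j) s₁ →
      Run ω (.loop e p) s₁ (∑ k ∈ Finset.Ico (m - j) m, (T k + e.cost + 1) + e.cost + 1) (I m) := by
    intro j
    induction j with
    | zero =>
      intro _ s₁ hF hI
      exact ⟨s₁, _, .loop_false ((Expr.eval_eq_zero_iff _ _).2 (hend s₁ hF hI)), by simp, hI⟩
    | succ j ih =>
      intro hj s₁ hF hI
      obtain ⟨he, s₂, t₁, h₁, h₂, h₃⟩ := hstep (m - (j + 1)) (by omega) s₁ hF hI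
      have hm : m - (j + 1) + 1 = m - j := by omega
      rw [hm] at h₃
      obtain ⟨s₃, t₂, h₄, h₅, h₆⟩ := ih (by omega) s₂ (hF.trans h₁.frame) h₃
      refine ⟨s₃, _, .loop_true (fun h' => he ((Expr.eval_eq_zero_iff _ _).1 h')) h₁ h₄, ?_, h₆⟩
      rw [Finset.sum_eq_sum_Ico_succ_bot (by omega : m - (j + 1) < m), hm]
      omega
  have := key m le_rfl s (Frame.refl _ _ _) (by simpa using h0)
  simpa using this

/-- A loop whose variant `V` decreases in each round. -/
theorem Run.while {e : Expr} (I : State w → Prop) (V : State w → ℕ) (T : ℕ) (h0 : I s)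
    (hstep : ∀ s₁, Frame p.regs p.arrays s s₁ → I s₁ → e.val s₁ ≠ 0 →
      Run ω p s₁ T (fun s₂ => I s₂ ∧ V s₂ < V s₁)) :
    Run ω (.loop e p) s (V s * (T + e.cost + 1) + e.cost + 1) (fun s' => I s' ∧ e.val s' = 0) := by
  have key : ∀ j, ∀ s₁, Frame p.regs p.arrays s s₁ → I s₁ → V s₁ = j →
      Run ω (.loop e p) s₁ (j * (T + e.cost + 1) + e.cost + 1)
        (fun s' => I s' ∧ e.val s' = 0) := by
    intro j
    induction j using Nat.strong_induction_on with
    | _ j ih =>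
      intro s₁ hF hI hV
      by_cases he : e.val s₁ = 0
      · exact ⟨s₁, _, .loop_false ((Expr.eval_eq_zero_iff _ _).2 he), by omega, hI, he⟩
      · obtain ⟨s₂, t₁, h₁, h₂, h₃, h₄⟩ := hstep s₁ hF hI he
        obtain ⟨s₃, t₂, h₅, h₆, h₇⟩ := ih (V s₂) (by omega) s₂ (hF.trans h₁.frame) h₃ rfl
        refine ⟨s₃, _, .loop_true (fun h' => he ((Expr.eval_eq_zero_iff _ _).1 h')) h₁ h₅, ?_, h₇⟩
        have : V s₂ + 1 ≤ j := by omega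
        have := Nat.mul_le_mul_right (T + e.cost + 1) this
        rw [Nat.add_mul] at this
        omega
  exact key _ s (Frame.refl _ _ _) h0 rfl

/-- `for x < b do p`. -/
def Prog.for (x : ℕ) (b : Expr) (p : Prog) : Prog :=
  .seq (.assign x 0) (.loop ((Expr.reg x).lt b) (.seq p (.assign x (.reg x + 1))))

/-- The counter is advanced after the body, so the body has to establish the next invariant for the
state in which the counter has already moved on. Round-dependent times are allowed because the
enumeration of triples has rows of very different lengths. -/
theorem Run.for_sum {x : ℕ} {b : Expr} (m : ℕ) (hm : m < 2 ^ w) (hw : 1 < 2 ^ w)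
    (I : ℕ → State w → Prop) (T : ℕ → ℕ)
    (hx : x ∉ p.regs) (h0 : I 0 (s.setReg x 0))
    (hb : ∀ s₁, Frame (x :: p.regs) p.arrays s s₁ → b.val s₁ = m)
    (hstep : ∀ k < m, ∀ s₁, Frame (x :: p.regs) p.arrays s s₁ → s₁.rval x = k → I k s₁ →
      Run ω p s₁ (T k) (fun s₂ => I (k + 1) (s₂.setReg x (BitVec.ofNat w (k + 1))))) :
    Run ω (.for x b p) s (∑ k ∈ Finset.range m, (T k + b.cost + 7) + b.cost + 5)
      (fun s' => I m s' ∧ Frame (x :: p.regs) p.arrays s s') := by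
  have hF0 : Frame (x :: p.regs) p.arrays s (s.setReg x 0) :=
    ⟨fun y hy => by simp [List.mem_cons] at hy; simp [hy.1], fun _ _ => rfl⟩
  have hloop := Run.loop (ω := ω) (s := s.setReg x 0) (e := (Expr.reg x).lt b)
    (p := .seq p (.assign x (.reg x + 1))) m
    (fun k s₁ => I k s₁ ∧ s₁.rval x = k ∧ Frame (x :: p.regs) p.arrays s s₁)
    (fun k => T k + 4) ⟨h0, by simp, hF0⟩
    (by
      rintro k hk s₁ - ⟨hI, hxk, hF⟩
      refine ⟨?_, ?_⟩
      · rw [Expr.val_cmp_lt _ _ _ hw, hb s₁ hF, Expr.val_reg, hxk]; simp [hk]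
      · refine Run.seq (hstep k hk s₁ hF hxk hI) fun s₂ h₂ hF₂ => ?_
        refine ⟨_, _, .assign _ _ _, le_refl 4, ?_⟩
        have hxv : s₂.reg x = BitVec.ofNat w k := by
          rw [hF₂.reg x hx, State.reg_eq, hxk]
        have he : (Expr.reg x + 1).eval s₂ = BitVec.ofNat w (k + 1) := by
          simp [hxv, BitVec.ofNat_add]
        rw [he]
        refine ⟨h₂, ?_, hF.trans (Frame.trans (hF₂.mono (List.subset_cons_self _ _)
          (List.Subset.refl _)) ⟨fun y hy => ?_, fun _ _ => rfl⟩)⟩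
        · change (BitVec.toNat (Function.update s₂.reg x _ x)) = _
          simp [Nat.mod_eq_of_lt (by omega : k + 1 < 2 ^ w)]
        · simp [List.mem_cons] at hy; simp [hy.1])
    (by
      rintro s₁ - ⟨hI, hxk, hF⟩
      rw [Expr.val_cmp_lt _ _ _ hw, hb s₁ hF, Expr.val_reg, hxk]; simp)
  obtain ⟨s', t, h₁, h₂, h₃, -, h₅⟩ := hloop
  refine ⟨s', _, .seq (.assign _ _ _) h₁, ?_, h₃, h₅⟩
  have : ∑ k ∈ Finset.range m, (T k + 4 + ((Expr.reg x).lt b).cost + 1) =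
      ∑ k ∈ Finset.range m, (T k + b.cost + 7) := by
    refine Finset.sum_congr rfl fun k _ => ?_
    simp only [Expr.cost]; omega
  rw [this] at h₂
  have h6 : (0 : Expr).cost = 1 := rfl
  simp only [Expr.cost] at h₂
  omega

theorem Run.for {x : ℕ} {b : Expr} (m : ℕ) (hm : m < 2 ^ w) (hw : 1 < 2 ^ w)
    (I : ℕ → State w → Prop) (T : ℕ)
    (hx : x ∉ p.regs) (h0 : I 0 (s.setReg x 0))
    (hb : ∀ s₁, Frame (x :: p.regs) p.arrays s s₁ → b.val s₁ = m)
    (hstep : ∀ k < m, ∀ s₁, Frame (x :: p.regs) p.arrays s s₁ → s₁.rval x = k → I k s₁ →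
      Run ω p s₁ T (fun s₂ => I (k + 1) (s₂.setReg x (BitVec.ofNat w (k + 1))))) :
    Run ω (.for x b p) s (m * (T + b.cost + 7) + b.cost + 5)
      (fun s' => I m s' ∧ Frame (x :: p.regs) p.arrays s s') := by
  simpa using Run.for_sum m hm hw I (fun _ => T) hx h0 hb hstep

/-- `for x < b do A[x] := e`. -/
def Prog.tab (x A : ℕ) (b e : Expr) : Prog := .for x b (.store A (.reg x) e)

/-- The value of `e` is prescribed in all states that differ from `s` only in `x` and `A`, so it
must not depend on the part of `A` already written. -/
theorem Run.tab {x A : ℕ} {b e : Expr} (m : ℕ) (hm : m < 2 ^ w) (hw : 1 < 2 ^ w)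
    (v : ℕ → BitVec w)
    (hb : ∀ s₁, Frame [x] [A] s s₁ → b.val s₁ = m)
    (he : ∀ k < m, ∀ s₁, Frame [x] [A] s s₁ → s₁.rval x = k → e.eval s₁ = v k) :
    Run ω (.tab x A b e) s (m * (b.cost + e.cost + 9) + b.cost + 5)
      (fun s' => (∀ k < m, s'.mem A (BitVec.ofNat w k) = v k) ∧ Frame [x] [A] s s') := by
  refine (Run.for m hm hw (fun k s₁ => ∀ i < k, s₁.mem A (BitVec.ofNat w i) = v i)
    (e.cost + 2) (by simp [Prog.regs]) (by simp) hb ?_).time_mono (by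
      rw [show e.cost + 2 + b.cost + 7 = b.cost + e.cost + 9 by ring])
  intro k hk s₁ hF hx hI
  refine ⟨_, _, .store _ _ _ _, by simp [Expr.cost]; omega, ?_⟩
  intro i hi
  have : ({ s₁ with mem := Function.update s₁.mem A (Function.update (s₁.mem A)
      ((Expr.reg x).eval s₁) (e.eval s₁)) } : State w) =
      s₁.setMem A (BitVec.ofNat w k) (e.eval s₁) := by
    rw [Expr.eval_eq, Expr.val_reg, hx]; rfl
  rw [this, State.setReg_mem, State.setMem_mem_ofNat _ _ _ _ _ _ (by omega) (by omega)]
  by_cases hik : i = k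
  · subst hik; simp [he i hk s₁ hF hx]
  · simp [hik, hI i (by omega)]

end WordRAM

/-! ### Negacyclic convolution by Fourier transforms over polynomial rings -/

namespace Negacyclic

/-- The extension of `f 0, …, f (r - 1)` to a function on `ℤ` with `g (z + r) = - g z`. -/
def nc (r : ℕ) (f : ℕ → ℤ) (z : ℤ) : ℤ := (if Even (z / r) then 1 else -1) * f (z % r).toNat

/-- Such a function stands for an element of ℤ[X]/(X^r + 1), its value at `z` being the coefficient
of X^z. Multiplication by X^e is the translation of the argument by -e, for every integer e. -/
def IsNeg (r : ℕ) (g : ℤ → ℤ) : Prop := ∀ z, g (z + r) = - g z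

variable {r : ℕ} {g : ℤ → ℤ}

theorem isNeg_nc (hr : 0 < r) (f : ℕ → ℤ) : IsNeg r (nc r f) := by
  intro z
  have h : (r : ℤ) ≠ 0 := by positivity
  have h1 : (z + r) / r = z / r + 1 := by simpa using Int.add_mul_ediv_right z 1 h
  simp only [nc, h1, Int.even_add_one, Int.add_emod_right]
  by_cases h2 : Even (z / r) <;> simp [h2]

theorem IsNeg.add_two_mul (hg : IsNeg r g) (z k : ℤ) : g (z + 2 * k * r) = g z := by
  have h1 : ∀ z, g (z + 2 * r) = g z := fun z => by
    rw [show z + 2 * (r : ℤ) = (z + r) + r by ring, hg, hg, neg_neg]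
  have h2 : ∀ z, g (z - 2 * r) = g z := fun z => by
    rw [← h1 (z - 2 * r), sub_add_cancel]
  induction k using Int.induction_on with
  | zero => simp
  | succ k ih => rw [show z + 2 * ((k : ℤ) + 1) * r = (z + 2 * k * r) + 2 * r by ring, h1, ih]
  | pred k ih => rw [show z + 2 * (-(k : ℤ) - 1) * r = (z + 2 * (-k) * r) - 2 * r by ring, h2, ih]

theorem IsNeg.add_odd_mul (hg : IsNeg r g) (z k : ℤ) (hk : Odd k) : g (z + k * r) = - g z := by
  obtain ⟨m, rfl⟩ := hk
  rw [show z + (2 * m + 1) * (r : ℤ) = (z + 2 * m * r) + r by ring, hg, hg.add_two_mul]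

theorem nc_of_lt (f : ℕ → ℤ) {t : ℕ} (ht : t < r) : nc r f t = f t := by
  have h1 : (t : ℤ) / r = 0 := Int.ediv_eq_zero_of_lt (by positivity) (by exact_mod_cast ht)
  have h2 : (t : ℤ) % r = t := Int.emod_eq_of_lt (by positivity) (by exact_mod_cast ht)
  simp [nc, h1, h2]

/-- One period determines an antiperiodic function. Formulas for array entries, valid for `t < r`,
become identities of functions on ℤ in this way. -/
theorem IsNeg.eq_nc (hr : 0 < r) (hg : IsNeg r g) {f : ℕ → ℤ} (h : ∀ t < r, g t = f t) (z : ℤ) :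
    g z = nc r f z := by
  have hr' : (r : ℤ) ≠ 0 := by positivity
  have h1 : ∀ g', IsNeg r g' → g' z = (if Even (z / r) then 1 else -1) * g' (z % r) := by
    intro g' hg'
    have h2 : z = z % r + (z / r) * r := by rw [mul_comm]; exact (Int.emod_add_mul_ediv z r).symm
    by_cases h3 : Even (z / r)
    · obtain ⟨k, hk⟩ := h3
      have : z = z % r + 2 * k * r := by rw [hk] at h2; linear_combination h2
      simp only [hk, Even.add_self, if_true, one_mul]
      conv_lhs => rw [this, hg'.add_two_mul]
    · conv_lhs => rw [h2, hg'.add_odd_mul _ _ (Int.not_even_iff_odd.1 h3)]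
      simp [h3]
  have h4 : 0 ≤ z % r := Int.emod_nonneg _ hr'
  have h5 : z % r < r := Int.emod_lt_of_pos _ (by positivity)
  rw [h1 g hg, h1 _ (isNeg_nc hr f)]
  obtain ⟨t, ht⟩ := Int.eq_ofNat_of_zero_le h4
  rw [ht] at h5 ⊢
  rw [h t (by exact_mod_cast h5), nc_of_lt _ (by exact_mod_cast h5)]

theorem nc_natCast (hr : 0 < r) (f : ℕ → ℤ) {u : ℕ} (hu : u < 2 * r) :
    nc r f u = if u < r then f u else - f (u - r) := by
  split_ifs with h
  · exact nc_of_lt f h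
  · have := isNeg_nc hr f ((u - r : ℕ) : ℤ)
    rw [← nc_of_lt f (by omega : u - r < r), ← this]
    congr 1; push_cast [Nat.le_of_not_lt h]; ring

/-! ### Orthogonality and the Fourier transform with a power of X as root of unity. -/

theorem sum_period (g : ℤ → ℤ) (hg : ∀ z, g (z + r) = g z) (v : ℤ) :
    ∑ t ∈ Finset.range r, g (t + v) = ∑ t ∈ Finset.range r, g t := by
  have h1 : ∀ v, ∑ t ∈ Finset.range r, g (t + (v + 1)) = ∑ t ∈ Finset.range r, g (t + v) := by
    intro v
    have e1 := Finset.sum_range_succ (fun t : ℕ => g (t + v)) r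
    have e2 := Finset.sum_range_succ' (fun t : ℕ => g (t + v)) r
    have e3 : g ((r : ℤ) + v) = g v := by rw [add_comm, hg]
    simp only [Nat.cast_add, Nat.cast_one, Nat.cast_zero, zero_add] at e1 e2
    have e4 : ∑ t ∈ Finset.range r, g (t + (v + 1)) = ∑ t ∈ Finset.range r, g (t + 1 + v) :=
      Finset.sum_congr rfl fun t _ => by congr 1; ring
    linarith
  induction v using Int.induction_on with
  | zero => simp
  | succ k ih => rw [h1, ih]
  | pred k ih => rw [← ih, ← h1, sub_add_cancel]

/-- Write δ = 2^a · o' with o' odd; the bound on δ forces a ≤ σ. Moving `l` by 2^(σ - a) moves the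
argument by o' · r, an odd multiple of the antiperiod, and so negates every summand. The summand has
period 2 · 2^σ in `l`, so the sum equals its own negative. -/
theorem orthogonality {c σ : ℕ} (hr : r = c * 2 ^ σ) (hg : IsNeg r g) (z δ : ℤ) (hδ : δ ≠ 0)
    (hlt : |δ| < 2 * 2 ^ σ) : ∑ l ∈ Finset.range (2 * 2 ^ σ), g (z + δ * c * l) = 0 := by
  obtain ⟨a, o, ho, hao⟩ := Nat.exists_eq_two_pow_mul_odd (Int.natAbs_ne_zero.2 hδ)
  have ha : a ≤ σ := by
    by_contra hcon
    have h1 : 2 ^ (σ + 1) ≤ 2 ^ a := Nat.pow_le_pow_right (by norm_num) (by omega)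
    have h2 : 2 ^ a ≤ δ.natAbs := hao ▸ Nat.le_mul_of_pos_right _ ho.pos
    have h3 : (δ.natAbs : ℤ) < 2 ^ (σ + 1) := by rw [Int.natCast_natAbs, pow_succ']; exact hlt
    have h4 : δ.natAbs < 2 ^ (σ + 1) := by exact_mod_cast h3
    omega
  obtain ⟨o', ho', hδo⟩ : ∃ o' : ℤ, Odd o' ∧ δ = 2 ^ a * o' := by
    rcases Int.natAbs_eq δ with h | h
    · exact ⟨o, by exact_mod_cast ho, by rw [h, hao]; push_cast; ring⟩
    · exact ⟨-o, Odd.neg (by exact_mod_cast ho), by rw [h, hao]; push_cast; ring⟩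
  have hpow : (2 : ℤ) ^ a * 2 ^ (σ - a) = 2 ^ σ := by rw [← pow_add]; congr 1; omega
  have hrz : (r : ℤ) = c * 2 ^ σ := by rw [hr]; push_cast; ring
  have hper := sum_period (r := 2 * 2 ^ σ) (fun l => g (z + δ * c * l)) (fun l => by
    rw [← hg.add_two_mul (z + δ * c * l) δ, hrz]; congr 1; push_cast; ring) (2 ^ (σ - a))
  have hneg : ∀ l : ℕ, g (z + δ * c * (l + 2 ^ (σ - a))) = - g (z + δ * c * l) := by
    intro l
    rw [← hg.add_odd_mul _ o' ho', hrz, ← hpow, hδo]; congr 1; ring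
  simp only [hneg, Finset.sum_neg_distrib] at hper
  omega

/-- The transform is an isometry for the trilinear form. -/
theorem sum_transform {c σ : ℕ} (hr : r = c * 2 ^ σ) (A B C : ℕ → ℤ → ℤ)
    (hA : ∀ i, IsNeg r (A i)) (hB : ∀ i, IsNeg r (B i)) (hC : ∀ i, IsNeg r (C i))
    (hA0 : ∀ i, 2 ^ σ ≤ i → i < 2 * 2 ^ σ → A i = 0)
    (hB0 : ∀ i, 2 ^ σ ≤ i → i < 2 * 2 ^ σ → B i = 0) :
    ∑ l ∈ Finset.range (2 * 2 ^ σ), ∑ t ∈ Finset.range r, ∑ u ∈ Finset.range r,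
      (∑ i ∈ Finset.range (2 * 2 ^ σ), A i (t - i * l * c)) *
      (∑ j ∈ Finset.range (2 * 2 ^ σ), B j (u - j * l * c)) *
      (∑ k ∈ Finset.range (2 * 2 ^ σ), C k (t + u - k * l * c)) =
    2 * 2 ^ σ * ∑ i ∈ Finset.range (2 ^ σ), ∑ j ∈ Finset.range (2 ^ σ),
      ∑ t ∈ Finset.range r, ∑ u ∈ Finset.range r, A i t * B j u * C (i + j) (t + u) := by
  set S := Finset.range (2 * 2 ^ σ) with hS
  -- Translating `t` by i·l·c and `u` by j·l·c collects all three twists in the third factor. The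
  -- sums over one period do not notice, because each variable occurs in exactly two antiperiodic
  -- factors and the product is periodic.
  have hshift : ∀ i j k l : ℕ,
      ∑ t ∈ Finset.range r, ∑ u ∈ Finset.range r,
        A i (t - i * l * c) * B j (u - j * l * c) * C k (t + u - k * l * c) =
      ∑ t ∈ Finset.range r, ∑ u ∈ Finset.range r,
        A i t * B j u * C k (t + u + (i + j - k : ℤ) * c * l) := by
    intro i j k l
    have e1 := sum_period (r := r) (fun t => ∑ u ∈ Finset.range r,
        A i (t - i * l * c) * B j (u - j * l * c) * C k (t + u - k * l * c))
        (fun z => Finset.sum_congr rfl fun u _ => by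
          rw [show z + r - i * l * c = (z - i * l * c) + r by ring,
            show z + r + u - k * l * c = (z + u - k * l * c) + r by ring, hA, hC]; ring)
        (i * l * c)
    refine e1.symm.trans (Finset.sum_congr rfl fun t _ => ?_)
    have e2 := sum_period (r := r) (fun u =>
        A i (t + i * l * c - i * l * c) * B j (u - j * l * c) *
          C k (t + i * l * c + u - k * l * c))
        (fun z => by
          rw [show z + r - j * l * c = (z - j * l * c) + r by ring,
            show t + i * l * c + (z + r) - k * l * c = (t + i * l * c + z - k * l * c) + r by ring,
            hB, hC]; ring)
        (j * l * c)
    refine e2.symm.trans (Finset.sum_congr rfl fun u _ => ?_)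
    congr 1
    · congr 1 <;> (congr 1; ring)
    · congr 1; ring
  have hexp : ∀ l ∈ S, ∑ t ∈ Finset.range r, ∑ u ∈ Finset.range r,
      (∑ i ∈ S, A i (t - i * l * c)) * (∑ j ∈ S, B j (u - j * l * c)) *
      (∑ k ∈ S, C k (t + u - k * l * c)) =
      ∑ i ∈ S, ∑ j ∈ S, ∑ k ∈ S, ∑ t ∈ Finset.range r, ∑ u ∈ Finset.range r,
        A i t * B j u * C k (t + u + (i + j - k : ℤ) * c * l) := by
    intro l _
    simp only [← hshift]
    simp only [Finset.sum_mul, Finset.mul_sum]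
    have sw : ∀ f : ℕ → ℕ → ℕ → ℕ → ℕ → ℤ,
        ∑ t ∈ Finset.range r, ∑ u ∈ Finset.range r, ∑ i ∈ S, ∑ j ∈ S, ∑ k ∈ S, f t u i j k =
        ∑ i ∈ S, ∑ j ∈ S, ∑ k ∈ S, ∑ t ∈ Finset.range r, ∑ u ∈ Finset.range r, f t u i j k := by
      intro f
      simp only [Finset.sum_comm (s := Finset.range r) (t := S)]
    rw [sw, Finset.sum_comm, Finset.sum_congr rfl fun j _ => Finset.sum_comm, Finset.sum_comm]
  rw [Finset.sum_congr rfl hexp]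
  have hsw : ∑ l ∈ S, ∑ i ∈ S, ∑ j ∈ S, ∑ k ∈ S, ∑ t ∈ Finset.range r, ∑ u ∈ Finset.range r,
        A i t * B j u * C k (t + u + (i + j - k : ℤ) * c * l) =
      ∑ i ∈ S, ∑ j ∈ S, ∑ k ∈ S, ∑ t ∈ Finset.range r, ∑ u ∈ Finset.range r,
        A i t * B j u * ∑ l ∈ S, C k (t + u + (i + j - k : ℤ) * c * l) := by
    simp only [Finset.mul_sum]
    rw [Finset.sum_comm]
    refine Finset.sum_congr rfl fun i _ => ?_
    rw [Finset.sum_comm]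
    refine Finset.sum_congr rfl fun j _ => ?_
    rw [Finset.sum_comm]
    refine Finset.sum_congr rfl fun k _ => ?_
    rw [Finset.sum_comm]
    refine Finset.sum_congr rfl fun t _ => ?_
    rw [Finset.sum_comm]
  rw [hsw]
  have hsub : Finset.range (2 ^ σ) ⊆ S := Finset.range_subset_range.2 (by omega)
  have hz1 : ∀ i ∈ S, i ∉ Finset.range (2 ^ σ) → A i = 0 := fun i hi hi' =>
    hA0 i (by simpa using hi') (by simpa [hS] using hi)
  have hz2 : ∀ i ∈ S, i ∉ Finset.range (2 ^ σ) → B i = 0 := fun i hi hi' =>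
    hB0 i (by simpa using hi') (by simpa [hS] using hi)
  rw [← Finset.sum_subset hsub (fun i hi hi' => by simp [hz1 i hi hi']), Finset.mul_sum]
  refine Finset.sum_congr rfl fun i hi => ?_
  rw [← Finset.sum_subset hsub (fun i hi hi' => by simp [hz2 i hi hi']), Finset.mul_sum]
  refine Finset.sum_congr rfl fun j hj => ?_
  simp only [Finset.mem_range] at hi hj
  -- The zero padding has confined `i` and `j` to indices below 2^σ, so `i + j` is an admissible `k`
  -- and the cyclic convolution does not wrap around. All other `k` vanish by `orthogonality` with δ
  -- = i + j - k.
  rw [Finset.sum_eq_single (i + j)]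
  · rw [Finset.mul_sum]
    refine Finset.sum_congr rfl fun t _ => ?_
    rw [Finset.mul_sum]
    refine Finset.sum_congr rfl fun u _ => ?_
    simp [hS]; ring
  · intro k hk hkij
    have hk' : k < 2 * 2 ^ σ := by simpa [hS] using hk
    refine Finset.sum_eq_zero fun t _ => Finset.sum_eq_zero fun u _ => ?_
    rw [orthogonality hr (hC k) _ _ (by omega) ?_, mul_zero]
    have h1 : (k : ℤ) < 2 * 2 ^ σ := by exact_mod_cast hk'
    have h2 : (i : ℤ) < 2 ^ σ := by exact_mod_cast hi
    have h3 : (j : ℤ) < 2 ^ σ := by exact_mod_cast hj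
    rw [abs_lt]; constructor <;> omega
  · intro h; exact absurd (by simp [hS]; omega) h

theorem sum_range_two_mul (n : ℕ) (f : ℕ → ℤ) : ∑ i ∈ Finset.range (2 * n), f i =
    ∑ i ∈ Finset.range n, f (2 * i) + ∑ i ∈ Finset.range n, f (2 * i + 1) := by
  induction n with
  | zero => simp
  | succ n ih =>
    rw [show 2 * (n + 1) = 2 * n + 1 + 1 by ring, Finset.sum_range_succ, Finset.sum_range_succ, ih,
      Finset.sum_range_succ _ n, Finset.sum_range_succ _ n]
    ring

theorem sum_range_mul (m n : ℕ) (f : ℕ → ℤ) : ∑ i ∈ Finset.range (m * n), f i =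
    ∑ b ∈ Finset.range m, ∑ l ∈ Finset.range n, f (b * n + l) := by
  induction m with
  | zero => simp
  | succ m ih => rw [Nat.succ_mul, Finset.sum_range_add, ih, Finset.sum_range_succ]

theorem sum_range_mul' (s r : ℕ) (f : ℕ → ℤ) : ∑ x ∈ Finset.range (s * r), f x =
    ∑ i ∈ Finset.range s, ∑ t ∈ Finset.range r, f (i + s * t) := by
  rw [mul_comm, sum_range_mul, Finset.sum_comm]
  refine Finset.sum_congr rfl fun i _ => Finset.sum_congr rfl fun t _ => ?_
  congr 1; ring

/-! #### The passes over the flat arrays -/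

/-- Block `q` of length `r`. -/
def blk (r : ℕ) (F : ℕ → ℤ) (q : ℕ) : ℕ → ℤ := fun t => F (q * r + t)

/-- The trilinear form. -/
def form (r : ℕ) (A B C : ℕ → ℤ) : ℤ :=
  ∑ t ∈ Finset.range r, ∑ u ∈ Finset.range r, A t * B u * nc r C (t + u)

/-- The sum of the forms of the first `K` blocks. -/
def total (K r : ℕ) (A B C : ℕ → ℤ) : ℤ :=
  ∑ b ∈ Finset.range K, form r (blk r A b) (blk r B b) (blk r C b)

/-- One butterfly pass. -/
def stage (r Q H : ℕ) (F : ℕ → ℤ) (x : ℕ) : ℤ :=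
  F (((x / r / H / (2 * Q) * Q + x / r / H % (2 * Q) % Q) * (2 * H) + x / r % H) * r + x % r) +
    nc r (blk r F ((x / r / H / (2 * Q) * Q + x / r / H % (2 * Q) % Q) * (2 * H) + x / r % H + H))
      ((x % r : ℕ) - (r / Q * (x / r / H % (2 * Q)) : ℕ))

/-- Each block is split into `s` blocks of length `r`, followed by `s` zero blocks. -/
def unzipPad (s r : ℕ) (F : ℕ → ℤ) (x : ℕ) : ℤ :=
  if x / r % (2 * s) < s then F (x / r / (2 * s) * (s * r) + (x / r % (2 * s) + s * (x % r))) else 0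

/-- Each block is split into `2 * s` blocks of length `r` of its extension. -/
def unzipExt (s r : ℕ) (F : ℕ → ℤ) (x : ℕ) : ℤ :=
  nc (s * r) (blk (s * r) F (x / r / (2 * s))) ((x / r % (2 * s) + s * (x % r) : ℕ))

/-- Before pass `q`, each group of 2^(σ+1) blocks carries the transforms of length 2^q of its
subsequences of step 2^(σ+1-q). The parameter `Q` of a pass is the length already reached, and `H`
is the step of the subsequences afterwards. -/
def stages (r σ : ℕ) : ℕ → (ℕ → ℤ) → ℕ → ℤ
  | 0, F => F
  | q + 1, F => stage r (2 ^ q) (2 ^ (σ - q)) (stages r σ q F)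

theorem decode {r q t : ℕ} (ht : t < r) : (q * r + t) / r = q ∧ (q * r + t) % r = t := by
  have hr : 0 < r := by omega
  rw [mul_comm]
  exact ⟨by rw [Nat.mul_add_div hr, Nat.div_eq_of_lt ht, add_zero],
    by rw [Nat.mul_add_mod, Nat.mod_eq_of_lt ht]⟩

/-- The defining formula of `stage` covers the coefficients in one period; both sides are
antiperiodic, so it holds at every integer. -/
theorem nc_stage {Q H b l i : ℕ} (hr : 0 < r) (F : ℕ → ℤ) (hl : l < 2 * Q) (hi : i < H) (z : ℤ) :
    nc r (blk r (stage r Q H F) ((b * (2 * Q) + l) * H + i)) z =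
      nc r (blk r F ((b * Q + l % Q) * (2 * H) + i)) z +
      nc r (blk r F ((b * Q + l % Q) * (2 * H) + i + H)) (z - (r / Q * l : ℕ)) := by
  refine (IsNeg.eq_nc (g := fun z => nc r (blk r F ((b * Q + l % Q) * (2 * H) + i)) z +
      nc r (blk r F ((b * Q + l % Q) * (2 * H) + i + H)) (z - (r / Q * l : ℕ))) hr ?_ ?_ z).symm
  · intro z
    beta_reduce
    rw [isNeg_nc hr, show z + r - (r / Q * l : ℕ) = z - (r / Q * l : ℕ) + r by ring, isNeg_nc hr]
    ring
  · intro t ht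
    simp only [blk, stage, (decode ht).1, (decode ht).2, (decode hi).1, (decode hi).2,
      (decode hl).1, (decode hl).2]
    rw [nc_of_lt _ ht]; rfl

/-- Decimation in time: the terms with even `j` form the transform of the subsequence starting at
`i`, those with odd `j` that of the subsequence starting at `i + 2^(σ-q)`, with one additional twist
by (r / 2^q)·l. -/
theorem nc_stages {c σ : ℕ} (hr : r = c * 2 ^ σ) (hr0 : 0 < r) (F : ℕ → ℤ) (b : ℕ) (q : ℕ)
    (hq : q ≤ σ + 1) (l i : ℕ) (hl : l < 2 ^ q) (hi : i < 2 ^ (σ + 1 - q)) (z : ℤ) :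
    nc r (blk r (stages r σ q F) ((b * 2 ^ q + l) * 2 ^ (σ + 1 - q) + i)) z =
      ∑ j ∈ Finset.range (2 ^ q), nc r (blk r F (b * 2 ^ (σ + 1) + (i + 2 ^ (σ + 1 - q) * j)))
        (z - j * l * (c * 2 ^ (σ + 1 - q) : ℕ)) := by
  induction q generalizing l i z with
  | zero =>
    have : l = 0 := by simpa using hl
    subst this; simp [stages]
  | succ q ih =>
    have hH : 2 ^ (σ + 1 - q) = 2 * 2 ^ (σ - q) := by
      rw [← pow_succ']; congr 1; omega
    have hH' : σ + 1 - (q + 1) = σ - q := by omega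
    have hdiv : r / 2 ^ q = c * 2 ^ (σ - q) := by
      have : r = c * 2 ^ (σ - q) * 2 ^ q := by
        rw [hr, mul_assoc, ← pow_add]; congr 2; omega
      rw [this, Nat.mul_div_cancel _ (by positivity)]
    have hm : l % 2 ^ q < 2 ^ q := Nat.mod_lt _ (by positivity)
    rw [hH'] at hi ⊢
    rw [stages, pow_succ', nc_stage hr0 _ (by rwa [← pow_succ']) hi, ← hH, ih (by omega) _ _ hm
      (by omega), add_assoc _ i, ih (by omega) _ _ hm (by omega), sum_range_two_mul, hdiv]
    have hn : ∀ k, IsNeg r (nc r (blk r F k)) := fun k => isNeg_nc hr0 _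
    -- The shorter transforms are known for frequencies below 2^q only. Passing from `l` to `l %
    -- 2^q` changes the shifts by multiples of the full period 2r, because 2^q times the basic shift
    -- is 2r (`hrz`).
    have hl' : (l : ℤ) = (l % 2 ^ q : ℕ) + 2 ^ q * (l / 2 ^ q : ℕ) := by
      exact_mod_cast (Nat.mod_add_div l (2 ^ q)).symm
    generalize l % 2 ^ q = m at hl' hm ⊢
    generalize l / 2 ^ q = n at hl'
    have hrz : (2 : ℤ) * r = 2 ^ q * (c * (2 * 2 ^ (σ - q))) := by
      rw [hr]; push_cast
      rw [show (2 : ℤ) ^ q * (c * (2 * 2 ^ (σ - q))) = 2 * (c * (2 ^ q * 2 ^ (σ - q))) by ring,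
        ← pow_add]
      congr 4; omega
    congr 1 <;> refine Finset.sum_congr rfl fun j _ => ?_
    · rw [← (hn _).add_two_mul (z - ((2 * j : ℕ) : ℤ) * l * (c * 2 ^ (σ - q) : ℕ))
        (j * n), hH]
      congr 2
      · congr 1; ring
      · push_cast; rw [hl']
        linear_combination (-(j * n : ℤ)) * hrz
    · rw [← (hn _).add_two_mul (z - ((2 * j + 1 : ℕ) : ℤ) * l * (c * 2 ^ (σ - q) : ℕ))
        (j * n), hH]
      congr 2
      · congr 1; ring
      · push_cast; rw [hl']
        linear_combination (-(j * n : ℤ)) * hrz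

theorem nc_unzipPad {s b k : ℕ} (hr : 0 < r) (F : ℕ → ℤ) (hk : k < 2 * s) :
    (∀ t < r, nc r (blk r (unzipPad s r F) (b * (2 * s) + k)) t =
      if k < s then blk (s * r) F b (k + s * t) else 0) ∧
    (s ≤ k → nc r (blk r (unzipPad s r F) (b * (2 * s) + k)) = 0) := by
  have key : ∀ t < r, blk r (unzipPad s r F) (b * (2 * s) + k) t =
      if k < s then blk (s * r) F b (k + s * t) else 0 := by
    intro t ht
    simp only [blk, unzipPad, (decode ht).1, (decode ht).2, (decode hk).1, (decode hk).2]
  refine ⟨fun t ht => by rw [nc_of_lt _ ht, key t ht], fun hs => ?_⟩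
  funext z
  refine (IsNeg.eq_nc (g := 0) hr (fun z => by simp) (fun t ht => ?_) z).symm
  rw [key t ht, if_neg (by omega)]; rfl

/-- The exponents k + s·z form one residue class modulo `s`, and moving `z` by `r` moves them by the
antiperiod s·r. The range of `k` is doubled because the third index of the form is a sum of two
indices below `s`. -/
theorem nc_unzipExt {s b k : ℕ} (hr : 0 < r) (hs : 0 < s) (F : ℕ → ℤ) (hk : k < 2 * s) (z : ℤ) :
    nc r (blk r (unzipExt s r F) (b * (2 * s) + k)) z = nc (s * r) (blk (s * r) F b) (k + s * z) := by
  refine (IsNeg.eq_nc (g := fun z => nc (s * r) (blk (s * r) F b) (k + s * z)) hr ?_ ?_ z).symm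
  · intro z
    simp only
    rw [← isNeg_nc (Nat.mul_pos hs hr)]; congr 1; push_cast; ring
  · intro t ht
    simp only [blk, unzipExt, (decode ht).1, (decode ht).2, (decode hk).1, (decode hk).2]
    push_cast; rfl

/-- One level of the recursion. Positions are written as i + s·t with s = 2^σ, so Z = X^s satisfies
Z^r = -1, and r = c·2^σ makes Z^c a root of unity of order 2·2^σ. The exponents add up as (i + j) +
s·(t + u), which brings the form into the shape of `sum_transform`. -/
theorem total_transform {c σ : ℕ} (hr : r = c * 2 ^ σ) (hr0 : 0 < r) (K : ℕ) (A B C : ℕ → ℤ) :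
    total (K * (2 * 2 ^ σ)) r (stages r σ (σ + 1) (unzipPad (2 ^ σ) r A))
      (stages r σ (σ + 1) (unzipPad (2 ^ σ) r B)) (stages r σ (σ + 1) (unzipExt (2 ^ σ) r C)) =
    2 * 2 ^ σ * total K (2 ^ σ * r) A B C := by
  have hfin : ∀ (F : ℕ → ℤ) (b l : ℕ), l < 2 * 2 ^ σ → ∀ z,
      nc r (blk r (stages r σ (σ + 1) F) (b * (2 * 2 ^ σ) + l)) z =
      ∑ j ∈ Finset.range (2 * 2 ^ σ), nc r (blk r F (b * (2 * 2 ^ σ) + j)) (z - j * l * c) := by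
    intro F b l hl z
    have := nc_stages hr hr0 F b (σ + 1) le_rfl l 0 (by rwa [pow_succ']) (by simp) z
    simpa [pow_succ'] using this
  rw [total, sum_range_mul, total, Finset.mul_sum]
  refine Finset.sum_congr rfl fun b _ => ?_
  have h1 := sum_transform hr (fun i => nc r (blk r (unzipPad (2 ^ σ) r A) (b * (2 * 2 ^ σ) + i)))
    (fun i => nc r (blk r (unzipPad (2 ^ σ) r B) (b * (2 * 2 ^ σ) + i)))
    (fun i => nc r (blk r (unzipExt (2 ^ σ) r C) (b * (2 * 2 ^ σ) + i)))
    (fun i => isNeg_nc hr0 _) (fun i => isNeg_nc hr0 _) (fun i => isNeg_nc hr0 _)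
    (fun i hi hi' => (nc_unzipPad hr0 A hi').2 hi) (fun i hi hi' => (nc_unzipPad hr0 B hi').2 hi)
  refine Eq.trans ?_ (h1.trans ?_)
  · refine Finset.sum_congr rfl fun l hl => Finset.sum_congr rfl fun t ht =>
      Finset.sum_congr rfl fun u hu => ?_
    simp only [Finset.mem_range] at hl ht hu
    rw [← hfin _ _ _ hl, ← hfin _ _ _ hl, ← hfin _ _ _ hl, nc_of_lt _ ht, nc_of_lt _ hu]
  · congr 1
    rw [form, sum_range_mul']
    simp only [sum_range_mul']
    refine Finset.sum_congr rfl fun i hi => ?_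
    rw [Finset.sum_comm]
    refine Finset.sum_congr rfl fun t ht => Finset.sum_congr rfl fun j hj =>
      Finset.sum_congr rfl fun u hu => ?_
    simp only [Finset.mem_range] at hi ht hj hu
    rw [(nc_unzipPad hr0 A (by omega)).1 t ht, (nc_unzipPad hr0 B (by omega)).1 u hu,
      nc_unzipExt hr0 (by positivity) C (by omega), if_pos hi, if_pos hj]
    congr 2; push_cast; ring

theorem form_two (A B C : ℕ → ℤ) :
    form 2 A B C = A 0 * B 0 * C 0 + (A 0 * B 1 + A 1 * B 0) * C 1 - A 1 * B 1 * C 0 := by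
  have h0 : nc 2 C 0 = C 0 := nc_of_lt C (t := 0) (by norm_num)
  have h1 : nc 2 C 1 = C 1 := nc_of_lt C (t := 1) (by norm_num)
  have h2 : nc 2 C (1 + 1) = - C 0 := by
    simpa using nc_natCast (r := 2) (by norm_num) C (u := 2) (by norm_num)
  simp only [form, Finset.sum_range_succ, Finset.sum_range_zero, Nat.cast_zero, Nat.cast_one,
    zero_add, add_zero, h0, h1, h2]
  ring

end Negacyclic

/-! ### The transform on the word RAM -/

namespace WordRAM

open Negacyclic

section Values

variable {w : ℕ} {s : State w} {a b : Expr} {m n : ℕ}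

theorem Expr.Val.add (ha : a.val s = m) (hb : b.val s = n) (h : m + n < 2 ^ w) :
    (a + b).val s = m + n := by
  rw [Expr.val_add _ _ _ (by rwa [ha, hb]), ha, hb]
theorem Expr.Val.mul (ha : a.val s = m) (hb : b.val s = n) (h : m * n < 2 ^ w) :
    (a * b).val s = m * n := by
  rw [Expr.val_mul _ _ _ (by rwa [ha, hb]), ha, hb]
theorem Expr.Val.sub (ha : a.val s = m) (hb : b.val s = n) (h : n ≤ m) :
    (a - b).val s = m - n := by
  rw [Expr.val_sub _ _ _ (by rwa [ha, hb]), ha, hb]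
theorem Expr.Val.div (ha : a.val s = m) (hb : b.val s = n) : (a / b).val s = m / n := by
  rw [Expr.val_div, ha, hb]
theorem Expr.Val.mod (ha : a.val s = m) (hb : b.val s = n) : (a % b).val s = m % n := by
  rw [Expr.val_mod, ha, hb]
theorem Expr.Val.get {A : ℕ} (ha : a.val s = m) : (Expr.get A a).val s = s.arr A m := by
  rw [Expr.val_get, ha]
theorem Expr.Val.lt (ha : a.val s = m) (hb : b.val s = n) (hw : 1 < 2 ^ w) :
    (a.lt b).val s = if m < n then 1 else 0 := by
  rw [Expr.val_cmp_lt _ _ _ hw, ha, hb]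
theorem Expr.Val.eq (ha : a.val s = m) (hb : b.val s = n) (hw : 1 < 2 ^ w) :
    (a.eq b).val s = if m = n then 1 else 0 := by
  rw [Expr.val_cmp_eq _ _ _ hw, ha, hb]
theorem Expr.Val.reg {x : ℕ} (h : s.rval x = m) : (Expr.reg x).val s = m := h
theorem Expr.Val.eval (ha : a.val s = m) : a.eval s = BitVec.ofNat w m := by
  rw [Expr.eval_eq, ha]
theorem Expr.Val.eval_get {A : ℕ} (ha : a.val s = m) :
    (Expr.get A a).eval s = s.mem A (BitVec.ofNat w m) := by
  rw [Expr.eval, Expr.Val.eval ha]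

theorem ofInt_sub (x y : ℤ) : BitVec.ofInt w (x - y) = BitVec.ofInt w x - BitVec.ofInt w y := by
  rw [sub_eq_add_neg, BitVec.ofInt_add, BitVec.ofInt_neg, BitVec.sub_eq_add_neg]

/-- The word `1` or `-1`, according to whether `a < b`. -/
def Expr.sign (a b : Expr) : Expr := 2 * a.lt b - 1

theorem Expr.eval_sign (ha : a.val s = m) (hb : b.val s = n) (hw : 1 < 2 ^ w) :
    (Expr.sign a b).eval s = BitVec.ofInt w (if m < n then 1 else -1) := by
  rw [Expr.sign, Expr.eval_sub, Expr.eval_mul, Expr.Val.eval (Expr.Val.lt ha hb hw)]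
  have h2 : BitVec.ofNat w 2 = BitVec.ofInt w 2 := (BitVec.ofInt_ofNat w 2).symm
  have h1 : BitVec.ofNat w 1 = BitVec.ofInt w 1 := (BitVec.ofInt_natCast w 1).symm
  have h0 : BitVec.ofNat w 0 = BitVec.ofInt w 0 := (BitVec.ofInt_natCast w 0).symm
  split_ifs
  · rw [Expr.eval_ofNat, Expr.eval_one]
    change BitVec.ofNat w 2 * _ - _ = _
    rw [h2, h1, ← BitVec.ofInt_mul, ← ofInt_sub]; rfl
  · rw [Expr.eval_ofNat, Expr.eval_one]
    change BitVec.ofNat w 2 * _ - _ = _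
    rw [h2, h1, h0, ← BitVec.ofInt_mul, ← ofInt_sub]; rfl

end Values

/-- The first `T` entries of array `A` represent the integers `F 0, …, F (T - 1)`. -/
def Holds {w : ℕ} (s : State w) (A T : ℕ) (F : ℕ → ℤ) : Prop :=
  ∀ x < T, s.mem A (BitVec.ofNat w x) = BitVec.ofInt w (F x)

theorem Holds.congr {w : ℕ} {s s' : State w} {A T : ℕ} {F : ℕ → ℤ} (h : Holds s A T F)
    (hs : s'.mem A = s.mem A) : Holds s' A T F := fun x hx => by rw [hs, h x hx]

/-- `A[x] := e` for all `x < T` (register `13` is `x`, register `19` is `T`), where `e` is evaluated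
before `A` is changed. -/
def pass (A : ℕ) (e : Expr) : Prog :=
  .seq (.tab 13 8 (.reg 19) e) (.tab 13 A (.reg 19) (.get 8 (.reg 13)))

variable {w : ℕ} {ω : ℕ → Bool} {s : State w}

theorem run_pass {A : ℕ} {e : Expr} (T : ℕ) (hw : 1 < 2 ^ w) (hA : A ≠ 8) (hT : s.rval 19 = T)
    (F : ℕ → ℤ)
    (he : ∀ k < T, ∀ s₁, Frame [13] [8] s s₁ → s₁.rval 13 = k → e.eval s₁ = BitVec.ofInt w (F k)) :
    Run ω (pass A e) s ((T + 1) * (e.cost + 40))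
      (fun s' => Holds s' A T F ∧ Frame [13] [8, A] s s') := by
  have hT' : T < 2 ^ w := hT ▸ s.rval_lt 19
  have h1 := Run.tab (ω := ω) (s := s) (x := 13) (A := 8) (b := .reg 19) (e := e) T hT' hw
    (fun k => BitVec.ofInt w (F k))
    (fun s₁ h => by rw [Expr.val_reg, h.rval 19 (by decide), hT]) he
  refine (Run.seq h1 (T₂ := T * 12 + 6) (Q := fun s' => Holds s' A T F ∧ Frame [13] [8, A] s s')
    fun s₁ ⟨hs₁, hF₁⟩ _ => ?_).time_mono (by
      have : (Expr.reg 19).cost = 1 := rfl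
      rw [this]; ring_nf; omega)
  have h2 := Run.tab (ω := ω) (s := s₁) (x := 13) (A := A) (b := .reg 19) (e := .get 8 (.reg 13))
    T hT' hw (fun k => BitVec.ofInt w (F k))
    (fun s₂ h => by rw [Expr.val_reg, h.rval 19 (by decide), hF₁.rval 19 (by decide), hT])
  refine (h2 (fun k hk s₂ hF hx => ?_)).mono le_rfl fun s' ⟨h4, h5⟩ => ⟨h4, ?_⟩
  · rw [Expr.Val.eval_get (Expr.Val.reg hx), hF.mem 8 (by simp [Ne.symm hA]), hs₁ k hk]
  · exact (hF₁.mono (by simp) (by simp)).trans (h5.mono (by simp) (by simp))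

theorem mul_add_lt {a b m n : ℕ} (ha : a < m) (hb : b < n) : a * n + b < m * n :=
  calc a * n + b < a * n + n := by omega
    _ = (a + 1) * n := by ring
    _ ≤ m * n := Nat.mul_le_mul_right _ ha

/-! #### The butterfly pass -/

namespace StageExpr
def t : Expr := .reg 13 % .reg 17
def i : Expr := .reg 13 / .reg 17 % .reg 21
def l : Expr := .reg 13 / .reg 17 / .reg 21 % (2 * .reg 20)
def b : Expr := .reg 13 / .reg 17 / .reg 21 / (2 * .reg 20)
def src : Expr := (b * .reg 20 + l % .reg 20) * (2 * .reg 21) + i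
def u : Expr := (t + (2 * .reg 17 - .reg 17 / .reg 20 * l)) % (2 * .reg 17)
end StageExpr

open StageExpr in
def stageExpr (A : ℕ) : Expr :=
  .get A (src * .reg 17 + t) +
    Expr.sign u (.reg 17) * .get A ((src + .reg 21) * .reg 17 + u % .reg 17)

theorem stageExpr_cost (A : ℕ) : (stageExpr A).cost = 139 := rfl

/-- Only addresses and lengths must be protected from overflow, and `hTw` does that. The entries are
images under the ring homomorphism from ℤ to the words, so their size is irrelevant. -/
theorem eval_stageExpr {A T K r Q H x : ℕ} {F : ℕ → ℤ} (hF : Holds s A T F)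
    (hT : T = K * (2 * Q) * H * r) (hTw : 2 * T + 2 < 2 ^ w) (hx : x < T) (h13 : s.rval 13 = x)
    (h17 : s.rval 17 = r) (h20 : s.rval 20 = Q) (h21 : s.rval 21 = H) :
    (stageExpr A).eval s = BitVec.ofInt w (stage r Q H F x) := by
  have hT0 : 0 < K * (2 * Q) * H * r := by omega
  have hr : 0 < r := Nat.pos_of_mul_pos_left hT0
  have hH : 0 < H := Nat.pos_of_mul_pos_left (Nat.pos_of_mul_pos_right hT0)
  have hQ : 0 < 2 * Q := Nat.pos_of_mul_pos_left (Nat.pos_of_mul_pos_right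
    (Nat.pos_of_mul_pos_right hT0))
  have hK : 0 < K := Nat.pos_of_mul_pos_right (Nat.pos_of_mul_pos_right
    (Nat.pos_of_mul_pos_right hT0))
  have hQ' : 0 < Q := by omega
  have hw : 1 < 2 ^ w := by omega
  have hrT : 2 * r ≤ T := by
    rw [hT]
    calc 2 * r = 1 * (2 * 1) * 1 * r := by ring
      _ ≤ K * (2 * Q) * H * r := by gcongr <;> omega
  have hHT : 2 * H ≤ T := by
    rw [hT]
    calc 2 * H = 1 * (2 * 1) * H * 1 := by ring
      _ ≤ K * (2 * Q) * H * r := by gcongr <;> omega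
  have hQT : 2 * Q ≤ T := by
    rw [hT]
    calc 2 * Q = 1 * (2 * Q) * 1 * 1 := by ring
      _ ≤ K * (2 * Q) * H * r := by gcongr <;> omega
  have v13 : (Expr.reg 13).val s = x := h13
  have v17 : (Expr.reg 17).val s = r := h17
  have v20 : (Expr.reg 20).val s = Q := h20
  have v21 : (Expr.reg 21).val s = H := h21
  have v2 : (2 : Expr).val s = 2 := Expr.val_lit s 2 (by omega)
  have v2Q : (2 * Expr.reg 20).val s = 2 * Q := Expr.Val.mul v2 v20 (by omega)
  have v2H : (2 * Expr.reg 21).val s = 2 * H := Expr.Val.mul v2 v21 (by omega)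
  have v2r : (2 * Expr.reg 17).val s = 2 * r := Expr.Val.mul v2 v17 (by omega)
  have vt : StageExpr.t.val s = x % r := Expr.Val.mod v13 v17
  have vi : StageExpr.i.val s = x / r % H := Expr.Val.mod (Expr.Val.div v13 v17) v21
  have vl : StageExpr.l.val s = x / r / H % (2 * Q) :=
    Expr.Val.mod (Expr.Val.div (Expr.Val.div v13 v17) v21) v2Q
  have vb : StageExpr.b.val s = x / r / H / (2 * Q) :=
    Expr.Val.div (Expr.Val.div (Expr.Val.div v13 v17) v21) v2Q
  have ht : x % r < r := Nat.mod_lt _ hr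
  have hi : x / r % H < H := Nat.mod_lt _ hH
  have hl : x / r / H % (2 * Q) < 2 * Q := Nat.mod_lt _ hQ
  have hb : x / r / H / (2 * Q) < K := by
    rw [Nat.div_lt_iff_lt_mul hQ, Nat.div_lt_iff_lt_mul hH, Nat.div_lt_iff_lt_mul hr, ← hT]
    exact hx
  set t := x % r with ht_def
  set i := x / r % H with hi_def
  set l := x / r / H % (2 * Q) with hl_def
  set b := x / r / H / (2 * Q) with hb_def
  have hlQ : l % Q < Q := Nat.mod_lt _ hQ'
  have b1 : b * Q + l % Q < K * Q := mul_add_lt hb hlQ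
  have b2 : (b * Q + l % Q) * (2 * H) + (i + H) < K * Q * (2 * H) := mul_add_lt b1 (by omega)
  have hTe : K * Q * (2 * H) * r = T := by rw [hT]; ring
  have b3 : K * Q * (2 * H) ≤ T := by rw [← hTe]; exact Nat.le_mul_of_pos_right _ hr
  have b4 : K * Q ≤ T := le_trans (Nat.le_mul_of_pos_right _ (by omega)) b3
  have hv : r / Q * l ≤ 2 * r := by
    calc r / Q * l ≤ r / Q * (2 * Q) := Nat.mul_le_mul_left _ hl.le
      _ = 2 * (r / Q * Q) := by ring
      _ ≤ 2 * r := Nat.mul_le_mul_left _ (Nat.div_mul_le_self _ _)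
  set src := (b * Q + l % Q) * (2 * H) + i with hsrc
  have vsrc : StageExpr.src.val s = src := by
    refine Expr.Val.add (Expr.Val.mul (Expr.Val.add (Expr.Val.mul vb v20 ?_)
      (Expr.Val.mod vl v20) ?_) v2H ?_) vi ?_ <;> omega
  -- The difference t - (r/Q)·l may be negative. It is reduced modulo 2r, the period of an
  -- antiperiodic function; whether the result is below `r` then decides the sign.
  set u := (t + (2 * r - r / Q * l)) % (2 * r) with hu
  have hu2 : u < 2 * r := Nat.mod_lt _ (by omega)
  have vu : StageExpr.u.val s = u := by
    refine Expr.Val.mod (Expr.Val.add vt (Expr.Val.sub v2r (Expr.Val.mul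
      (Expr.Val.div v17 v20) vl ?_) ?_) ?_) v2r <;> omega
  have b5 : src * r + t < T := by rw [← hTe]; exact mul_add_lt (by omega) ht
  have hur : u % r < r := Nat.mod_lt _ hr
  have b6 : (src + H) * r + u % r < T := by rw [← hTe]; exact mul_add_lt (by omega) hur
  have e1 : (Expr.get A (StageExpr.src * .reg 17 + StageExpr.t)).eval s =
      BitVec.ofInt w (F (src * r + t)) := by
    rw [Expr.Val.eval_get (Expr.Val.add (Expr.Val.mul vsrc v17 (by omega)) vt (by omega)),
      hF _ b5]
  have e2 : (Expr.get A ((StageExpr.src + .reg 21) * .reg 17 + StageExpr.u % .reg 17)).eval s =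
      BitVec.ofInt w (F ((src + H) * r + u % r)) := by
    rw [Expr.Val.eval_get (Expr.Val.add (Expr.Val.mul (Expr.Val.add vsrc v21 (by omega)) v17
      (by omega)) (Expr.Val.mod vu v17) (by omega)), hF _ b6]
  rw [stageExpr, Expr.eval_add, Expr.eval_mul, e1, e2, Expr.eval_sign vu v17 hw,
    ← BitVec.ofInt_mul, ← BitVec.ofInt_add]
  congr 1
  have e3 : nc r (blk r F (src + H)) ((t : ℕ) - (r / Q * l : ℕ)) = nc r (blk r F (src + H)) u := by
    rw [hu, ← (isNeg_nc hr _).add_two_mul ((t : ℤ) - (r / Q * l : ℕ))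
      (1 - ((t + (2 * r - r / Q * l)) / (2 * r) : ℕ))]
    congr 1
    have h7 := Nat.mod_add_div (t + (2 * r - r / Q * l)) (2 * r)
    generalize (t + (2 * r - r / Q * l)) / (2 * r) = z at *
    have h8 : ((t + (2 * r - r / Q * l)) % (2 * r) : ℕ) + 2 * (r : ℤ) * z =
        t + (2 * r - (r / Q * l : ℕ)) := by
      have h9 : ((2 * r - r / Q * l : ℕ) : ℤ) = 2 * r - (r / Q * l : ℕ) := by push_cast [hv]; ring
      rw [← h9]; exact_mod_cast h7
    linear_combination -h8
  rw [stage, e3, nc_natCast hr _ hu2]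
  congr 1
  by_cases hur' : u < r
  · simp only [hur', if_true, one_mul, blk, Nat.mod_eq_of_lt hur']
  · have : u % r = u - r := by
      rw [Nat.mod_eq_sub_mod (by omega), Nat.mod_eq_of_lt (by omega)]
    simp only [hur', if_false, blk, this]; ring

end WordRAM

namespace WordRAM

open Negacyclic

variable {w : ℕ} {ω : ℕ → Bool} {s : State w}

/-! #### Splitting the blocks -/

namespace UnzipExpr
def t : Expr := .reg 13 % .reg 17
def k : Expr := .reg 13 / .reg 17 % .reg 18
def b : Expr := .reg 13 / .reg 17 / .reg 18
def pos : Expr := k + .reg 16 * t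
end UnzipExpr

open UnzipExpr in
def unzipPadExpr (A : ℕ) : Expr :=
  k.lt (.reg 16) * .get A (b * (.reg 16 * .reg 17) + pos)

open UnzipExpr in
def unzipExtExpr (A : ℕ) : Expr :=
  Expr.sign pos (.reg 16 * .reg 17) *
    .get A (b * (.reg 16 * .reg 17) + pos % (.reg 16 * .reg 17))

theorem eval_unzipExpr {A T K c r x : ℕ} {F : ℕ → ℤ} (hF : Holds s A T F)
    (hT : T = K * (c * r)) (hTw : 4 * T + 4 < 2 ^ w) (hx : x < 2 * T) (h13 : s.rval 13 = x)
    (h16 : s.rval 16 = c) (h17 : s.rval 17 = r) (h18 : s.rval 18 = 2 * c) :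
    (unzipPadExpr A).eval s = BitVec.ofInt w (unzipPad c r F x) ∧
    (unzipExtExpr A).eval s = BitVec.ofInt w (unzipExt c r F x) := by
  have hT0 : 0 < K * (c * r) := by omega
  have hcr : 0 < c * r := Nat.pos_of_mul_pos_left hT0
  have hr : 0 < r := Nat.pos_of_mul_pos_left hcr
  have hc : 0 < c := Nat.pos_of_mul_pos_right hcr
  have hK : 0 < K := Nat.pos_of_mul_pos_right hT0
  have hw : 1 < 2 ^ w := by omega
  have hcrT : c * r ≤ T := by rw [hT]; exact Nat.le_mul_of_pos_left _ hK
  have hccr : c ≤ c * r := Nat.le_mul_of_pos_right _ hr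
  have v13 : (Expr.reg 13).val s = x := h13
  have v16 : (Expr.reg 16).val s = c := h16
  have v17 : (Expr.reg 17).val s = r := h17
  have v18 : (Expr.reg 18).val s = 2 * c := h18
  have v1617 : (Expr.reg 16 * Expr.reg 17).val s = c * r := Expr.Val.mul v16 v17 (by omega)
  have vt : UnzipExpr.t.val s = x % r := Expr.Val.mod v13 v17
  have vk : UnzipExpr.k.val s = x / r % (2 * c) := Expr.Val.mod (Expr.Val.div v13 v17) v18
  have vb : UnzipExpr.b.val s = x / r / (2 * c) := Expr.Val.div (Expr.Val.div v13 v17) v18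
  have ht : x % r < r := Nat.mod_lt _ hr
  have hk : x / r % (2 * c) < 2 * c := Nat.mod_lt _ (by omega)
  have hb : x / r / (2 * c) < K := by
    rw [Nat.div_lt_iff_lt_mul (by omega), Nat.div_lt_iff_lt_mul hr]
    calc x < 2 * T := hx
      _ = K * (2 * c) * r := by rw [hT]; ring
  set t := x % r with ht_def
  set k := x / r % (2 * c) with hk_def
  set b := x / r / (2 * c) with hb_def
  have h1 : c * t + c ≤ c * r := by
    calc c * t + c = c * (t + 1) := by ring
      _ ≤ c * r := Nat.mul_le_mul_left _ ht
  have vpos : UnzipExpr.pos.val s = k + c * t :=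
    Expr.Val.add vk (Expr.Val.mul v16 vt (by omega)) (by omega)
  have h2 : b * (c * r) + c * r ≤ T := by
    rw [hT]
    calc b * (c * r) + c * r = (b + 1) * (c * r) := by ring
      _ ≤ _ := Nat.mul_le_mul_right _ hb
  have vbase : (UnzipExpr.b * (Expr.reg 16 * Expr.reg 17)).val s = b * (c * r) :=
    Expr.Val.mul vb v1617 (by omega)
  have hpad : unzipPad c r F x = if k < c then F (b * (c * r) + (k + c * t)) else 0 := rfl
  have hext : unzipExt c r F x = nc (c * r) (blk (c * r) F b) ((k + c * t : ℕ)) := rfl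
  constructor
  · rw [unzipPadExpr, Expr.eval_mul, Expr.Val.eval (Expr.Val.lt vk v16 hw), hpad,
      Expr.Val.eval_get (Expr.Val.add vbase vpos (by omega))]
    by_cases hkc : k < c
    · rw [if_pos hkc, if_pos hkc, hF _ (by omega)]
      rw [← BitVec.ofInt_natCast, ← BitVec.ofInt_mul, Nat.cast_one, one_mul]
    · rw [if_neg hkc, if_neg hkc]
      simp
  · have h3 : (k + c * t) % (c * r) < c * r := Nat.mod_lt _ hcr
    rw [unzipExtExpr, Expr.eval_mul, Expr.eval_sign vpos v1617 hw, hext,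
      Expr.Val.eval_get (Expr.Val.add vbase (Expr.Val.mod vpos v1617) (by omega)), hF _ (by omega),
      ← BitVec.ofInt_mul, nc_natCast hcr _ (by omega)]
    congr 1
    by_cases hkc : k + c * t < c * r
    · simp only [hkc, if_true, one_mul, blk, Nat.mod_eq_of_lt hkc]
    · have : (k + c * t) % (c * r) = k + c * t - c * r := by
        rw [Nat.mod_eq_sub_mod (by omega), Nat.mod_eq_of_lt (by omega)]
      simp only [hkc, if_false, blk, this]; ring

/-! #### A level of the recursion -/

/-- The same pass over the arrays `5`, `6`, `7`. -/
def passes (e₁ e₂ e₃ : Expr) : Prog := .seq (pass 5 e₁) (.seq (pass 6 e₂) (pass 7 e₃))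

theorem run_passes {e₁ e₂ e₃ : Expr} (T C : ℕ) (hw : 1 < 2 ^ w) (hT : s.rval 19 = T)
    (F₁ F₂ F₃ : ℕ → ℤ)
    (he₁ : ∀ k < T, ∀ s₁, Frame [13] [8] s s₁ → s₁.rval 13 = k →
      e₁.eval s₁ = BitVec.ofInt w (F₁ k))
    (he₂ : ∀ k < T, ∀ s₁, Frame [13] [8, 5] s s₁ → s₁.rval 13 = k →
      e₂.eval s₁ = BitVec.ofInt w (F₂ k))
    (he₃ : ∀ k < T, ∀ s₁, Frame [13] [8, 5, 6] s s₁ → s₁.rval 13 = k →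
      e₃.eval s₁ = BitVec.ofInt w (F₃ k))
    (hC : e₁.cost + e₂.cost + e₃.cost + 120 ≤ C) :
    Run ω (passes e₁ e₂ e₃) s ((T + 1) * C)
      (fun s' => Holds s' 5 T F₁ ∧ Holds s' 6 T F₂ ∧ Holds s' 7 T F₃ ∧
        Frame [13] [8, 5, 6, 7] s s') := by
  have h := run_pass (ω := ω) (A := 5) T hw (by decide) hT F₁ he₁
  refine Run.time_mono (Run.seq h (T₂ := (T + 1) * (e₂.cost + e₃.cost + 80)) ?_) ?_
  · rintro s₁ ⟨h₁, hF₁⟩ -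
    have h := run_pass (ω := ω) (A := 6) T hw (by decide) (by rw [hF₁.rval 19 (by decide), hT]) F₂
      fun k hk s₂ hF hx => he₂ k hk s₂ ((hF₁.mono (by simp) (by simp)).trans
        (hF.mono (by simp) (by simp))) hx
    refine Run.time_mono (Run.seq h (T₂ := (T + 1) * (e₃.cost + 40)) ?_) ?_
    · rintro s₂ ⟨h₂, hF₂⟩ -
      have hF₂' : Frame [13] [8, 5, 6] s s₂ :=
        (hF₁.mono (by simp) (by simp)).trans (hF₂.mono (by simp) (by simp))
      refine (run_pass T hw (by decide) (by rw [hF₂'.rval 19 (by decide), hT]) F₃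
        fun k hk s₃ hF hx => he₃ k hk s₃ (hF₂'.trans (hF.mono (by simp) (by simp))) hx).mono
        le_rfl fun s₃ ⟨h₃, hF₃⟩ => ?_
      exact ⟨h₁.congr (by rw [hF₃.mem 5 (by decide), hF₂.mem 5 (by decide)]),
        h₂.congr (hF₃.mem 6 (by decide)), h₃,
        (hF₂'.mono (by simp) (by simp)).trans (hF₃.mono (by simp) (by simp))⟩
    · rw [← Nat.mul_add]; exact Nat.mul_le_mul_left _ (by omega)
  · rw [← Nat.mul_add]; exact Nat.mul_le_mul_left _ (by omega)

def stageProg : Prog :=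
  .seq (passes (stageExpr 5) (stageExpr 6) (stageExpr 7))
    (.seq (.assign 20 (2 * .reg 20)) (.assign 21 (.reg 21 / 2)))

/-- On entry register 14 holds f, where blocks have length 2^(f+1), and register 15 the number of
blocks. Registers 16 and 17 receive the lengths s and r of the two factors of a block, 18 the
transform length 2s, 19 the new total size, and 20 and 21 the parameters Q and H of the first
butterfly pass. -/
def levelProg : Prog :=
  .seq (.seq (.assign 16 (.get 4 (.reg 14 - .reg 14 / 2)))
    (.seq (.assign 17 (.get 4 (.reg 14 / 2 + 1)))
    (.seq (.assign 18 (2 * .reg 16))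
    (.seq (.assign 19 (.reg 15 * .reg 18 * .reg 17))
    (.seq (.assign 20 1) (.assign 21 (.reg 16)))))))
  (.seq (passes (unzipPadExpr 5) (unzipPadExpr 6) (unzipExtExpr 7))
  (.seq (.loop (.reg 21) stageProg)
  (.seq (.assign 15 (.reg 15 * .reg 18)) (.assign 14 (.reg 14 / 2)))))

/-- Register 21 is described by the quotient 2^σ / 2^q rather than by 2^(σ-q): after the pass with q
= σ it is 0, and this zero ends the loop. -/
theorem run_stageProg {T K r q σ : ℕ} {F₁ F₂ F₃ : ℕ → ℤ} (hq : q ≤ σ)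
    (hT : T = K * (2 * 2 ^ σ) * r) (hr : 0 < r) (hK : 0 < K) (hTw : 2 * T + 2 < 2 ^ w)
    (h17 : s.rval 17 = r)
    (h19 : s.rval 19 = T) (h20 : s.rval 20 = 2 ^ q) (h21 : s.rval 21 = 2 ^ σ / 2 ^ q)
    (h₁ : Holds s 5 T F₁) (h₂ : Holds s 6 T F₂) (h₃ : Holds s 7 T F₃) :
    Run ω stageProg s ((T + 1) * 700)
      (fun s' => Holds s' 5 T (stage r (2 ^ q) (2 ^ (σ - q)) F₁) ∧
        Holds s' 6 T (stage r (2 ^ q) (2 ^ (σ - q)) F₂) ∧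
        Holds s' 7 T (stage r (2 ^ q) (2 ^ (σ - q)) F₃) ∧ s'.rval 20 = 2 ^ (q + 1) ∧
        s'.rval 21 = 2 ^ σ / 2 ^ (q + 1)) := by
  have hw : 1 < 2 ^ w := by omega
  have hdiv : 2 ^ σ / 2 ^ q = 2 ^ (σ - q) := Nat.pow_div hq (by norm_num)
  have hT' : T = K * (2 * 2 ^ q) * 2 ^ (σ - q) * r := by
    rw [hT, ← pow_mul_pow_sub 2 hq]; ring
  have hqT : 2 * 2 ^ q ≤ T := by
    rw [hT']
    calc 2 * 2 ^ q = 1 * (2 * 2 ^ q) * 1 * 1 := by ring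
      _ ≤ _ := by gcongr; exacts [hK, Nat.one_le_two_pow, hr]
  have ev : ∀ A F M, A ≠ 8 → A ∉ M → Holds s A T F → ∀ k < T, ∀ s₁ : State w, Frame [13] M s s₁ →
      s₁.rval 13 = k →
      (stageExpr A).eval s₁ = BitVec.ofInt w (stage r (2 ^ q) (2 ^ (σ - q)) F k) :=
    fun A F M hA hAM hH k hk s₁ hF hx => eval_stageExpr (hH.congr (hF.mem A hAM)) hT' hTw hk
      hx (by rw [hF.rval 17 (by decide), h17]) (by rw [hF.rval 20 (by decide), h20])
      (by rw [hF.rval 21 (by decide), h21, hdiv])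
  refine (Run.seq (run_passes T 546 hw h19 _ _ _ (ev 5 F₁ _ (by decide) (by decide) h₁)
    (ev 6 F₂ _ (by decide) (by decide) h₂) (ev 7 F₃ _ (by decide) (by decide) h₃)
    (by simp [stageExpr_cost])) (T₂ := 8) fun s₁ ⟨h4, h5, h6, hF⟩ _ => ?_).time_mono (by omega)
  have e20 : s₁.rval 20 = 2 ^ q := by rw [hF.rval 20 (by decide), h20]
  have e21 : s₁.rval 21 = 2 ^ σ / 2 ^ q := by rw [hF.rval 21 (by decide), h21]
  refine (Run.simple rfl ?_).time_mono (show _ ≤ 8 from le_rfl)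
  have e3 : (2 * Expr.reg 20).val s₁ = 2 * 2 ^ q :=
    Expr.Val.mul (Expr.val_lit _ 2 (by omega)) e20 (by omega)
  have e4 : ∀ v, (Expr.reg 21 / 2).val (s₁.setReg 20 v) = 2 ^ σ / 2 ^ q / 2 := fun v =>
    Expr.Val.div (by simpa using e21) (Expr.val_lit _ 2 (by omega))
  simp only [Prog.Post, Prog.den]
  refine ⟨h4, h5, h6, ?_, ?_⟩
  · rw [State.setReg_rval, if_neg (by decide), State.setReg_rval, if_pos rfl, pow_succ', ← e3]
    rfl
  · rw [State.setReg_rval, if_pos rfl, Nat.pow_succ, ← Nat.div_div_eq_div_mul]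
    exact e4 _

end WordRAM

namespace WordRAM

open Negacyclic

variable {w : ℕ} {ω : ℕ → Bool} {s : State w}

/-- Array `4` contains the powers of two up to `2 ^ M`. -/
def PowTable (s : State w) (M : ℕ) : Prop := ∀ i ≤ M, s.arr 4 i = 2 ^ i

theorem run_stages {T K r σ : ℕ} {F₁ F₂ F₃ : ℕ → ℤ} (hT : T = K * (2 * 2 ^ σ) * r) (hr : 0 < r)
    (hK : 0 < K) (hTw : 2 * T + 2 < 2 ^ w) (h17 : s.rval 17 = r) (h19 : s.rval 19 = T)
    (h20 : s.rval 20 = 1) (h21 : s.rval 21 = 2 ^ σ)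
    (h₁ : Holds s 5 T F₁) (h₂ : Holds s 6 T F₂) (h₃ : Holds s 7 T F₃) :
    Run ω (.loop (.reg 21) stageProg) s ((σ + 2) * ((T + 1) * 702))
      (fun s' => Holds s' 5 T (stages r σ (σ + 1) F₁) ∧
        Holds s' 6 T (stages r σ (σ + 1) F₂) ∧ Holds s' 7 T (stages r σ (σ + 1) F₃)) := by
  have h := Run.loop (ω := ω) (s := s) (p := stageProg) (e := .reg 21) (σ + 1)
    (fun q s' => Holds s' 5 T (stages r σ q F₁) ∧ Holds s' 6 T (stages r σ q F₂) ∧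
      Holds s' 7 T (stages r σ q F₃) ∧ s'.rval 20 = 2 ^ q ∧ s'.rval 21 = 2 ^ σ / 2 ^ q)
    (fun _ => (T + 1) * 700) ⟨h₁, h₂, h₃, by simpa using h20, by simpa using h21⟩
    (by
      rintro q hq s₁ hF ⟨h1, h2, h3, h4, h5⟩
      refine ⟨?_, ?_⟩
      · rw [Expr.val_reg, h5, Nat.pow_div (by omega) (by norm_num)]; positivity
      · exact run_stageProg (by omega) hT hr hK hTw (by rw [hF.rval 17 (by decide), h17])
          (by rw [hF.rval 19 (by decide), h19]) h4 h5 h1 h2 h3)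
    (by
      rintro s₁ hF ⟨h1, h2, h3, h4, h5⟩
      rw [Expr.val_reg, h5]
      exact Nat.div_eq_of_lt (Nat.pow_lt_pow_right (by norm_num) (by omega)))
  refine h.mono ?_ fun s' ⟨h1, h2, h3, _, _⟩ => ⟨h1, h2, h3⟩
  simp only [Expr.cost, Finset.sum_const, Finset.card_range, smul_eq_mul]
  nlinarith

/-- Blocks of length 2^(f+1) are split as 2^(f - f/2) times 2^(f/2 + 1). The padding doubles the
total size, and the number of blocks and the value of the form are related by the same factor `K'`.
-/
theorem run_levelProg {T K f M : ℕ} {F₁ F₂ F₃ : ℕ → ℤ} (hT : T = K * 2 ^ (f + 1)) (hf : 0 < f)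
    (hK : 0 < K) (hTw : 8 * T + 8 < 2 ^ w) (hM : PowTable s M) (hfM : f + 1 ≤ M)
    (h14 : s.rval 14 = f) (h15 : s.rval 15 = K)
    (h₁ : Holds s 5 T F₁) (h₂ : Holds s 6 T F₂) (h₃ : Holds s 7 T F₃) :
    Run ω levelProg s ((f + 4) * ((T + 1) * 1500))
      (fun s' => s'.rval 14 = f / 2 ∧ ∃ K' F₁' F₂' F₃', 0 < K' ∧ s'.rval 15 = K * K' ∧
        K * K' * 2 ^ (f / 2 + 1) = 2 * T ∧
        Holds s' 5 (2 * T) F₁' ∧ Holds s' 6 (2 * T) F₂' ∧ Holds s' 7 (2 * T) F₃' ∧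
        total (K * K') (2 ^ (f / 2 + 1)) F₁' F₂' F₃' = K' * total K (2 ^ (f + 1)) F₁ F₂ F₃) := by
  have hw : 1 < 2 ^ w := by omega
  obtain ⟨σ, hσ⟩ : ∃ σ, σ = f - f / 2 := ⟨_, rfl⟩
  obtain ⟨r, hr⟩ : ∃ r, r = 2 ^ (f / 2 + 1) := ⟨_, rfl⟩
  have hr0 : 0 < r := hr ▸ by positivity
  have hsr : 2 ^ σ * r = 2 ^ (f + 1) := by rw [hr, ← pow_add]; congr 1; omega
  -- The roots of unity exist because σ = ⌈f/2⌉ is at most f/2 + 1 (rounded down); the cofactor is 2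
  -- for even f and 1 for odd f.
  have hrc : r = 2 ^ (f / 2 + 1 - σ) * 2 ^ σ := by rw [hr, ← pow_add]; congr 1; omega
  have hT' : T = K * (2 ^ σ * r) := by rw [hT, hsr]
  have h2T : 2 * T = K * (2 * 2 ^ σ) * r := by rw [hT']; ring
  have hσT : 2 ^ σ ≤ T := by
    rw [hT']
    calc 2 ^ σ = 1 * (2 ^ σ * 1) := by ring
      _ ≤ _ := by gcongr; exacts [hK, hr0]
  have hKT : K * (2 * 2 ^ σ) ≤ 2 * T := by rw [h2T]; exact Nat.le_mul_of_pos_right _ hr0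
  have hfw : f + 1 < 2 ^ (f + 1) := Nat.lt_two_pow_self
  have hfT : 2 ^ (f + 1) ≤ T := by rw [hT]; exact Nat.le_mul_of_pos_left _ hK
  have hpw2 : ∀ s' : State w, (2 : Expr).val s' = 2 := fun s' => Expr.val_lit s' 2 (by omega)
  have A : Run ω (.seq (.assign 16 (.get 4 (.reg 14 - .reg 14 / 2)))
    (.seq (.assign 17 (.get 4 (.reg 14 / 2 + 1)))
    (.seq (.assign 18 (2 * .reg 16))
    (.seq (.assign 19 (.reg 15 * .reg 18 * .reg 17))
    (.seq (.assign 20 1) (.assign 21 (.reg 16))))))) s 40 (fun s₁ => s₁.rval 16 = 2 ^ σ ∧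
      s₁.rval 17 = r ∧ s₁.rval 18 = 2 * 2 ^ σ ∧ s₁.rval 19 = 2 * T ∧ s₁.rval 20 = 1 ∧
      s₁.rval 21 = 2 ^ σ) := by
    refine (Run.simple rfl ?_).time_mono (by decide)
    refine Prog.Post.seq_assign (n := 2 ^ σ) ?_ fun v16 e16 => ?_
    · rw [← hM σ (by omega), hσ]
      exact Expr.Val.get (Expr.Val.sub (Expr.Val.reg h14) (Expr.Val.div (Expr.Val.reg h14)
        (hpw2 _)) (Nat.div_le_self _ _))
    refine Prog.Post.seq_assign (n := r) ?_ fun v17 e17 => ?_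
    · rw [hr, ← hM (f / 2 + 1) (by omega)]
      exact Expr.Val.get (Expr.Val.add (Expr.Val.div (Expr.Val.reg (by simp [h14])) (hpw2 _))
        (Expr.val_one _ hw) (by omega))
    refine Prog.Post.seq_assign (n := 2 * 2 ^ σ) ?_ fun v18 e18 => ?_
    · exact Expr.Val.mul (hpw2 _) (Expr.Val.reg (by simp [e16])) (by omega)
    refine Prog.Post.seq_assign (n := 2 * T) ?_ fun v19 e19 => ?_
    · rw [h2T]
      exact Expr.Val.mul (Expr.Val.mul (Expr.Val.reg (by simp [h15])) (Expr.Val.reg (by simp [e18]))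
        (by omega)) (Expr.Val.reg (by simp [e17])) (by omega)
    refine Prog.Post.seq_assign (n := 1) (Expr.val_one _ hw) fun v20 e20 => ?_
    refine Prog.Post.assign (n := 2 ^ σ) (Expr.Val.reg (by simp [e16])) fun v21 e21 => ?_
    simp [e16, e17, e18, e19, e20, e21]
  refine Run.time_mono (Run.seq A (T₂ := (f + 4) * ((T + 1) * 1500) - 40) ?_) (by
    have : 1 * (1 * 1500) ≤ (f + 4) * ((T + 1) * 1500) := by gcongr <;> omega
    omega)
  rintro s₁ ⟨a16, a17, a18, a19, a20, a21⟩ hF₁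
  have b₁ := h₁.congr (hF₁.mem 5 (by decide))
  have b₂ := h₂.congr (hF₁.mem 6 (by decide))
  have b₃ := h₃.congr (hF₁.mem 7 (by decide))
  have ev : ∀ A F M, A ∉ M → Holds s₁ A T F → ∀ k < 2 * T, ∀ s₂ : State w, Frame [13] M s₁ s₂ →
      s₂.rval 13 = k →
      (unzipPadExpr A).eval s₂ = BitVec.ofInt w (unzipPad (2 ^ σ) r F k) ∧
      (unzipExtExpr A).eval s₂ = BitVec.ofInt w (unzipExt (2 ^ σ) r F k) :=
    fun A F M hAM hH k hk s₂ hF hx => eval_unzipExpr (hH.congr (hF.mem A hAM)) hT' (by omega) hk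
      hx (by rw [hF.rval 16 (by decide), a16]) (by rw [hF.rval 17 (by decide), a17])
      (by rw [hF.rval 18 (by decide), a18])
  have B := run_passes (ω := ω) (2 * T) 700 hw a19 _ _ _
    (fun k hk s₂ hF hx => (ev 5 F₁ _ (by decide) b₁ k hk s₂ hF hx).1)
    (fun k hk s₂ hF hx => (ev 6 F₂ _ (by decide) b₂ k hk s₂ hF hx).1)
    (fun k hk s₂ hF hx => (ev 7 F₃ _ (by decide) b₃ k hk s₂ hF hx).2) (by decide)
  refine Run.time_mono (Run.seq B (T₂ := (f + 4) * ((T + 1) * 1500) - 40 - (2 * T + 1) * 700) ?_)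
    (by
      have : 1 * ((2 * T + 1) * 700 + 40) ≤ (f + 4) * ((T + 1) * 1500) := by gcongr <;> omega
      omega)
  rintro s₂ ⟨c₁, c₂, c₃, hF₂⟩ -
  have C := run_stages (ω := ω) h2T hr0 hK (by omega) (by rw [hF₂.rval 17 (by decide), a17])
    (by rw [hF₂.rval 19 (by decide), a19]) (by rw [hF₂.rval 20 (by decide), a20])
    (by rw [hF₂.rval 21 (by decide), a21]) c₁ c₂ c₃
  refine Run.time_mono (Run.seq C (T₂ := 8) ?_) ?_
  · rintro s₃ ⟨d₁, d₂, d₃⟩ hF₃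
    refine (Run.simple rfl ?_).time_mono (by decide)
    have e14 : s₃.rval 14 = f := by
      rw [hF₃.rval 14 (by decide), hF₂.rval 14 (by decide), hF₁.rval 14 (by decide), h14]
    have e15 : s₃.rval 15 = K := by
      rw [hF₃.rval 15 (by decide), hF₂.rval 15 (by decide), hF₁.rval 15 (by decide), h15]
    have e18 : s₃.rval 18 = 2 * 2 ^ σ := by
      rw [hF₃.rval 18 (by decide), hF₂.rval 18 (by decide), a18]
    refine Prog.Post.seq_assign (n := K * (2 * 2 ^ σ)) (Expr.Val.mul (Expr.Val.reg e15)
      (Expr.Val.reg e18) (by omega)) fun v15 g15 => ?_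
    refine Prog.Post.assign (n := f / 2) (Expr.Val.div (Expr.Val.reg (by simp [e14])) (hpw2 _))
      fun v14 g14 => ?_
    refine ⟨by simp [g14], 2 * 2 ^ σ, _, _, _, by positivity, by simp [g15], by rw [h2T, hr],
      d₁, d₂, d₃, ?_⟩
    rw [← hr, total_transform hrc hr0, hsr]; push_cast; ring
  · have h5 : (f + 4) * ((T + 1) * 1500) = (f + 2) * ((T + 1) * 1500) + 3000 * T + 3000 := by ring
    have h6 : (σ + 2) * ((2 * T + 1) * 702) ≤ (f + 2) * ((T + 1) * 1500) :=
      Nat.mul_le_mul (by omega) (by omega)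
    omega

/-- A level doubles the total size and at least halves f, so size times f never grows beyond its
initial value `B`. While f > 0 the size is thus at most `B`, and the last level at most doubles it
once more; hence the second bound by `2 * B` in the invariant, which still says something when f is
0. -/
theorem run_levels {B K f M : ℕ} {F₁ F₂ F₃ : ℕ → ℤ} (hf : 0 < f) (hB : K * 2 ^ (f + 1) * f = B)
    (hK : 0 < K) (hBw : 16 * B + 8 < 2 ^ w) (hM : PowTable s M) (hfM : f + 1 ≤ M)
    (h14 : s.rval 14 = f) (h15 : s.rval 15 = K)
    (h₁ : Holds s 5 (K * 2 ^ (f + 1)) F₁) (h₂ : Holds s 6 (K * 2 ^ (f + 1)) F₂)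
    (h₃ : Holds s 7 (K * 2 ^ (f + 1)) F₃) :
    Run ω (.loop (.reg 14) levelProg) s ((f + 4) ^ 2 * ((B + 1) * 3000))
      (fun s' => ∃ K' F₁' F₂' F₃', 0 < K' ∧ s'.rval 15 = K * K' ∧ K * K' ≤ B ∧
        Holds s' 5 (K * K' * 2) F₁' ∧ Holds s' 6 (K * K' * 2) F₂' ∧ Holds s' 7 (K * K' * 2) F₃' ∧
        total (K * K') 2 F₁' F₂' F₃' = K' * total K (2 ^ (f + 1)) F₁ F₂ F₃) := by
  have h := Run.while (ω := ω) (s := s) (p := levelProg) (e := .reg 14)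
    (fun s' => ∃ f' K' F₁' F₂' F₃', 0 < K' ∧ s'.rval 14 = f' ∧ f' ≤ f ∧ s'.rval 15 = K * K' ∧
        K * K' * 2 ^ (f' + 1) * f' ≤ B ∧ K * K' * 2 ^ (f' + 1) ≤ 2 * B ∧
        Holds s' 5 (K * K' * 2 ^ (f' + 1)) F₁' ∧ Holds s' 6 (K * K' * 2 ^ (f' + 1)) F₂' ∧
        Holds s' 7 (K * K' * 2 ^ (f' + 1)) F₃' ∧
        total (K * K') (2 ^ (f' + 1)) F₁' F₂' F₃' = K' * total K (2 ^ (f + 1)) F₁ F₂ F₃)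
    -- Using f itself as variant overestimates the number of levels, which is logarithmic in f; the
    -- bound is still polylogarithmic in the length.
    (fun s' => s'.rval 14) ((f + 4) * ((B + 1) * 1500))
    ⟨f, 1, F₁, F₂, F₃, by norm_num, h14, le_rfl, by simpa using h15, by simpa using hB.le, by
      rw [mul_one, ← hB]
      calc K * 2 ^ (f + 1) ≤ K * 2 ^ (f + 1) * f := Nat.le_mul_of_pos_right _ hf
        _ ≤ _ := by omega, by simpa using h₁, by simpa using h₂, by simpa using h₃, by simp⟩
    (by
      rintro s₁ hF ⟨f', K', G₁, G₂, G₃, hK', e14, hf', e15, hB', -, g₁, g₂, g₃, ht⟩ he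
      rw [Expr.val_reg, e14] at he
      have hf0 : 0 < f' := Nat.pos_of_ne_zero he
      have hT : K * K' * 2 ^ (f' + 1) ≤ B :=
        (Nat.le_mul_of_pos_right _ hf0).trans hB'
      refine (run_levelProg rfl hf0 (Nat.mul_pos hK hK') (by omega)
        (fun i hi => by rw [hF.arr 4 (by decide), hM i hi]) (by omega) e14 e15 g₁ g₂ g₃).mono
        (by gcongr) ?_
      rintro s₂ ⟨i14, L, H₁, H₂, H₃, hL, i15, iT, j₁, j₂, j₃, jt⟩
      rw [mul_assoc K K' L] at i15 iT jt
      refine ⟨⟨f' / 2, K' * L, H₁, H₂, H₃, Nat.mul_pos hK' hL, i14, by omega, i15, ?_, ?_,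
        ?_, ?_, ?_, ?_⟩, ?_⟩
      · rw [iT]
        calc 2 * (K * K' * 2 ^ (f' + 1)) * (f' / 2) = K * K' * 2 ^ (f' + 1) * (f' / 2 * 2) := by ring
          _ ≤ K * K' * 2 ^ (f' + 1) * f' := Nat.mul_le_mul_left _ (Nat.div_mul_le_self _ _)
          _ ≤ B := hB'
      · rw [iT]; omega
      · rw [iT]; exact j₁
      · rw [iT]; exact j₂
      · rw [iT]; exact j₃
      · rw [jt, ht]; push_cast; ring
      · rw [i14, e14]; omega)
  refine h.mono ?_ ?_
  · simp only [Expr.cost, h14]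
    have : (f + 4) ^ 2 * ((B + 1) * 3000) = f * ((f + 4) * ((B + 1) * 1500)) +
      (4 * (f + 4) * ((B + 1) * 1500) + (f + 4) ^ 2 * ((B + 1) * 1500)) := by ring
    rw [this]
    have h1 : f * 1 ≤ 4 * (f + 4) * ((B + 1) * 1500) := Nat.mul_le_mul (by omega) (by omega)
    have h2 : (f + 4) * 1 ≤ (f + 4) ^ 2 * ((B + 1) * 1500) :=
      Nat.mul_le_mul (Nat.le_self_pow (by norm_num) _) (by omega)
    have h3 : f * ((f + 4) * ((B + 1) * 1500) + 1 + 1) =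
      f * ((f + 4) * ((B + 1) * 1500)) + 2 * f := by ring
    rw [h3]
    omega
  · rintro s' ⟨⟨f', K', G₁, G₂, G₃, hK', e14, hf', e15, hB', hB2, g₁, g₂, g₃, ht⟩, he⟩
    rw [Expr.val_reg, e14] at he
    subst he
    simp only [zero_add, pow_one] at *
    exact ⟨K', G₁, G₂, G₃, hK', e15, by omega, g₁, g₂, g₃, ht⟩

/-! #### The base of the recursion -/

def baseExpr : Expr :=
  .get 5 (2 * .reg 13) * .get 6 (2 * .reg 13) * .get 7 (2 * .reg 13) +
  (.get 5 (2 * .reg 13) * .get 6 (2 * .reg 13 + 1) +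
    .get 5 (2 * .reg 13 + 1) * .get 6 (2 * .reg 13)) * .get 7 (2 * .reg 13 + 1) -
  .get 5 (2 * .reg 13 + 1) * .get 6 (2 * .reg 13 + 1) * .get 7 (2 * .reg 13)

/-- Register `22` gets the sum of the forms of the blocks of length two. -/
def baseProg : Prog :=
  .seq (.assign 22 0) (.for 13 (.reg 15) (.assign 22 (.reg 22 + baseExpr)))

theorem run_baseProg {K : ℕ} {F₁ F₂ F₃ : ℕ → ℤ} (h15 : s.rval 15 = K) (hKw : 2 * K + 2 < 2 ^ w)
    (h₁ : Holds s 5 (K * 2) F₁) (h₂ : Holds s 6 (K * 2) F₂) (h₃ : Holds s 7 (K * 2) F₃) :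
    Run ω baseProg s ((K + 1) * 100)
      (fun s' => s'.reg 22 = BitVec.ofInt w (total K 2 F₁ F₂ F₃)) := by
  have hw : 1 < 2 ^ w := by omega
  refine Run.time_mono (Run.seq (Run.simple (Q := fun s' => s' = s.setReg 22 0) rfl rfl)
    (T₂ := (K + 1) * 98) ?_) (by change 2 + _ ≤ _; omega)
  rintro _ rfl -
  refine (Run.for (ω := ω) (s := s.setReg 22 0) (x := 13) (b := .reg 15)
    (p := .assign 22 (.reg 22 + baseExpr)) K (by omega) hw
    (fun k s₁ => s₁.reg 22 = BitVec.ofInt w (total k 2 F₁ F₂ F₃)) 88 (by decide)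
    (by simp [total]) (fun s₁ hF => by
      rw [Expr.val_reg, hF.rval 15 (by decide)]; simpa using h15) ?_).mono ?_ fun s' h => h.1
  · intro k hk s₁ hF hx hI
    refine (Run.simple rfl ?_).time_mono (by decide)
    have v2 : (2 * Expr.reg 13).val s₁ = k * 2 := by
      rw [mul_comm k]
      exact Expr.Val.mul (Expr.val_lit _ 2 (by omega)) (Expr.Val.reg hx) (by omega)
    have v3 : (2 * Expr.reg 13 + 1).val s₁ = k * 2 + 1 :=
      Expr.Val.add v2 (Expr.val_one _ hw) (by omega)
    have g : ∀ A F, A ∉ (.assign 22 (.reg 22 + baseExpr) : Prog).arrays → Holds s A (K * 2) F →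
        (Expr.get A (2 * .reg 13)).eval s₁ = BitVec.ofInt w (F (k * 2)) ∧
        (Expr.get A (2 * .reg 13 + 1)).eval s₁ = BitVec.ofInt w (F (k * 2 + 1)) := by
      intro A F hA hH
      rw [Expr.Val.eval_get v2, Expr.Val.eval_get v3, hF.mem A hA]
      exact ⟨hH _ (by omega), hH _ (by omega)⟩
    simp only [Prog.Post, Prog.den, State.setReg_reg, if_true]
    rw [if_neg (by decide), Expr.eval_add, Expr.eval_reg, hI, baseExpr]
    simp only [Expr.eval_add, Expr.eval_sub, Expr.eval_mul,
      (g 5 F₁ (by decide) h₁).1, (g 5 F₁ (by decide) h₁).2, (g 6 F₂ (by decide) h₂).1,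
      (g 6 F₂ (by decide) h₂).2, (g 7 F₃ (by decide) h₃).1, (g 7 F₃ (by decide) h₃).2]
    simp only [← BitVec.ofInt_mul, ← BitVec.ofInt_add, ← ofInt_sub]
    congr 1
    simp only [total, Finset.sum_range_succ, form_two, blk, add_zero]
  · change K * (88 + 1 + 7) + 1 + 5 ≤ _; omega

end WordRAM

/-! ### Counting the triples that are zero-sum modulo `p` -/

namespace ThreeSum

/-- Three finite sequences of natural numbers; the triples with `α i + β j = γ k` are sought. -/
structure Inst where
  la : ℕ
  lb : ℕ
  lc : ℕ
  α : ℕ → ℕ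
  β : ℕ → ℕ
  γ : ℕ → ℕ

namespace Inst

/-- The number of triples with `α i + β j ≡ γ k` modulo `p`. -/
def count (I : Inst) (p : ℕ) : ℕ :=
  ∑ i ∈ Finset.range I.la, ∑ j ∈ Finset.range I.lb,
    ((Finset.range I.lc).filter fun k => (I.α i + I.β j) % p = I.γ k % p).card

theorem count_le (I : Inst) (p : ℕ) : I.count p ≤ I.la * I.lb * I.lc := by
  have h : ∀ i ∈ Finset.range I.la, ∑ j ∈ Finset.range I.lb,
      ((Finset.range I.lc).filter fun k => (I.α i + I.β j) % p = I.γ k % p).card ≤ I.lb * I.lc := by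
    intro i _
    simpa using Finset.sum_le_card_nsmul (Finset.range I.lb) _ I.lc fun j _ =>
      (Finset.card_filter_le _ _).trans (Finset.card_range _).le
  have h2 := Finset.sum_le_card_nsmul (Finset.range I.la) _ _ h
  rw [Finset.card_range, smul_eq_mul, ← mul_assoc] at h2
  exact h2

end Inst

/-- The number of `i < m` with `a i = x`. -/
def hist (m : ℕ) (a : ℕ → ℕ) (x : ℕ) : ℕ := ((Finset.range m).filter fun i => a i = x).card

theorem hist_succ (m : ℕ) (a : ℕ → ℕ) (x : ℕ) :
    hist (m + 1) a x = hist m a x + if x = a m then 1 else 0 := by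
  simp only [hist, Finset.card_filter, Finset.sum_range_succ]
  exact congrArg _ (if_congr eq_comm rfl rfl)

theorem sum_hist {m N : ℕ} {a : ℕ → ℕ} (ha : ∀ i < m, a i < N) (f : ℕ → ℤ) :
    ∑ t ∈ Finset.range N, (hist m a t : ℤ) * f t = ∑ i ∈ Finset.range m, f (a i) := by
  simp only [hist, Finset.card_filter, Nat.cast_sum, Finset.sum_mul]
  rw [Finset.sum_comm]
  refine Finset.sum_congr rfl fun i hi => ?_
  rw [Finset.sum_eq_single (a i)]
  · simp
  · intro b _ hb; simp [Ne.symm hb]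
  · intro h; simp at h hi; have := ha i hi; omega

open Negacyclic in
-- A sum of two residues is below 2p ≤ N, so the antiperiodic extension never acts. Such a sum is
-- congruent to γ if and only if it equals γ % p or γ % p + p, which is why the third sequence is a
-- sum of two histograms.
theorem total_hist (I : Inst) {p N : ℕ} (hp : 0 < p) (hN : 2 * p ≤ N) :
    total 1 N (fun x => hist I.la (fun i => I.α i % p) x)
      (fun x => hist I.lb (fun j => I.β j % p) x)
      (fun x => (hist I.lc (fun k => I.γ k % p) x + hist I.lc (fun k => I.γ k % p + p) x : ℕ)) =
    I.count p := by
  have hlt : ∀ a : ℕ, a % p < p := fun a => Nat.mod_lt _ hp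
  have hb : ∀ F, blk N F 0 = F := fun F => by funext t; simp [blk]
  simp only [total, Finset.sum_range_one, form, hb, mul_assoc]
  simp only [← Finset.mul_sum]
  rw [sum_hist (fun i _ => (hlt _).trans_le (by omega))
    (fun t => ∑ u ∈ Finset.range N, (hist I.lb (fun j => I.β j % p) u : ℤ) *
      nc N (fun x => (hist I.lc (fun k => I.γ k % p) x + hist I.lc (fun k => I.γ k % p + p) x : ℕ))
        (t + u)), Inst.count, Nat.cast_sum]
  refine Finset.sum_congr rfl fun i _ => ?_
  rw [sum_hist (fun i _ => (hlt _).trans_le (by omega)) (fun u =>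
      nc N (fun x => (hist I.lc (fun k => I.γ k % p) x + hist I.lc (fun k => I.γ k % p + p) x : ℕ))
        ((I.α i % p : ℕ) + u)), Nat.cast_sum]
  refine Finset.sum_congr rfl fun j _ => ?_
  have h1 := hlt (I.α i)
  have h2 := hlt (I.β j)
  rw [← Nat.cast_add, nc_of_lt _ (by omega)]
  norm_cast
  rw [hist, hist, ← Finset.card_union_of_disjoint]
  · congr 1
    ext k
    simp only [Finset.mem_union, Finset.mem_filter, ← and_or_left]
    refine and_congr_right fun _ => ?_
    have h3 := hlt (I.γ k)
    have h4 : (I.α i + I.β j) % p = if I.α i % p + I.β j % p < p then I.α i % p + I.β j % p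
        else I.α i % p + I.β j % p - p := by
      rw [Nat.add_mod]
      split_ifs with h5
      · exact Nat.mod_eq_of_lt h5
      · rw [Nat.mod_eq_sub_mod (not_lt.1 h5), Nat.mod_eq_of_lt (by omega)]
    rw [h4]
    split_ifs <;> omega
  · rw [Finset.disjoint_filter]
    intro k _ h3 h4; omega

end ThreeSum

/-! ### Counting on the word RAM: histograms, recursion and final division. -/

namespace WordRAM

open Negacyclic ThreeSum

variable {w : ℕ} {ω : ℕ → Bool} {s : State w}

theorem Holds.incr {A N a : ℕ} {F G : ℕ → ℤ} {v : BitVec w} (h : Holds s A N F) (hN : N ≤ 2 ^ w)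
    (ha : a < N) (hv : v = BitVec.ofInt w (F a + 1))
    (hG : ∀ x, G x = F x + if x = a then 1 else 0) :
    Holds (s.setMem A (BitVec.ofNat w a) v) A N G := by
  intro x hx
  rw [State.setMem_mem_ofNat _ _ _ _ _ _ (by omega) (by omega), hG]
  by_cases hxa : x = a
  · subst hxa; simp [hv]
  · simp [hxa, h x hx]

/-- `A[e] := A[e] + 1`. -/
def incr (A : ℕ) (e : Expr) : Prog := .store A e (.get A e + 1)

theorem den_incr {A a N : ℕ} {e : Expr} {F : ℕ → ℤ} (h : Holds s A N F) (ha : a < N)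
    (he : e.val s = a) :
    (incr A e).den s = s.setMem A (BitVec.ofNat w a) (BitVec.ofInt w (F a + 1)) := by
  have : (Expr.get A e + 1).eval s = BitVec.ofInt w (F a + 1) := by
    rw [Expr.eval_add, Expr.Val.eval_get he, h a ha, BitVec.ofInt_add, Expr.eval_one]
    rw [← BitVec.ofInt_natCast, Nat.cast_one]
  rw [incr, Prog.den, this, Expr.Val.eval he]

/-- Array `A` gets the histogram of the residues modulo register `11` of the first entries of array
`A'`. -/
def histProg (A A' : ℕ) (b : Expr) : Prog :=
  .seq (.tab 13 A (.reg 23) 0) (.for 13 b (incr A (.get A' (.reg 13) % .reg 11)))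

/-- The same with residues `x` and `x + p`. -/
def histProg₂ (A A' : ℕ) (b : Expr) : Prog :=
  .seq (.tab 13 A (.reg 23) 0)
    (.for 13 b (.seq (incr A (.get A' (.reg 13) % .reg 11))
      (incr A (.get A' (.reg 13) % .reg 11 + .reg 11))))

theorem ofNat_zero_eq : BitVec.ofNat w 0 = BitVec.ofInt w 0 := (BitVec.ofInt_natCast w 0).symm

theorem run_histProg {A A' x m p N : ℕ} {a : ℕ → ℕ} (hA : A' ≠ A) (hw : 1 < 2 ^ w) (hp : 0 < p)
    (hN : 2 * p ≤ N) (hx : x ≠ 13) (hb : s.rval x = m) (h11 : s.rval 11 = p) (h23 : s.rval 23 = N)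
    (ha : ∀ i < m, s.arr A' i = a i) :
    Run ω (histProg A A' (.reg x)) s (N * 11 + m * 20 + 20)
      (fun s' => Holds s' A N (fun x => hist m (fun i => a i % p) x)) := by
  have hNw : N < 2 ^ w := h23 ▸ s.rval_lt _
  have h1 := Run.tab (ω := ω) (s := s) (x := 13) (A := A) (b := .reg 23) (e := 0) N hNw hw
    (fun _ => BitVec.ofInt w 0) (fun s₁ hF => by rw [Expr.val_reg, hF.rval 23 (by decide), h23])
    (fun k _ s₁ _ _ => by rw [Expr.eval_zero, ofNat_zero_eq])
  refine Run.time_mono (Run.seq h1 (T₂ := m * 20 + 14) ?_) (by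
    change N * (1 + 1 + 9) + 1 + 5 + _ ≤ _; omega)
  rintro s₁ ⟨h2, hF₁⟩ -
  refine (Run.for (ω := ω) (s := s₁) (x := 13) (b := .reg x) m (hb ▸ s.rval_lt _) hw
    (fun k s' => Holds s' A N (fun x => hist k (fun i => a i % p) x)) 12
    (by simp [incr, Prog.regs]) (by intro i hi; simpa [hist] using h2 i hi) (fun s₂ hF => by
      rw [Expr.val_reg, hF.rval x (by simp [incr, Prog.regs, hx]), hF₁.rval x (by simp [hx]), hb])
    ?_).mono (by change m * (12 + 1 + 7) + 1 + 5 ≤ _; omega) fun s' h => h.1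
  intro k hk s₂ hF hx hI
  refine (Run.simple rfl ?_).time_mono (show _ ≤ 12 from le_rfl)
  have e : (Expr.get A' (.reg 13) % .reg 11).val s₂ = a k % p := by
    refine Expr.Val.mod ?_ (Expr.Val.reg ?_)
    · rw [Expr.Val.get (Expr.Val.reg hx), hF.arr A' (by simp [incr, Prog.arrays, hA]),
        hF₁.arr A' (by simp [hA]), ha k hk]
    · rw [hF.rval 11 (by simp [incr, Prog.regs]), hF₁.rval 11 (by decide), h11]
  have hlt : a k % p < N := (Nat.mod_lt _ hp).trans_le (by omega)
  rw [Prog.Post, den_incr hI hlt e]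
  exact (hI.incr hNw.le hlt rfl fun x => by rw [hist_succ]; push_cast; rfl).congr rfl

theorem run_histProg₂ {A A' x m p N : ℕ} {a : ℕ → ℕ} (hA : A' ≠ A) (hw : 1 < 2 ^ w) (hp : 0 < p)
    (hN : 2 * p ≤ N) (hx : x ≠ 13) (hb : s.rval x = m) (h11 : s.rval 11 = p) (h23 : s.rval 23 = N)
    (ha : ∀ i < m, s.arr A' i = a i) :
    Run ω (histProg₂ A A' (.reg x)) s (N * 11 + m * 40 + 20)
      (fun s' => Holds s' A N
        (fun x => (hist m (fun i => a i % p) x + hist m (fun i => a i % p + p) x : ℕ))) := by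
  have hNw : N < 2 ^ w := h23 ▸ s.rval_lt _
  have h1 := Run.tab (ω := ω) (s := s) (x := 13) (A := A) (b := .reg 23) (e := 0) N hNw hw
    (fun _ => BitVec.ofInt w 0) (fun s₁ hF => by rw [Expr.val_reg, hF.rval 23 (by decide), h23])
    (fun k _ s₁ _ _ => by rw [Expr.eval_zero, ofNat_zero_eq])
  refine Run.time_mono (Run.seq h1 (T₂ := m * 40 + 14) ?_) (by
    change N * (1 + 1 + 9) + 1 + 5 + _ ≤ _; omega)
  rintro s₁ ⟨h2, hF₁⟩ -
  refine (Run.for (ω := ω) (s := s₁) (x := 13) (b := .reg x) m (hb ▸ s.rval_lt _) hw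
    (fun k s' => Holds s' A N
      (fun x => (hist k (fun i => a i % p) x + hist k (fun i => a i % p + p) x : ℕ))) 32
    (by simp [incr, Prog.regs]) (by intro i hi; simpa [hist] using h2 i hi) (fun s₂ hF => by
      rw [Expr.val_reg, hF.rval x (by simp [incr, Prog.regs, hx]), hF₁.rval x (by simp [hx]), hb])
    ?_).mono (by change m * (32 + 1 + 7) + 1 + 5 ≤ _; omega) fun s' h => h.1
  intro k hk s₂ hF hx hI
  refine (Run.simple rfl ?_).time_mono (show 12 + 16 ≤ 32 by norm_num)
  have e : ∀ s₃ : State w, Frame [] [A] s₂ s₃ →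
      (Expr.get A' (.reg 13) % .reg 11).val s₃ = a k % p := by
    intro s₃ hF₃
    refine Expr.Val.mod ?_ (Expr.Val.reg ?_)
    · rw [Expr.Val.get (Expr.Val.reg ((hF₃.rval 13 (by decide)).trans hx)),
        hF₃.arr A' (by simp [hA]), hF.arr A' (by simp [incr, Prog.arrays, hA]),
        hF₁.arr A' (by simp [hA]), ha k hk]
    · rw [hF₃.rval 11 (by decide), hF.rval 11 (by simp [incr, Prog.regs]), hF₁.rval 11 (by decide),
        h11]
  have hF₃ : ∀ i v, Frame [] [A] s₂ (s₂.setMem A i v) := fun i v =>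
    ⟨fun _ _ => rfl, fun B hB => State.setMem_mem_ne _ _ _ _ _ (by simpa using hB)⟩
  have hltp : a k % p < p := Nat.mod_lt _ hp
  have h11' : ∀ i v, (Expr.reg 11).val (s₂.setMem A i v) = p := fun i v => by
    rw [Expr.val_reg, (hF₃ i v).rval 11 (by decide), hF.rval 11 (by simp [incr, Prog.regs]),
      hF₁.rval 11 (by decide), h11]
  rw [Prog.Post, Prog.den, den_incr hI (by omega) (e _ (Frame.refl _ _ _))]
  have hI' := hI.incr (a := a k % p) (G := fun x => (hist (k + 1) (fun i => a i % p) x +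
    hist k (fun i => a i % p + p) x : ℕ)) hNw.le (by omega) rfl
    fun x => by rw [hist_succ]; push_cast; ring
  rw [den_incr hI' (by omega : a k % p + p < N) (Expr.Val.add (e _ (hF₃ _ _)) (h11' _ _)
    (by omega))]
  exact (hI'.incr hNw.le (by omega) rfl fun x => by
    rw [hist_succ _ (fun i => a i % p + p)]; push_cast; ring).congr rfl

/-- Register `12` gets the number of triples that are zero-sum modulo register `11`. -/
def countProg : Prog :=
  .seq (.assign 23 (2 * .reg 10))
  (.seq (histProg 5 9 (.reg 1))
  (.seq (histProg 6 10 (.reg 2))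
  (.seq (histProg₂ 7 11 (.reg 3))
  (.seq (.seq (.assign 14 (3 * .reg 7)) (.assign 15 1))
  (.seq (.loop (.reg 14) levelProg)
  (.seq baseProg
  (.assign 12 (.reg 22 / .reg 15))))))))

/-- What the count depends on: the lengths are in registers `1, 2, 3`, the sequences in arrays
`9, 10, 11`; register `7` is `h`, register `10` is `2 ^ (3 h)`, and array `4` has powers of two. -/
structure Ready (I : Inst) (h : ℕ) (s : State w) : Prop where
  la : s.rval 1 = I.la
  lb : s.rval 2 = I.lb
  lc : s.rval 3 = I.lc
  hh : s.rval 7 = h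
  cube : s.rval 10 = 2 ^ (3 * h)
  pow : PowTable s (3 * h + 1)
  α : ∀ i < I.la, s.arr 9 i = I.α i
  β : ∀ i < I.lb, s.arr 10 i = I.β i
  γ : ∀ i < I.lc, s.arr 11 i = I.γ i

theorem Ready.frame {I : Inst} {h : ℕ} {s' : State w} (H : Ready I h s) {R M : List ℕ}
    (hF : Frame R M s s') (hR : ∀ x ∈ [1, 2, 3, 7, 10], x ∉ R) (hM : ∀ A ∈ [4, 9, 10, 11], A ∉ M) :
    Ready I h s' where
  la := by rw [hF.rval 1 (hR _ (by simp)), H.la]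
  lb := by rw [hF.rval 2 (hR _ (by simp)), H.lb]
  lc := by rw [hF.rval 3 (hR _ (by simp)), H.lc]
  hh := by rw [hF.rval 7 (hR _ (by simp)), H.hh]
  cube := by rw [hF.rval 10 (hR _ (by simp)), H.cube]
  pow i hi := by rw [hF.arr 4 (hM _ (by simp)), H.pow i hi]
  α i hi := by rw [hF.arr 9 (hM _ (by simp)), H.α i hi]
  β i hi := by rw [hF.arr 10 (hM _ (by simp)), H.β i hi]
  γ i hi := by rw [hF.arr 11 (hM _ (by simp)), H.γ i hi]

/-- The recursion starts with a single block, so the number of blocks in register 15 at its end is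
also the factor by which the form has been multiplied. The same register serves as loop bound in the
base case and as final divisor. -/
theorem run_countProg {I : Inst} {h p : ℕ} (H : Ready I h s) (hh : 0 < h) (hp : 0 < p)
    (hph : p ≤ 2 ^ (3 * h)) (h11 : s.rval 11 = p)
    (hcap : 16 * (2 ^ (3 * h + 1) * (3 * h)) * (I.la * I.lb * I.lc + 1) + 8 < 2 ^ w) :
    Run ω countProg s ((3 * h + 4) ^ 3 * (2 ^ (3 * h) + I.la + I.lb + I.lc) * 10000)
      (fun s' => s'.rval 12 = I.count p) := by
  set f := 3 * h with hf
  set B := 2 ^ (f + 1) * f with hB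
  have hB0 : 2 ^ (f + 1) ≤ B := Nat.le_mul_of_pos_right _ (by omega)
  have hf2 : f < 2 ^ f := Nat.lt_two_pow_self
  have hpow : 2 ^ (f + 1) = 2 * 2 ^ f := pow_succ' _ _
  have hBw : 16 * B + 8 < 2 ^ w := by
    refine lt_of_le_of_lt ?_ hcap
    exact Nat.add_le_add_right (Nat.le_mul_of_pos_right (16 * B) (Nat.succ_pos _)) 8
  have hw : 1 < 2 ^ w := by omega
  have A1 : Run ω (.assign 23 (2 * .reg 10)) s 4
      (fun s₁ => s₁.rval 23 = 2 ^ (f + 1)) := by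
    refine (Run.simple rfl (Prog.Post.assign (n := 2 ^ (f + 1)) ?_ fun v hv => ?_)).time_mono
      (show _ ≤ 4 from le_rfl)
    · rw [hpow]
      exact Expr.Val.mul (Expr.val_lit _ 2 (by omega)) (Expr.Val.reg H.cube) (by omega)
    · simp [hv]
  obtain ⟨Z, hZ⟩ : ∃ Z, Z = (f + 4) ^ 2 * ((B + 1) * 3000) := ⟨_, rfl⟩
  refine Run.time_mono (Run.seq A1 (T₂ := (2 ^ (f + 1) * 33 + I.la * 20 + I.lb * 20 + I.lc * 40
    + 74) + Z + (B + 1) * 100) ?_) ?_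
  swap
  · have hx : 1 ≤ 2 ^ f := Nat.one_le_two_pow
    have hB3 : B + 1 ≤ 3 * (2 ^ f * (f + 4)) := by rw [hB, hpow]; nlinarith
    rw [hpow]
    have e1 : (f + 4) ^ 2 * ((B + 1) * 3000) ≤ (f + 4) ^ 3 * 2 ^ f * 9000 := by
      calc (f + 4) ^ 2 * ((B + 1) * 3000) ≤ (f + 4) ^ 2 * ((3 * (2 ^ f * (f + 4))) * 3000) := by
            gcongr
        _ = _ := by ring
    have e2 : (B + 1) * 100 ≤ (f + 4) ^ 3 * 2 ^ f * 100 := by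
      have h3 : 3 * 1 ≤ (f + 4) ^ 2 := by nlinarith
      calc (B + 1) * 100 ≤ (3 * 1 * (2 ^ f * (f + 4))) * 100 := by omega
        _ ≤ ((f + 4) ^ 2 * (2 ^ f * (f + 4))) * 100 := by gcongr
        _ = _ := by ring
    have e4 : 64 * 1 ≤ (f + 4) ^ 3 := by nlinarith [sq_nonneg f, Nat.zero_le (f ^ 3)]
    have e5 : 64 * 2 ^ f ≤ (f + 4) ^ 3 * 2 ^ f := Nat.mul_le_mul_right _ (by omega)
    have e6 : 64 * (I.la + I.lb + I.lc) ≤ (f + 4) ^ 3 * (I.la + I.lb + I.lc) :=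
      Nat.mul_le_mul_right _ (by omega)
    have e7 : (f + 4) ^ 3 * (2 ^ f + I.la + I.lb + I.lc) * 10000 =
      (f + 4) ^ 3 * 2 ^ f * 9000 + (f + 4) ^ 3 * 2 ^ f * 1000 +
        (f + 4) ^ 3 * (I.la + I.lb + I.lc) * 10000 := by ring
    rw [e7, hZ]
    omega
  rintro s₁ b23 hF₁
  have H₁ := H.frame hF₁ (by decide) (by decide)
  have c11 : s₁.rval 11 = p := by rw [hF₁.rval 11 (by decide), h11]
  refine Run.time_mono (Run.seq (run_histProg (by decide) hw hp (by omega) (by decide) H₁.la c11 b23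
    H₁.α) (T₂ := (2 ^ (f + 1) * 22 + I.lb * 20 + I.lc * 40 + 54) + Z + (B + 1) * 100) ?_) (by omega)
  rintro s₂ k5 hF₂
  have H₂ := H₁.frame hF₂ (by decide) (by decide)
  have d11 : s₂.rval 11 = p := by rw [hF₂.rval 11 (by decide), c11]
  have d23 : s₂.rval 23 = 2 ^ (f + 1) := by rw [hF₂.rval 23 (by decide), b23]
  refine Run.time_mono (Run.seq (run_histProg (by decide) hw hp (by omega) (by decide) H₂.lb d11 d23
    H₂.β) (T₂ := (2 ^ (f + 1) * 11 + I.lc * 40 + 34) + Z + (B + 1) * 100) ?_) (by omega)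
  rintro s₃ k6 hF₃
  have H₃ := H₂.frame hF₃ (by decide) (by decide)
  have e11 : s₃.rval 11 = p := by rw [hF₃.rval 11 (by decide), d11]
  have e23 : s₃.rval 23 = 2 ^ (f + 1) := by rw [hF₃.rval 23 (by decide), d23]
  refine Run.time_mono (Run.seq (run_histProg₂ (by decide) hw hp (by omega) (by decide) H₃.lc e11
    e23 H₃.γ) (T₂ := 14 + Z + (B + 1) * 100) ?_) (by omega)
  rintro s₄ k7 hF₄
  have H₄ := H₃.frame hF₄ (by decide) (by decide)
  have A2 : Run ω (.seq (.assign 14 (3 * .reg 7)) (.assign 15 1)) s₄ 6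
      (fun s₅ => s₅.rval 14 = f ∧ s₅.rval 15 = 1) := by
    refine (Run.simple rfl (Prog.Post.seq_assign (n := f) ?_ fun v hv => Prog.Post.assign (n := 1)
      (Expr.val_one _ hw) fun v' hv' => ?_)).time_mono (show _ ≤ 6 from le_rfl)
    · exact Expr.Val.mul (Expr.val_lit _ 3 (by omega)) (Expr.Val.reg H₄.hh) (by omega)
    · simp [hv, hv']
  refine Run.time_mono (Run.seq A2 (T₂ := Z + ((B + 1) * 100 + 4)) ?_) (by omega)
  rintro s₅ ⟨f14, f15⟩ hF₅
  have k5' := (k5.congr (hF₃.mem 5 (by decide))).congr (hF₄.mem 5 (by decide)) |>.congr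
    (hF₅.mem 5 (by decide))
  have k6' := (k6.congr (hF₄.mem 6 (by decide))).congr (hF₅.mem 6 (by decide))
  have k7' := k7.congr (hF₅.mem 7 (by decide))
  have H₅ := H₄.frame hF₅ (by decide) (by decide)
  have L := run_levels (ω := ω) (s := s₅) (B := B) (K := 1) (f := f) (by omega) (by simp [hB])
    one_pos hBw H₅.pow le_rfl f14 f15 (by rw [one_mul]; exact k5') (by rw [one_mul]; exact k6') (by rw [one_mul]; exact k7')
  rw [← hZ] at L
  refine Run.seq L ?_
  rintro s₆ ⟨K, F₁, F₂, F₃, hK, g15, hKB, l5, l6, l7, htot⟩ hF₆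
  simp only [one_mul] at g15 hKB l5 l6 l7 htot
  rw [total_hist I hp (by omega)] at htot
  refine Run.time_mono (Run.seq (run_baseProg g15 (by omega) l5 l6 l7) (T₂ := 4) ?_) ?_
  · rintro s₇ b22 hF₇
    refine (Run.simple rfl (Prog.Post.assign (n := I.count p) ?_ fun v hv => by simp [hv])).time_mono
      (show _ ≤ 4 from le_rfl)
    -- The one place where the size of a value matters: register 22 is known modulo 2^w only, and
    -- this bound identifies it with a natural number divisible by `K`.
    have hlt : K * I.count p < 2 ^ w := by
      have h1 : K * I.count p ≤ 16 * B * (I.la * I.lb * I.lc + 1) :=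
        Nat.mul_le_mul (by omega) ((I.count_le p).trans (Nat.le_succ _))
      omega
    have h22 : s₇.rval 22 = K * I.count p := by
      rw [State.rval, b22, htot, ← Nat.cast_mul, BitVec.ofInt_natCast, BitVec.toNat_ofNat,
        Nat.mod_eq_of_lt hlt]
    have := Expr.Val.div (Expr.Val.reg h22) (Expr.Val.reg (s := s₇) (x := 15) (m := K)
      (by rw [hF₇.rval 15 (by decide), g15]))
    rwa [Nat.mul_div_cancel_left _ hK] at this
  · have := Nat.mul_le_mul_right 100 (Nat.succ_le_succ hKB); omega
end WordRAM

/-! ### From lists of integers to sequences of natural numbers -/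

namespace ThreeSum

/-- `⌈digits n / 2⌉` -/
def halfDigits (n : ℕ) : ℕ := (digits n + 1) / 2

/-- The entries are shifted by `B`, those of the third list are negated. -/
def Lists.inst (x : Lists) (B : ℕ) : Inst where
  la := x.a.length
  lb := x.b.length
  lc := x.c.length
  α i := (x.a.getD i 0 + B).toNat
  β j := (x.b.getD j 0 + B).toNat
  γ k := (2 * B - x.c.getD k 0).toNat

def Inst.IsSol (I : Inst) (y : Triple) : Prop :=
  y.1 < I.la ∧ y.2.1 < I.lb ∧ y.2.2 < I.lc ∧ I.α y.1 + I.β y.2.1 = I.γ y.2.2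

theorem Lists.Bounded.getD {x : Lists} {n d : ℕ} (h : x.Bounded n d) (i : ℕ) :
    |x.a.getD i 0| < 2 ^ (d * digits n) ∧ |x.b.getD i 0| < 2 ^ (d * digits n) ∧
      |x.c.getD i 0| < 2 ^ (d * digits n) := by
  have key : ∀ l : List ℤ, (∀ u ∈ l, |u| < 2 ^ (d * digits n)) →
      |l.getD i 0| < 2 ^ (d * digits n) := by
    intro l hl
    by_cases hi : i < l.length
    · rw [List.getD_eq_getElem _ _ hi]; exact hl _ (List.getElem_mem hi)
    · rw [List.getD_eq_default _ _ (by omega)]; simp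
  exact ⟨key _ fun u hu => h u (by simp [hu]), key _ fun u hu => h u (by simp [hu]),
    key _ fun u hu => h u (by simp [hu])⟩

/-- The shifts cancel: with B = 2^(d · digits n), the sum α + β exceeds a + b by 2B, and γ is 2B -
c. The bound on the entries keeps all three numbers nonnegative, so nothing is truncated. -/
theorem isSol_inst_iff {x : Lists} {n d : ℕ} (h : x.Bounded n d) (y : Triple) :
    (x.inst (2 ^ (d * digits n))).IsSol y ↔ IsZeroSum x y := by
  have h1 := (h.getD y.1).1
  have h2 := (h.getD y.2.1).2.1
  have h3 := (h.getD y.2.2).2.2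
  rw [abs_lt] at h1 h2 h3
  simp only [Inst.IsSol, Lists.inst, IsZeroSum]
  have hcast : ((2 ^ (d * digits n) : ℕ) : ℤ) = 2 ^ (d * digits n) := by push_cast; rfl
  rw [hcast]
  generalize (2 : ℤ) ^ (d * digits n) = B at *
  constructor
  · rintro ⟨ha, hb, hc, he⟩
    rw [List.getD_eq_getElem _ _ ha, List.getD_eq_getElem _ _ hb, List.getD_eq_getElem _ _ hc] at *
    exact ⟨_, _, _, List.getElem?_eq_getElem ha, List.getElem?_eq_getElem hb,
      List.getElem?_eq_getElem hc, by omega⟩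
  · rintro ⟨u, v, z, ha, hb, hc, he⟩
    obtain ⟨ha', rfl⟩ := List.getElem?_eq_some_iff.1 ha
    obtain ⟨hb', rfl⟩ := List.getElem?_eq_some_iff.1 hb
    obtain ⟨hc', rfl⟩ := List.getElem?_eq_some_iff.1 hc
    refine ⟨ha', hb', hc', ?_⟩
    rw [List.getD_eq_getElem _ _ ha', List.getD_eq_getElem _ _ hb', List.getD_eq_getElem _ _ hc'] at *
    omega

theorem inst_lt {x : Lists} {n d : ℕ} (h : x.Bounded n d) (i : ℕ) :
    (x.inst (2 ^ (d * digits n))).α i < 2 * 2 ^ (d * digits n) ∧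
    (x.inst (2 ^ (d * digits n))).β i < 2 * 2 ^ (d * digits n) ∧
    (x.inst (2 ^ (d * digits n))).γ i < 3 * 2 ^ (d * digits n) := by
  have h1 := (h.getD i).1
  have h2 := (h.getD i).2.1
  have h3 := (h.getD i).2.2
  rw [abs_lt] at h1 h2 h3
  simp only [Lists.inst]
  have hcast : ((2 ^ (d * digits n) : ℕ) : ℤ) = 2 ^ (d * digits n) := by push_cast; rfl
  rw [← hcast] at h1 h2 h3
  generalize 2 ^ (d * digits n) = B at h1 h2 h3 ⊢
  omega

theorem digits_pos (n : ℕ) : 0 < digits n := Nat.succ_pos _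

theorem lt_two_pow_digits (n : ℕ) : n < 2 ^ digits n := Nat.lt_pow_succ_log_self (by norm_num) n

/-- These inequalities say that 2^h is √n up to constant factors: n < 2^(2h), and 2^(2h) ≤ 4n for n
> 0. Moreover h is positive even for n = 0. -/
theorem halfDigits_bounds (n : ℕ) :
    0 < halfDigits n ∧ digits n ≤ 2 * halfDigits n ∧ 2 * halfDigits n ≤ digits n + 1 := by
  have := digits_pos n
  unfold halfDigits; omega

end ThreeSum

/-! ### Preparation of an instance: number of digits, powers of two, shifted lists. -/

namespace WordRAM

open ThreeSum

/-- Registers `5, 7, 8, 9, 10` get `digits n`, `h = ⌈digits n / 2⌉`, `2 ^ h`, `2 ^ (d * digits n)`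
and `2 ^ (3 * h)`; array `4` gets powers of two; arrays `9, 10, 11` get the shifted lists. -/
def setupProg (d : ℕ) : Prog :=
  .seq (.seq (.assign 5 1) (.assign 6 (.reg 0)))
  (.seq (.loop (Expr.lt 1 (.reg 6)) (.seq (.assign 6 (.reg 6 / 2)) (.assign 5 (.reg 5 + 1))))
  (.seq (.store 4 0 1)
  (.seq (.for 13 (.lit (d + 10) * .reg 5)
    (.store 4 (.reg 13 + 1) (.get 4 (.reg 13) + .get 4 (.reg 13))))
  (.seq (.seq (.assign 7 ((.reg 5 + 1) / 2)) (.seq (.assign 8 (.get 4 (.reg 7)))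
    (.seq (.assign 9 (.get 4 (.lit d * .reg 5))) (.assign 10 (.get 4 (3 * .reg 7))))))
  (.seq (.tab 13 9 (.reg 1) (.get 0 (.reg 13) + .reg 9))
  (.seq (.tab 13 10 (.reg 2) (.get 1 (.reg 13) + .reg 9))
  (.tab 13 11 (.reg 3) (2 * .reg 9 - .get 2 (.reg 13)))))))))

variable {w : ℕ} {ω : ℕ → Bool} {s : State w}

theorem run_digits {n : ℕ} (hw : 2 < 2 ^ w) (hnw : Nat.log 2 n + 1 < 2 ^ w) (h5 : s.rval 5 = 1)
    (h6 : s.rval 6 = n) :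
    Run ω (.loop (Expr.lt 1 (.reg 6)) (.seq (.assign 6 (.reg 6 / 2)) (.assign 5 (.reg 5 + 1)))) s
      (digits n * 20) (fun s' => s'.rval 5 = digits n) := by
  refine (Run.while (ω := ω) (fun s' => s'.rval 5 + Nat.log 2 (s'.rval 6) = digits n)
    (fun s' => Nat.log 2 (s'.rval 6)) 8 ?_ ?_).mono ?_ ?_
  · rw [h5, h6, digits, add_comm]
  · intro s₁ hF hI he
    rw [Expr.Val.lt (Expr.val_one _ (by omega)) (Expr.Val.reg rfl) (by omega)] at he
    have h1 : 2 ≤ s₁.rval 6 := by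
      by_contra h; exact he (if_neg (by omega))
    have h2 : Nat.log 2 (s₁.rval 6) = Nat.log 2 (s₁.rval 6 / 2) + 1 :=
      Nat.log_of_one_lt_of_le (by norm_num) h1
    refine (Run.simple rfl (Prog.Post.seq_assign (n := s₁.rval 6 / 2) (Expr.Val.div
      (Expr.Val.reg rfl) (Expr.val_lit _ 2 hw)) fun v hv => Prog.Post.assign (n := s₁.rval 5 + 1)
      (Expr.Val.add (Expr.Val.reg (by simp)) (Expr.val_one _ (by omega)) ?_) fun v' hv' =>
      ?_)).time_mono (by decide)
    · rw [digits] at hI; omega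
    · simp only [State.setReg_rval, hv, hv']
      norm_num
      omega
  · simp only [h6, digits]
    change Nat.log 2 n * (8 + 3 + 1) + 3 + 1 ≤ _
    omega
  · rintro s' ⟨hI, he⟩
    rw [Expr.Val.lt (Expr.val_one _ (by omega)) (Expr.Val.reg rfl) (by omega)] at he
    have h1 : s'.rval 6 < 2 := by
      by_contra h; rw [if_pos (by omega)] at he; exact absurd he (by norm_num)
    rwa [Nat.log_of_lt h1, add_zero] at hI

theorem run_powTable {M : ℕ} {b : Expr} (hw : 1 < 2 ^ w) (hM : M < w)
    (hb : ∀ s₁, Frame [13] [4] s s₁ → b.val s₁ = M) (h0 : s.arr 4 0 = 1) :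
    Run ω (.for 13 b (.store 4 (.reg 13 + 1) (.get 4 (.reg 13) + .get 4 (.reg 13)))) s
      (M * (b.cost + 20) + b.cost + 5) (fun s' => PowTable s' M) := by
  have hMw : M < 2 ^ w := hM.trans Nat.lt_two_pow_self
  have hpow : ∀ i ≤ M, 2 ^ i < 2 ^ w := fun i hi => Nat.pow_lt_pow_right (by norm_num) (by omega)
  refine (Run.for (ω := ω) M hMw hw (fun k s' => PowTable s' k) 9 (by decide) ?_ hb ?_).mono
    (by nlinarith) fun s' h => h.1
  · intro i hi
    obtain rfl : i = 0 := by omega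
    simpa using h0
  · intro k hk s₁ hF hx hI
    have e := hI k le_rfl
    refine (Run.simple rfl (Prog.Post.store (m := k + 1) (n := 2 ^ k + 2 ^ k)
      (Expr.Val.add (Expr.Val.reg hx) (Expr.val_one _ hw) (by omega))
      (Expr.Val.add ((Expr.Val.get (Expr.Val.reg hx)).trans e)
        ((Expr.Val.get (Expr.Val.reg hx)).trans e) ?_) fun v hv => ?_)).time_mono (by decide)
    · rw [← mul_two, ← pow_succ]; exact hpow _ hk
    · intro i hi
      rw [State.setReg_arr, State.setMem_arr _ _ _ _ _ _ (by omega) (by omega)]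
      by_cases hik : i = k + 1
      · simp [hik, hv]; ring
      · simp [hik, hI i (by omega)]

theorem getD_map_ofInt (l : List ℤ) (i : ℕ) :
    (l.map (BitVec.ofInt w)).getD i 0 = BitVec.ofInt w (l.getD i 0) := by
  rw [List.getD_eq_getElem?_getD, List.getD_eq_getElem?_getD, List.getElem?_map]
  cases l[i]? <;> simp

/-- `A` holds the words of the list. -/
def HoldsList (s : State w) (A : ℕ) (l : List ℤ) : Prop :=
  ∀ i < l.length, s.mem A (BitVec.ofNat w i) = BitVec.ofInt w (l.getD i 0)

theorem HoldsList.congr {s' : State w} {A : ℕ} {l : List ℤ} (h : HoldsList s A l)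
    (hs : s'.mem A = s.mem A) : HoldsList s' A l := fun i hi => by rw [hs, h i hi]

structure SetupPost (d n : ℕ) (x : Lists) (s' : State w) : Prop where
  ready : Ready (x.inst (2 ^ (d * digits n))) (halfDigits n) s'
  r5 : s'.rval 5 = digits n
  r8 : s'.rval 8 = 2 ^ halfDigits n

theorem run_setupProg {d n : ℕ} {x : Lists} (hwd : (d + 40) * digits n ≤ w)
    (hx : x.Bounded n d) (h0 : s.rval 0 = n)
    (h1 : s.rval 1 = x.a.length) (h2 : s.rval 2 = x.b.length) (h3 : s.rval 3 = x.c.length)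
    (ha : HoldsList s 0 x.a) (hb : HoldsList s 1 x.b) (hc : HoldsList s 2 x.c) :
    Run ω (setupProg d) s ((d + 20) * 60 * digits n +
      (x.a.length + x.b.length + x.c.length) * 20 + 60) (SetupPost d n x) := by
  have hD := digits_pos n
  have hw40 : 40 ≤ w := by nlinarith
  have hw40' : 2 ^ 40 ≤ 2 ^ w := Nat.pow_le_pow_right (by norm_num) hw40
  have hw : 1 < 2 ^ w := by omega
  have hww : w < 2 ^ w := Nat.lt_two_pow_self
  have hDw : digits n + 40 < w + 40 := by nlinarith
  have hDd : (d + 10) * digits n < w := by nlinarith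
  obtain ⟨hh1, hh2, hh3⟩ := halfDigits_bounds n
  set D := digits n with hDdef
  set h := halfDigits n with hhdef
  have hDd' : d * D + 10 * D < w := by nlinarith
  have hdD : d ≤ d * D := Nat.le_mul_of_pos_right _ hD
  have hM : 3 * h + 1 ≤ (d + 10) * D := by nlinarith
  have hB2 : 2 ^ (d * D + 2) < 2 ^ w := Nat.pow_lt_pow_right (by norm_num) (by omega)
  have hB4 : 2 ^ (d * D + 2) = 4 * 2 ^ (d * D) := by rw [pow_add]; ring
  have S1 : Run ω (.seq (.assign 5 1) (.assign 6 (.reg 0))) s 4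
      (fun s₁ => s₁.rval 5 = 1 ∧ s₁.rval 6 = n) :=
    (Run.simple rfl (Prog.Post.seq_assign (n := 1) (Expr.val_one _ hw) fun v hv =>
      Prog.Post.assign (n := n) (Expr.Val.reg (by simpa using h0)) fun v' hv' => by
        simp [hv, hv'])).time_mono (by decide)
  refine Run.time_mono (Run.seq S1 (T₂ := D * 20 + ((d + 10) * D * 23 + (x.a.length + x.b.length +
    x.c.length) * 20 + 56)) ?_) (by nlinarith)
  rintro s₁ ⟨a5, a6⟩ hF₁
  refine Run.seq (run_digits (by omega) (by change D < _; omega) a5 a6) ?_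
  rintro s₂ b5 hF₂
  have S3 : Run ω (.store 4 0 1) s₂ 3 (fun s₃ => s₃.arr 4 0 = 1) :=
    (Run.simple rfl (Prog.Post.store (m := 0) (n := 1) (Expr.val_zero _) (Expr.val_one _ hw)
      fun v hv => by
        rw [State.setMem_arr _ _ _ _ _ _ (by omega) (by omega)]; simp [hv])).time_mono (by decide)
  refine Run.time_mono (Run.seq S3 (T₂ := (d + 10) * D * 23 + (x.a.length + x.b.length +
    x.c.length) * 20 + 53) ?_) (by omega)
  rintro s₃ c0 hF₃
  have c5 : s₃.rval 5 = D := by rw [hF₃.rval 5 (by decide), b5]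
  have hb' : ∀ s₄, Frame [13] [4] s₃ s₄ → (Expr.lit (d + 10) * Expr.reg 5).val s₄ = (d + 10) * D :=
    fun s₄ hF => Expr.Val.mul (Expr.val_lit _ _ (by nlinarith)) (Expr.Val.reg (by
      rw [hF.rval 5 (by decide), c5])) (by omega)
  refine Run.time_mono (Run.seq (run_powTable hw hDd hb' c0) (T₂ := (x.a.length + x.b.length +
    x.c.length) * 20 + 45) ?_) (by
      change (d + 10) * D * (3 + 20) + 3 + 5 + _ ≤ _; omega)
  rintro s₄ hpw hF₄
  have d5 : s₄.rval 5 = D := by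
    rw [hF₄.rval 5 (by simp [Prog.for, Prog.regs]), c5]
  have S5 : Run ω (.seq (.assign 7 ((.reg 5 + 1) / 2)) (.seq (.assign 8 (.get 4 (.reg 7)))
    (.seq (.assign 9 (.get 4 (.lit d * .reg 5))) (.assign 10 (.get 4 (3 * .reg 7)))))) s₄ 20
      (fun s₅ => s₅.rval 7 = h ∧ s₅.rval 8 = 2 ^ h ∧ s₅.rval 9 = 2 ^ (d * D) ∧
        s₅.rval 10 = 2 ^ (3 * h)) := by
    refine (Run.simple rfl (Prog.Post.seq_assign (n := h) (Expr.Val.div (Expr.Val.add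
      (Expr.Val.reg d5) (Expr.val_one _ hw) (by omega)) (Expr.val_lit _ 2 (by omega)))
      fun v7 hv7 => ?_)).time_mono (by
        change 6 + (3 + ((1 + 1 + 1 + 1 + 1) + 5)) ≤ 20; norm_num)
    refine Prog.Post.seq_assign (n := 2 ^ h) ?_ fun v8 hv8 => ?_
    · rw [← hpw h (by omega)]
      exact Expr.Val.get (Expr.Val.reg (by simp [hv7]))
    refine Prog.Post.seq_assign (n := 2 ^ (d * D)) ?_ fun v9 hv9 => ?_
    · rw [← hpw (d * D) (by nlinarith)]
      exact Expr.Val.get (Expr.Val.mul (Expr.val_lit _ _ (by omega)) (Expr.Val.reg (by simp [d5]))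
        (by omega))
    refine Prog.Post.assign (n := 2 ^ (3 * h)) ?_ fun v10 hv10 => ?_
    · rw [← hpw (3 * h) (by omega)]
      exact Expr.Val.get (Expr.Val.mul (Expr.val_lit _ 3 (by omega)) (Expr.Val.reg (by simp [hv7]))
        (by omega))
    simp [hv7, hv8, hv9, hv10]
  refine Run.time_mono (Run.seq S5 (T₂ := (x.a.length + x.b.length +
    x.c.length) * 20 + 24) ?_) (by omega)
  rintro s₅ ⟨e7, e8, e9, e10⟩ hF₅
  have F5 : Frame [5, 6, 7, 8, 9, 10, 13] [4] s s₅ :=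
    ((((hF₁.mono (by decide) (by decide)).trans (hF₂.mono (by decide) (by decide))).trans
      (hF₃.mono (by decide) (by decide))).trans (hF₄.mono (by simp [Prog.for, Prog.regs]) (by simp [Prog.for, Prog.arrays]))).trans
      (hF₅.mono (by simp [Prog.regs]) (by simp [Prog.arrays]))
  have bnd : ∀ i, |x.a.getD i 0| < 2 ^ (d * D) ∧ |x.b.getD i 0| < 2 ^ (d * D) ∧
      |x.c.getD i 0| < 2 ^ (d * D) := hx.getD
  have hBz : (4 : ℤ) * 2 ^ (d * D) < 2 ^ w := by rw [hB4] at hB2; exact_mod_cast hB2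
  -- Two's complement turns the shift into plain word arithmetic. The shifted integers are
  -- nonnegative, and the later bound by 3·2^(d · digits n) < 2^w shows that the words store them
  -- without reduction.
  have shift : ∀ (s' : State w) (A i : ℕ) (u : ℤ), s'.rval 9 = 2 ^ (d * D) →
      s'.mem A (BitVec.ofNat w i) = BitVec.ofInt w u → s'.rval 13 = i → |u| < 2 ^ (d * D) →
      (Expr.get A (.reg 13) + .reg 9).eval s' =
        BitVec.ofNat w (u + (2 ^ (d * D) : ℕ)).toNat ∧
      (2 * .reg 9 - Expr.get A (.reg 13)).eval s' =
        BitVec.ofNat w (2 * (2 ^ (d * D) : ℕ) - u).toNat := by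
    intro s' A i u h9 hm h13 hu
    rw [abs_lt] at hu
    have e1 : ((u + (2 ^ (d * D) : ℕ)).toNat : ℤ) = u + (2 ^ (d * D) : ℕ) :=
      Int.toNat_of_nonneg (by push_cast; omega)
    have e2 : ((2 * (2 ^ (d * D) : ℕ) - u).toNat : ℤ) = 2 * (2 ^ (d * D) : ℕ) - u :=
      Int.toNat_of_nonneg (by push_cast; omega)
    have m2 : (2 * Expr.reg 9).eval s' = BitVec.ofInt w (2 * (2 ^ (d * D) : ℕ)) := by
      rw [Expr.Val.eval (Expr.Val.mul (Expr.val_ofNat _ 2 (by omega)) (Expr.Val.reg h9)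
        (by change 2 * _ < _; omega)), ← BitVec.ofInt_natCast]
      push_cast; rfl
    rw [Expr.eval_add, Expr.eval_sub, Expr.Val.eval_get (Expr.Val.reg h13), hm, m2,
      Expr.Val.eval (Expr.Val.reg h9), ← ofInt_sub, ← BitVec.ofInt_natCast, ← BitVec.ofInt_add,
      ← BitVec.ofInt_natCast, e1, ← BitVec.ofInt_natCast, e2]
    exact ⟨rfl, rfl⟩
  have T6 := Run.tab (ω := ω) (s := s₅) (x := 13) (A := 9) (b := .reg 1)
    (e := .get 0 (.reg 13) + .reg 9) x.a.length (h1 ▸ s.rval_lt _) hw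
    (fun i => BitVec.ofNat w (x.a.getD i 0 + (2 ^ (d * D) : ℕ)).toNat)
    (fun s₆ hF => by rw [Expr.val_reg, hF.rval 1 (by decide), F5.rval 1 (by decide), h1])
    (fun i hi s₆ hF hi' => (shift s₆ 0 i _ (by rw [hF.rval 9 (by decide), e9])
      (by rw [hF.mem 0 (by decide), F5.mem 0 (by decide), ha i hi]) hi' (bnd i).1).1)
  refine Run.time_mono (Run.seq T6 (T₂ := (x.b.length +
    x.c.length) * 20 + 18) ?_) (by change x.a.length * (1 + 4 + 9) + 1 + 5 + _ ≤ _; omega)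
  rintro s₆ ⟨g9, F6⟩ -
  have T7 := Run.tab (ω := ω) (s := s₆) (x := 13) (A := 10) (b := .reg 2)
    (e := .get 1 (.reg 13) + .reg 9) x.b.length (h2 ▸ s.rval_lt _) hw
    (fun i => BitVec.ofNat w (x.b.getD i 0 + (2 ^ (d * D) : ℕ)).toNat)
    (fun s₆ hF => by
      rw [Expr.val_reg, hF.rval 2 (by decide), F6.rval 2 (by decide), F5.rval 2 (by decide), h2])
    (fun i hi s₆ hF hi' => (shift s₆ 1 i _ (by rw [hF.rval 9 (by decide), F6.rval 9 (by decide), e9])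
      (by rw [hF.mem 1 (by decide), F6.mem 1 (by decide), F5.mem 1 (by decide), hb i hi]) hi'
      (bnd i).2.1).1)
  refine Run.time_mono (Run.seq T7 (T₂ := x.c.length * 20 + 12) ?_)
    (by change x.b.length * (1 + 4 + 9) + 1 + 5 + _ ≤ _; omega)
  rintro s₇ ⟨g10, F7⟩ -
  have T8 := Run.tab (ω := ω) (s := s₇) (x := 13) (A := 11) (b := .reg 3)
    (e := 2 * .reg 9 - .get 2 (.reg 13)) x.c.length (h3 ▸ s.rval_lt _) hw
    (fun i => BitVec.ofNat w (2 * (2 ^ (d * D) : ℕ) - x.c.getD i 0).toNat)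
    (fun s₆ hF => by
      rw [Expr.val_reg, hF.rval 3 (by decide), F7.rval 3 (by decide), F6.rval 3 (by decide),
        F5.rval 3 (by decide), h3])
    (fun i hi s₆ hF hi' => (shift s₆ 2 i _ (by
      rw [hF.rval 9 (by decide), F7.rval 9 (by decide), F6.rval 9 (by decide), e9])
      (by rw [hF.mem 2 (by decide), F7.mem 2 (by decide), F6.mem 2 (by decide),
        F5.mem 2 (by decide), hc i hi]) hi' (bnd i).2.2).2)
  refine T8.mono (by change x.c.length * (1 + 6 + 9) + 1 + 5 ≤ _; omega) ?_
  rintro s₈ ⟨g11, F8⟩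
  have lt : ∀ i, (x.inst (2 ^ (d * D))).α i < 2 * 2 ^ (d * D) ∧
      (x.inst (2 ^ (d * D))).β i < 2 * 2 ^ (d * D) ∧
      (x.inst (2 ^ (d * D))).γ i < 3 * 2 ^ (d * D) := inst_lt hx
  have F6' : Frame [13] [9, 10, 11] s₅ s₈ := ((F6.mono (by decide) (by decide)).trans
    (F7.mono (by decide) (by decide))).trans (F8.mono (by decide) (by decide))
  have F5' : Frame [5, 6, 7, 8, 9, 10, 13] [4, 9, 10, 11] s s₈ :=
    (F5.mono (by decide) (by decide)).trans (F6'.mono (by decide) (by decide))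
  refine ⟨⟨by rw [F5'.rval 1 (by decide), h1]; rfl, by rw [F5'.rval 2 (by decide), h2]; rfl,
    by rw [F5'.rval 3 (by decide), h3]; rfl, by rw [F6'.rval 7 (by decide), e7],
    by rw [F6'.rval 10 (by decide), e10], fun i hi => ?_, fun i hi => ?_, fun i hi => ?_,
    fun i hi => ?_⟩, ?_, by rw [F6'.rval 8 (by decide), e8]⟩
  · rw [F6'.arr 4 (by decide), hF₅.arr 4 (by simp [Prog.arrays]), hpw i (by omega)]
  · rw [State.arr, F8.mem 9 (by decide), F7.mem 9 (by decide), g9 i hi, BitVec.toNat_ofNat]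
    exact Nat.mod_eq_of_lt ((lt i).1.trans (by omega))
  · rw [State.arr, F8.mem 10 (by decide), g10 i hi, BitVec.toNat_ofNat]
    exact Nat.mod_eq_of_lt ((lt i).2.1.trans (by omega))
  · rw [State.arr, g11 i hi, BitVec.toNat_ofNat]
    exact Nat.mod_eq_of_lt ((lt i).2.2.trans (by omega))
  · rw [F6'.rval 5 (by decide), hF₅.rval 5 (by simp [Prog.regs]), d5]

end WordRAM

/-! ### The certificate verifier -/

namespace ThreeSum

namespace Inst

variable (I : Inst)

/-- The number `e` encodes a triple of positions which is zero-sum modulo `p` but not zero-sum. -/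
def Spurious (n p e : ℕ) : Prop :=
  e / n / n < I.la ∧ e / n % n < I.lb ∧ e % n < I.lc ∧
    (I.α (e / n / n) + I.β (e / n % n)) % p = I.γ (e % n) % p ∧
    I.α (e / n / n) + I.β (e / n % n) ≠ I.γ (e % n)

/-- The sequence `f` of length `L` consists of a modulus `p ≤ Y` with at most `N` triples that are
zero-sum modulo `p`, and an increasing list of these triples, none of which is zero-sum. -/
def Certifies (n Y N : ℕ) (f : ℕ → ℕ) (L : ℕ) : Prop :=
  0 < f 0 ∧ f 0 ≤ Y ∧ I.count (f 0) ≤ N ∧ I.count (f 0) + 1 = L ∧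
    ∀ q < I.count (f 0), I.Spurious n (f 0) (f (q + 1)) ∧ (q ≠ 0 → f q < f (q + 1))

/-- The triples that are zero-sum modulo `p`. -/
def congruent (p : ℕ) : Finset Triple :=
  (Finset.range I.la ×ˢ Finset.range I.lb ×ˢ Finset.range I.lc).filter
    fun y => (I.α y.1 + I.β y.2.1) % p = I.γ y.2.2 % p

theorem card_congruent (p : ℕ) : (I.congruent p).card = I.count p := by
  simp only [congruent, count, Finset.card_filter, Finset.sum_product]

variable {I}

/-- Pigeonhole: the list contributes `count` distinct triples vanishing modulo p, none of them
zero-sum. A solution `y` also vanishes modulo p and is different from all of these, so there would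
be at least one more such triple than there are. -/
theorem Certifies.not_isSol {n Y N L : ℕ} {f : ℕ → ℕ} (h : I.Certifies n Y N f L) (y : Triple) :
    ¬ I.IsSol y := by
  rintro ⟨h1, h2, h3, h4⟩
  obtain ⟨-, -, -, -, h⟩ := h
  set p := f 0
  let g : ℕ → Triple := fun q => (f (q + 1) / n / n, f (q + 1) / n % n, f (q + 1) % n)
  have hmono : ∀ q < I.count p, ∀ r < q, f (r + 1) < f (q + 1) := by
    intro q
    induction q with
    | zero => intro _ r hr; omega
    | succ q ih =>
      intro hq r hr
      have h6 := (h (q + 1) hq).2 (Nat.succ_ne_zero _)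
      rcases Nat.lt_succ_iff_lt_or_eq.1 hr with h5 | rfl
      · exact (ih (by omega) r h5).trans h6
      · exact h6
  have hinj : Set.InjOn g (Finset.range (I.count p) : Set ℕ) := by
    intro q hq r hr hqr
    simp only [Finset.coe_range, Set.mem_Iio] at hq hr
    simp only [g, Prod.mk.injEq] at hqr
    -- A number is recovered from its last two digits in base n and the remaining quotient. No bound
    -- on the listed codes is required for this, so the verifier need not check one.
    have e : f (q + 1) = f (r + 1) := by
      rw [← Nat.div_add_mod (f (q + 1)) n, ← Nat.div_add_mod (f (q + 1) / n) n, hqr.1, hqr.2.1,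
        hqr.2.2, Nat.div_add_mod, Nat.div_add_mod]
    rcases lt_trichotomy q r with h5 | h5 | h5
    · have := hmono r hr q h5; omega
    · exact h5
    · have := hmono q hq r h5; omega
  have hsub : (Finset.range (I.count p)).image g ⊆ (I.congruent p).erase y := by
    intro z hz
    obtain ⟨q, hq, rfl⟩ := Finset.mem_image.1 hz
    obtain ⟨⟨a1, a2, a3, a4, a5⟩, -⟩ := h q (Finset.mem_range.1 hq)
    refine Finset.mem_erase.2 ⟨?_, ?_⟩
    · rintro rfl; exact a5 h4
    · simp [congruent, g, a1, a2, a3, a4]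
  have hy : y ∈ I.congruent p := by simp [congruent, h1, h2, h3, h4]
  have hc := Finset.card_le_card hsub
  rw [Finset.card_image_of_injOn hinj, Finset.card_range, Finset.card_erase_of_mem hy,
    card_congruent] at hc
  have : 0 < I.count p := by rw [← card_congruent]; exact Finset.card_pos.2 ⟨y, hy⟩
  omega

end Inst

/-- The number of triples that a certificate may list. -/
def certBound (d D h : ℕ) : ℕ := 2 ^ (3 * h) * (2 * h * (d * D + 2)) ^ 3

end ThreeSum

/-! ### The certificate verifier as a program. -/

namespace WordRAM

open ThreeSum

variable {w : ℕ} {ω : ℕ → Bool} {s : State w}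

section Conditions

variable {a b : Expr} {m n : ℕ}

theorem Expr.lt_ne_zero (ha : a.val s = m) (hb : b.val s = n) (hw : 1 < 2 ^ w) :
    (a.lt b).val s ≠ 0 ↔ m < n := by
  rw [Expr.Val.lt ha hb hw]; simp

theorem Expr.eq_ne_zero (ha : a.val s = m) (hb : b.val s = n) (hw : 1 < 2 ^ w) :
    (a.eq b).val s ≠ 0 ↔ m = n := by
  rw [Expr.Val.eq ha hb hw]; simp

/-- `a ≠ b` -/
def Expr.ne (a b : Expr) : Expr := (a.eq b).eq 0

theorem Expr.ne_ne_zero (ha : a.val s = m) (hb : b.val s = n) (hw : 1 < 2 ^ w) :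
    (a.ne b).val s ≠ 0 ↔ m ≠ n := by
  rw [Expr.ne, Expr.eq_ne_zero (Expr.Val.eq ha hb hw) (Expr.val_zero _) hw]; simp

end Conditions

/-- Set register `x` to zero if one of the conditions fails. -/
def Prog.require (x : ℕ) : List Expr → Prog
  | [] => .skip
  | e :: l => .ite e (Prog.require x l) (.assign x 0)

theorem Prog.require_simple (x : ℕ) (l : List Expr) : (Prog.require x l).simple = true := by
  induction l with
  | nil => rfl
  | cons e l ih => simp [Prog.require, Prog.simple, ih]

open Classical in
theorem Prog.require_den (x : ℕ) (l : List Expr) (s : State w) :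
    (Prog.require x l).den s = if ∀ e ∈ l, e.val s ≠ 0 then s else s.setReg x 0 := by
  induction l with
  | nil => simp [Prog.require, Prog.den]
  | cons e l ih =>
    rw [Prog.require, Prog.den, ih]
    by_cases h : e.val s = 0
    · simp [h, Prog.den, Expr.eval_zero]
    · simp [h]

theorem run_require {x : ℕ} {l : List Expr} {P : Prop} (h : (∀ e ∈ l, e.val s ≠ 0) ↔ P) :
    Run ω (Prog.require x l) s (Prog.require x l).size
      (fun s' => (P ∧ s' = s) ∨ (¬ P ∧ s' = s.setReg x 0)) := by
  refine Run.simple (Prog.require_simple _ _) ?_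
  rw [Prog.Post, Prog.require_den, ← h]
  by_cases h' : ∀ e ∈ l, e.val s ≠ 0
  · rw [if_pos h']; exact Or.inl ⟨h', rfl⟩
  · rw [if_neg h']; exact Or.inr ⟨h', rfl⟩

theorem Run.skip {Q : State w → Prop} (h : Q s) : Run ω .skip s 1 Q := ⟨s, 1, .skip s, le_rfl, h⟩

/-- The positions encoded by register `25`. -/
def posA : Expr := .reg 25 / .reg 0 / .reg 0
def posB : Expr := .reg 25 / .reg 0 % .reg 0
def posC : Expr := .reg 25 % .reg 0

/-- Register `24` is set to zero unless register `25` encodes a triple as it should. -/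
def checkEntry : Prog := .require 24
  [posA.lt (.reg 1), posB.lt (.reg 2), posC.lt (.reg 3),
    ((Expr.get 9 posA + .get 10 posB) % .reg 11).eq (.get 11 posC % .reg 11),
    (Expr.get 9 posA + .get 10 posB).ne (.get 11 posC)]

theorem run_checkEntry {I : Inst} {h n p e : ℕ} (hw : 1 < 2 ^ w) (H : Ready I h s)
    (h0 : s.rval 0 = n) (h11 : s.rval 11 = p) (h25 : s.rval 25 = e)
    (hI : ∀ i j, I.α i + I.β j < 2 ^ w) :
    Run ω checkEntry s 100 (fun s' => (I.Spurious n p e ∧ s' = s) ∨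
      (¬ I.Spurious n p e ∧ s' = s.setReg 24 0)) := by
  refine (run_require ?_).time_mono (by decide)
  have va : posA.val s = e / n / n := Expr.Val.div (Expr.Val.div h25 h0) h0
  have vb : posB.val s = e / n % n := Expr.Val.mod (Expr.Val.div h25 h0) h0
  have vc : posC.val s = e % n := Expr.Val.mod h25 h0
  simp only [List.forall_mem_cons, List.not_mem_nil, false_implies, implies_true, and_true]
  rw [Inst.Spurious, Expr.lt_ne_zero va (Expr.Val.reg H.la) hw,
    Expr.lt_ne_zero vb (Expr.Val.reg H.lb) hw, Expr.lt_ne_zero vc (Expr.Val.reg H.lc) hw]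
  -- The contents of the arrays are known at valid positions only, so the last two conditions are
  -- translated under the assumption of the first three.
  refine and_congr_right fun ha => and_congr_right fun hb => and_congr_right fun hc => ?_
  have ea : (Expr.get 9 posA).val s = I.α (e / n / n) := (Expr.Val.get va).trans (H.α _ ha)
  have eb : (Expr.get 10 posB).val s = I.β (e / n % n) := (Expr.Val.get vb).trans (H.β _ hb)
  have ec : (Expr.get 11 posC).val s = I.γ (e % n) := (Expr.Val.get vc).trans (H.γ _ hc)
  have eab := Expr.Val.add ea eb (hI _ _)
  rw [Expr.eq_ne_zero (Expr.Val.mod eab (Expr.Val.reg h11)) (Expr.Val.mod ec (Expr.Val.reg h11)) hw,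
    Expr.ne_ne_zero eab ec hw]

/-- Register `24` is set to zero unless the entry `x + 1` of array `3` encodes a triple as it should
and, for `x > 0`, is larger than the entry `x`, where `x` is register `13`. -/
def checkNext : Prog :=
  .seq (.assign 25 (.get 3 (.reg 13 + 1)))
    (.seq checkEntry (.ite (.reg 13) (.require 24 [(Expr.get 3 (.reg 13)).lt (.reg 25)]) .skip))

theorem run_checkNext {I : Inst} {h n p q : ℕ} {f : ℕ → ℕ} (hw : 1 < 2 ^ w) (H : Ready I h s)
    (h0 : s.rval 0 = n) (h11 : s.rval 11 = p) (h13 : s.rval 13 = q) (hq : q + 1 < 2 ^ w)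
    (hf : ∀ i, i ≤ q + 1 → s.arr 3 i = f i) (hI : ∀ i j, I.α i + I.β j < 2 ^ w) :
    Run ω checkNext s 120 (fun s' => s'.rval 24 ≠ 0 ↔ s.rval 24 ≠ 0 ∧
      I.Spurious n p (f (q + 1)) ∧ (q ≠ 0 → f q < f (q + 1))) := by
  have A : Run ω (.assign 25 (.get 3 (.reg 13 + 1))) s 5
      (fun s₁ => s₁.rval 25 = f (q + 1) ∧ s₁.rval 24 = s.rval 24) :=
    (Run.simple rfl (Prog.Post.assign (n := f (q + 1)) ((Expr.Val.get (Expr.Val.add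
      (Expr.Val.reg h13) (Expr.val_one _ hw) hq)).trans (hf _ le_rfl)) fun v hv => by
        simp [hv])).time_mono (by decide)
  refine Run.time_mono (Run.seq A (T₂ := 115) ?_) (by norm_num)
  rintro s₁ ⟨h25, h24⟩ hF₁
  refine Run.time_mono (Run.seq (run_checkEntry hw (H.frame hF₁ (by decide) (by decide))
    (by rw [hF₁.rval 0 (by decide), h0]) (by rw [hF₁.rval 11 (by decide), h11]) h25 hI)
    (T₂ := 10 + 1 + 1) ?_) (by norm_num)
  intro s₂ hs₂ hF₂
  have F₂ : Frame [24, 25] [] s s₂ := (hF₁.mono (by decide) (by decide)).trans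
    (hF₂.mono (by decide) (by decide))
  have g13 : (Expr.reg 13).val s₂ = q := by rw [Expr.val_reg, F₂.rval 13 (by decide), h13]
  have g25 : (Expr.reg 25).val s₂ = f (q + 1) := by
    rw [Expr.val_reg, hF₂.rval 25 (by decide), h25]
  have key : s₂.rval 24 ≠ 0 ↔ s.rval 24 ≠ 0 ∧ I.Spurious n p (f (q + 1)) := by
    rcases hs₂ with ⟨h1, rfl⟩ | ⟨h1, rfl⟩
    · rw [h24]; simp [h1]
    · simp [h1]
  rw [← and_assoc, ← key]
  refine Run.ite (fun hne => ?_) (fun he => ?_)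
  · rw [g13] at hne
    have e3 : (Expr.get 3 (.reg 13)).val s₂ = f q := by
      rw [Expr.Val.get g13, F₂.arr 3 (by decide), hf _ (by omega)]
    refine (run_require (P := f q < f (q + 1)) ?_).mono (by decide) ?_
    · simp only [List.forall_mem_cons, List.not_mem_nil, false_implies, implies_true, and_true]
      exact Expr.lt_ne_zero e3 g25 hw
    · rintro s' (⟨h1, rfl⟩ | ⟨h1, rfl⟩)
      · simp [h1]
      · simp only [State.setReg_rval, if_true]
        simp [hne, h1]
  · rw [g13] at he
    refine (Run.skip ?_).time_mono (by norm_num)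
    simp [he]

/-- The largest admissible number of triples, cf. `certBound`. -/
def boundExpr (d : ℕ) : Expr :=
  .reg 10 * (2 * .reg 7 * (.lit d * .reg 5 + 2)) * (2 * .reg 7 * (.lit d * .reg 5 + 2)) *
    (2 * .reg 7 * (.lit d * .reg 5 + 2))

/-- The certificate verifier after the setup. -/
def certCheck (d : ℕ) : Prog :=
  .seq (.seq (.assign 24 1) (.assign 11 (.get 3 0)))
  (.seq (.require 24 [Expr.lt 0 (.reg 11), (Expr.reg 11).lt (.reg 10 + 1)])
  (.seq (.ite (.reg 24)
    (.seq countProg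
    (.seq (.require 24 [(Expr.reg 12).lt (boundExpr d + 1), (Expr.reg 12 + 1).eq (.reg 4)])
    (.ite (.reg 24) (.for 13 (.reg 12) checkNext) .skip)))
    .skip)
  (.assign 0 (.reg 24))))

/-- The certificate verifier. -/
def certProg (d : ℕ) : Prog := .seq (setupProg d) (certCheck d)

/-! ### Numerical bounds: all relevant values fit into a word. -/

theorem add_two_pow_three_le (m : ℕ) : (m + 2) ^ 3 ≤ 27 * 2 ^ m := by
  induction m with
  | zero => norm_num
  | succ m ih =>
    rcases Nat.lt_or_ge m 2 with hm | hm
    · interval_cases m <;> norm_num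
    · have : (m + 1 + 2) ^ 3 ≤ 2 * (m + 2) ^ 3 := by
        obtain ⟨k, rfl⟩ := Nat.exists_eq_add_of_le hm
        ring_nf
        omega
      rw [pow_succ 2]; omega

theorem certBound_lt {d D h : ℕ} (hD : 0 < D) (hh : 2 * h ≤ D + 1) :
    certBound d D h < 2 ^ ((d + 12) * D) := by
  have h1 : 2 * h ≤ 2 ^ D := hh.trans Nat.lt_two_pow_self
  have h2 := add_two_pow_three_le (d * D)
  have h3 : 2 ^ (3 * h) ≤ 2 ^ (3 * D) := Nat.pow_le_pow_right (by norm_num) (by omega)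
  have h4 : 2 ^ 5 ≤ 2 ^ (5 * D) := Nat.pow_le_pow_right (by norm_num) (by omega)
  calc certBound d D h = 2 ^ (3 * h) * ((2 * h) ^ 3 * (d * D + 2) ^ 3) := by
        rw [certBound, mul_pow]
    _ ≤ 2 ^ (3 * D) * ((2 ^ D) ^ 3 * (27 * 2 ^ (d * D))) := by gcongr
    _ < 2 ^ (3 * D) * ((2 ^ D) ^ 3 * (2 ^ (5 * D) * 2 ^ (d * D))) := by
        gcongr; omega
    _ = 2 ^ (11 * D + d * D) := by ring
    _ ≤ _ := Nat.pow_le_pow_right (by norm_num) (by nlinarith)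

/-- Room for the largest value that has to be exact, the count times the accumulated transform
factor. The count is at most n^3 and the factor at most 2^(3h+1)·3h; the estimate used needs
14·digits n + 1 bits. -/
theorem count_cap {D h n w la lb lc : ℕ} (hD : 0 < D) (hh : 2 * h ≤ D + 1) (hw : 40 * D ≤ w)
    (hn : n < 2 ^ D) (ha : la ≤ n) (hb : lb ≤ n) (hc : lc ≤ n) :
    16 * (2 ^ (3 * h + 1) * (3 * h)) * (la * lb * lc + 1) + 8 < 2 ^ w := by
  have h1 : 3 * h ≤ 2 ^ (3 * D) := (Nat.lt_two_pow_self (n := 3 * h)).le.trans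
    (Nat.pow_le_pow_right (by norm_num) (by omega))
  have h2 : la * lb * lc + 1 ≤ 2 ^ (3 * D) := by
    have h3 : 1 ≤ 2 ^ D := Nat.one_le_two_pow
    calc la * lb * lc + 1 ≤ (2 ^ D - 1) * 2 ^ D * 2 ^ D + 1 := by gcongr <;> omega
      _ ≤ (2 ^ D - 1) * 2 ^ D * 2 ^ D + 1 * 2 ^ D * 2 ^ D := by
          gcongr; nlinarith
      _ = (2 ^ D - 1 + 1) * 2 ^ D * 2 ^ D := by ring
      _ = 2 ^ (3 * D) := by rw [Nat.sub_add_cancel h3]; ring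
  calc 16 * (2 ^ (3 * h + 1) * (3 * h)) * (la * lb * lc + 1) + 8
      ≤ 16 * (2 ^ (4 * D) * 2 ^ (3 * D)) * 2 ^ (3 * D) + 8 := by
        gcongr <;> omega
    _ = 2 ^ (10 * D + 4) + 2 ^ 3 := by ring
    _ ≤ 2 ^ (14 * D) + 2 ^ (14 * D) := by
        gcongr <;> omega
    _ = 2 ^ (14 * D + 1) := by ring
    _ < 2 ^ w := Nat.pow_lt_pow_right (by norm_num) (by omega)

theorem inst_add_lt {d n : ℕ} {x : Lists} (hx : x.Bounded n d) (hwd : (d + 40) * digits n ≤ w)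
    (i j : ℕ) : (x.inst (2 ^ (d * digits n))).α i + (x.inst (2 ^ (d * digits n))).β j < 2 ^ w := by
  have h1 := (inst_lt hx i).1
  have h2 := (inst_lt hx j).2.1
  have h3 : 4 * 2 ^ (d * digits n) < 2 ^ w := by
    have hD := digits_pos n
    calc 4 * 2 ^ (d * digits n) = 2 ^ (d * digits n + 2) := by ring
      _ < 2 ^ w := Nat.pow_lt_pow_right (by norm_num) (by nlinarith)
  omega

theorem val_boundExpr {d D h : ℕ} (hD : 0 < D) (h0 : 0 < h) (hh : 2 * h ≤ D + 1)
    (hwd : (d + 40) * D ≤ w) (h5 : s.rval 5 = D) (h7 : s.rval 7 = h)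
    (h10 : s.rval 10 = 2 ^ (3 * h)) :
    (boundExpr d + 1).val s = certBound d D h + 1 := by
  have hB := certBound_lt (d := d) hD hh
  have hw : 2 ^ ((d + 12) * D) < 2 ^ w := Nat.pow_lt_pow_right (by norm_num) (by nlinarith)
  have hw40 : 2 ^ 40 ≤ 2 ^ w := Nat.pow_le_pow_right (by norm_num) (by nlinarith)
  obtain ⟨x, hx⟩ : ∃ x, x = 2 * h * (d * D + 2) := ⟨_, rfl⟩
  obtain ⟨z, hz⟩ : ∃ z, z = 2 ^ (3 * h) := ⟨_, rfl⟩
  have hx1 : 0 < x := by rw [hx]; positivity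
  have hz1 : 0 < z := by rw [hz]; positivity
  have hBx : certBound d D h = z * x * x * x := by rw [certBound, ← hx, hz]; ring
  have l3 : z * x * x * x < 2 ^ w := by omega
  have l2 : z * x * x < 2 ^ w := (Nat.le_mul_of_pos_right _ hx1).trans_lt l3
  have l1 : z * x < 2 ^ w := (Nat.le_mul_of_pos_right _ hx1).trans_lt l2
  have lx : x < 2 ^ w := (Nat.le_mul_of_pos_left _ hz1).trans_lt l1
  have ly : 2 * h < 2 ^ w := (Nat.le_mul_of_pos_right _ (by omega)).trans_lt (hx ▸ lx)
  have lm : d * D + 2 < 2 ^ w := (Nat.le_mul_of_pos_left _ (by omega)).trans_lt (hx ▸ lx)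
  have hdD : d ≤ d * D := Nat.le_mul_of_pos_right _ hD
  have v2 : (2 : Expr).val s = 2 := Expr.val_lit s 2 (by omega)
  have vx : (2 * .reg 7 * (.lit d * .reg 5 + 2) : Expr).val s = x := by
    rw [hx]
    exact Expr.Val.mul (Expr.Val.mul v2 (Expr.Val.reg h7) ly)
      (Expr.Val.add (Expr.Val.mul (Expr.val_lit _ _ (by omega)) (Expr.Val.reg h5) (by omega)) v2 lm)
      (hx ▸ lx)
  rw [hBx]
  exact Expr.Val.add (Expr.Val.mul (Expr.Val.mul (Expr.Val.mul (Expr.Val.reg (hz ▸ h10)) vx l1) vx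
    l2) vx l3) (Expr.val_one _ (by omega)) (by omega)

/-- A bound on the time of the certificate verifier. -/
def certTime (d n : ℕ) : ℕ :=
  (d + 20) * 60 * digits n + n * 60 +
    (3 * halfDigits n + 4) ^ 3 * (2 ^ (3 * halfDigits n) + 3 * n) * 10000 +
    certBound d (digits n) (halfDigits n) * 130 + 400

/-- The time bound must hold for every certificate. A modulus outside 1, …, 2^(3h) is rejected
before the count starts, and the list is read only after the count has been compared with
`certBound`, so its loop is short whatever the certificate claims. -/
theorem run_certCheck {I : Inst} {d D h n : ℕ} (hwd : (d + 40) * D ≤ w) (hD : 0 < D) (hh1 : 0 < h)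
    (hh3 : 2 * h ≤ D + 1) (P : Ready I h s) (h5 : s.rval 5 = D) (h0 : s.rval 0 = n)
    (hIlt : ∀ i j, I.α i + I.β j < 2 ^ w)
    (hcap : 16 * (2 ^ (3 * h + 1) * (3 * h)) * (I.la * I.lb * I.lc + 1) + 8 < 2 ^ w) :
    Run ω (certCheck d) s ((3 * h + 4) ^ 3 * (2 ^ (3 * h) + I.la + I.lb + I.lc) * 10000 +
      certBound d D h * 130 + 300) (fun s' => s'.rval 0 ≠ 0 ↔
        I.Certifies n (2 ^ (3 * h)) (certBound d D h) (s.arr 3) (s.rval 4)) := by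
  have hvB := fun s' => val_boundExpr (s := s') (d := d) hD hh1 hh3 hwd
  have hBw : certBound d D h < 2 ^ ((d + 12) * D) := certBound_lt hD hh3
  have hww : 2 ^ ((d + 12) * D) < 2 ^ w := Nat.pow_lt_pow_right (by norm_num) (by nlinarith)
  have hw : 1 < 2 ^ w := Nat.one_lt_two_pow (by nlinarith)
  have h3h : 2 ^ (3 * h) + 1 < 2 ^ w := by
    have : 2 ^ (3 * h + 1) < 2 ^ w := Nat.pow_lt_pow_right (by norm_num) (by nlinarith)
    have h4 : 1 < 2 ^ (3 * h) := Nat.one_lt_two_pow (by omega)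
    rw [pow_succ] at this; omega
  have hn3 : I.la * I.lb * I.lc + 1 < 2 ^ w := by
    refine lt_of_le_of_lt ?_ hcap
    have : 1 ≤ 2 ^ (3 * h + 1) * (3 * h) := Nat.mul_pos (by positivity) (by omega)
    exact (Nat.le_mul_of_pos_left _ (by omega)).trans (Nat.le_add_right _ 8)
  have S4' := fun (s' : State w) p H hp hph h11 =>
    run_countProg (ω := ω) (s := s') (p := p) (I := I) (h := h) H hh1 hp hph h11 hcap
  generalize (3 * h + 4) ^ 3 * (2 ^ (3 * h) + I.la + I.lb + I.lc) * 10000 = C at S4' ⊢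
  generalize certBound d D h = B at *
  generalize hY : 2 ^ (3 * h) = Y at *
  obtain ⟨f, hf⟩ : ∃ f, f = s.arr 3 := ⟨_, rfl⟩
  rw [← hf]
  have S2 : Run ω (.seq (.assign 24 1) (.assign 11 (.get 3 0))) s 5
      (fun s₂ => s₂.rval 24 = 1 ∧ s₂.rval 11 = f 0) :=
    (Run.simple rfl (Prog.Post.seq_assign (Expr.val_one _ hw) fun v hv => Prog.Post.assign
      (n := f 0) ((Expr.Val.get (Expr.val_zero _)).trans (by rw [hf]; rfl)) fun v' hv' => by
        simp [hv, hv'])).time_mono (by decide)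
  refine Run.time_mono (Run.seq S2 (T₂ := C + B * 130 + 290) ?_) (by omega)
  rintro s₂ ⟨a24, a11⟩ hF₂
  have P₂ := P.frame hF₂ (by decide) (by decide)
  refine Run.time_mono (Run.seq (run_require (P := 0 < f 0 ∧ f 0 ≤ Y) ?_)
    (T₂ := C + B * 130 + 200) ?_) (by
      have : (Prog.require 24 [Expr.lt 0 (.reg 11), (Expr.reg 11).lt (.reg 10 + 1)]).size = 15 := rfl
      omega)
  · simp only [List.forall_mem_cons, List.not_mem_nil, false_implies, implies_true, and_true]
    rw [Expr.lt_ne_zero (Expr.val_zero _) (Expr.Val.reg a11) hw, Expr.lt_ne_zero (Expr.Val.reg a11)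
      (Expr.Val.add (Expr.Val.reg (P₂.cube.trans hY)) (Expr.val_one _ hw) h3h) hw, Nat.lt_succ_iff]
  intro s₃ hs₃ hF₃
  have P₃ := P₂.frame hF₃ (by decide) (by decide)
  have F₃ : Frame [11, 24] [] s s₃ := (hF₂.mono (by decide) (by decide)).trans
    (hF₃.mono (by decide) (by decide))
  have b11 : s₃.rval 11 = f 0 := by rw [hF₃.rval 11 (by decide), a11]
  have key3 : s₃.rval 24 ≠ 0 ↔ 0 < f 0 ∧ f 0 ≤ Y := by
    rcases hs₃ with ⟨h1, rfl⟩ | ⟨h1, rfl⟩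
    · simp [a24, h1]
    · simp only [State.setReg_rval, if_true, h1, iff_false]; simp
  suffices hmain : Run ω (.ite (.reg 24)
      (.seq countProg
      (.seq (.require 24 [(Expr.reg 12).lt (boundExpr d + 1), (Expr.reg 12 + 1).eq (.reg 4)])
      (.ite (.reg 24) (.for 13 (.reg 12) checkNext) .skip))) .skip) s₃ (C + B * 130 + 190)
      (fun s' => s'.rval 24 ≠ 0 ↔ I.Certifies n (Y) B f (s.rval 4)) by
    refine Run.time_mono (Run.seq hmain (T₂ := 2) ?_) (by omega)
    intro s₄ h4 _
    refine (Run.simple rfl (Prog.Post.assign (n := s₄.rval 24) rfl fun v hv => ?_)).time_mono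
      (by decide)
    rw [← h4]; simp [hv]
  refine Run.time_mono (Run.ite (T := C + B * 130 + 180) ?_ ?_) (by
    change C + B * 130 + 180 + 1 + 1 ≤ _; omega)
  swap
  · intro he
    refine (Run.skip ?_).time_mono (by omega)
    rw [key3, Inst.Certifies]
    have := key3.not.1 (not_not.2 he)
    tauto
  intro he
  obtain ⟨hf0, hfY⟩ := key3.1 he
  have S4 := S4' s₃ (f 0) P₃ hf0 hfY b11
  refine Run.time_mono (Run.seq S4 (T₂ := B * 130 + 180) ?_) (by omega)
  intro s₄ h12 hF₄
  have P₄ := P₃.frame hF₄ (by decide) (by decide)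
  have c24 : s₄.rval 24 = s₃.rval 24 := hF₄.rval 24 (by decide)
  have c5 : s₄.rval 5 = D := by rw [hF₄.rval 5 (by decide), F₃.rval 5 (by decide), h5]
  have c4 : s₄.rval 4 = s.rval 4 := by rw [hF₄.rval 4 (by decide), F₃.rval 4 (by decide)]
  have hcount : I.count (f 0) + 1 < 2 ^ w := by have := I.count_le (f 0); omega
  refine Run.time_mono (Run.seq (run_require (P := I.count (f 0) ≤ B ∧ I.count (f 0) + 1 = s.rval 4)
    ?_) (T₂ := B * 130 + 100) ?_) ?_
  · simp only [List.forall_mem_cons, List.not_mem_nil, false_implies, implies_true, and_true]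
    rw [Expr.lt_ne_zero (Expr.Val.reg h12) (hvB s₄ c5 P₄.hh (P₄.cube.trans hY)) hw,
      Expr.eq_ne_zero (Expr.Val.add (Expr.Val.reg h12) (Expr.val_one _ hw) hcount)
        (Expr.Val.reg c4) hw, Nat.lt_succ_iff]
  swap
  · have : (Prog.require 24 [(Expr.reg 12).lt (boundExpr d + 1),
      (Expr.reg 12 + 1).eq (.reg 4)]).size = 47 := rfl
    omega
  intro s₅ hs₅ hF₅
  have P₅ := P₄.frame hF₅ (by simp [Prog.require, Prog.regs]) (by simp [Prog.require, Prog.arrays])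
  have F₅ : Frame [24] [] s₄ s₅ := hF₅.mono (by simp [Prog.require, Prog.regs])
    (by simp [Prog.require, Prog.arrays])
  have key5 : s₅.rval 24 ≠ 0 ↔ I.count (f 0) ≤ B ∧ I.count (f 0) + 1 = s.rval 4 := by
    rcases hs₅ with ⟨h1, rfl⟩ | ⟨h1, rfl⟩
    · rw [c24]; exact iff_of_true he h1
    · simp only [State.setReg_rval, if_true, h1, iff_false]; simp
  refine Run.time_mono (Run.ite (T := B * 130 + 90) ?_ ?_) (by
    change B * 130 + 90 + 1 + 1 ≤ _; omega)
  swap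
  · intro he
    refine (Run.skip ?_).time_mono (by omega)
    have := key5.not.1 (not_not.2 he)
    rw [Inst.Certifies]
    refine iff_of_false (not_not.2 he) ?_
    rintro ⟨-, -, h1, h2, -⟩; exact this ⟨h1, h2⟩
  intro he5
  obtain ⟨hcB, hcL⟩ := key5.1 he5
  have d12 : s₅.rval 12 = I.count (f 0) := by rw [F₅.rval 12 (by decide), h12]
  refine (Run.for (ω := ω) (s := s₅) (x := 13) (b := .reg 12) (p := checkNext) (I.count (f 0))
    (by omega) hw (fun k s' => s'.rval 24 ≠ 0 ↔ ∀ q < k, I.Spurious n (f 0) (f (q + 1)) ∧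
      (q ≠ 0 → f q < f (q + 1))) 120 (by decide) ?_ ?_ ?_).mono ?_ ?_
  · simpa using he5
  · intro s' hF
    rw [Expr.val_reg, hF.rval 12 (by decide), d12]
  · intro k hk s' hF h13 hinv
    have F' : Frame [13, 24, 25] [] s₅ s' := hF.mono (by decide) (by decide)
    refine (run_checkNext (f := f) hw (P₅.frame F' (by decide) (by decide)) (n := n) (p := f 0) ?_ ?_
      h13 (by omega) (fun i _ => ?_) hIlt).mono le_rfl fun s'' hs'' => ?_
    · rw [F'.rval 0 (by decide), F₅.rval 0 (by decide), hF₄.rval 0 (by decide),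
        F₃.rval 0 (by decide), h0]
    · rw [F'.rval 11 (by decide), F₅.rval 11 (by decide), hF₄.rval 11 (by decide), b11]
    · rw [F'.arr 3 (by decide), F₅.arr 3 (by decide), hF₄.arr 3 (by decide),
        F₃.arr 3 (by decide), hf]
    · rw [State.setReg_rval, if_neg (by decide), hs'', hinv, Nat.forall_lt_succ_right]
  · change I.count (f 0) * (120 + 1 + 7) + 1 + 5 ≤ _
    omega
  · rintro s' ⟨h1, -⟩
    exact h1.trans ⟨fun h => ⟨hf0, hfY, hcB, hcL, h⟩, fun h => h.2.2.2.2⟩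

theorem run_certProg {d n : ℕ} {x : Lists} (hwd : (d + 40) * digits n ≤ w)
    (hx : x.IsSubInput n d) (h0 : s.rval 0 = n)
    (h1 : s.rval 1 = x.a.length) (h2 : s.rval 2 = x.b.length) (h3 : s.rval 3 = x.c.length)
    (ha : HoldsList s 0 x.a) (hb : HoldsList s 1 x.b) (hc : HoldsList s 2 x.c) :
    Run ω (certProg d) s (certTime d n) (fun s' => s'.rval 0 ≠ 0 ↔
      (x.inst (2 ^ (d * digits n))).Certifies n (2 ^ (3 * halfDigits n))
        (certBound d (digits n) (halfDigits n)) (s.arr 3) (s.rval 4)) := by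
  obtain ⟨la, lb, lc, hxb⟩ := hx
  have hD := digits_pos n
  have hnD := lt_two_pow_digits n
  obtain ⟨hh1, hh2, hh3⟩ := halfDigits_bounds n
  have S1 := run_setupProg (ω := ω) hwd hxb h0 h1 h2 h3 ha hb hc
  set I := x.inst (2 ^ (d * digits n)) with hI
  have hIa : I.la = x.a.length := rfl
  have hIb : I.lb = x.b.length := rfl
  have hIc : I.lc = x.c.length := rfl
  have hIlt : ∀ i j, I.α i + I.β j < 2 ^ w := inst_add_lt hxb hwd
  set D := digits n with hDdef
  set h := halfDigits n with hhdef
  have hcap := count_cap hD hh3 (by nlinarith : 40 * D ≤ w) hnD la lb lc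
  have hT : (d + 20) * 60 * D + (x.a.length + x.b.length + x.c.length) * 20 + 60 +
      ((3 * h + 4) ^ 3 * (2 ^ (3 * h) + I.la + I.lb + I.lc) * 10000 +
      certBound d D h * 130 + 300) ≤ certTime d n := by
    rw [certTime, ← hDdef, ← hhdef]
    have := Nat.mul_le_mul_right 10000 (Nat.mul_le_mul_left ((3 * h + 4) ^ 3)
      (show 2 ^ (3 * h) + I.la + I.lb + I.lc ≤ 2 ^ (3 * h) + 3 * n by omega))
    omega
  refine Run.time_mono (Run.seq S1 fun s₁ P hF₁ => ?_) hT
  have F₁ : Frame [5, 6, 7, 8, 9, 10, 13] [4, 9, 10, 11] s s₁ := hF₁.mono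
    (by simp [setupProg, Prog.for, Prog.tab, Prog.regs])
    (by simp [setupProg, Prog.for, Prog.tab, Prog.arrays])
  refine (run_certCheck hwd hD hh1 hh3 P.ready P.r5 (by rw [F₁.rval 0 (by decide), h0]) hIlt
    hcap).mono le_rfl fun s' hs' => ?_
  rw [hs', F₁.rval 4 (by decide), show s₁.arr 3 = s.arr 3 from funext (F₁.arr 3 (by decide))]

end WordRAM

/-! ### Good moduli -/

namespace ThreeSum

/-- Chebyshev's bound yields 2^h - h - 1 ≤ h·π(2^h). For h ≥ 3 the left side is at least half of
2^h, because 2h + 2 ≤ 2^h; the two smaller cases are computed. -/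
theorem two_pow_le_primeCounting {h : ℕ} (hh : 0 < h) :
    2 ^ h ≤ 2 * h * Nat.primeCounting (2 ^ h) := by
  have key : (2 : ℝ) ^ h - h - 1 ≤ h * Nat.primeCounting (2 ^ h) := by
    have h1 := Chebyshev.pi_ge (2 ^ h)
    have hl : 0 < Real.log 2 := Real.log_pos (by norm_num)
    have hh' : (0 : ℝ) < h := by exact_mod_cast hh
    have h3 : Real.log ((2 ^ h : ℕ) + 1) ≤ (h + 1) * Real.log 2 := by
      have : (1 : ℝ) ≤ 2 ^ h := one_le_pow₀ (by norm_num)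
      calc Real.log ((2 ^ h : ℕ) + 1) ≤ Real.log (2 ^ (h + 1)) :=
            Real.log_le_log (by positivity) (by push_cast; rw [pow_succ]; linarith)
        _ = _ := by rw [Real.log_pow]; push_cast; rfl
    rw [Nat.cast_pow, Real.log_pow, Nat.cast_ofNat, div_le_iff₀ (by positivity)] at h1
    rw [Nat.cast_pow, Nat.cast_ofNat] at h3
    have h4 : ((2 : ℝ) ^ h - h - 1) * Real.log 2 ≤
        (h * Nat.primeCounting (2 ^ h)) * Real.log 2 := by linarith
    exact le_of_mul_le_mul_right h4 hl
  rcases Nat.lt_or_ge h 3 with h3 | h3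
  · have hp : Nat.primeCounting 2 = 1 := by decide
    have hp' : Nat.primeCounting 4 = 2 := by decide
    interval_cases h
    · simp [hp]
    · simp [hp']
  · have h5 : 2 * h + 2 ≤ 2 ^ h := by
      obtain ⟨k, rfl⟩ := Nat.exists_eq_add_of_le h3
      clear key hh h3
      induction k with
      | zero => norm_num
      | succ k ih => rw [← add_assoc, pow_succ]; omega
    have h6 : (2 * h + 2 : ℝ) ≤ 2 ^ h := by exact_mod_cast h5
    have : (2 : ℝ) ^ h ≤ 2 * h * Nat.primeCounting (2 ^ h) := by linarith
    exact_mod_cast this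

/-- The product of the distinct prime factors divides `z`, and each of them is at least 2. -/
theorem card_primeFactors_le {z M : ℕ} (h0 : z ≠ 0) (h : z < 2 ^ M) : z.primeFactors.card ≤ M := by
  have h1 : 2 ^ z.primeFactors.card ≤ z :=
    (Finset.pow_card_le_prod _ _ _ fun p hp => (Nat.prime_of_mem_primeFactors hp).two_le).trans
      (Nat.le_of_dvd (Nat.pos_of_ne_zero h0) (Nat.prod_primeFactors_dvd z))
  exact ((Nat.pow_lt_pow_iff_right (by norm_num)).1 (h1.trans_lt h)).le

namespace Inst

variable {I : Inst}

/-- Average over the primes l ≤ 2^h. In the absence of solutions the defect |γ - α - β| of a triple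
is a nonzero number below 2^M, so it survives for at most M primes. Double counting bounds the sum
of the counts modulo p·l by M times the count modulo p, and a prime attaining the minimum does at
least as well as the average. -/
theorem exists_count_mul_le {M h p : ℕ} (hh : 0 < h) (hI : ∀ y, ¬ I.IsSol y)
    (hM : ∀ i j k, I.α i + I.β j < 2 ^ M ∧ I.γ k < 2 ^ M) :
    ∃ l, 0 < l ∧ l ≤ 2 ^ h ∧ I.count (p * l) * 2 ^ h ≤ I.count p * (2 * h * M) := by
  set P := (Finset.range (2 ^ h + 1)).filter Nat.Prime with hP
  have hcard : P.card = Nat.primeCounting (2 ^ h) := by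
    rw [Nat.primeCounting, Nat.primeCounting', Nat.count_eq_card_filter_range]
  let z : Triple → ℕ := fun y => ((I.γ y.2.2 : ℤ) - (I.α y.1 + I.β y.2.1 : ℕ)).natAbs
  have hsum : ∑ l ∈ P, I.count (p * l) ≤ I.count p * M := by
    calc ∑ l ∈ P, I.count (p * l)
        ≤ ∑ l ∈ P, ((I.congruent p).filter fun y => l ∣ z y).card := by
          refine Finset.sum_le_sum fun l _ => ?_
          rw [← card_congruent]
          refine Finset.card_le_card fun y hy => ?_
          simp only [congruent, Finset.mem_filter] at hy ⊢
          -- Only one implication is needed: a congruence modulo p·l gives those modulo p and modulo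
          -- l. Hence `l` may well divide `p`.
          have hy' : I.α y.1 + I.β y.2.1 ≡ I.γ y.2.2 [MOD p * l] := hy.2
          exact ⟨⟨hy.1, hy'.of_mul_right _⟩, Int.natCast_dvd.1
            (Nat.modEq_iff_dvd.1 (hy'.of_mul_left _))⟩
      _ = ∑ y ∈ I.congruent p, (P.filter fun l => l ∣ z y).card := by
          simp only [Finset.card_filter]
          exact Finset.sum_comm
      _ ≤ ∑ _y ∈ I.congruent p, M := by
          refine Finset.sum_le_sum fun y hy => ?_
          simp only [congruent, Finset.mem_filter, Finset.mem_product, Finset.mem_range] at hy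
          have hne : z y ≠ 0 := by
            intro h0
            refine hI y ⟨hy.1.1, hy.1.2.1, hy.1.2.2, ?_⟩
            simp only [z] at h0; omega
          have hlt : z y < 2 ^ M := by
            have := hM y.1 y.2.1 y.2.2
            simp only [z]; omega
          refine (Finset.card_le_card fun l hl => ?_).trans (card_primeFactors_le hne hlt)
          simp only [hP, Finset.mem_filter] at hl
          exact Nat.mem_primeFactors.2 ⟨hl.1.2, hl.2, hne⟩
      _ = I.count p * M := by rw [Finset.sum_const, card_congruent, smul_eq_mul]
  have hP0 : P.Nonempty := ⟨2, by
    simp only [hP, Finset.mem_filter, Finset.mem_range]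
    exact ⟨Nat.lt_succ_of_le (Nat.le_self_pow hh.ne' 2), Nat.prime_two⟩⟩
  obtain ⟨l, hl, hle⟩ := Finset.exists_min_image P (fun l => I.count (p * l)) hP0
  simp only [hP, Finset.mem_filter, Finset.mem_range] at hl
  refine ⟨l, hl.2.pos, Nat.lt_succ_iff.1 hl.1, ?_⟩
  have h1 : P.card * I.count (p * l) ≤ I.count p * M := by
    simpa using (Finset.card_nsmul_le_sum P _ _ hle).trans hsum
  calc I.count (p * l) * 2 ^ h ≤ I.count (p * l) * (2 * h * P.card) := by
        rw [hcard]; exact Nat.mul_le_mul_left _ (two_pow_le_primeCounting hh)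
    _ = 2 * h * (P.card * I.count (p * l)) := by ring
    _ ≤ 2 * h * (I.count p * M) := Nat.mul_le_mul_left _ h1
    _ = _ := by ring

end Inst

end ThreeSum

/-! ### The list of the spurious triples -/

namespace ThreeSum

theorem length_flatMap_range {β : Type*} (m : ℕ) (f : ℕ → List β) :
    ((List.range m).flatMap f).length = ∑ i ∈ Finset.range m, (f i).length := by
  induction m with
  | zero => rfl
  | succ m ih => simp [List.range_succ, Finset.sum_range_succ, ih]

theorem flatMap_range_succ {β : Type*} (m : ℕ) (f : ℕ → List β) :
    (List.range (m + 1)).flatMap f = (List.range m).flatMap f ++ f m := by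
  simp [List.range_succ]

theorem length_filter_range (m : ℕ) (p : ℕ → Prop) [DecidablePred p] :
    ((List.range m).filter p).length = ((Finset.range m).filter p).card := by
  induction m with
  | zero => rfl
  | succ m ih =>
    rw [List.range_succ, List.filter_append, List.length_append, ih, Finset.range_add_one,
      Finset.filter_insert]
    by_cases h : p m <;> simp [h]

namespace Inst

variable (I : Inst)

/-- The first `m` positions of the third list, as far as the entries are `g` modulo `p`. -/
def bucket (p m g : ℕ) : List ℕ := (List.range m).filter fun k => I.γ k % p = g

theorem bucket_succ (p m g : ℕ) :
    I.bucket p (m + 1) g = I.bucket p m g ++ if I.γ m % p = g then [m] else [] := by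
  rw [bucket, List.range_succ, List.filter_append, bucket]
  by_cases h : I.γ m % p = g <;> simp [h]

theorem length_bucket_le (p m g : ℕ) : (I.bucket p m g).length ≤ m :=
  (List.length_filter_le _ _).trans (List.length_range).le

/-- The codes of the triples with first entries `i, j`, zero-sum modulo `p`. -/
def row (n p i j : ℕ) : List ℕ :=
  (I.bucket p I.lc ((I.α i + I.β j) % p)).map fun k => (i * n + j) * n + k

def rows (n p i m : ℕ) : List ℕ := (List.range m).flatMap (I.row n p i)

/-- The codes of the triples, zero-sum modulo `p`, whose first entry is before `m`. -/
def allRows (n p m : ℕ) : List ℕ := (List.range m).flatMap fun i => I.rows n p i I.lb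

theorem rows_succ (n p i m : ℕ) : I.rows n p i (m + 1) = I.rows n p i m ++ I.row n p i m :=
  flatMap_range_succ _ _

theorem allRows_succ (n p m : ℕ) :
    I.allRows n p (m + 1) = I.allRows n p m ++ I.rows n p m I.lb :=
  flatMap_range_succ _ _

theorem length_allRows (n p : ℕ) : (I.allRows n p I.la).length = I.count p := by
  simp only [allRows, rows, length_flatMap_range, row, List.length_map, bucket, count]
  refine Finset.sum_congr rfl fun i _ => Finset.sum_congr rfl fun j _ => ?_
  rw [← length_filter_range]
  exact congrArg List.length (List.filter_congr fun k _ => by simp [eq_comm])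

variable {I}

theorem mem_bucket {p m g k : ℕ} : k ∈ I.bucket p m g ↔ k < m ∧ I.γ k % p = g := by
  simp [bucket]

theorem mem_row {n p i j e : ℕ} : e ∈ I.row n p i j ↔ ∃ k < I.lc,
    (I.α i + I.β j) % p = I.γ k % p ∧ e = (i * n + j) * n + k := by
  simp only [row, List.mem_map, mem_bucket]
  constructor
  · rintro ⟨k, ⟨h1, h2⟩, rfl⟩; exact ⟨k, h1, h2.symm, rfl⟩
  · rintro ⟨k, h1, h2, rfl⟩; exact ⟨k, ⟨h1, h2.symm⟩, rfl⟩

theorem mem_rows {n p i m e : ℕ} : e ∈ I.rows n p i m ↔ ∃ j < m, e ∈ I.row n p i j := by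
  simp [rows]

theorem mem_allRows {n p m e : ℕ} : e ∈ I.allRows n p m ↔ ∃ i < m, e ∈ I.rows n p i I.lb := by
  simp [allRows]

theorem pairwise_row (n p i j : ℕ) : (I.row n p i j).Pairwise (· < ·) := by
  refine List.Pairwise.map _ (fun a b h => Nat.add_lt_add_left h _) ?_
  exact List.Pairwise.filter _ List.pairwise_lt_range

/-- Since third positions are below n, the last base-n digit of a code is the third position, and
increasing the second position outweighs any change of the third. -/
theorem pairwise_rows {n p : ℕ} (hc : I.lc ≤ n) (i m : ℕ) :
    (I.rows n p i m).Pairwise (· < ·) := by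
  refine List.pairwise_flatMap.2 ⟨fun j _ => pairwise_row n p i j,
    List.pairwise_lt_range.imp fun {j j'} hj x hx y hy => ?_⟩
  obtain ⟨k, hk, -, rfl⟩ := mem_row.1 hx
  obtain ⟨k', -, -, rfl⟩ := mem_row.1 hy
  nlinarith

theorem pairwise_allRows {n p : ℕ} (hb : I.lb ≤ n) (hc : I.lc ≤ n) (m : ℕ) :
    (I.allRows n p m).Pairwise (· < ·) := by
  refine List.pairwise_flatMap.2 ⟨fun i _ => pairwise_rows hc i _,
    List.pairwise_lt_range.imp fun {i i'} hi x hx y hy => ?_⟩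
  obtain ⟨j, hj, hx⟩ := mem_rows.1 hx
  obtain ⟨j', -, hy⟩ := mem_rows.1 hy
  obtain ⟨k, hk, -, rfl⟩ := mem_row.1 hx
  obtain ⟨k', -, -, rfl⟩ := mem_row.1 hy
  have h1 : i * n + j + 1 ≤ i' * n + j' := by nlinarith
  nlinarith

theorem spurious_of_mem {n p e : ℕ} (hb : I.lb ≤ n) (hc : I.lc ≤ n) (hI : ∀ y, ¬ I.IsSol y)
    (h : e ∈ I.allRows n p I.la) : I.Spurious n p e := by
  obtain ⟨i, hi, h⟩ := mem_allRows.1 h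
  obtain ⟨j, hj, h⟩ := mem_rows.1 h
  obtain ⟨k, hk, hmod, rfl⟩ := mem_row.1 h
  have e1 : ((i * n + j) * n + k) / n = i * n + j := by
    rw [mul_comm, Nat.mul_add_div (by omega), Nat.div_eq_of_lt (by omega), add_zero]
  have e2 : ((i * n + j) * n + k) % n = k := by
    rw [Nat.mul_add_mod_self_right, Nat.mod_eq_of_lt (by omega)]
  have e3 : (i * n + j) / n = i := by
    rw [mul_comm, Nat.mul_add_div (by omega), Nat.div_eq_of_lt (by omega), add_zero]
  have e4 : (i * n + j) % n = j := by
    rw [Nat.mul_add_mod_self_right, Nat.mod_eq_of_lt (by omega)]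
  rw [Spurious, e1, e2, e3, e4]
  exact ⟨hi, hj, hk, hmod, fun h => hI (i, j, k) ⟨hi, hj, hk, h⟩⟩

/-- Completeness of the certificates: the list of all congruent triples in the order of their codes
passes every test. Entry 0 is the modulus, so the list is read with an offset of one. -/
theorem certifies_of_list {n p Y N L : ℕ} {f : ℕ → ℕ} (hb : I.lb ≤ n) (hc : I.lc ≤ n)
    (hI : ∀ y, ¬ I.IsSol y) (hp : 0 < p) (hpY : p ≤ Y) (hN : I.count p ≤ N) (h0 : f 0 = p)
    (hL : L = I.count p + 1)
    (hf : ∀ q (h : q < (I.allRows n p I.la).length), f (q + 1) = (I.allRows n p I.la)[q]) :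
    I.Certifies n Y N f L := by
  have hlen := I.length_allRows n p
  rw [Certifies, h0]
  refine ⟨hp, hpY, hN, hL.symm, fun q hq => ⟨?_, fun hq0 => ?_⟩⟩
  · rw [hf q (hlen ▸ hq)]
    exact spurious_of_mem hb hc hI (List.getElem_mem _)
  · obtain ⟨r, rfl⟩ := Nat.exists_eq_succ_of_ne_zero hq0
    rw [Nat.succ_eq_add_one, hf r (by omega), hf (r + 1) (by omega)]
    exact List.pairwise_iff_getElem.1 (pairwise_allRows hb hc _) _ _ _ _ (Nat.lt_succ_self r)

/-- Memory is a function on all addresses, a certificate a finite list; only the first `L` places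
are ever consulted, so the two descriptions may be exchanged. -/
theorem Certifies.congr {n Y N L : ℕ} {f g : ℕ → ℕ} (h : I.Certifies n Y N f L)
    (hfg : ∀ q < L, f q = g q) : I.Certifies n Y N g L := by
  obtain ⟨h1, h2, h3, h4, h5⟩ := h
  have e0 := hfg 0 (by omega)
  rw [Certifies, ← e0]
  refine ⟨h1, h2, h3, h4, fun q hq => ?_⟩
  rw [← hfg q (by omega), ← hfg (q + 1) (by omega)]
  exact h5 q hq

end Inst

end ThreeSum

namespace WordRAM

open ThreeSum

variable {w : ℕ} {ω : ℕ → Bool} {s : State w}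

/-! ### The choice of the modulus -/

/-- Register `26` is multiplied by the number `l ≤ Y` that minimises the count. -/
def greedyProg : Prog :=
  .seq (.assign 28 (.reg 1 * .reg 2 * .reg 3 + 1))
  (.seq (.for 27 (.reg 8) (.seq (.assign 11 (.reg 26 * (.reg 27 + 1)))
    (.seq countProg (.ite ((Expr.reg 12).lt (.reg 28))
      (.seq (.assign 28 (.reg 12)) (.assign 29 (.reg 11))) .skip))))
  (.assign 26 (.reg 29)))

/-- The averaging argument speaks of primes, but the program tries every factor up to 2^h. The
minimum over more candidates is no larger, and no primality test is needed. -/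
theorem run_greedyProg {I : Inst} {h p C M : ℕ} (H : Ready I h s) (hh : 0 < h) (hp : 0 < p)
    (hph : p * 2 ^ h ≤ 2 ^ (3 * h)) (h8 : s.rval 8 = 2 ^ h) (h26 : s.rval 26 = p)
    (hcap : 16 * (2 ^ (3 * h + 1) * (3 * h)) * (I.la * I.lb * I.lc + 1) + 8 < 2 ^ w)
    (hab : I.la * I.lb < 2 ^ w)
    (hC : C = (3 * h + 4) ^ 3 * (2 ^ (3 * h) + I.la + I.lb + I.lc) * 10000)
    (hI : ∀ y, ¬ I.IsSol y) (hM : ∀ i j k, I.α i + I.β j < 2 ^ M ∧ I.γ k < 2 ^ M) :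
    Run ω greedyProg s (2 ^ h * (C + 40) + 30) (fun s' => ∃ l, 0 < l ∧ l ≤ 2 ^ h ∧
      s'.rval 26 = p * l ∧ I.count (p * l) * 2 ^ h ≤ I.count p * (2 * h * M)) := by
  have hn3 : I.la * I.lb * I.lc + 1 < 2 ^ w := by
    refine lt_of_le_of_lt ?_ hcap
    have : 1 ≤ 2 ^ (3 * h + 1) * (3 * h) := Nat.mul_pos (by positivity) (by omega)
    exact (Nat.le_mul_of_pos_left _ (by omega)).trans (Nat.le_add_right _ 8)
  have hw : 1 < 2 ^ w := by omega
  have S4 := fun (s' : State w) p H hp hph h11 =>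
    run_countProg (ω := ω) (s := s') (p := p) (I := I) (h := h) H hh hp hph h11 hcap
  rw [← hC] at S4
  have hYw : p * 2 ^ h < 2 ^ w := hph.trans_lt (H.cube ▸ s.rval_lt _)
  have hY1 : 2 ^ h < 2 ^ w := (Nat.le_mul_of_pos_left _ hp).trans_lt hYw
  have hY0 : 0 < 2 ^ h := by positivity
  obtain ⟨l₀, hl₀, hl₀Y, hbest⟩ := Inst.exists_count_mul_le (p := p) hh hI hM
  generalize 2 ^ h = Y at *
  -- The start value exceeds every possible count, so the first round always stores its candidate;
  -- afterwards register 29 is meaningful.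
  have S1 : Run ω (.assign 28 (.reg 1 * .reg 2 * .reg 3 + 1)) s 8
      (fun s₁ => s₁.rval 28 = I.la * I.lb * I.lc + 1) :=
    (Run.simple rfl (Prog.Post.assign (n := I.la * I.lb * I.lc + 1) (Expr.Val.add (Expr.Val.mul
      (Expr.Val.mul (Expr.Val.reg H.la) (Expr.Val.reg H.lb) hab) (Expr.Val.reg H.lc) (by omega))
      (Expr.val_one _ hw) hn3) fun v hv => by simp [hv])).time_mono (by decide)
  refine Run.time_mono (Run.seq S1 (T₂ := Y * (C + 40) + 20) ?_) (by omega)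
  intro s₁ a28 hF₁
  have F₁ : Frame [28] [] s s₁ := hF₁
  have S2 : Run ω (.for 27 (.reg 8) (.seq (.assign 11 (.reg 26 * (.reg 27 + 1)))
      (.seq countProg (.ite ((Expr.reg 12).lt (.reg 28))
      (.seq (.assign 28 (.reg 12)) (.assign 29 (.reg 11))) .skip)))) s₁ (Y * (C + 40) + 6)
      (fun s' => ((s'.rval 28 = I.la * I.lb * I.lc + 1 ∧ Y = 0) ∨
        ∃ l < Y, s'.rval 29 = p * (l + 1) ∧ s'.rval 28 = I.count (p * (l + 1))) ∧
        ∀ l < Y, s'.rval 28 ≤ I.count (p * (l + 1))) := by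
    refine (Run.for (ω := ω) (s := s₁) (x := 27) (b := .reg 8) Y hY1 hw
      (fun k s' => ((s'.rval 28 = I.la * I.lb * I.lc + 1 ∧ k = 0) ∨
        ∃ l < k, s'.rval 29 = p * (l + 1) ∧ s'.rval 28 = I.count (p * (l + 1))) ∧
        ∀ l < k, s'.rval 28 ≤ I.count (p * (l + 1))) (C + 20) (by decide) (by simp [a28]) ?_ ?_).mono
        (by change Y * (C + 20 + 1 + 7) + 1 + 5 ≤ _; nlinarith) fun s' h => h.1
    · intro s' hF
      rw [Expr.val_reg, hF.rval 8 (by decide), F₁.rval 8 (by decide), h8]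
    intro k hk s₂ hF₂ h27 hinv
    have F₂ : Frame [11, 12, 13, 14, 15, 16, 17, 18, 19, 20, 21, 22, 23, 27, 28, 29] [5, 6, 7, 8]
      s s₂ := (hF₁.mono (by decide) (by decide)).trans (hF₂.mono (by decide) (by decide))
    have hpk : p * (k + 1) ≤ p * Y := Nat.mul_le_mul_left _ hk
    have A : Run ω (.assign 11 (.reg 26 * (.reg 27 + 1))) s₂ 6
        (fun s₃ => s₃.rval 11 = p * (k + 1)) :=
      (Run.simple rfl (Prog.Post.assign (n := p * (k + 1)) (Expr.Val.mul (Expr.Val.reg (by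
        rw [F₂.rval 26 (by decide), h26])) (Expr.Val.add (Expr.Val.reg h27) (Expr.val_one _ hw)
        (by omega)) (by omega)) fun v hv => by simp [hv])).time_mono (by decide)
    refine Run.time_mono (Run.seq A (T₂ := C + 12) ?_) (by omega)
    intro s₃ b11 hF₃
    have F₃ := F₂.trans (hF₃.mono (by decide) (by decide))
    refine Run.seq (S4 s₃ _ (H.frame F₃ (by decide) (by decide)) (by positivity) (by omega) b11) ?_
    intro s₄ b12 hF₄
    have c28 : s₄.rval 28 = s₂.rval 28 := by rw [hF₄.rval 28 (by decide), hF₃.rval 28 (by decide)]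
    have c29 : s₄.rval 29 = s₂.rval 29 := by rw [hF₄.rval 29 (by decide), hF₃.rval 29 (by decide)]
    have c11 : s₄.rval 11 = p * (k + 1) := by rw [hF₄.rval 11 (by decide), b11]
    refine Run.time_mono (Run.ite (T := 5) (fun he => ?_) (fun he => ?_)) (by decide)
    · rw [Expr.lt_ne_zero (Expr.Val.reg b12) (Expr.Val.reg c28) hw] at he
      refine (Run.simple rfl (Prog.Post.seq_assign (n := I.count (p * (k + 1))) (Expr.Val.reg b12)
        fun v hv => Prog.Post.assign (n := p * (k + 1)) (Expr.Val.reg (by simp [c11]))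
        fun v' hv' => ?_)).time_mono (by decide)
      simp only [State.setReg_rval, hv, hv']
      norm_num
      refine ⟨⟨k, by omega, Or.inl rfl, rfl⟩, fun l hl => ?_⟩
      rcases Nat.lt_or_eq_of_le hl with hl | rfl
      · exact he.le.trans (hinv.2 l hl)
      · exact le_rfl
    · have he := (Expr.lt_ne_zero (Expr.Val.reg b12) (Expr.Val.reg c28) hw).not.1 (not_not.2 he)
      refine (Run.skip ?_).time_mono (by norm_num)
      simp only [State.setReg_rval, c28, c29]
      norm_num
      refine ⟨?_, fun l hl => ?_⟩
      · rcases hinv.1 with ⟨h1, rfl⟩ | ⟨l, hl, h1⟩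
        · have := I.count_le (p * (0 + 1)); omega
        · exact ⟨l, by omega, h1⟩
      · rcases Nat.lt_or_eq_of_le hl with hl | rfl
        · exact hinv.2 l hl
        · omega
  refine Run.time_mono (Run.seq S2 (T₂ := 2) ?_) (by omega)
  rintro s₂ ⟨⟨-, h1⟩ | ⟨l, hl, h29, h28⟩, hmin⟩ -
  · omega
  refine (Run.simple rfl (Prog.Post.assign (n := p * (l + 1)) (Expr.Val.reg h29) fun v hv =>
    ⟨l + 1, Nat.succ_pos _, hl, by simp [hv], ?_⟩)).time_mono (by decide)
  have := hmin (l₀ - 1) (by omega)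
  rw [Nat.sub_add_cancel hl₀, h28] at this
  exact (Nat.mul_le_mul_right _ this).trans hbest

/-- Register `26` gets a modulus with few spurious triples. -/
def modulusProg : Prog := .seq (.assign 26 1) (.seq greedyProg (.seq greedyProg greedyProg))

/-- Three rounds suffice: the trivial count is at most 2^(6h), each round gains 2^h up to the factor
2hM, and the product of three factors stays below 2^(3h), the length for which a count is
affordable. -/
theorem run_modulusProg {I : Inst} {h C M : ℕ} (H : Ready I h s) (hh : 0 < h)
    (h8 : s.rval 8 = 2 ^ h)
    (hcap : 16 * (2 ^ (3 * h + 1) * (3 * h)) * (I.la * I.lb * I.lc + 1) + 8 < 2 ^ w)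
    (hab : I.la * I.lb < 2 ^ w)
    (hC : C = (3 * h + 4) ^ 3 * (2 ^ (3 * h) + I.la + I.lb + I.lc) * 10000)
    (hI : ∀ y, ¬ I.IsSol y) (hM : ∀ i j k, I.α i + I.β j < 2 ^ M ∧ I.γ k < 2 ^ M)
    (hla : I.la ≤ 2 ^ (2 * h)) (hlb : I.lb ≤ 2 ^ (2 * h)) (hlc : I.lc ≤ 2 ^ (2 * h)) :
    Run ω modulusProg s (3 * (2 ^ h * (C + 40) + 30) + 2) (fun s' => 0 < s'.rval 26 ∧
      s'.rval 26 ≤ 2 ^ (3 * h) ∧ I.count (s'.rval 26) ≤ 2 ^ (3 * h) * (2 * h * M) ^ 3) := by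
  have h3 : 2 ^ (3 * h) = 2 ^ h * 2 ^ h * 2 ^ h := by ring
  have hw : 1 < 2 ^ w := by omega
  have h0 : 0 < 2 ^ h := by positivity
  have S1 : Run ω (.assign 26 1) s 2 (fun s₁ => s₁.rval 26 = 1) :=
    (Run.simple rfl (Prog.Post.assign (Expr.val_one _ hw) fun v hv => by
      simp [hv])).time_mono (by decide)
  have key : ∀ s' p, Ready I h s' → 0 < p → p * 2 ^ h ≤ 2 ^ (3 * h) → s'.rval 8 = 2 ^ h →
    s'.rval 26 = p → _ := fun s' p a b c d e =>
      run_greedyProg (ω := ω) (s := s') a hh b c d e hcap hab hC hI hM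
  refine Run.time_mono (Run.seq S1 (T₂ := 3 * (2 ^ h * (C + 40) + 30)) ?_) (by omega)
  intro s₁ a26 hF₁
  have H₁ := H.frame hF₁ (by decide) (by decide)
  have b8 : s₁.rval 8 = 2 ^ h := by rw [hF₁.rval 8 (by decide), h8]
  refine Run.time_mono (Run.seq (key s₁ 1 H₁ one_pos (by rw [h3]; nlinarith) b8 a26)
    (T₂ := 2 * (2 ^ h * (C + 40) + 30)) ?_) (by omega)
  rintro s₂ ⟨l₁, p₁, q₁, c26, r₁⟩ hF₂
  rw [one_mul] at c26 r₁
  have H₂ := H₁.frame hF₂ (by decide) (by decide)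
  have c8 : s₂.rval 8 = 2 ^ h := by rw [hF₂.rval 8 (by decide), b8]
  refine Run.time_mono (Run.seq (key s₂ l₁ H₂ p₁ (by
      rw [h3, mul_assoc]; exact Nat.mul_le_mul q₁ (by nlinarith)) c8 c26)
    (T₂ := 2 ^ h * (C + 40) + 30) ?_) (by omega)
  rintro s₃ ⟨l₂, p₂, q₂, d26, r₂⟩ hF₃
  have H₃ := H₂.frame hF₃ (by decide) (by decide)
  have d8 : s₃.rval 8 = 2 ^ h := by rw [hF₃.rval 8 (by decide), c8]
  refine (key s₃ (l₁ * l₂) H₃ (by positivity) (by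
    rw [h3]; exact Nat.mul_le_mul_right _ (Nat.mul_le_mul q₁ q₂)) d8 d26).mono le_rfl ?_
  rintro s₄ ⟨l₃, p₃, q₃, e26, r₃⟩
  rw [e26]
  refine ⟨by positivity, by rw [h3]; gcongr, ?_⟩
  have hc1 : I.count 1 ≤ (2 ^ h) ^ 6 := by
    calc I.count 1 ≤ I.la * I.lb * I.lc := I.count_le 1
      _ ≤ 2 ^ (2 * h) * 2 ^ (2 * h) * 2 ^ (2 * h) := by gcongr
      _ = _ := by ring
  -- Each round is stated as a multiplication by 2^h instead of a division; the three factors are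
  -- cancelled only at the end.
  refine Nat.le_of_mul_le_mul_right (c := (2 ^ h) ^ 3) ?_ (by positivity)
  generalize 2 * h * M = Z at *
  rw [h3]
  generalize 2 ^ h = Y at *
  calc I.count (l₁ * l₂ * l₃) * Y ^ 3 = (I.count (l₁ * l₂ * l₃) * Y) * Y * Y := by ring
    _ ≤ (I.count (l₁ * l₂) * Z) * Y * Y := by gcongr
    _ = (I.count (l₁ * l₂) * Y) * Z * Y := by ring
    _ ≤ (I.count l₁ * Z) * Z * Y := by gcongr
    _ = (I.count l₁ * Y) * Z * Z := by ring
    _ ≤ (I.count 1 * Z) * Z * Z := by gcongr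
    _ ≤ (Y ^ 6 * Z) * Z * Z := by gcongr
    _ = _ := by ring

end WordRAM

/-! ### The generator of certificates -/

namespace ThreeSum.Inst

variable (I : Inst)

theorem length_row_le (n p i j : ℕ) : (I.row n p i j).length ≤ I.lc := by
  rw [row, List.length_map]; exact I.length_bucket_le _ _ _

theorem length_rows_le (n p i m : ℕ) : (I.rows n p i m).length ≤ m * I.lc := by
  rw [rows, length_flatMap_range]
  simpa using Finset.sum_le_card_nsmul (Finset.range m) _ _ fun j _ => I.length_row_le n p i j

theorem length_allRows_le (n p m : ℕ) : (I.allRows n p m).length ≤ m * (I.lb * I.lc) := by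
  rw [allRows, length_flatMap_range]
  simpa using Finset.sum_le_card_nsmul (Finset.range m) _ _ fun i _ => I.length_rows_le n p i I.lb

end ThreeSum.Inst

/-! ### Buckets of residues and enumeration of the congruent triples. -/

namespace WordRAM

open ThreeSum

variable {w : ℕ} {ω : ℕ → Bool} {s : State w}

/-- Array `12` holds the sizes of the buckets, and array `13` the buckets. -/
def Buckets (I : Inst) (n p m : ℕ) (s : State w) : Prop :=
  ∀ g < p, s.arr 12 g = (I.bucket p m g).length ∧
    ∀ q (h : q < (I.bucket p m g).length), s.arr 13 (g * n + q) = (I.bucket p m g)[q]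

def bucketProg : Prog :=
  .seq (.tab 13 12 (.reg 11) 0)
  (.for 13 (.reg 3) (.seq (.assign 25 (.get 11 (.reg 13) % .reg 11))
    (.seq (.store 13 (.reg 25 * .reg 0 + .get 12 (.reg 25)) (.reg 13))
    (.store 12 (.reg 25) (.get 12 (.reg 25) + 1)))))

/-- Bucket g occupies the addresses from g·n on; it never reaches the next one because it holds
fewer than n entries before each insertion. Only the sizes are initialised, the contents beyond them
being arbitrary. Positions arrive in increasing order, so each bucket is sorted. -/
theorem run_bucketProg {I : Inst} {n h p : ℕ} (H : Ready I h s) (hw : 1 < 2 ^ w) (hp : 0 < p)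
    (h0 : s.rval 0 = n) (h11 : s.rval 11 = p) (hlc : I.lc ≤ n) (hpn : p * n < 2 ^ w) :
    Run ω bucketProg s (p * 11 + I.lc * 40 + 20) (Buckets I n p I.lc) := by
  have hpw : p < 2 ^ w := h11 ▸ s.rval_lt _
  have S1 := Run.tab (ω := ω) (s := s) (x := 13) (A := 12) (b := .reg 11) (e := 0) p hpw hw
    (fun _ => BitVec.ofNat w 0) (fun s₁ hF => by rw [Expr.val_reg, hF.rval 11 (by decide), h11])
    (fun k _ s₁ _ _ => Expr.eval_zero _)
  refine Run.time_mono (Run.seq S1 (T₂ := I.lc * 40 + 14) ?_) (by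
    change p * (1 + 1 + 9) + 1 + 5 + _ ≤ _; omega)
  rintro s₁ ⟨hz, F₁⟩ -
  have hlcw : I.lc < 2 ^ w := H.lc ▸ s.rval_lt _
  refine (Run.for (ω := ω) (s := s₁) (x := 13) (b := .reg 3) I.lc hlcw hw (Buckets I n p) 25
    (by decide) ?_ ?_ ?_).mono (by change I.lc * (25 + 1 + 7) + 1 + 5 ≤ _; omega) fun s' h => h.1
  · intro g hg
    refine ⟨?_, fun q hq => ?_⟩
    · rw [State.setReg_arr, State.arr, hz g hg]; simp [Inst.bucket]
    · simp [Inst.bucket] at hq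
  · intro s₂ hF
    rw [Expr.val_reg, hF.rval 3 (by decide), F₁.rval 3 (by decide), H.lc]
  intro m hm s₂ hF₂ h13 hB
  have F₂ : Frame [13, 25] [12, 13] s s₂ := (F₁.mono (by decide) (by decide)).trans
    (hF₂.mono (by decide) (by decide))
  obtain ⟨g₀, hg₀⟩ : ∃ g₀, g₀ = I.γ m % p := ⟨_, rfl⟩
  have hg₀p : g₀ < p := hg₀ ▸ Nat.mod_lt _ hp
  obtain ⟨ℓ, hℓ⟩ : ∃ ℓ, ℓ = (I.bucket p m g₀).length := ⟨_, rfl⟩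
  have hℓm : ℓ ≤ m := hℓ ▸ I.length_bucket_le _ _ _
  have hℓ12 : s₂.arr 12 g₀ = ℓ := (hB g₀ hg₀p).1.trans hℓ.symm
  have addr : ∀ g < p, ∀ q < n, g * n + q < 2 ^ w := fun g hg q hq =>
    (mul_add_lt hg hq).trans hpn
  have ha := addr g₀ hg₀p ℓ (by omega)
  refine (Run.simple rfl (Prog.Post.seq_assign (n := g₀) ?_ fun v hv => Prog.Post.seq_store
    (m := g₀ * n + ℓ) (n := m) ?_ ?_ fun v' hv' => Prog.Post.store (m := g₀) (n := ℓ + 1) ?_ ?_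
    fun v'' hv'' => ?_)).time_mono (by decide)
  · rw [hg₀]
    refine Expr.Val.mod ?_ (Expr.Val.reg (by rw [F₂.rval 11 (by decide), h11]))
    rw [Expr.Val.get (Expr.Val.reg h13), F₂.arr 11 (by decide), H.γ m hm]
  · have e25 : (Expr.reg 25).val (s₂.setReg 25 v) = g₀ := by simp [hv]
    exact Expr.Val.add (Expr.Val.mul e25 (Expr.Val.reg (by simp [F₂.rval 0 (by decide), h0]))
      (by omega)) ((Expr.Val.get e25).trans hℓ12) ha
  · exact Expr.Val.reg (by simpa using h13)
  · exact Expr.Val.reg (by simp [hv])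
  · have e25 : (Expr.reg 25).val ((s₂.setReg 25 v).setMem 13 (BitVec.ofNat w (g₀ * n + ℓ)) v')
      = g₀ := by simp [hv]
    refine Expr.Val.add ((Expr.Val.get e25).trans ?_) (Expr.val_one _ hw) (by omega)
    rw [State.setMem_arr_ne _ _ _ _ _ (by decide)]
    exact hℓ12
  · intro g hg
    have E12 : (((s₂.setReg 25 v).setMem 13 (BitVec.ofNat w (g₀ * n + ℓ)) v').setMem 12
        (BitVec.ofNat w g₀) v'').arr 12 g = if g = g₀ then ℓ + 1 else s₂.arr 12 g := by
      rw [State.setMem_arr _ _ _ _ _ _ (by omega) (by omega), hv'',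
        State.setMem_arr_ne _ _ _ _ _ (by decide), State.setReg_arr]
      simp
    have E13 : ∀ q < n, (((s₂.setReg 25 v).setMem 13 (BitVec.ofNat w (g₀ * n + ℓ)) v').setMem 12
        (BitVec.ofNat w g₀) v'').arr 13 (g * n + q) =
        if g = g₀ ∧ q = ℓ then m else s₂.arr 13 (g * n + q) := by
      intro q hq
      rw [State.setMem_arr_ne _ _ _ _ _ (by decide), State.setMem_arr _ _ _ _ _ _ ha (addr g hg q hq),
        State.setReg_arr, hv']
      refine if_congr ⟨fun h => ?_, fun h => ⟨rfl, by rw [h.1, h.2]⟩⟩ rfl rfl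
      -- Dividing the address by n recovers the bucket, since both offsets are below n.
      have h1 : g = g₀ := by
        have := congrArg (· / n) h.2
        simpa [Nat.mul_add_div, mul_comm _ n, Nat.mul_add_div (by omega : 0 < n),
          Nat.div_eq_of_lt hq, Nat.div_eq_of_lt (by omega : ℓ < n)] using this
      exact ⟨h1, by have := h.2; rw [h1] at this; omega⟩
    rw [State.setReg_arr, E12]
    have hlen := I.length_bucket_le p (m + 1) g
    have hs := I.bucket_succ p m g
    rw [← hg₀] at hs
    by_cases hgg : g = g₀
    · subst hgg
      rw [if_pos rfl] at hs
      rw [if_pos rfl]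
      refine ⟨by rw [hs]; simp [hℓ], fun q hq => ?_⟩
      rw [State.setReg_arr, E13 q (by omega)]
      simp only [hs]
      rw [hs, List.length_append, List.length_singleton] at hq
      by_cases hqℓ : q = ℓ
      · subst hqℓ; simp [hℓ]
      · rw [if_neg (by tauto), List.getElem_append_left (by omega)]
        exact (hB g hg).2 q (by omega)
    · rw [if_neg (Ne.symm hgg), List.append_nil] at hs
      rw [if_neg hgg, hs]
      refine ⟨(hB g hg).1, fun q hq => ?_⟩
      rw [State.setReg_arr, E13 q (by rw [hs] at hlen; omega), if_neg (by tauto)]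
      exact (hB g hg).2 q hq

/-- Register `12` holds the length of the list, and array `3` holds the list from place `1` on. -/
def Emitted (E : List ℕ) (s : State w) : Prop :=
  s.rval 12 = E.length ∧ ∀ q (h : q < E.length), s.arr 3 (q + 1) = E[q]

theorem Emitted.setReg {E : List ℕ} (h : Emitted E s) {x : ℕ} (hx : x ≠ 12) (v : BitVec w) :
    Emitted E (s.setReg x v) := by
  refine ⟨by simpa [Ne.symm hx] using h.1, h.2⟩

/-- Append a number to the list. -/
def emit (e : Expr) : Prog := .seq (.store 3 (.reg 12 + 1) e) (.assign 12 (.reg 12 + 1))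

theorem run_emit {E : List ℕ} {e : Expr} {v : ℕ} (hw : 1 < 2 ^ w) (h : Emitted E s)
    (hE : E.length + 1 < 2 ^ w) (he : e.val s = v) :
    Run ω (emit e) s (e.cost + 8) (Emitted (E ++ [v])) := by
  refine (Run.simple rfl (Prog.Post.seq_store (m := E.length + 1) (n := v) (Expr.Val.add
    (Expr.Val.reg h.1) (Expr.val_one _ hw) hE) he fun u hu => Prog.Post.assign
    (n := E.length + 1) (Expr.Val.add (Expr.Val.reg h.1) (Expr.val_one _ hw) hE)
    fun u' hu' => ?_)).time_mono ?_
  · refine ⟨by simp [hu'], fun q hq => ?_⟩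
    rw [List.length_append, List.length_singleton] at hq
    rw [State.setReg_arr, State.setMem_arr _ _ _ _ _ _ hE (by omega), hu]
    by_cases hqE : q = E.length
    · subst hqE; simp
    · rw [if_neg (by omega), List.getElem_append_left (by omega)]
      exact h.2 q (by omega)
  · change 3 + e.cost + 1 + 4 ≤ _; omega

def rowProg : Prog :=
  .seq (.assign 16 ((.get 9 (.reg 13) + .get 10 (.reg 14)) % .reg 11))
    (.for 15 (.get 12 (.reg 16)) (emit ((.reg 13 * .reg 0 + .reg 14) * .reg 0 +
      .get 13 (.reg 16 * .reg 0 + .reg 15))))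

/-- List the triples that are zero-sum modulo register `11`. -/
def enumProg : Prog := .seq (.assign 12 0) (.for 13 (.reg 1) (.for 14 (.reg 2) rowProg))

theorem run_rowProg {I : Inst} {n h p i j : ℕ} {E : List ℕ} (H : Ready I h s) (hw : 1 < 2 ^ w)
    (hp : 0 < p) (h0 : s.rval 0 = n) (h11 : s.rval 11 = p) (hB : Buckets I n p I.lc s)
    (hla : I.la ≤ n) (hlb : I.lb ≤ n) (hlc : I.lc ≤ n) (hpn : p * n < 2 ^ w)
    (hn : n * n * n < 2 ^ w) (hIlt : ∀ i j, I.α i + I.β j < 2 ^ w) (h13 : s.rval 13 = i)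
    (h14 : s.rval 14 = j) (hi : i < I.la) (hj : j < I.lb) (hE : Emitted E s)
    (hlen : E.length + I.lc + 1 < 2 ^ w) :
    Run ω rowProg s ((I.row n p i j).length * 31 + 15) (Emitted (E ++ I.row n p i j)) := by
  obtain ⟨g, hg⟩ : ∃ g, g = (I.α i + I.β j) % p := ⟨_, rfl⟩
  have hgp : g < p := hg ▸ Nat.mod_lt _ hp
  have S1 : Run ω (.assign 16 ((.get 9 (.reg 13) + .get 10 (.reg 14)) % .reg 11)) s 8
      (fun s₁ => s₁.rval 16 = g ∧ Emitted E s₁) :=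
    (Run.simple rfl (Prog.Post.assign (n := g) (hg ▸ Expr.Val.mod (Expr.Val.add
      ((Expr.Val.get (Expr.Val.reg h13)).trans (H.α i hi))
      ((Expr.Val.get (Expr.Val.reg h14)).trans (H.β j hj)) (hIlt i j)) (Expr.Val.reg h11))
      fun v hv => ⟨by simp [hv], hE.setReg (by decide) v⟩)).time_mono (by decide)
  refine Run.time_mono (Run.seq S1 (T₂ := (I.row n p i j).length * 31 + 7) ?_) (by omega)
  rintro s₁ ⟨h16, hE₁⟩ hF₁
  have hrow : I.row n p i j = (I.bucket p I.lc g).map fun k => (i * n + j) * n + k := by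
    rw [hg]; rfl
  have hrl : (I.row n p i j).length = (I.bucket p I.lc g).length := by rw [hrow, List.length_map]
  have hrc := I.length_row_le n p i j
  refine (Run.for (ω := ω) (s := s₁) (x := 15) (b := .get 12 (.reg 16)) (I.row n p i j).length
    (by omega) hw (fun k => Emitted (E ++ (I.row n p i j).take k)) 22 (by decide) ?_ ?_ ?_).mono
    (by change (I.row n p i j).length * (22 + 2 + 7) + 2 + 5 ≤ _; omega) fun s' h => by
      rw [← List.take_length (l := I.row n p i j)]; exact h.1
  · simpa using hE₁.setReg (by decide) _
  · intro s' hF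
    have F := (hF₁.mono (R' := [12, 15, 16]) (M' := [3]) (by decide) (by decide)).trans
      (hF.mono (by decide) (by decide))
    rw [Expr.Val.get (Expr.Val.reg (by rw [hF.rval 16 (by decide), h16])), F.arr 12 (by decide),
      (hB g hgp).1, hrl]
  · intro k hk s' hF h15 hinv
    have F := (hF₁.mono (R' := [12, 15, 16]) (M' := [3]) (by decide) (by decide)).trans
      (hF.mono (by decide) (by decide))
    have hb := I.length_bucket_le p I.lc g
    have v0 : (Expr.reg 0).val s' = n := by rw [Expr.val_reg, F.rval 0 (by decide), h0]
    have v13 : (Expr.reg 13).val s' = i := by rw [Expr.val_reg, F.rval 13 (by decide), h13]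
    have v14 : (Expr.reg 14).val s' = j := by rw [Expr.val_reg, F.rval 14 (by decide), h14]
    have v16 : (Expr.reg 16).val s' = g := by rw [Expr.val_reg, hF.rval 16 (by decide), h16]
    have hkn : k < n := by omega
    have vB : (Expr.get 13 (.reg 16 * .reg 0 + .reg 15)).val s' =
        (I.bucket p I.lc g)[k]'(by omega) := by
      have hlt := (mul_add_lt hgp hkn).trans hpn
      rw [Expr.Val.get (Expr.Val.add (Expr.Val.mul v16 v0 (by omega)) (Expr.Val.reg h15) hlt),
        F.arr 13 (by decide)]
      exact (hB g hgp).2 k (by omega)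
    have hmem := Inst.mem_bucket.1 (List.getElem_mem (l := I.bucket p I.lc g) (n := k) (by omega))
    have l1 : i * n + j < n * n := mul_add_lt (by omega) (by omega)
    have l2 : (i * n + j) * n + (I.bucket p I.lc g)[k]'(by omega) < 2 ^ w :=
      (mul_add_lt l1 (by omega)).trans hn
    have l3 : i * n + j < 2 ^ w := by
      have : n * n ≤ n * n * n := Nat.le_mul_of_pos_right _ (by omega)
      omega
    refine (run_emit hw hinv ?_ (Expr.Val.add (Expr.Val.mul (Expr.Val.add (Expr.Val.mul v13 v0
      (by omega)) v14 l3) v0 (by omega)) vB l2)).mono (by decide) fun s'' hs'' => ?_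
    · rw [List.length_append, List.length_take]; omega
    · refine Emitted.setReg ?_ (by decide) _
      rw [List.append_assoc] at hs''
      convert hs'' using 2
      rw [List.take_add_one, List.getElem?_eq_getElem hk]
      simp [hrow]

/-- A pair (i, j) costs a constant plus a constant per triple produced, and the lengths of all rows
add up to the count. This is why the loops are summed round by round instead of by their worst case.
-/
theorem run_enumProg {I : Inst} {n h p : ℕ} (H : Ready I h s) (hw : 1 < 2 ^ w)
    (hp : 0 < p) (h0 : s.rval 0 = n) (h11 : s.rval 11 = p) (hB : Buckets I n p I.lc s)
    (hla : I.la ≤ n) (hlb : I.lb ≤ n) (hlc : I.lc ≤ n) (hpn : p * n < 2 ^ w)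
    (hn : n * n * n + 1 < 2 ^ w) (hIlt : ∀ i j, I.α i + I.β j < 2 ^ w) :
    Run ω enumProg s (I.count p * 31 + n * (n * 23 + 14) + 8)
      (Emitted (I.allRows n p I.la)) := by
  have S1 : Run ω (.assign 12 0) s 2 (Emitted []) :=
    (Run.simple rfl (Prog.Post.assign (n := 0) (Expr.val_zero _) fun v hv =>
      ⟨by simp [hv], fun q hq => by simp at hq⟩)).time_mono (by decide)
  refine Run.time_mono (Run.seq S1 (T₂ := I.count p * 31 + n * (n * 23 + 14) + 6) ?_) (by omega)
  intro s₁ hE₁ hF₁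
  have T := Run.for_sum (ω := ω) (s := s₁) (x := 13) (b := .reg 1) (p := .for 14 (.reg 2) rowProg)
    I.la (H.la ▸ s.rval_lt _) hw (fun i => Emitted (I.allRows n p i))
    (fun i => (I.rows n p i I.lb).length * 31 + n * 23 + 6) (by decide)
    (by simpa [Inst.allRows] using hE₁.setReg (by decide) _)
    (fun s' hF => by rw [Expr.val_reg, hF.rval 1 (by decide), hF₁.rval 1 (by decide), H.la]) ?_
  · refine T.mono ?_ fun s' h => h.1
    rw [← I.length_allRows n p, Inst.allRows, length_flatMap_range, Finset.sum_mul]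
    change _ + 1 + 5 ≤ _
    have e : ∀ i ∈ Finset.range I.la, (I.rows n p i I.lb).length * 31 + n * 23 + 6 +
      (Expr.reg 1).cost + 7 = (I.rows n p i I.lb).length * 31 + (n * 23 + 14) := fun i _ => by
        change _ + 1 + 7 = _; omega
    rw [Finset.sum_congr rfl e, Finset.sum_add_distrib, Finset.sum_const, Finset.card_range,
      smul_eq_mul]
    have := Nat.mul_le_mul_right (n * 23 + 14) hla
    omega
  · intro i hi s₂ hF₂ h13 hE₂
    have F₂ : Frame [12, 13, 14, 15, 16] [3] s s₂ := (hF₁.mono (by decide) (by decide)).trans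
      (hF₂.mono (by decide) (by decide))
    have T := Run.for_sum (ω := ω) (s := s₂) (x := 14) (b := .reg 2) (p := rowProg)
      I.lb (H.lb ▸ s.rval_lt _) hw (fun j => Emitted (I.allRows n p i ++ I.rows n p i j))
      (fun j => (I.row n p i j).length * 31 + 15) (by decide)
      (by simpa [Inst.rows] using hE₂.setReg (by decide) _)
      (fun s' hF => by rw [Expr.val_reg, hF.rval 2 (by decide), F₂.rval 2 (by decide), H.lb]) ?_
    · refine T.mono ?_ fun s' h => by
        rw [Inst.allRows_succ]; exact h.1.setReg (by decide) _
      rw [Inst.rows, length_flatMap_range, Finset.sum_mul]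
      change _ + 1 + 5 ≤ _
      have e : ∀ j ∈ Finset.range I.lb, (I.row n p i j).length * 31 + 15 +
        (Expr.reg 2).cost + 7 = (I.row n p i j).length * 31 + 23 := fun i _ => rfl
      rw [Finset.sum_congr rfl e, Finset.sum_add_distrib, Finset.sum_const, Finset.card_range,
        smul_eq_mul]
      have := Nat.mul_le_mul_right 23 hlb
      omega
    · intro j hj s₃ hF₃ h14 hE₃
      have F₃ : Frame [12, 13, 14, 15, 16] [3] s s₃ := F₂.trans
        (hF₃.mono (by decide) (by decide))
      have hlen : (I.allRows n p i ++ I.rows n p i j).length + I.lc + 1 < 2 ^ w := by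
        rw [List.length_append]
        have h1 := I.length_allRows_le n p i
        have h2 := I.length_rows_le n p i j
        have h3 : (i + 1) * (I.lb * I.lc) ≤ n * (n * n) := Nat.mul_le_mul (by omega)
          (Nat.mul_le_mul hlb hlc)
        have h4 : (j + 1) * I.lc ≤ I.lb * I.lc := Nat.mul_le_mul_right _ hj
        rw [Nat.add_mul, one_mul] at h3 h4
        rw [mul_assoc] at hn
        omega
      refine (run_rowProg (H.frame F₃ (by decide) (by decide)) hw hp (by
        rw [F₃.rval 0 (by decide), h0]) (by rw [F₃.rval 11 (by decide), h11]) ?_ hla hlb hlc hpn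
        (by omega) hIlt (by rw [hF₃.rval 13 (by decide), h13]) h14 hi hj hE₃ hlen).mono le_rfl
        fun s' h => ?_
      · intro g hg
        rw [F₃.arr 12 (by decide)]
        refine ⟨(hB g hg).1, fun q hq => ?_⟩
        rw [F₃.arr 13 (by decide)]
        exact (hB g hg).2 q hq
      · rw [Inst.rows_succ, ← List.append_assoc]
        exact h.setReg (by decide) _

end WordRAM

/-! ### Assembling a certificate. -/

namespace WordRAM

open ThreeSum

variable {w : ℕ} {ω : ℕ → Bool} {s : State w}

/-- The generator of certificates after the setup. -/
def genBody : Prog :=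
  .seq modulusProg (.seq (.assign 11 (.reg 26)) (.seq bucketProg (.seq enumProg
    (.seq (.store 3 0 (.reg 11)) (.assign 4 (.reg 12 + 1))))))

/-- The generator of certificates. -/
def genProg (d : ℕ) : Prog := .seq (setupProg d) genBody

/-- The bound `n ≤ 2 ^ (2 * h)` makes three greedy rounds enough, and the absence of solutions both
lets the averaging work and makes every enumerated triple spurious. -/
theorem run_genBody {I : Inst} {h n C M : ℕ} (P : Ready I h s) (h0 : s.rval 0 = n)
    (h8 : s.rval 8 = 2 ^ h) (hh : 0 < h)
    (hIlt : ∀ i j, I.α i + I.β j < 2 ^ w)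
    (hcap : 16 * (2 ^ (3 * h + 1) * (3 * h)) * (I.la * I.lb * I.lc + 1) + 8 < 2 ^ w)
    (hC : C = (3 * h + 4) ^ 3 * (2 ^ (3 * h) + I.la + I.lb + I.lc) * 10000)
    (hI : ∀ y, ¬ I.IsSol y) (hM : ∀ i j k, I.α i + I.β j < 2 ^ M ∧ I.γ k < 2 ^ M)
    (hla : I.la ≤ n) (hlb : I.lb ≤ n) (hlc : I.lc ≤ n) (hnh : n ≤ 2 ^ (2 * h))
    (hYn : 2 ^ (3 * h) * n < 2 ^ w) (hn3 : n * n * n + 1 < 2 ^ w) :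
    Run ω genBody s (3 * (2 ^ h * (C + 40) + 30) + 2 ^ (3 * h) * 11 + n * 40 +
      2 ^ (3 * h) * (2 * h * M) ^ 3 * 31 + n * (n * 23 + 14) + 100) (fun s' =>
        I.Certifies n (2 ^ (3 * h)) (2 ^ (3 * h) * (2 * h * M) ^ 3) (s'.arr 3) (s'.rval 4)) := by
  have hw : 1 < 2 ^ w := by omega
  have hab : I.la * I.lb < 2 ^ w := by
    rcases Nat.eq_zero_or_pos n with rfl | hn
    · have : I.la = 0 := by omega
      rw [this]; omega
    · have := Nat.mul_le_mul hla hlb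
      have := Nat.le_mul_of_pos_right (n * n) hn
      omega
  have S1 := run_modulusProg (ω := ω) P hh h8 hcap hab hC hI hM (hla.trans hnh) (hlb.trans hnh)
    (hlc.trans hnh)
  have hp1 : ∀ p, p ≤ 2 ^ (3 * h) → p * n < 2 ^ w := fun p hp =>
    (Nat.mul_le_mul_right _ hp).trans_lt hYn
  generalize 2 ^ h * (C + 40) = C' at *
  generalize 2 ^ (3 * h) * (2 * h * M) ^ 3 = N at *
  clear hYn hcap
  generalize hY : 2 ^ (3 * h) = Y at *
  have S2 : Run ω modulusProg s (3 * (C' + 30) + 2) _ := S1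
  refine Run.time_mono (Run.seq S2
    (T₂ := Y * 11 + n * 40 + (N * 31 + n * (n * 23 + 14)) + 37) ?_) (by omega)
  intro s₁ ⟨hp, hpY, hpN⟩ hF₁
  obtain ⟨p, h26⟩ : ∃ p, s₁.rval 26 = p := ⟨_, rfl⟩
  rw [h26] at hp hpY hpN
  have P₁ := P.frame hF₁ (by decide) (by decide)
  have A : Run ω (.assign 11 (.reg 26)) s₁ 2 (fun s₂ => s₂.rval 11 = p) :=
    (Run.simple rfl (Prog.Post.assign (Expr.Val.reg h26) fun v hv => by
      simp [hv])).time_mono (by decide)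
  refine Run.time_mono (Run.seq A
    (T₂ := Y * 11 + n * 40 + (N * 31 + n * (n * 23 + 14)) + 35) ?_) (by omega)
  intro s₂ b11 hF₂
  have P₂ := P₁.frame hF₂ (by decide) (by decide)
  have b0 : s₂.rval 0 = n := by rw [hF₂.rval 0 (by decide), hF₁.rval 0 (by decide), h0]
  refine Run.time_mono (Run.seq (run_bucketProg P₂ hw hp b0 b11 hlc (hp1 p hpY))
    (T₂ := (N * 31 + n * (n * 23 + 14)) + 15) ?_) (by omega)
  intro s₃ hB hF₃
  have P₃ := P₂.frame hF₃ (by decide) (by decide)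
  have c0 : s₃.rval 0 = n := by rw [hF₃.rval 0 (by decide), b0]
  have c11 : s₃.rval 11 = p := by rw [hF₃.rval 11 (by decide), b11]
  refine Run.time_mono (Run.seq (run_enumProg P₃ hw hp c0 c11 hB hla hlb hlc (hp1 p hpY) hn3 hIlt)
    (T₂ := 7) ?_) (by omega)
  intro s₄ hE hF₄
  have d11 : s₄.rval 11 = p := by rw [hF₄.rval 11 (by decide), c11]
  have hlen := I.length_allRows n p
  have hcw : I.count p + 1 < 2 ^ w := by
    have h1 := I.count_le p
    have h2 : I.la * I.lb * I.lc ≤ n * n * n := Nat.mul_le_mul (Nat.mul_le_mul hla hlb) hlc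
    omega
  have e12 : s₄.rval 12 = I.count p := by rw [hE.1, hlen]
  refine (Run.simple rfl (Prog.Post.seq_store (m := 0) (n := p) (Expr.val_zero _)
    (Expr.Val.reg d11) fun v hv => Prog.Post.assign (n := I.count p + 1) (Expr.Val.add
    (Expr.Val.reg e12) (Expr.val_one _ hw) hcw) fun v' hv' => ?_)).time_mono (by decide)
  have hq : ∀ q, q < 2 ^ w → (((s₄.setMem 3 (BitVec.ofNat w 0) v).setReg 4 v').arr 3 q) =
      if q = 0 then p else s₄.arr 3 q := fun q hq => by
    rw [State.setReg_arr, State.setMem_arr _ _ _ _ _ _ (by omega) hq, hv]; simp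
  refine Inst.certifies_of_list hlb hlc hI hp hpY hpN ?_ ?_ fun q hq' => ?_
  · rw [hq 0 (by omega), if_pos rfl]
  · simp [hv']
  · rw [hq (q + 1) (by omega), if_neg (Nat.succ_ne_zero q)]
    exact hE.2 q hq'

/-- A bound on the time of the generator of certificates. -/
def genTime (d n : ℕ) : ℕ :=
  (d + 20) * 60 * digits n + n * 60 +
    3 * (2 ^ halfDigits n * ((3 * halfDigits n + 4) ^ 3 * (2 ^ (3 * halfDigits n) + 3 * n) * 10000
      + 40) + 30) +
    2 ^ (3 * halfDigits n) * 11 + n * 40 + certBound d (digits n) (halfDigits n) * 31 +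
    n * (n * 23 + 14) + 200

theorem run_genProg {d n : ℕ} {x : Lists} (hwd : (d + 40) * digits n ≤ w)
    (hx : x.IsSubInput n d) (hns : ¬ Solvable x) (h0 : s.rval 0 = n)
    (h1 : s.rval 1 = x.a.length) (h2 : s.rval 2 = x.b.length) (h3 : s.rval 3 = x.c.length)
    (ha : HoldsList s 0 x.a) (hb : HoldsList s 1 x.b) (hc : HoldsList s 2 x.c) :
    Run ω (genProg d) s (genTime d n) (fun s' =>
      (x.inst (2 ^ (d * digits n))).Certifies n (2 ^ (3 * halfDigits n))
        (certBound d (digits n) (halfDigits n)) (s'.arr 3) (s'.rval 4)) := by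
  obtain ⟨la, lb, lc, hxb⟩ := hx
  have hD := digits_pos n
  have hnD := lt_two_pow_digits n
  obtain ⟨hh1, hh2, hh3⟩ := halfDigits_bounds n
  have S1 := run_setupProg (ω := ω) hwd hxb h0 h1 h2 h3 ha hb hc
  have hns' : ∀ y, ¬ (x.inst (2 ^ (d * digits n))).IsSol y := fun y hy =>
    hns ⟨y, (isSol_inst_iff hxb y).1 hy⟩
  -- The exponent d · digits n + 2 is the M of the averaging argument, as α + β is below 4 and γ
  -- below 3 times 2^(d · digits n). It is the same number as in `certBound`.
  have hM : ∀ i j k, (x.inst (2 ^ (d * digits n))).α i + (x.inst (2 ^ (d * digits n))).β j <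
      2 ^ (d * digits n + 2) ∧ (x.inst (2 ^ (d * digits n))).γ k < 2 ^ (d * digits n + 2) := by
    intro i j k
    have h1 := (inst_lt hxb i).1
    have h2 := (inst_lt hxb j).2.1
    have h3 := (inst_lt hxb k).2.2
    rw [pow_add]; omega
  set I := x.inst (2 ^ (d * digits n)) with hI
  have hIlt : ∀ i j, I.α i + I.β j < 2 ^ w := inst_add_lt hxb hwd
  have hcap := count_cap hD hh3 (by nlinarith : 40 * digits n ≤ w) hnD la lb lc
  set D := digits n with hDdef
  set h := halfDigits n with hhdef
  have hYn : 2 ^ (3 * h) * n < 2 ^ w := by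
    calc 2 ^ (3 * h) * n ≤ 2 ^ (3 * h) * 2 ^ D := Nat.mul_le_mul_left _ hnD.le
      _ = 2 ^ (3 * h + D) := by ring
      _ < 2 ^ w := Nat.pow_lt_pow_right (by norm_num) (by nlinarith)
  have hn3 : n * n * n + 1 < 2 ^ w := by
    calc n * n * n + 1 ≤ 2 ^ D * 2 ^ D * 2 ^ D + 2 ^ D := by
          gcongr; exact Nat.one_le_two_pow
      _ ≤ 2 ^ D * 2 ^ D * 2 ^ D + 2 ^ D * 2 ^ D * 2 ^ D := by
          gcongr; rw [mul_assoc]; exact Nat.le_mul_of_pos_right _ (by positivity)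
      _ = 2 ^ (3 * D + 1) := by ring
      _ < 2 ^ w := Nat.pow_lt_pow_right (by norm_num) (by nlinarith)
  have hnh : n ≤ 2 ^ (2 * h) := hnD.le.trans (Nat.pow_le_pow_right (by norm_num) hh2)
  obtain ⟨C, hC⟩ : ∃ C, C = (3 * h + 4) ^ 3 * (2 ^ (3 * h) + I.la + I.lb + I.lc) * 10000 :=
    ⟨_, rfl⟩
  have hIa : I.la = x.a.length := rfl
  have hIb : I.lb = x.b.length := rfl
  have hIc : I.lc = x.c.length := rfl
  refine Run.time_mono (Run.seq S1 (T₂ := 3 * (2 ^ h * (C + 40) + 30) + 2 ^ (3 * h) * 11 + n * 40 +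
      certBound d D h * 31 + n * (n * 23 + 14) + 100) fun s₁ P hF₁ => ?_) ?_
  · exact run_genBody (C := C) P.ready (by
      rw [hF₁.rval 0 (by simp [setupProg, Prog.for, Prog.tab, Prog.regs]), h0])
      P.r8 hh1 hIlt hcap hC hns' hM la lb lc hnh hYn hn3
  · rw [genTime, ← hDdef, ← hhdef]
    have h7 : C ≤ (3 * h + 4) ^ 3 * (2 ^ (3 * h) + 3 * n) * 10000 := by
      rw [hC]
      exact Nat.mul_le_mul_right _ (Nat.mul_le_mul_left _ (by omega))
    have h8 := Nat.mul_le_mul_left (2 ^ h) (Nat.add_le_add_right h7 40)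
    omega

end WordRAM

namespace WordRAM

open ThreeSum

variable {w : ℕ} {ω : ℕ → Bool} {s : State w}

/-! ### Programs without coin tosses -/

theorem Prog.coinFree_require (x : ℕ) (l : List Expr) : (Prog.require x l).CoinFree := by
  induction l with
  | nil => trivial
  | cons e l ih => exact ⟨ih, trivial⟩

theorem coinFree_countProg : countProg.CoinFree := by
  simp [countProg, histProg, histProg₂, Prog.tab, Prog.for, incr, levelProg, baseProg, stageProg,
    passes, pass, Prog.CoinFree]

theorem coinFree_certProg (d : ℕ) : (certProg d).CoinFree := by
  simp [certProg, certCheck, checkNext, checkEntry, setupProg, Prog.tab, Prog.for, Prog.CoinFree,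
    Prog.coinFree_require, coinFree_countProg]

/-! ### Renaming of the arrays -/

def Expr.map (g : ℕ → ℕ) : Expr → Expr
  | .lit c => .lit c
  | .reg x => .reg x
  | .get A e => .get (g A) (e.map g)
  | .op o a b => .op o (a.map g) (b.map g)

/-- The program with array `A` replaced by array `g A`. -/
def Prog.map (g : ℕ → ℕ) : Prog → Prog
  | .skip => .skip
  | .assign x e => .assign x (e.map g)
  | .store A a e => .store (g A) (a.map g) (e.map g)
  | .toss x => .toss x
  | .seq p q => .seq (p.map g) (q.map g)
  | .ite e p q => .ite (e.map g) (p.map g) (q.map g)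
  | .loop e p => .loop (e.map g) (p.map g)

/-- The state that a renamed program works on. -/
def State.pull (g : ℕ → ℕ) (s : State w) : State w := ⟨s.reg, fun A => s.mem (g A), s.coins⟩

theorem Expr.eval_map (g : ℕ → ℕ) (e : Expr) (s : State w) :
    (e.map g).eval s = e.eval (s.pull g) := by
  induction e with
  | lit | reg => rfl
  | get A e ih => simp only [Expr.map, Expr.eval, ih]; rfl
  | op o a b iha ihb => simp only [Expr.map, Expr.eval, iha, ihb]

theorem Expr.cost_map (g : ℕ → ℕ) (e : Expr) : (e.map g).cost = e.cost := by
  induction e with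
  | lit | reg => rfl
  | get A e ih => simp only [Expr.map, Expr.cost, ih]
  | op o a b iha ihb => simp only [Expr.map, Expr.cost, iha, ihb]

/-- A simulation along `State.pull`. Injectivity is needed at stores: writing into array `g A` must
not disturb the image of any other array. -/
theorem Exec.map {g : ℕ → ℕ} (hg : Function.Injective g) {p : Prog} {s₀ s₁ : State w} {t : ℕ}
    (h : Exec ω p s₀ s₁ t) :
    ∀ s : State w, s.pull g = s₀ → ∃ s', Exec ω (p.map g) s s' t ∧ s'.pull g = s₁ := by
  induction h with
  | skip s₀ => exact fun s hs => ⟨s, .skip s, hs⟩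
  | assign s₀ x e =>
    rintro s rfl
    have := Exec.assign (ω := ω) s x (e.map g)
    rw [Expr.cost_map, Expr.eval_map] at this
    exact ⟨_, this, rfl⟩
  | store s₀ A a e =>
    rintro s rfl
    have := Exec.store (ω := ω) s (g A) (a.map g) (e.map g)
    rw [Expr.cost_map, Expr.cost_map, Expr.eval_map, Expr.eval_map] at this
    refine ⟨_, this, ?_⟩
    simp only [State.pull]
    congr 1
    funext B
    by_cases h : B = A
    · subst h; simp
    · simp [h, hg.ne h]
  | toss s₀ x =>
    rintro s rfl
    exact ⟨_, .toss s x, rfl⟩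
  | seq _ _ ih₁ ih₂ =>
    intro s hs
    obtain ⟨s', h₁, h₂⟩ := ih₁ s hs
    obtain ⟨s'', h₃, h₄⟩ := ih₂ s' h₂
    exact ⟨s'', .seq h₁ h₃, h₄⟩
  | @ite_true e p q _ _ _ he _ ih =>
    rintro s rfl
    obtain ⟨s', h₁, h₂⟩ := ih s rfl
    have := Exec.ite_true (e := e.map g) (q := q.map g) (by rwa [Expr.eval_map]) h₁
    rw [Expr.cost_map] at this
    exact ⟨s', this, h₂⟩
  | @ite_false e p q _ _ _ he _ ih =>
    rintro s rfl
    obtain ⟨s', h₁, h₂⟩ := ih s rfl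
    have := Exec.ite_false (e := e.map g) (p := p.map g) (by rwa [Expr.eval_map]) h₁
    rw [Expr.cost_map] at this
    exact ⟨s', this, h₂⟩
  | @loop_true e p _ _ _ _ _ he _ _ ih₁ ih₂ =>
    rintro s rfl
    obtain ⟨s', h₁, h₂⟩ := ih₁ s rfl
    obtain ⟨s'', h₃, h₄⟩ := ih₂ s' h₂
    have := Exec.loop_true (e := e.map g) (by rwa [Expr.eval_map]) h₁ h₃
    rw [Expr.cost_map] at this
    exact ⟨s'', this, h₄⟩
  | @loop_false e p _ he =>
    rintro s rfl
    have := Exec.loop_false (ω := ω) (e := e.map g) (p := p.map g) (by rwa [Expr.eval_map])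
    rw [Expr.cost_map] at this
    exact ⟨s, this, rfl⟩

theorem Run.map {g : ℕ → ℕ} (hg : Function.Injective g) {p : Prog} {T : ℕ} {Q : State w → Prop}
    (h : Run ω p (s.pull g) T Q) : Run ω (p.map g) s T (fun s' => Q (s'.pull g)) := by
  obtain ⟨s₁, t, h₁, h₂, h₃⟩ := h
  obtain ⟨s', h₄, h₅⟩ := h₁.map hg s rfl
  exact ⟨s', t, h₄, h₂, by change Q _; rwa [h₅]⟩

theorem Prog.regs_map (g : ℕ → ℕ) (p : Prog) : (p.map g).regs = p.regs := by
  induction p <;> simp_all [Prog.map, Prog.regs]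

theorem Prog.arrays_map (g : ℕ → ℕ) (p : Prog) : (p.map g).arrays = p.arrays.map g := by
  induction p <;> simp_all [Prog.map, Prog.arrays]

theorem Prog.CoinFree.map {p : Prog} (g : ℕ → ℕ) (h : p.CoinFree) : (p.map g).CoinFree := by
  induction p with
  | skip | assign | store => trivial
  | toss => exact h.elim
  | seq p q ihp ihq => exact ⟨ihp h.1, ihq h.2⟩
  | ite e p q ihp ihq => exact ⟨ihp h.1, ihq h.2⟩
  | loop e p ih => exact ih h

@[simp] theorem State.pull_rval (g : ℕ → ℕ) (s : State w) (x : ℕ) :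
    (s.pull g).rval x = s.rval x := rfl
@[simp] theorem State.pull_arr (g : ℕ → ℕ) (s : State w) (A : ℕ) :
    (s.pull g).arr A = s.arr (g A) := rfl

end WordRAM

/-! ### The nondeterministic proof -/

namespace ThreeSum

open WordRAM

/-- The condition for the certificate verifier to accept. -/
def Lists.Certified (d n : ℕ) (x : Lists) (f : ℕ → ℕ) (L : ℕ) : Prop :=
  (x.inst (2 ^ (d * digits n))).Certifies n (2 ^ (3 * halfDigits n))
    (certBound d (digits n) (halfDigits n)) f L

theorem Lists.Certified.not_solvable {d n L : ℕ} {x : Lists} {f : ℕ → ℕ} (hx : x.IsSubInput n d)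
    (h : x.Certified d n f L) : ¬ Solvable x := by
  rintro ⟨y, hy⟩
  exact h.not_isSol y ((isSol_inst_iff hx.2.2.2 y).2 hy)

variable {d n w : ℕ} {x : Lists} {π : List (BitVec w)}

theorem lt_two_pow_word (hwd : (d + 40) * digits n ≤ w) : n < 2 ^ w :=
  (lt_two_pow_digits n).trans_le (Nat.pow_le_pow_right (by norm_num) (by nlinarith))

theorem certStart_rval (hwd : (d + 40) * digits n ≤ w) (hx : x.IsSubInput n d)
    (hπ : π.length < 2 ^ w) :
    (certStart w n x π).rval 0 = n ∧ (certStart w n x π).rval 1 = x.a.length ∧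
    (certStart w n x π).rval 2 = x.b.length ∧ (certStart w n x π).rval 3 = x.c.length ∧
    (certStart w n x π).rval 4 = π.length := by
  have hn := lt_two_pow_word hwd
  obtain ⟨ha, hb, hc, -⟩ := hx
  have key : ∀ m, m < 2 ^ w → (BitVec.ofNat w m).toNat = m := fun m hm => by
    rw [BitVec.toNat_ofNat, Nat.mod_eq_of_lt hm]
  exact ⟨key n hn, key _ (by omega), key _ (by omega), key _ (by omega), key _ hπ⟩

theorem holdsList_of_mem {s : State w} {A : ℕ} {l : List ℤ} (hl : l.length ≤ 2 ^ w)
    (h : ∀ i, s.mem A i = (l.map (BitVec.ofInt w)).getD i.toNat 0) : HoldsList s A l := by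
  intro i hi
  rw [h, getD_map_ofInt, BitVec.toNat_ofNat, Nat.mod_eq_of_lt (by omega)]

/-- Removes the machine from the statement. By determinism the run that is known to halt is the only
one, so rejection as well as acceptance is decided by the combinatorial condition. -/
theorem certAccepts_iff (hwd : (d + 40) * digits n ≤ w) (hx : x.IsSubInput n d)
    (hπ : π.length < 2 ^ w) :
    CertAccepts w (certProg d) n x π ↔ x.Certified d n (fun q => (π.getD q 0).toNat) π.length := by
  have hn := lt_two_pow_word hwd
  obtain ⟨h0, h1, h2, h3, h4⟩ := certStart_rval hwd hx hπ
  obtain ⟨s', t, h5, -, h7⟩ := run_certProg (ω := fun _ => false) hwd hx h0 h1 h2 h3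
    (holdsList_of_mem (by have := hx.1; omega) fun _ => rfl)
    (holdsList_of_mem (by have := hx.2.1; omega) fun _ => rfl)
    (holdsList_of_mem (by have := hx.2.2.1; omega) fun _ => rfl)
  have harr : ∀ q < π.length, (certStart w n x π).arr 3 q = (π.getD q 0).toNat := by
    intro q hq
    change (π.getD (BitVec.ofNat w q).toNat 0).toNat = _
    rw [BitVec.toNat_ofNat, Nat.mod_eq_of_lt (by omega)]
  have h8 : s'.reg 0 ≠ 0 ↔ s'.rval 0 ≠ 0 := by
    rw [State.rval, ← BitVec.toNat_inj.ne]; simp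
  rw [h4] at h7
  constructor
  · rintro ⟨s'', t', h9, h10⟩
    obtain ⟨rfl, -⟩ := h5.det h9
    exact (h7.1 (h8.1 h10)).congr harr
  · intro h
    exact ⟨s', t, h5, h8.2 (h7.2 (h.congr fun q hq => (harr q hq).symm))⟩

theorem isNoSolutionProof {T : ℕ → ℝ} (hT : ∀ n, (certTime d n : ℝ) ≤ T n) :
    IsNoSolutionProof d (d + 40) (certProg d) T where
  coinFree := coinFree_certProg d
  time n x hx π hπ := by
    have hn := lt_two_pow_word (d := d) (n := n) le_rfl
    obtain ⟨h0, h1, h2, h3, h4⟩ := certStart_rval le_rfl hx hπ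
    obtain ⟨s', t, h5, h6, -⟩ := run_certProg (ω := fun _ => false) le_rfl hx h0 h1 h2 h3
      (holdsList_of_mem (by have := hx.1; omega) fun _ => rfl)
      (holdsList_of_mem (by have := hx.2.1; omega) fun _ => rfl)
      (holdsList_of_mem (by have := hx.2.2.1; omega) fun _ => rfl)
    exact ⟨s', t, h5, le_trans (by exact_mod_cast h6) (hT n)⟩
  complete n x hx hns := by
    have hn := lt_two_pow_word (d := d) (n := n) le_rfl
    -- The generator only needs the lists, so it may be started from the memory layout with an empty
    -- certificate. What it leaves in array 3 is the certificate wanted, and its length, being held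
    -- in a register, automatically fits.
    have hπ : ([] : List (BitVec ((d + 40) * digits n))).length < 2 ^ ((d + 40) * digits n) := by
      simp
    obtain ⟨h0, h1, h2, h3, h4⟩ := certStart_rval le_rfl hx hπ
    obtain ⟨s', t, h5, h6, h7⟩ := run_genProg (ω := fun _ => false) le_rfl hx hns h0 h1 h2 h3
      (holdsList_of_mem (by have := hx.1; omega) fun _ => rfl)
      (holdsList_of_mem (by have := hx.2.1; omega) fun _ => rfl)
      (holdsList_of_mem (by have := hx.2.2.1; omega) fun _ => rfl)
    refine ⟨s'.read 3 (s'.reg 4), ?_, ?_⟩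
    · simpa [State.read] using (s'.reg 4).isLt
    · rw [certAccepts_iff le_rfl hx (by simpa [State.read] using (s'.reg 4).isLt)]
      have hl : (s'.read 3 (s'.reg 4)).length = s'.rval 4 := by simp [State.read, State.rval]
      rw [hl]
      refine Inst.Certifies.congr h7 fun q hq => ?_
      rw [List.getD_eq_getElem _ _ (by omega)]
      simp [State.read, State.arr]
  sound n x hx hs π hπ h :=
    ((certAccepts_iff le_rfl hx hπ).1 h).not_solvable hx hs

end ThreeSum

/-! ### Prefix instances and the first solution -/

namespace ThreeSum

open WordRAM

theorem isZeroSum_iff {x : Lists} {y : Triple} : IsZeroSum x y ↔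
    y.1 < x.a.length ∧ y.2.1 < x.b.length ∧ y.2.2 < x.c.length ∧
      x.a.getD y.1 0 + x.b.getD y.2.1 0 + x.c.getD y.2.2 0 = 0 := by
  constructor
  · rintro ⟨u, v, z, ha, hb, hc, he⟩
    obtain ⟨ha', rfl⟩ := List.getElem?_eq_some_iff.1 ha
    obtain ⟨hb', rfl⟩ := List.getElem?_eq_some_iff.1 hb
    obtain ⟨hc', rfl⟩ := List.getElem?_eq_some_iff.1 hc
    refine ⟨ha', hb', hc', ?_⟩
    rwa [List.getD_eq_getElem _ _ ha', List.getD_eq_getElem _ _ hb', List.getD_eq_getElem _ _ hc']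
  · rintro ⟨ha, hb, hc, he⟩
    rw [List.getD_eq_getElem _ _ ha, List.getD_eq_getElem _ _ hb, List.getD_eq_getElem _ _ hc] at he
    exact ⟨_, _, _, List.getElem?_eq_getElem ha, List.getElem?_eq_getElem hb,
      List.getElem?_eq_getElem hc, he⟩

theorem getD_take {l : List ℤ} {m i : ℕ} (h : i < m) : (l.take m).getD i 0 = l.getD i 0 := by
  rw [List.getD_eq_getElem?_getD, List.getD_eq_getElem?_getD, List.getElem?_take_of_lt h]

theorem toList_getElem? {l : List ℤ} {i : ℕ} (h : i < l.length) :
    l[i]?.toList = [l.getD i 0] := by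
  rw [List.getElem?_eq_getElem h, List.getD_eq_getElem _ _ h]; rfl

theorem solvable_prefix₁ {x : Lists} {y : Triple} (hy : IsZeroSum x y) :
    Solvable (x.prefix₁ y) ↔ ∃ y', IsZeroSum x y' ∧ y'.1 < y.1 := by
  have h1 := (isZeroSum_iff.1 hy).1
  simp only [Solvable, isZeroSum_iff, Lists.prefix₁, List.length_take]
  refine exists_congr fun y' => ⟨fun ⟨h2, h3, h4, h5⟩ => ?_, fun ⟨⟨h2, h3, h4, h5⟩, h6⟩ => ?_⟩
  · rw [getD_take (by omega)] at h5; exact ⟨⟨by omega, h3, h4, h5⟩, by omega⟩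
  · rw [getD_take h6]; exact ⟨by omega, h3, h4, h5⟩

theorem solvable_prefix₂ {x : Lists} {y : Triple} (hy : IsZeroSum x y) :
    Solvable (x.prefix₂ y) ↔ ∃ y', IsZeroSum x y' ∧ y'.1 = y.1 ∧ y'.2.1 < y.2.1 := by
  obtain ⟨h1, h2, -⟩ := isZeroSum_iff.1 hy
  simp only [Solvable, isZeroSum_iff, Lists.prefix₂, List.length_take, toList_getElem? h1,
    List.length_singleton]
  constructor
  · rintro ⟨y', h3, h4, h5, h6⟩
    -- The only position in the list (a_i) is 0; it corresponds to position i of the original list.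
    rw [getD_take (by omega), show y'.1 = 0 by omega] at h6
    exact ⟨(y.1, y'.2), ⟨h1, by simp only; omega, h5, h6⟩, rfl, by simp only; omega⟩
  · rintro ⟨y', ⟨h3, h4, h5, h6⟩, h7, h8⟩
    refine ⟨(0, y'.2), one_pos, by simp only; omega, h5, ?_⟩
    rw [getD_take h8, ← h7]; exact h6

theorem solvable_prefix₃ {x : Lists} {y : Triple} (hy : IsZeroSum x y) :
    Solvable (x.prefix₃ y) ↔
      ∃ y', IsZeroSum x y' ∧ y'.1 = y.1 ∧ y'.2.1 = y.2.1 ∧ y'.2.2 < y.2.2 := by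
  obtain ⟨h1, h2, h3, -⟩ := isZeroSum_iff.1 hy
  simp only [Solvable, isZeroSum_iff, Lists.prefix₃, List.length_take, toList_getElem? h1,
    toList_getElem? h2, List.length_singleton]
  constructor
  · rintro ⟨y', h4, h5, h6, h7⟩
    rw [getD_take (by omega), show y'.1 = 0 by omega, show y'.2.1 = 0 by omega] at h7
    exact ⟨(y.1, y.2.1, y'.2.2), ⟨h1, h2, by simp only; omega, h7⟩, rfl, rfl, by simp only; omega⟩
  · rintro ⟨y', ⟨h4, h5, h6, h7⟩, h8, h9, h10⟩
    refine ⟨(0, 0, y'.2.2), one_pos, one_pos, by simp only; omega, ?_⟩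
    rw [getD_take h10, ← h8, ← h9]; exact h7

/-- A solution before `y` has a smaller first position, or the same first and a smaller second one,
or agrees in both and has a smaller third one. These are precisely the solutions of the three prefix
instances. -/
theorem isLexFirst_iff {x : Lists} {y : Triple} : IsLexFirst x y ↔ IsZeroSum x y ∧
    ¬ Solvable (x.prefix₁ y) ∧ ¬ Solvable (x.prefix₂ y) ∧ ¬ Solvable (x.prefix₃ y) := by
  refine and_congr_right fun hy => ?_
  rw [solvable_prefix₁ hy, solvable_prefix₂ hy, solvable_prefix₃ hy]
  constructor
  · intro h
    refine ⟨?_, ?_, ?_⟩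
    · rintro ⟨y', h1, h2⟩
      have := h y' h1 (by rintro rfl; omega)
      unfold LexBefore at this; omega
    · rintro ⟨y', h1, h2, h3⟩
      have := h y' h1 (by rintro rfl; omega)
      unfold LexBefore at this; omega
    · rintro ⟨y', h1, h2, h3, h4⟩
      have := h y' h1 (by rintro rfl; omega)
      unfold LexBefore at this; omega
  · rintro ⟨h1, h2, h3⟩ y' hy' hne
    push Not at h1 h2 h3
    have e1 := h1 y' hy'
    have e2 := h2 y' hy'
    have e3 := h3 y' hy'
    unfold LexBefore
    by_contra hcon
    refine hne ?_
    have f1 : y'.1 = y.1 := by omega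
    have f2 : y'.2.1 = y.2.1 := by have := e2 f1; omega
    have f3 : y'.2.2 = y.2.2 := by have := e3 f1 f2; omega
    exact Prod.ext f1 (Prod.ext f2 f3)

theorem IsLexFirst.unique {x : Lists} {y y' : Triple} (h : IsLexFirst x y) (h' : IsLexFirst x y') :
    y = y' := by
  by_contra hne
  have h1 := h.2 y' h'.1 (Ne.symm hne)
  have h2 := h'.2 y h.1 hne
  unfold LexBefore at h1 h2; omega

/-- The positions are minimised one after the other, each minimum being taken among the solutions
that attain the previous ones. -/
theorem exists_isLexFirst {x : Lists} (h : Solvable x) : ∃ y, IsLexFirst x y := by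
  classical
  obtain ⟨y₀, h₀⟩ := h
  have h1 : ∃ i, ∃ y, IsZeroSum x y ∧ y.1 = i := ⟨_, y₀, h₀, rfl⟩
  obtain ⟨y₁, hy₁, e₁⟩ := Nat.find_spec h1
  have h2 : ∃ j, ∃ y, IsZeroSum x y ∧ y.1 = y₁.1 ∧ y.2.1 = j := ⟨_, y₁, hy₁, rfl, rfl⟩
  obtain ⟨y₂, hy₂, e₂, e₂'⟩ := Nat.find_spec h2
  have h3 : ∃ k, ∃ y, IsZeroSum x y ∧ y.1 = y₁.1 ∧ y.2.1 = y₂.2.1 ∧ y.2.2 = k :=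
    ⟨_, y₂, hy₂, e₂, rfl, rfl⟩
  obtain ⟨y₃, hy₃, e₃, e₃', e₃''⟩ := Nat.find_spec h3
  refine ⟨y₃, isLexFirst_iff.2 ⟨hy₃, ?_, ?_, ?_⟩⟩
  · rw [solvable_prefix₁ hy₃]
    rintro ⟨y', hy', h⟩
    exact Nat.find_min h1 (by omega : y'.1 < _) ⟨y', hy', rfl⟩
  · rw [solvable_prefix₂ hy₃]
    rintro ⟨y', hy', h, h'⟩
    exact Nat.find_min h2 (by omega : y'.2.1 < _) ⟨y', hy', by omega, rfl⟩
  · rw [solvable_prefix₃ hy₃]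
    rintro ⟨y', hy', h, h', h''⟩
    exact Nat.find_min h3 (by omega : y'.2.2 < _) ⟨y', hy', by omega, by omega, rfl⟩

open Classical in
/-- The lexicographically first solution. -/
noncomputable def Lists.first (x : Lists) : Triple :=
  if h : ∃ y, IsLexFirst x y then h.choose else (0, 0, 0)

theorem Lists.isLexFirst_first {x : Lists} (h : Solvable x) : IsLexFirst x x.first := by
  have h' := exists_isLexFirst h
  rw [Lists.first, dif_pos h']
  exact h'.choose_spec

section SubInput

variable {x : Lists} {n d : ℕ} {y : Triple}

theorem Lists.IsInput.prefix₁ (hx : x.IsInput n d) (y : Triple) : (x.prefix₁ y).IsSubInput n d := by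
  obtain ⟨ha, hb, hc, h⟩ := hx
  refine ⟨by simp [Lists.prefix₁]; omega, hb.le, hc.le, fun u hu => h u ?_⟩
  simp only [Lists.prefix₁, List.mem_append] at hu ⊢
  exact hu.imp_left (Or.imp_left List.mem_of_mem_take)

theorem Lists.IsInput.prefix₂ (hx : x.IsInput n d) (hy : IsZeroSum x y) :
    (x.prefix₂ y).IsSubInput n d := by
  obtain ⟨ha, hb, hc, h⟩ := hx
  have h1 := (isZeroSum_iff.1 hy).1
  simp only [Lists.prefix₂, toList_getElem? h1]
  refine ⟨by simp; omega, by simp; omega, hc.le, fun u hu => h u ?_⟩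
  simp only [List.mem_append, List.mem_singleton] at hu ⊢
  refine hu.imp_left (Or.imp (fun h => ?_) List.mem_of_mem_take)
  rw [h, List.getD_eq_getElem _ _ h1]
  exact List.getElem_mem h1

theorem Lists.IsInput.prefix₃ (hx : x.IsInput n d) (hy : IsZeroSum x y) :
    (x.prefix₃ y).IsSubInput n d := by
  obtain ⟨ha, hb, hc, h⟩ := hx
  obtain ⟨h1, h2, -⟩ := isZeroSum_iff.1 hy
  simp only [Lists.prefix₃, toList_getElem? h1, toList_getElem? h2]
  refine ⟨by simp; omega, by simp; omega, by simp; omega, fun u hu => h u ?_⟩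
  simp only [List.mem_append, List.mem_singleton] at hu ⊢
  refine Or.imp (Or.imp (fun h => ?_) fun h => ?_) List.mem_of_mem_take hu
  · rw [h, List.getD_eq_getElem _ _ h1]; exact List.getElem_mem h1
  · rw [h, List.getD_eq_getElem _ _ h2]; exact List.getElem_mem h2

end SubInput

end ThreeSum

/-! ### The verifier -/

namespace WordRAM

open ThreeSum

variable {w : ℕ} {ω : ℕ → Bool} {s : State w}

theorem ofInt_eq_zero_iff {z : ℤ} (h : |z| < 2 ^ w) : BitVec.ofInt w z = 0 ↔ z = 0 := by
  constructor
  · intro h0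
    have h1 := congrArg BitVec.toNat h0
    rw [BitVec.toNat_ofInt, show BitVec.toNat (0 : BitVec w) = 0 by simp] at h1
    have h2 : (2 : ℤ) ^ w ∣ z := by
      refine Int.dvd_of_emod_eq_zero ?_
      have h3 := Int.emod_nonneg z (b := (2 ^ w : ℕ)) (by positivity)
      push_cast at h1 h3
      omega
    by_contra hz
    have := Int.le_of_dvd (abs_pos.2 hz) ((dvd_abs _ _).2 h2)
    omega
  · rintro rfl; simp

/-- The lists are taken from arrays `a, b, 2`, the certificate is in array `c`. -/
def place (a b c : ℕ) : ℕ → ℕ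
  | 0 => a
  | 1 => b
  | 2 => 2
  | 3 => c
  | A + 4 => A + 14

/-- Scratch arrays are sent to 14 and beyond, so they cannot collide with the arrays below 14 that
hold the lists and certificates. -/
theorem place_injective {a b c : ℕ} (h : ∀ u ∈ [a, b, 2, c], u < 14) (h' : [a, b, 2, c].Nodup) :
    Function.Injective (place a b c) := by
  simp only [List.forall_mem_cons, List.not_mem_nil, false_implies, implies_true, and_true] at h
  simp only [List.nodup_cons, List.mem_cons, List.not_mem_nil, or_false, not_or] at h'
  intro A B hAB
  unfold place at hAB
  split at hAB <;> split at hAB <;> first | rfl | omega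

/-- Run a renamed copy `p` of a program on lists of the lengths `la, lb, lc`; register `40` holds
the size of the input. -/
def callProg (p : Prog) (g : ℕ → ℕ) (la lb lc L : Expr) : Prog :=
  .seq (.seq (.assign 0 (.reg 40)) (.seq (.assign 1 la) (.seq (.assign 2 lb) (.seq (.assign 3 lc)
    (.assign 4 L))))) (p.map g)

/-- The arguments are evaluated one by one while registers 0 to 4 are being overwritten. Their
values are therefore prescribed in every state that differs from the present one in these registers
only. -/
theorem run_callProg {p : Prog} {g : ℕ → ℕ} (hg : Function.Injective g) {la lb lc L : Expr}
    {n ma mb mc ℓ T : ℕ} {Q : State w → Prop} (h40 : s.rval 40 = n)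
    (ha : ∀ s', Frame [0, 1, 2, 3, 4] [] s s' → la.val s' = ma)
    (hb : ∀ s', Frame [0, 1, 2, 3, 4] [] s s' → lb.val s' = mb)
    (hc : ∀ s', Frame [0, 1, 2, 3, 4] [] s s' → lc.val s' = mc)
    (hL : ∀ s', Frame [0, 1, 2, 3, 4] [] s s' → L.val s' = ℓ)
    (h : ∀ s', Frame [0, 1, 2, 3, 4] [] s s' → s'.rval 0 = n → s'.rval 1 = ma → s'.rval 2 = mb →
      s'.rval 3 = mc → s'.rval 4 = ℓ → Run ω p (s'.pull g) T fun s'' => Q s'') :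
    Run ω (callProg p g la lb lc L) s (la.cost + lb.cost + lc.cost + L.cost + 6 + T)
      (fun s' => Q (s'.pull g)) := by
  have F : ∀ (s' : State w) x v, Frame [0, 1, 2, 3, 4] [] s s' → x < 5 →
      Frame [0, 1, 2, 3, 4] [] s (s'.setReg x v) := fun s' x v hF hx =>
    hF.trans ⟨fun y hy => by
      simp only [List.mem_cons, not_or] at hy
      rw [State.setReg_reg, if_neg (by omega)], fun _ _ => rfl⟩
  have S1 : Run ω (.seq (.assign 0 (.reg 40)) (.seq (.assign 1 la) (.seq (.assign 2 lb)
      (.seq (.assign 3 lc) (.assign 4 L))))) s (la.cost + lb.cost + lc.cost + L.cost + 6)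
      (fun s' => Frame [0, 1, 2, 3, 4] [] s s' ∧ s'.rval 0 = n ∧ s'.rval 1 = ma ∧ s'.rval 2 = mb ∧
      s'.rval 3 = mc ∧ s'.rval 4 = ℓ) := by
    refine (Run.simple rfl (Prog.Post.seq_assign (Expr.Val.reg h40) fun v0 h0 =>
      Prog.Post.seq_assign (ha _ ?_) fun v1 h1 => Prog.Post.seq_assign (hb _ ?_) fun v2 h2 =>
      Prog.Post.seq_assign (hc _ ?_) fun v3 h3 => Prog.Post.assign (hL _ ?_) fun v4 h4 =>
      ⟨?_, by simp [h0], by simp [h1], by simp [h2], by simp [h3], by simp [h4]⟩)).time_mono ?_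
    any_goals repeat first | exact Frame.refl _ _ _ | refine F _ _ _ ?_ (by norm_num)
    · simp only [Prog.size, Expr.cost]; omega
  refine Run.seq S1 fun s₁ ⟨h1, h2, h3, h4, h5, h6⟩ _ => ?_
  exact (h s₁ h1 h2 h3 h4 h5 h6).map hg

theorem regs_countProg : countProg.regs ⊆ List.range 30 := by decide

theorem arrays_countProg : countProg.arrays ⊆ [5, 6, 7, 8] := by decide

/-- The parameter `d` occurs in constants only, so this is a finite check. Together with its
companions it protects registers 40 and above, where the callers keep their data. -/
theorem regs_setupProg (d : ℕ) : (setupProg d).regs ⊆ List.range 30 := by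
  rw [show (setupProg d).regs = (setupProg 0).regs from rfl]; decide

theorem arrays_setupProg (d : ℕ) : (setupProg d).arrays ⊆ [4, 9, 10, 11] := by
  rw [show (setupProg d).arrays = (setupProg 0).arrays from rfl]; decide

theorem regs_certProg (d : ℕ) : (certProg d).regs ⊆ List.range 30 := by
  simp only [certProg, certCheck, Prog.regs, List.append_subset]
  refine ⟨regs_setupProg d, by decide, by decide,
    ⟨⟨regs_countProg, ?_⟩, by decide⟩, by decide⟩
  exact ⟨(by simp [Prog.require, Prog.regs]), (by decide), (by decide)⟩

theorem arrays_certProg (d : ℕ) : (certProg d).arrays ⊆ [4, 5, 6, 7, 8, 9, 10, 11] := by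
  simp only [certProg, certCheck, Prog.arrays, List.append_subset]
  refine ⟨List.Subset.trans (arrays_setupProg d) (by decide),
    by decide, by decide, ⟨⟨List.Subset.trans arrays_countProg (by decide), ?_⟩, by decide⟩, by decide⟩
  exact ⟨(by simp [Prog.require, Prog.arrays]), (by decide), (by decide)⟩

theorem regs_genProg (d : ℕ) : (genProg d).regs ⊆ List.range 30 := by
  have h : greedyProg.regs ⊆ List.range 30 := by
    simp only [greedyProg, Prog.for, Prog.regs, List.append_subset]
    simp [regs_countProg]
  simp only [genProg, genBody, modulusProg, Prog.regs, List.append_subset]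
  exact ⟨regs_setupProg d,
    ⟨by decide, h, h, h⟩, by decide, by decide, by decide, by decide, by decide⟩

theorem arrays_genProg (d : ℕ) :
    (genProg d).arrays ⊆ [3, 4, 5, 6, 7, 8, 9, 10, 11, 12, 13] := by
  have h : greedyProg.arrays ⊆ [3, 4, 5, 6, 7, 8, 9, 10, 11, 12, 13] := by
    simp only [greedyProg, Prog.for, Prog.arrays, List.append_subset]
    simpa using List.Subset.trans arrays_countProg (by decide)
  simp only [genProg, genBody, modulusProg, Prog.arrays, List.append_subset]
  exact ⟨List.Subset.trans (arrays_setupProg d) (by decide),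
    ⟨by decide, h, h, h⟩, by decide, by decide, by decide, by decide, by decide⟩

end WordRAM

/-! ### The verifier program and its acceptance condition. -/

namespace WordRAM

open ThreeSum

variable {w : ℕ} {ω : ℕ → Bool} {s : State w}

/-- Set register `47` to zero unless the certificate in array `c` is accepted for the lists in
arrays `a, b, 2`. -/
def checkProg (d a b c : ℕ) (la lb lc L : Expr) : Prog :=
  .seq (callProg (certProg d) (place a b c) la lb lc L) (.require 47 [.reg 0])

/-- Expressions that do not depend on what is changed in a copy of a program. -/
def Expr.Fixed (s : State w) (e : Expr) (n : ℕ) : Prop :=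
  ∀ s' : State w, (∀ x, 40 ≤ x → s'.reg x = s.reg x) → e.val s' = n

theorem Expr.fixed_reg {x n : ℕ} (hx : 40 ≤ x) (h : s.rval x = n) : (Expr.reg x).Fixed s n :=
  fun s' hs' => by rw [Expr.val_reg, State.rval, hs' x hx]; exact h

theorem Expr.fixed_one (hw : 1 < 2 ^ w) : (1 : Expr).Fixed s 1 := fun _ _ => Expr.val_one _ hw

theorem frame_regs_ge {R M : List ℕ} {s' : State w} (h : Frame R M s s') (hR : R ⊆ List.range 30) :
    ∀ x, 40 ≤ x → s'.reg x = s.reg x := fun x hx => h.reg x fun h' => by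
  have := List.mem_range.1 (hR h'); omega

theorem run_checkProg {d n a b c ℓ : ℕ} {x : Lists} {la lb lc L : Expr}
    (hwd : (d + 40) * digits n ≤ w) (hg : ∀ u ∈ [a, b, 2, c], u < 14) (hg' : [a, b, 2, c].Nodup)
    (hx : x.IsSubInput n d) (h40 : s.rval 40 = n)
    (hla : la.Fixed s x.a.length) (hlb : lb.Fixed s x.b.length) (hlc : lc.Fixed s x.c.length)
    (hL : L.Fixed s ℓ) (ha : HoldsList s a x.a) (hb : HoldsList s b x.b) (hc : HoldsList s 2 x.c) :
    Run ω (checkProg d a b c la lb lc L) s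
      (la.cost + lb.cost + lc.cost + L.cost + certTime d n + 12) (fun s' =>
        (s'.rval 47 ≠ 0 ↔ s.rval 47 ≠ 0 ∧ x.Certified d n (s.arr c) ℓ) ∧
        Frame (47 :: List.range 30) [14, 15, 16, 17, 18, 19, 20, 21] s s') := by
  have fx : ∀ {e : Expr} {m}, e.Fixed s m → ∀ s', Frame [0, 1, 2, 3, 4] [] s s' → e.val s' = m :=
    fun h s' hF => h s' (frame_regs_ge hF (by decide))
  have S1 := run_callProg (ω := ω) (place_injective hg hg') h40 (fx hla) (fx hlb) (fx hlc) (fx hL)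
    (p := certProg d) (T := certTime d n)
    (Q := fun s'' => s''.rval 0 ≠ 0 ↔ x.Certified d n (s.arr c) ℓ)
    (fun s' hF h0 h1 h2 h3 h4 => by
      have := run_certProg (ω := ω) (s := s'.pull (place a b c)) hwd hx h0 h1 h2 h3
        (ha.congr (hF.mem a (by simp))) (hb.congr (hF.mem b (by simp)))
        (hc.congr (hF.mem 2 (by simp)))
      rw [State.pull_rval, h4, State.pull_arr] at this
      rw [show s.arr c = s'.arr c from funext fun i => (hF.arr c (by simp) i).symm]
      exact this)
  refine Run.time_mono (Run.seq S1 (T₂ := 6) ?_) (by omega)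
  intro s₁ h₁ hF₁
  have F₁ : Frame (List.range 30) [14, 15, 16, 17, 18, 19, 20, 21] s s₁ := by
    refine hF₁.mono ?_ ?_
    · simp only [callProg, Prog.regs, Prog.regs_map, List.append_subset]
      exact ⟨⟨by decide, by decide, by decide, by decide, by decide⟩, regs_certProg d⟩
    · simp only [callProg, Prog.arrays, Prog.arrays_map, List.nil_append]
      exact (List.map_subset _ (arrays_certProg d))
  refine (run_require (P := s₁.rval 0 ≠ 0) (by simp)).mono (by decide) ?_
  have h47 := F₁.rval 47 (by decide)
  rw [State.pull_rval] at h₁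
  rintro s₂ (⟨h2, rfl⟩ | ⟨h2, rfl⟩)
  · exact ⟨by rw [h47, ← h₁]; tauto, F₁.mono (List.subset_cons_self _ _) (List.Subset.refl _)⟩
  · refine ⟨?_, (F₁.mono (List.subset_cons_self _ _) (List.Subset.refl _)).trans
      ⟨fun y hy => ?_, fun _ _ => rfl⟩⟩
    · rw [← h₁]; simp at h2 ⊢; simp [h2]
    · simp only [List.mem_cons, not_or] at hy
      rw [State.setReg_reg, if_neg hy.1]

/-- The verifier: save the registers, check the triple, check the certificates. -/
def verifier (d : ℕ) : Prog :=
  .seq (.seq (.assign 40 (.reg 0)) (.seq (.assign 41 (.reg 1)) (.seq (.assign 42 (.reg 2))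
    (.seq (.assign 43 (.reg 3)) (.seq (.assign 44 (.reg 4)) (.seq (.assign 45 (.reg 5))
    (.seq (.assign 46 (.reg 6)) (.seq (.assign 47 1)
    (.seq (.store 6 0 (.get 0 (.reg 1))) (.store 7 0 (.get 1 (.reg 2))))))))))))
  (.seq (.require 47 [(Expr.reg 41).lt (.reg 40), (Expr.reg 42).lt (.reg 40),
    (Expr.reg 43).lt (.reg 40),
    Expr.eq (.get 0 (.reg 41) + .get 1 (.reg 42) + .get 2 (.reg 43)) 0])
  (.seq (.ite (.reg 47)
    (.seq (checkProg d 0 1 3 (.reg 41) (.reg 40) (.reg 40) (.reg 44))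
    (.seq (checkProg d 6 1 4 1 (.reg 42) (.reg 40) (.reg 45))
    (checkProg d 6 7 5 1 1 (.reg 43) (.reg 46)))) .skip)
  (.seq (.assign 0 (.reg 47)) (.seq (.assign 1 (.reg 41)) (.seq (.assign 2 (.reg 42))
    (.assign 3 (.reg 43)))))))

theorem coinFree_verifier (d : ℕ) : (verifier d).CoinFree := by
  simp [verifier, checkProg, callProg, Prog.CoinFree, Prog.coinFree_require,
    (coinFree_certProg d).map]

/-- The sum of three entries is below 3·2^(d · digits n) ≤ 2^w in absolute value, so its word is
zero only if the integer is. -/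
theorem ofInt_add_add_eq_zero_iff {d n : ℕ} {x : Lists} (hwd : (d + 40) * digits n ≤ w)
    (hx : x.Bounded n d) (i j k : ℕ) :
    BitVec.ofInt w (x.a.getD i 0) + BitVec.ofInt w (x.b.getD j 0) + BitVec.ofInt w (x.c.getD k 0) =
      0 ↔ x.a.getD i 0 + x.b.getD j 0 + x.c.getD k 0 = 0 := by
  rw [← BitVec.ofInt_add, ← BitVec.ofInt_add, ofInt_eq_zero_iff]
  have h1 := (hx.getD i).1
  have h2 := (hx.getD j).2.1
  have h3 := (hx.getD k).2.2
  have h4 : (3 : ℤ) * 2 ^ (d * digits n) ≤ 2 ^ w := by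
    have hD := digits_pos n
    have h5 : 2 ^ (d * digits n + 2) ≤ 2 ^ w := Nat.pow_le_pow_right (by norm_num) (by nlinarith)
    have h6 : (2 : ℤ) ^ (d * digits n + 2) ≤ 2 ^ w := by exact_mod_cast h5
    rw [pow_add] at h6
    have : (0 : ℤ) < 2 ^ (d * digits n) := by positivity
    omega
  rw [abs_lt] at *
  constructor <;> omega

/-- The condition for the verifier to accept a triple and three certificates. -/
def _root_.ThreeSum.Lists.Accepts (d n : ℕ) (x : Lists) (m : Message w) : Prop :=
  IsZeroSum x m.triple ∧
    (x.prefix₁ m.triple).Certified d n (fun q => (m.π₁.getD q 0).toNat) m.π₁.length ∧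
    (x.prefix₂ m.triple).Certified d n (fun q => (m.π₂.getD q 0).toNat) m.π₂.length ∧
    (x.prefix₃ m.triple).Certified d n (fun q => (m.π₃.getD q 0).toNat) m.π₃.length

theorem certified_congr {d n L : ℕ} {x : Lists} {f g : ℕ → ℕ} (h : ∀ q < L, f q = g q) :
    x.Certified d n f L ↔ x.Certified d n g L :=
  ⟨fun h' => Inst.Certifies.congr h' h, fun h' => Inst.Certifies.congr h' fun q hq => (h q hq).symm⟩

theorem holdsList_singleton {A : ℕ} {u : ℤ} (h : s.mem A (BitVec.ofNat w 0) = BitVec.ofInt w u) :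
    HoldsList s A [u] := by
  intro i hi
  obtain rfl : i = 0 := by simpa using hi
  simpa using h

theorem HoldsList.take {A m : ℕ} {l : List ℤ} (h : HoldsList s A l) : HoldsList s A (l.take m) := by
  intro i hi
  rw [List.length_take] at hi
  rw [getD_take (by omega)]
  exact h i (by omega)

/-- Both outcomes are read off the same run, because a rejection too has to be a halting run with
output ⊥ within the time bound. -/
theorem run_verifier {d n : ℕ} {x : Lists} {m : Message w} (hwd : (d + 40) * digits n ≤ w)
    (hx : x.IsInput n d) (hm : m.Fits) :
    Run ω (verifier d) (verifierStart w n x m) (3 * certTime d n + 200) (fun s' =>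
      (x.Accepts d n m → outputOf s' = some m.triple) ∧
      (¬ x.Accepts d n m → outputOf s' = none)) := by
  have hn := lt_two_pow_word hwd
  have hD := digits_pos n
  have hw : 1 < 2 ^ w := Nat.one_lt_two_pow (by nlinarith)
  obtain ⟨s, hs⟩ : ∃ s, s = verifierStart w n x m := ⟨_, rfl⟩
  have ofN : ∀ k, k < 2 ^ w → (BitVec.ofNat w k).toNat = k := fun k hk => by
    rw [BitVec.toNat_ofNat, Nat.mod_eq_of_lt hk]
  have h0 : s.rval 0 = n := by rw [hs]; exact ofN n hn
  have h1 : s.reg 1 = m.i := by rw [hs]; rfl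
  have h2 : s.reg 2 = m.j := by rw [hs]; rfl
  have h3 : s.reg 3 = m.k := by rw [hs]; rfl
  have h4 : s.rval 4 = m.π₁.length := by rw [hs]; exact ofN _ hm.1
  have h5 : s.rval 5 = m.π₂.length := by rw [hs]; exact ofN _ hm.2.1
  have h6 : s.rval 6 = m.π₃.length := by rw [hs]; exact ofN _ hm.2.2
  have hx' := hx
  obtain ⟨hla, hlb, hlc, hxb⟩ := hx'
  have ha : HoldsList s 0 x.a := holdsList_of_mem (by omega) fun _ => by rw [hs]; rfl
  have hb : HoldsList s 1 x.b := holdsList_of_mem (by omega) fun _ => by rw [hs]; rfl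
  have hc : HoldsList s 2 x.c := holdsList_of_mem (by omega) fun _ => by rw [hs]; rfl
  have c1 : ∀ q < m.π₁.length, s.arr 3 q = (m.π₁.getD q 0).toNat := fun q hq => by
    rw [hs]
    change (m.π₁.getD (BitVec.ofNat w q).toNat 0).toNat = _
    rw [ofN q (hq.trans hm.1)]
  have c2 : ∀ q < m.π₂.length, s.arr 4 q = (m.π₂.getD q 0).toNat := fun q hq => by
    rw [hs]
    change (m.π₂.getD (BitVec.ofNat w q).toNat 0).toNat = _
    rw [ofN q (hq.trans hm.2.1)]
  have c3 : ∀ q < m.π₃.length, s.arr 5 q = (m.π₃.getD q 0).toNat := fun q hq => by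
    rw [hs]
    change (m.π₃.getD (BitVec.ofNat w q).toNat 0).toNat = _
    rw [ofN q (hq.trans hm.2.2)]
  rw [← hs]
  have S1 : Run ω (.seq (.assign 40 (.reg 0)) (.seq (.assign 41 (.reg 1)) (.seq (.assign 42 (.reg 2))
      (.seq (.assign 43 (.reg 3)) (.seq (.assign 44 (.reg 4)) (.seq (.assign 45 (.reg 5))
      (.seq (.assign 46 (.reg 6)) (.seq (.assign 47 1)
      (.seq (.store 6 0 (.get 0 (.reg 1))) (.store 7 0 (.get 1 (.reg 2)))))))))))) s 30
      (fun s₁ => s₁.rval 40 = n ∧ s₁.reg 41 = m.i ∧ s₁.reg 42 = m.j ∧ s₁.reg 43 = m.k ∧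
        s₁.rval 44 = m.π₁.length ∧ s₁.rval 45 = m.π₂.length ∧ s₁.rval 46 = m.π₃.length ∧
        s₁.rval 47 = 1 ∧ s₁.mem 6 (BitVec.ofNat w 0) = s.mem 0 m.i ∧
        s₁.mem 7 (BitVec.ofNat w 0) = s.mem 1 m.j) := by
    refine (Run.simple rfl ?_).time_mono (by decide)
    simp [Prog.Post, Prog.den, h1, h2, h3, State.setMem_mem, ofN 1 hw]
    exact ⟨h0, h4, h5, h6⟩
  refine Run.time_mono (Run.seq S1 (T₂ := 3 * certTime d n + 170) ?_) (by omega)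
  rintro s₁ ⟨a40, a41, a42, a43, a44, a45, a46, a47, m6, m7⟩ hF₁
  have F₁ : Frame [40, 41, 42, 43, 44, 45, 46, 47] [6, 7] s s₁ := hF₁
  have ha₁ := ha.congr (F₁.mem 0 (by decide))
  have hb₁ := hb.congr (F₁.mem 1 (by decide))
  have hc₁ := hc.congr (F₁.mem 2 (by decide))
  have ei : BitVec.ofNat w m.i.toNat = m.i := by simp
  have ej : BitVec.ofNat w m.j.toNat = m.j := by simp
  have ek : BitVec.ofNat w m.k.toNat = m.k := by simp
  have r41 : s₁.rval 41 = m.triple.1 := by rw [State.rval, a41]; rfl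
  have r42 : s₁.rval 42 = m.triple.2.1 := by rw [State.rval, a42]; rfl
  have r43 : s₁.rval 43 = m.triple.2.2 := by rw [State.rval, a43]; rfl
  refine Run.time_mono (Run.seq (run_require (P := IsZeroSum x m.triple) ?_)
    (T₂ := 3 * certTime d n + 130) ?_) (by
      have : (Prog.require 47 [(Expr.reg 41).lt (.reg 40), (Expr.reg 42).lt (.reg 40),
        (Expr.reg 43).lt (.reg 40),
        Expr.eq (.get 0 (.reg 41) + .get 1 (.reg 42) + .get 2 (.reg 43)) 0]).size ≤ 40 := by decide
      omega)
  · simp only [List.forall_mem_cons, List.not_mem_nil, false_implies, implies_true, and_true]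
    rw [isZeroSum_iff, hla, hlb, hlc, Expr.lt_ne_zero (Expr.Val.reg r41) (Expr.Val.reg a40) hw,
      Expr.lt_ne_zero (Expr.Val.reg r42) (Expr.Val.reg a40) hw,
      Expr.lt_ne_zero (Expr.Val.reg r43) (Expr.Val.reg a40) hw]
    refine and_congr_right fun hi => and_congr_right fun hj => and_congr_right fun hk => ?_
    rw [Expr.eq_ne_zero rfl (Expr.val_zero _) hw, ← Expr.eval_eq_zero_iff, Expr.eval_add,
      Expr.eval_add, Expr.Val.eval_get (Expr.Val.reg r41), Expr.Val.eval_get (Expr.Val.reg r42),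
      Expr.Val.eval_get (Expr.Val.reg r43), ha₁ _ (by omega), hb₁ _ (by omega), hc₁ _ (by omega)]
    exact ofInt_add_add_eq_zero_iff hwd hxb _ _ _
  intro s₂ hs₂ hF₂
  have F₂ : Frame [47] [] s₁ s₂ := hF₂.mono (by decide) (by decide)
  have key₂ : s₂.rval 47 ≠ 0 ↔ IsZeroSum x m.triple := by
    rcases hs₂ with ⟨h1, rfl⟩ | ⟨h1, rfl⟩
    · simp [a47, h1]
    · simp only [State.setReg_rval, if_true, h1, iff_false]; simp
  suffices hmain : Run ω (.ite (.reg 47)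
      (.seq (checkProg d 0 1 3 (.reg 41) (.reg 40) (.reg 40) (.reg 44))
      (.seq (checkProg d 6 1 4 1 (.reg 42) (.reg 40) (.reg 45))
      (checkProg d 6 7 5 1 1 (.reg 43) (.reg 46)))) .skip) s₂ (3 * certTime d n + 100)
      (fun s' => (s'.rval 47 ≠ 0 ↔ x.Accepts d n m) ∧ ∀ x', 40 ≤ x' → x' ≠ 47 →
        s'.reg x' = s₂.reg x') by
    refine Run.time_mono (Run.seq hmain (T₂ := 8) ?_) (by omega)
    rintro s₃ ⟨h7, h8⟩ -
    refine (Run.simple rfl ?_).time_mono (show _ ≤ 8 from le_rfl)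
    have e1 : s₃.reg 41 = m.i := by
      rw [h8 41 (by norm_num) (by norm_num), F₂.reg 41 (by decide), a41]
    have e2 : s₃.reg 42 = m.j := by
      rw [h8 42 (by norm_num) (by norm_num), F₂.reg 42 (by decide), a42]
    have e3 : s₃.reg 43 = m.k := by
      rw [h8 43 (by norm_num) (by norm_num), F₂.reg 43 (by decide), a43]
    have h9 : s₃.reg 47 = 0 ↔ s₃.rval 47 = 0 := Expr.eval_eq_zero_iff s₃ (.reg 47)
    rw [← h7]
    simp only [Prog.Post, Prog.den, outputOf, State.setReg_reg, Expr.eval_reg, e1, e2, e3,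
      Message.triple]
    norm_num [h9]
    tauto
  have cr : ∀ x', (Expr.reg x').cost = 1 := fun _ => rfl
  have co : (1 : Expr).cost = 1 := rfl
  refine Run.time_mono (Run.ite (T := 3 * certTime d n + 90) (fun he => ?_) (fun he => ?_)) (by
    rw [cr]; omega)
  swap
  · have he' := key₂.not.1 (not_not.2 he)
    refine (Run.skip ⟨iff_of_false (not_not.2 he) fun h => he' h.1, fun _ _ _ => rfl⟩).time_mono
      (by omega)
  have hzs := key₂.1 he
  obtain ⟨hi, hj, hk, -⟩ := isZeroSum_iff.1 hzs
  have G₂ : Frame [40, 41, 42, 43, 44, 45, 46, 47] [6, 7] s s₂ := F₁.trans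
    (F₂.mono (by decide) (by decide))
  have fixedReg : ∀ {s' : State w} {M x' k}, Frame (47 :: List.range 30) M s₂ s' → 40 ≤ x' → x' ≠ 47 →
      s₁.rval x' = k → (Expr.reg x').Fixed s' k := fun {s' M x' k} hF h7 h8 h9 =>
    Expr.fixed_reg h7 (by
      rw [hF.rval x' (by simp [h8]; omega), F₂.rval x' (by simp [h8]), h9])
  -- Arrays 6 and 7 were written before the triple was checked, possibly from an invalid position,
  -- which does no harm. Only now, with valid i and j, do they represent the lists (a_i) and (b_j).
  have M6 : HoldsList s₂ 6 [x.a.getD m.triple.1 0] := holdsList_singleton (by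
    rw [F₂.mem 6 (by decide), m6, ← ei]; exact ha _ hi)
  have M7 : HoldsList s₂ 7 [x.b.getD m.triple.2.1 0] := holdsList_singleton (by
    rw [F₂.mem 7 (by decide), m7, ← ej]; exact hb _ hj)
  have Z₂ := Frame.refl (47 :: List.range 30) [14, 15, 16, 17, 18, 19, 20, 21] s₂
  -- A prefix is not copied: the same array is passed on with a smaller length.
  have K1 := run_checkProg (ω := ω) (s := s₂) (a := 0) (b := 1) (c := 3) (x := x.prefix₁ m.triple)
    (n := n) hwd (by decide) (by decide) (hx.prefix₁ _) (by rw [F₂.rval 40 (by decide), a40])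
    (fixedReg (x' := 41) Z₂ (by norm_num) (by norm_num) (r41.trans (by simp [Lists.prefix₁]; omega)))
    (fixedReg (x' := 40) Z₂ (by norm_num) (by norm_num) (a40.trans hlb.symm))
    (fixedReg (x' := 40) Z₂ (by norm_num) (by norm_num) (a40.trans hlc.symm))
    (fixedReg (x' := 44) Z₂ (by norm_num) (by norm_num) a44)
    (ha.congr (G₂.mem 0 (by decide))).take (hb.congr (G₂.mem 1 (by decide)))
    (hc.congr (G₂.mem 2 (by decide)))
  refine Run.time_mono (Run.seq K1 (T₂ := 2 * certTime d n + 60) ?_) (by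
    simp only [cr]; omega)
  rintro s₃ ⟨k3, F₃⟩ -
  have K2 := run_checkProg (ω := ω) (s := s₃) (a := 6) (b := 1) (c := 4) (x := x.prefix₂ m.triple)
    (n := n) (la := 1) hwd (by decide) (by decide) (hx.prefix₂ hzs)
    (by rw [F₃.rval 40 (by decide), F₂.rval 40 (by decide), a40])
    (by rw [Lists.prefix₂, toList_getElem? hi]; exact Expr.fixed_one hw)
    (fixedReg (x' := 42) F₃ (by norm_num) (by norm_num) (r42.trans (by simp [Lists.prefix₂]; omega)))
    (fixedReg (x' := 40) F₃ (by norm_num) (by norm_num) (a40.trans hlc.symm))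
    (fixedReg (x' := 45) F₃ (by norm_num) (by norm_num) a45)
    (by rw [Lists.prefix₂, toList_getElem? hi]; exact M6.congr (F₃.mem 6 (by decide)))
    ((hb.congr (G₂.mem 1 (by decide))).congr (F₃.mem 1 (by decide))).take
    ((hc.congr (G₂.mem 2 (by decide))).congr (F₃.mem 2 (by decide)))
  refine Run.time_mono (Run.seq K2 (T₂ := certTime d n + 30) ?_) (by
    simp only [cr, co]; omega)
  rintro s₄ ⟨k4, F₄⟩ -
  have F₄' := F₃.trans F₄
  have K3 := run_checkProg (ω := ω) (s := s₄) (a := 6) (b := 7) (c := 5) (x := x.prefix₃ m.triple)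
    (n := n) (la := 1) (lb := 1) hwd (by decide) (by decide) (hx.prefix₃ hzs)
    (by rw [F₄'.rval 40 (by decide), F₂.rval 40 (by decide), a40])
    (by rw [Lists.prefix₃, toList_getElem? hi]; exact Expr.fixed_one hw)
    (by rw [Lists.prefix₃, toList_getElem? hj]; exact Expr.fixed_one hw)
    (fixedReg (x' := 43) F₄' (by norm_num) (by norm_num) (r43.trans (by simp [Lists.prefix₃]; omega)))
    (fixedReg (x' := 46) F₄' (by norm_num) (by norm_num) a46)
    (by rw [Lists.prefix₃, toList_getElem? hi]; exact M6.congr (F₄'.mem 6 (by decide)))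
    (by rw [Lists.prefix₃, toList_getElem? hj]; exact M7.congr (F₄'.mem 7 (by decide)))
    ((hc.congr (G₂.mem 2 (by decide))).congr (F₄'.mem 2 (by decide))).take
  refine K3.mono (by simp only [cr, co]; omega) ?_
  rintro s₅ ⟨k5, F₅⟩
  have F₅' := F₄'.trans F₅
  refine ⟨?_, fun x' h7 h8 => F₅'.reg x' (by simp [h8]; omega)⟩
  rw [k5, k4, k3, key₂, Lists.Accepts,
    certified_congr (f := s₂.arr 3) fun q hq => (G₂.arr 3 (by decide) q).trans (c1 q hq),
    certified_congr (f := s₃.arr 4) fun q hq => (F₃.arr 4 (by decide) q).trans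
      ((G₂.arr 4 (by decide) q).trans (c2 q hq)),
    certified_congr (f := s₄.arr 5) fun q hq => (F₄'.arr 5 (by decide) q).trans
      ((G₂.arr 5 (by decide) q).trans (c3 q hq))]
  tauto

end WordRAM

/-! ### The prover -/

namespace WordRAM

open ThreeSum

variable {w : ℕ} {ω : ℕ → Bool} {s : State w}

/-- Array `8` gets, at each word, the first position of the word in the third list, plus one. -/
def tableProg : Prog :=
  .for 13 (.reg 40) (.store 8 (.get 2 (.reg 40 - 1 - .reg 13)) (.reg 40 - .reg 13))

/-- Array `8` points to the first position, from `n - m` on, of each word in the list. -/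
def IsTable (l : List ℤ) (m : ℕ) (s : State w) : Prop :=
  ∀ v, (s.mem 8 v = 0 ∧ ∀ k, l.length - m ≤ k → k < l.length → BitVec.ofInt w (l.getD k 0) ≠ v) ∨
    ∃ k, l.length - m ≤ k ∧ k < l.length ∧ BitVec.ofInt w (l.getD k 0) = v ∧
      s.mem 8 v = BitVec.ofNat w (k + 1) ∧
      ∀ k', l.length - m ≤ k' → k' < k → BitVec.ofInt w (l.getD k' 0) ≠ v

/-- Positions are entered from last to first, so the earliest position of each word survives.
Addresses range over all words, and no time is spent on clearing the table, because it starts as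
zero; the stored positions are increased by one to be distinguishable from this zero. -/
theorem run_tableProg {l : List ℤ} (hw : 1 < 2 ^ w) (h40 : s.rval 40 = l.length)
    (hl : HoldsList s 2 l) (h8 : ∀ v, s.mem 8 v = 0) :
    Run ω tableProg s (l.length * 18 + 6) (IsTable l l.length) := by
  have hlw : l.length < 2 ^ w := h40 ▸ s.rval_lt _
  refine (Run.for (ω := ω) (s := s) (x := 13) (b := .reg 40) l.length hlw hw (IsTable l) 10
    (by decide) ?_ ?_ ?_).mono (by change l.length * (10 + 1 + 7) + 1 + 5 ≤ _; omega) fun s' h => h.1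
  · exact fun v => Or.inl ⟨h8 v, fun k h1 h2 => by omega⟩
  · intro s' hF
    rw [Expr.val_reg, hF.rval 40 (by decide), h40]
  intro m hm s₁ hF h13 hT
  have v40 : (Expr.reg 40).val s₁ = l.length := by rw [Expr.val_reg, hF.rval 40 (by decide), h40]
  obtain ⟨k₀, hk₀⟩ : ∃ k₀, k₀ = l.length - 1 - m := ⟨_, rfl⟩
  have ve : (Expr.reg 40 - 1 - .reg 13).val s₁ = k₀ := by
    rw [hk₀]
    exact Expr.Val.sub (Expr.Val.sub v40 (Expr.val_one _ hw) (by omega)) (Expr.Val.reg h13)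
      (by omega)
  have vv : (Expr.reg 40 - .reg 13).val s₁ = k₀ + 1 := by
    rw [Expr.Val.sub v40 (Expr.Val.reg h13) (by omega)]; omega
  refine (Run.simple rfl ?_).time_mono (show _ ≤ 10 by decide)
  have hden : (Prog.store 8 (.get 2 (.reg 40 - 1 - .reg 13)) (.reg 40 - .reg 13)).den s₁ =
      s₁.setMem 8 (BitVec.ofInt w (l.getD k₀ 0)) (BitVec.ofNat w (k₀ + 1)) := by
    rw [Prog.den, Expr.Val.eval vv, Expr.Val.eval_get ve, hF.mem 2 (by decide), hl _ (by omega)]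
  rw [Prog.Post, hden]
  intro v
  have hlen : l.length - (m + 1) = k₀ := by omega
  rw [State.setReg_mem, State.setMem_mem, hlen]
  by_cases hv : v = BitVec.ofInt w (l.getD k₀ 0)
  · refine Or.inr ⟨k₀, le_rfl, by omega, hv.symm, by simp [hv], fun k' h1 h2 => by omega⟩
  · rw [if_neg (by tauto)]
    rcases hT v with ⟨h1, h2⟩ | ⟨k, h1, h2, h3, h4, h5⟩
    · refine Or.inl ⟨h1, fun k h3 h4 => ?_⟩
      rcases Nat.eq_or_lt_of_le h3 with rfl | h3
      · exact Ne.symm hv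
      · exact h2 k (by omega) h4
    · refine Or.inr ⟨k, by omega, h2, h3, h4, fun k' h6 h7 => ?_⟩
      rcases Nat.eq_or_lt_of_le h6 with rfl | h6
      · exact Ne.symm hv
      · exact h5 k' (by omega) h7

def searchStep : Prog :=
  .ite (.reg 47) .skip (.seq (.assign 15 (.get 8 (0 - (.get 0 (.reg 13) + .get 1 (.reg 14)))))
    (.ite (.reg 15) (.seq (.assign 41 (.reg 13)) (.seq (.assign 42 (.reg 14))
      (.seq (.assign 43 (.reg 15 - 1)) (.assign 47 1)))) .skip))

/-- Registers `41, 42, 43` get the first solution; register `47` tells whether there is one. -/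
def searchProg : Prog :=
  .seq (.assign 47 0) (.for 13 (.reg 40) (.for 14 (.reg 40) searchStep))

/-- Either the first solution has been found, or there is none before `(i, j, 0)`. -/
def Searched (x : Lists) (i j : ℕ) (s : State w) : Prop :=
  (s.rval 47 = 0 ∧ ∀ y, IsZeroSum x y → ¬ (y.1 < i ∨ (y.1 = i ∧ y.2.1 < j))) ∨
    (s.rval 47 ≠ 0 ∧ ∃ y, IsLexFirst x y ∧ s.rval 41 = y.1 ∧ s.rval 42 = y.2.1 ∧ s.rval 43 = y.2.2)

theorem Searched.setReg {x : Lists} {i j y : ℕ} (h : Searched x i j s) (hy : y < 40)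
    (v : BitVec w) : Searched x i j (s.setReg y v) := by
  have e : ∀ z, 40 ≤ z → (s.setReg y v).rval z = s.rval z := fun z hz => by
    rw [State.setReg_rval, if_neg (by omega)]
  rw [Searched, e 47 (by norm_num), e 41 (by norm_num), e 42 (by norm_num), e 43 (by norm_num)]
  exact h

/-- The table gives the least k with c_k = -(a_i + b_j). Pairs (i, j) are visited in lexicographic
order and earlier pairs gave nothing, so the first hit is the lexicographically first solution;
afterwards register 47 makes every step idle. -/
theorem run_searchStep {d n i j : ℕ} {x : Lists} (hwd : (d + 40) * digits n ≤ w) (hw : 1 < 2 ^ w)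
    (hx : x.IsInput n d) (hn : n < 2 ^ w)
    (ha : HoldsList s 0 x.a) (hb : HoldsList s 1 x.b) (hT : IsTable x.c n s)
    (h13 : s.rval 13 = i) (h14 : s.rval 14 = j) (hi : i < n) (hj : j < n)
    (h : Searched x i j s) : Run ω searchStep s 30 (Searched x i (j + 1)) := by
  obtain ⟨hla, hlb, hlc, hxb⟩ := hx
  refine Run.time_mono (Run.ite (T := 26) (fun he => ?_) (fun he => ?_)) (by decide)
  · refine (Run.skip ?_).time_mono (by norm_num)
    rcases h with h | h
    · exact absurd h.1 he
    · exact Or.inr h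
  have hno : ∀ y, IsZeroSum x y → ¬ (y.1 < i ∨ (y.1 = i ∧ y.2.1 < j)) := by
    rcases h with h | h
    · exact h.2
    · exact absurd he h.1
  obtain ⟨v, hv⟩ : ∃ v, v = -(BitVec.ofInt w (x.a.getD i 0) + BitVec.ofInt w (x.b.getD j 0)) :=
    ⟨_, rfl⟩
  have hzero : ∀ k, BitVec.ofInt w (x.c.getD k 0) = v ↔
      x.a.getD i 0 + x.b.getD j 0 + x.c.getD k 0 = 0 := fun k => by
    rw [← ofInt_add_add_eq_zero_iff hwd hxb, hv, eq_comm, neg_eq_iff_add_eq_zero]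
  have ev : (0 - (Expr.get 0 (.reg 13) + .get 1 (.reg 14))).eval s = v := by
    rw [Expr.eval_sub, Expr.eval_add, Expr.Val.eval_get (Expr.Val.reg h13),
      Expr.Val.eval_get (Expr.Val.reg h14), ha i (by omega), hb j (by omega), Expr.eval_zero, hv]
    exact BitVec.zero_sub _
  have S1 : Run ω (.assign 15 (.get 8 (0 - (.get 0 (.reg 13) + .get 1 (.reg 14))))) s 9
      (fun s₁ => s₁.rval 15 = (s.mem 8 v).toNat) :=
    (Run.simple rfl (Prog.Post.assign (n := (s.mem 8 v).toNat) (by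
      rw [Expr.val, Expr.eval_get, ev]) fun v hv => by simp [hv])).time_mono (by decide)
  refine Run.time_mono (Run.seq S1 (T₂ := 14) ?_) (by norm_num)
  intro s₁ h15 hF₁
  have F₁ : Frame [15] [] s s₁ := hF₁
  have hT' := hT v
  rw [hlc] at hT'
  simp only [Nat.sub_self, Nat.zero_le, true_implies, true_and] at hT'
  refine Run.time_mono (Run.ite (T := 10) (fun he₁ => ?_) (fun he₁ => ?_)) (by decide)
  · rw [Expr.val_reg, h15] at he₁
    rcases hT' with ⟨h1, -⟩ | ⟨k, h1, h2, h3, h4⟩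
    · rw [h1] at he₁; simp at he₁
    · have e15 : s₁.rval 15 = k + 1 := by
        rw [h15, h3, BitVec.toNat_ofNat, Nat.mod_eq_of_lt (by omega)]
      refine (Run.simple rfl (Prog.Post.seq_assign (n := i) (Expr.Val.reg (by
        rw [F₁.rval 13 (by decide), h13])) fun v1 hv1 => Prog.Post.seq_assign (n := j)
        (Expr.Val.reg (by simp [F₁.rval 14 (by decide), h14])) fun v2 hv2 => Prog.Post.seq_assign
        (n := k) (Expr.Val.sub (Expr.Val.reg (by simpa using e15)) (Expr.val_one _ hw) (by omega))
        fun v3 hv3 => Prog.Post.assign (Expr.val_one _ hw) fun v4 hv4 =>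
        Or.inr ⟨by simp [hv4], (i, j, k), ⟨?_, fun y hy hne => ?_⟩, by simp [hv1], by simp [hv2],
          by simp [hv3]⟩)).time_mono (by decide)
      · exact isZeroSum_iff.2 ⟨by simp only; omega, by simp only; omega, by simp only; omega,
          (hzero k).1 h2⟩
      · have h5 := hno y hy
        unfold LexBefore
        simp only
        by_contra hcon
        have e1 : y.1 = i := by omega
        have e2 : y.2.1 = j := by omega
        obtain ⟨-, -, h6, h7⟩ := isZeroSum_iff.1 hy
        rw [e1, e2, ← hzero] at h7
        refine h4 y.2.2 ?_ h7
        refine lt_of_le_of_ne (by omega) fun e3 => hne ?_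
        exact Prod.ext e1 (Prod.ext e2 e3)
  · rw [Expr.val_reg, h15] at he₁
    refine (Run.skip (Or.inl ⟨by rw [F₁.rval 47 (by decide)]; exact he, fun y hy hlt => ?_⟩)).time_mono
      (by norm_num)
    have h5 := hno y hy
    rcases hT' with ⟨-, h1⟩ | ⟨k, h1, h2, h3, h4⟩
    · have e1 : y.1 = i := by omega
      have e2 : y.2.1 = j := by omega
      obtain ⟨-, -, h6, h7⟩ := isZeroSum_iff.1 hy
      rw [e1, e2, ← hzero] at h7
      exact h1 y.2.2 (by omega) h7
    · rw [h3, BitVec.toNat_ofNat, Nat.mod_eq_of_lt (by omega)] at he₁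
      omega

theorem run_searchProg {d n : ℕ} {x : Lists} (hwd : (d + 40) * digits n ≤ w) (hw : 1 < 2 ^ w)
    (hx : x.IsInput n d) (hn : n < 2 ^ w) (h40 : s.rval 40 = n)
    (ha : HoldsList s 0 x.a) (hb : HoldsList s 1 x.b) (hT : IsTable x.c n s) :
    Run ω searchProg s (n * (n * 38 + 14) + 8) (Searched x n 0) := by
  have S1 : Run ω (.assign 47 0) s 2 (Searched x 0 0) :=
    (Run.simple rfl (Prog.Post.assign (n := 0) (Expr.val_zero _) fun v hv =>
      Or.inl ⟨by simp [hv], fun y _ h => by omega⟩)).time_mono (by decide)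
  refine Run.time_mono (Run.seq S1 (T₂ := n * (n * 38 + 14) + 6) ?_) (by omega)
  intro s₁ h₁ hF₁
  refine (Run.for (ω := ω) (s := s₁) (x := 13) (b := .reg 40) n hn hw (fun i => Searched x i 0)
    (n * 38 + 6) (by decide) (h₁.setReg (by norm_num) _) ?_ ?_).mono
    (by change n * (n * 38 + 14) + 1 + 5 ≤ _; omega) fun s' h => h.1
  · intro s' hF
    rw [Expr.val_reg, hF.rval 40 (by decide), hF₁.rval 40 (by decide), h40]
  intro i hi s₂ hF₂ h13 h₂
  have F₂ : Frame [13, 14, 15, 41, 42, 43, 47] [] s s₂ := (hF₁.mono (by decide) (by decide)).trans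
    (hF₂.mono (by decide) (by decide))
  refine (Run.for (ω := ω) (s := s₂) (x := 14) (b := .reg 40) n hn hw (fun j => Searched x i j)
    30 (by decide) (h₂.setReg (by norm_num) _) ?_ ?_).mono
    (by change n * (30 + 1 + 7) + 1 + 5 ≤ _; omega) ?_
  · intro s' hF
    rw [Expr.val_reg, hF.rval 40 (by decide), F₂.rval 40 (by decide), h40]
  · intro j hj s₃ hF₃ h14 h₃
    have F₃ : Frame [13, 14, 15, 41, 42, 43, 47] [] s s₃ := F₂.trans
      (hF₃.mono (by decide) (by decide))
    refine (run_searchStep hwd hw hx hn (ha.congr (F₃.mem 0 (by decide)))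
      (hb.congr (F₃.mem 1 (by decide))) (fun v => ?_) (by rw [hF₃.rval 13 (by decide), h13]) h14 hi hj
      h₃).mono le_rfl fun s' h => h.setReg (by norm_num) _
    rw [F₃.mem 8 (by decide)]
    exact hT v
  -- Having no solution before (i, n, 0) is the same as having none before (i + 1, 0, 0), since
  -- second positions are below n.
  · rintro s' ⟨h, -⟩
    refine Searched.setReg ?_ (by norm_num) _
    rcases h with ⟨h1, h2⟩ | h
    · refine Or.inl ⟨h1, fun y hy h3 => h2 y hy ?_⟩
      have := (isZeroSum_iff.1 hy).2.1
      rw [hx.2.1] at this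
      omega
    · exact Or.inr h

theorem run_callGen {d n a b c : ℕ} {x : Lists} {la lb lc : Expr}
    (hwd : (d + 40) * digits n ≤ w) (hg : ∀ u ∈ [a, b, 2, c], u < 14) (hg' : [a, b, 2, c].Nodup)
    (hx : x.IsSubInput n d) (hns : ¬ Solvable x) (h40 : s.rval 40 = n)
    (hla : la.Fixed s x.a.length) (hlb : lb.Fixed s x.b.length) (hlc : lc.Fixed s x.c.length)
    (ha : HoldsList s a x.a) (hb : HoldsList s b x.b) (hc : HoldsList s 2 x.c) :
    Run ω (callProg (genProg d) (place a b c) la lb lc 0) s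
      (la.cost + lb.cost + lc.cost + genTime d n + 7) (fun s' =>
        x.Certified d n (s'.arr c) (s'.rval 4) ∧
        Frame (List.range 30) [c, 14, 15, 16, 17, 18, 19, 20, 21, 22, 23] s s') := by
  have fx : ∀ {e : Expr} {m}, e.Fixed s m → ∀ s', Frame [0, 1, 2, 3, 4] [] s s' → e.val s' = m :=
    fun h s' hF => h s' (frame_regs_ge hF (by decide))
  have S1 := run_callProg (ω := ω) (place_injective hg hg') h40 (fx hla) (fx hlb) (fx hlc)
    (L := 0) (fun s' _ => Expr.val_zero s')
    (p := genProg d) (T := genTime d n)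
    (Q := fun s'' => x.Certified d n (s''.arr 3) (s''.rval 4))
    (fun s' hF h0 h1 h2 h3 _ => run_genProg (ω := ω) (s := s'.pull (place a b c)) hwd hx hns h0 h1 h2
        h3 (ha.congr (hF.mem a (by simp))) (hb.congr (hF.mem b (by simp)))
        (hc.congr (hF.mem 2 (by simp))))
  have hco : (0 : Expr).cost = 1 := rfl
  refine S1.frame.mono (by omega) fun s' ⟨h1, h2⟩ => ⟨h1, h2.mono ?_ ?_⟩
  · simp only [callProg, Prog.regs, Prog.regs_map, List.append_subset]
    exact ⟨⟨by decide, by decide, by decide, by decide, by decide⟩, regs_genProg d⟩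
  · simp only [callProg, Prog.arrays, Prog.arrays_map, List.nil_append]
    exact (List.map_subset _ (arrays_genProg d))

/-- Compute the three certificates for the triple in registers `41, 42, 43`. -/
def messageProg (d : ℕ) : Prog :=
  .seq (.seq (.store 6 0 (.get 0 (.reg 41))) (.store 7 0 (.get 1 (.reg 42))))
  (.seq (callProg (genProg d) (place 0 1 3) (.reg 41) (.reg 40) (.reg 40) 0)
  (.seq (.assign 44 (.reg 4))
  (.seq (callProg (genProg d) (place 6 1 4) 1 (.reg 42) (.reg 40) 0)
  (.seq (.assign 45 (.reg 4))
  (.seq (callProg (genProg d) (place 6 7 5) 1 1 (.reg 43) 0)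
  (.seq (.assign 6 (.reg 4)) (.seq (.assign 5 (.reg 45)) (.seq (.assign 4 (.reg 44))
    (.seq (.assign 1 (.reg 41)) (.seq (.assign 2 (.reg 42)) (.assign 3 (.reg 43))))))))))))

theorem length_read (s : State w) (A : ℕ) (L : BitVec w) : (s.read A L).length = L.toNat := by
  simp [State.read]

theorem getD_read (s : State w) (A : ℕ) (L : BitVec w) {q : ℕ} (hq : q < L.toNat) :
    ((s.read A L).getD q 0).toNat = s.arr A q := by
  rw [List.getD_eq_getElem _ _ (by rwa [length_read])]
  simp [State.read, State.arr]

theorem certified_read {d n A : ℕ} {x : Lists} {L : BitVec w}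
    (h : x.Certified d n (s.arr A) L.toNat) :
    x.Certified d n (fun q => ((s.read A L).getD q 0).toNat) (s.read A L).length := by
  rw [length_read]
  exact Inst.Certifies.congr h fun q hq => (getD_read s A L hq).symm

theorem fits_messageOf (s : State w) : (messageOf s).Fits := by
  simp only [Message.Fits, messageOf, length_read]
  exact ⟨BitVec.isLt _, BitVec.isLt _, BitVec.isLt _⟩

/-- Being the first solution is exactly what makes the three prefix instances unsolvable, so the
generator succeeds on each of them. The lengths of the first two certificates are saved at once, as
each call overwrites register 4. -/
theorem run_messageProg {d n : ℕ} {x : Lists} {y : Triple} (hwd : (d + 40) * digits n ≤ w)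
    (hx : x.IsInput n d) (hy : IsLexFirst x y) (h40 : s.rval 40 = n)
    (h41 : s.rval 41 = y.1) (h42 : s.rval 42 = y.2.1) (h43 : s.rval 43 = y.2.2)
    (ha : HoldsList s 0 x.a) (hb : HoldsList s 1 x.b) (hc : HoldsList s 2 x.c) :
    Run ω (messageProg d) s (3 * genTime d n + 100) (fun s' =>
      x.Accepts d n (messageOf s') ∧ (messageOf s').triple = y) := by
  have hD := digits_pos n
  have hw : 1 < 2 ^ w := Nat.one_lt_two_pow (by nlinarith)
  obtain ⟨hzs, ns1, ns2, ns3⟩ := isLexFirst_iff.1 hy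
  obtain ⟨hi, hj, hk, -⟩ := isZeroSum_iff.1 hzs
  have hla := hx.1
  have hlb := hx.2.1
  have hlc := hx.2.2.1
  have cr : ∀ x', (Expr.reg x').cost = 1 := fun _ => rfl
  have co : (1 : Expr).cost = 1 := rfl
  have S1 : Run ω (.seq (.store 6 0 (.get 0 (.reg 41))) (.store 7 0 (.get 1 (.reg 42)))) s 8
      (fun s₁ => HoldsList s₁ 6 [x.a.getD y.1 0] ∧ HoldsList s₁ 7 [x.b.getD y.2.1 0]) := by
    refine (Run.simple rfl ?_).time_mono (show _ ≤ 8 by decide)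
    refine And.intro (holdsList_singleton ?_) (holdsList_singleton ?_)
    · rw [← ha _ hi, ← h41]
      simp [Prog.den, State.setMem_mem, State.rval]
    · rw [← hb _ hj, ← h42]
      simp [Prog.den, State.setMem_mem, State.rval]
  refine Run.time_mono (Run.seq S1 (T₂ := 3 * genTime d n + 90) ?_) (by omega)
  rintro s₁ ⟨M6, M7⟩ hF₁
  have F₁ : Frame (44 :: 45 :: List.range 30)
      [3, 4, 5, 6, 7, 14, 15, 16, 17, 18, 19, 20, 21, 22, 23] s s₁ :=
    hF₁.mono (by decide) (by decide)
  have fixedReg : ∀ {s' : State w} {M x' k}, Frame (44 :: 45 :: List.range 30) M s s' → 40 ≤ x' →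
      x' ≠ 44 → x' ≠ 45 → s.rval x' = k → (Expr.reg x').Fixed s' k :=
    fun {s' M x' k} hF h7 h8 h8' h9 => Expr.fixed_reg h7 (by
      rw [hF.rval x' (by simp [h8, h8']; omega), h9])
  refine Run.time_mono (Run.seq (run_callGen (x := x.prefix₁ y) (n := n) hwd (by decide) (by decide)
    (hx.prefix₁ _) ns1 (by rw [F₁.rval 40 (by decide), h40])
    (fixedReg (x' := 41) F₁ (by norm_num) (by norm_num) (by norm_num)
      (h41.trans (by simp [Lists.prefix₁]; omega)))
    (fixedReg (x' := 40) F₁ (by norm_num) (by norm_num) (by norm_num) (h40.trans hlb.symm))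
    (fixedReg (x' := 40) F₁ (by norm_num) (by norm_num) (by norm_num) (h40.trans hlc.symm))
    (ha.congr (hF₁.mem 0 (by decide))).take (hb.congr (hF₁.mem 1 (by decide)))
    (hc.congr (hF₁.mem 2 (by decide)))) (T₂ := 2 * genTime d n + 60) ?_) (by
      simp only [cr]; omega)
  rintro s₂ ⟨k₁, hF₂⟩ -
  have S3 : Run ω (.assign 44 (.reg 4)) s₂ 2 (fun s₃ => s₃.rval 44 = s₂.rval 4) :=
    (Run.simple rfl (Prog.Post.assign rfl fun v hv => by simp [hv])).time_mono (by decide)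
  refine Run.time_mono (Run.seq S3 (T₂ := 2 * genTime d n + 58) ?_) (by omega)
  intro s₃ h44 hF₃
  have F₃ := (F₁.trans (hF₂.mono (List.subset_cons_of_subset _ (List.subset_cons_self _ _))
    (by decide))).trans (hF₃.mono (by decide) (by decide))
  have G₃ : Frame (44 :: List.range 30) [3, 14, 15, 16, 17, 18, 19, 20, 21, 22, 23] s₁ s₃ :=
    (hF₂.mono (List.subset_cons_self _ _) (List.Subset.refl _)).trans
      (hF₃.mono (by decide) (by decide))
  refine Run.time_mono (Run.seq (run_callGen (x := x.prefix₂ y) (n := n) (la := 1) hwd (by decide)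
    (by decide) (hx.prefix₂ hzs) ns2 (by rw [F₃.rval 40 (by decide), h40])
    (by rw [Lists.prefix₂, toList_getElem? hi]; exact Expr.fixed_one hw)
    (fixedReg (x' := 42) F₃ (by norm_num) (by norm_num) (by norm_num)
      (h42.trans (by simp [Lists.prefix₂]; omega)))
    (fixedReg (x' := 40) F₃ (by norm_num) (by norm_num) (by norm_num) (h40.trans hlc.symm))
    (by rw [Lists.prefix₂, toList_getElem? hi]; exact M6.congr (G₃.mem 6 (by decide)))
    (hb.congr (F₃.mem 1 (by decide))).take (hc.congr (F₃.mem 2 (by decide))))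
    (T₂ := genTime d n + 30) ?_) (by simp only [cr, co]; omega)
  rintro s₄ ⟨k₂, hF₄⟩ -
  have S5 : Run ω (.assign 45 (.reg 4)) s₄ 2 (fun s₅ => s₅.rval 45 = s₄.rval 4) :=
    (Run.simple rfl (Prog.Post.assign rfl fun v hv => by simp [hv])).time_mono (by decide)
  refine Run.time_mono (Run.seq S5 (T₂ := genTime d n + 28) ?_) (by omega)
  intro s₅ h45 hF₅
  have F₅ := (F₃.trans (hF₄.mono (List.subset_cons_of_subset _ (List.subset_cons_self _ _))
    (by decide))).trans (hF₅.mono (by decide) (by decide))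
  have G₅ : Frame (45 :: List.range 30) [4, 14, 15, 16, 17, 18, 19, 20, 21, 22, 23] s₃ s₅ :=
    (hF₄.mono (List.subset_cons_self _ _) (List.Subset.refl _)).trans
      (hF₅.mono (by decide) (by decide))
  refine Run.time_mono (Run.seq (run_callGen (x := x.prefix₃ y) (n := n) (la := 1) (lb := 1) hwd
    (by decide) (by decide) (hx.prefix₃ hzs) ns3 (by rw [F₅.rval 40 (by decide), h40])
    (by rw [Lists.prefix₃, toList_getElem? hi]; exact Expr.fixed_one hw)
    (by rw [Lists.prefix₃, toList_getElem? hj]; exact Expr.fixed_one hw)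
    (fixedReg (x' := 43) F₅ (by norm_num) (by norm_num) (by norm_num)
      (h43.trans (by simp [Lists.prefix₃]; omega)))
    (by
      rw [Lists.prefix₃, toList_getElem? hi]
      exact (M6.congr (G₃.mem 6 (by decide))).congr (G₅.mem 6 (by decide)))
    (by
      rw [Lists.prefix₃, toList_getElem? hj]
      exact (M7.congr (G₃.mem 7 (by decide))).congr (G₅.mem 7 (by decide)))
    (hc.congr (F₅.mem 2 (by decide))).take)
    (T₂ := 14) ?_) (by simp only [cr, co]; omega)
  rintro s₆ ⟨k₃, hF₆⟩ -
  have F₆ := F₅.trans (hF₆.mono (List.subset_cons_of_subset _ (List.subset_cons_self _ _))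
    (by decide))
  -- The order matters: register 4 still holds the length of the third certificate and must be moved
  -- to register 6 before it receives the first length.
  have S7 : Run ω (.seq (.assign 6 (.reg 4)) (.seq (.assign 5 (.reg 45)) (.seq (.assign 4 (.reg 44))
    (.seq (.assign 1 (.reg 41)) (.seq (.assign 2 (.reg 42)) (.assign 3 (.reg 43))))))) s₆ 12
      (fun s' => s'.rval 6 = s₆.rval 4 ∧ s'.rval 5 = s₆.rval 45 ∧ s'.rval 4 = s₆.rval 44 ∧
        s'.rval 1 = s₆.rval 41 ∧ s'.rval 2 = s₆.rval 42 ∧ s'.rval 3 = s₆.rval 43) := by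
    refine (Run.simple rfl ?_).time_mono (show _ ≤ 12 from le_rfl)
    simp [Prog.Post, Prog.den]
    simp [State.rval]
  refine S7.frame.mono (by norm_num) ?_
  rintro s₇ ⟨⟨r6, r5, r4, r1, r2, r3⟩, hF₇⟩
  have htr : (messageOf s₇).triple = y := by
    refine Prod.ext ?_ (Prod.ext ?_ ?_)
    · exact r1.trans ((F₆.rval 41 (by decide)).trans h41)
    · exact r2.trans ((F₆.rval 42 (by decide)).trans h42)
    · exact r3.trans ((F₆.rval 43 (by decide)).trans h43)
  refine ⟨⟨by rwa [htr], ?_, ?_, ?_⟩, htr⟩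
  · rw [htr]
    refine certified_read ?_
    change (x.prefix₁ y).Certified d n (s₇.arr 3) (s₇.rval 4)
    rw [r4, hF₆.rval 44 (by decide), G₅.rval 44 (by decide), h44,
      show s₇.arr 3 = s₂.arr 3 from funext fun q => by
        rw [hF₇.arr 3 (by decide), hF₆.arr 3 (by decide), G₅.arr 3 (by decide),
          hF₃.arr 3 (by decide)]]
    exact k₁
  · rw [htr]
    refine certified_read ?_
    change (x.prefix₂ y).Certified d n (s₇.arr 4) (s₇.rval 5)
    rw [r5, hF₆.rval 45 (by decide), h45,
      show s₇.arr 4 = s₄.arr 4 from funext fun q => by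
        rw [hF₇.arr 4 (by decide), hF₆.arr 4 (by decide), hF₅.arr 4 (by decide)]]
    exact k₂
  · rw [htr]
    refine certified_read ?_
    change (x.prefix₃ y).Certified d n (s₇.arr 5) (s₇.rval 6)
    rw [r6, show s₇.arr 5 = s₆.arr 5 from funext fun q => by rw [hF₇.arr 5 (by decide)]]
    exact k₃

/-- The prover; it does not toss coins. -/
def prover (d : ℕ) : Prog :=
  .seq (.assign 40 (.reg 0)) (.seq tableProg (.seq searchProg
    (.ite (.reg 47) (messageProg d) .skip)))

def proverTime (d n : ℕ) : ℕ := 3 * genTime d n + n * (n * 38 + 14) + n * 18 + 130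

/-- The time bound is unconditional, whereas the message is specified for solvable inputs only. The
bound holds for every coin sequence, so the expected time needs no probabilistic argument. -/
theorem run_prover {d n : ℕ} {x : Lists} (hwd : (d + 40) * digits n ≤ w) (hx : x.IsInput n d) :
    Run ω (prover d) (proverStart w n x) (proverTime d n) (fun s' => Solvable x →
      x.Accepts d n (messageOf s') ∧ (messageOf s').triple = x.first) := by
  have hn := lt_two_pow_word hwd
  have hD := digits_pos n
  have hw : 1 < 2 ^ w := Nat.one_lt_two_pow (by nlinarith)
  obtain ⟨s, hs⟩ : ∃ s, s = proverStart w n x := ⟨_, rfl⟩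
  have h0 : s.rval 0 = n := by
    rw [hs]; exact (BitVec.toNat_ofNat _ _).trans (Nat.mod_eq_of_lt hn)
  have hx' := hx
  obtain ⟨hla, hlb, hlc, hxb⟩ := hx'
  have ha : HoldsList s 0 x.a := holdsList_of_mem (by omega) fun _ => by rw [hs]; rfl
  have hb : HoldsList s 1 x.b := holdsList_of_mem (by omega) fun _ => by rw [hs]; rfl
  have hc : HoldsList s 2 x.c := holdsList_of_mem (by omega) fun _ => by rw [hs]; rfl
  have h8 : ∀ v, s.mem 8 v = 0 := fun v => by rw [hs]; rfl
  rw [← hs]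
  have S1 : Run ω (.assign 40 (.reg 0)) s 2 (fun s₁ => s₁.rval 40 = n) :=
    (Run.simple rfl (Prog.Post.assign (Expr.Val.reg h0) fun v hv => by
      simp [hv])).time_mono (by decide)
  refine Run.time_mono (Run.seq S1 (T₂ := 3 * genTime d n + n * (n * 38 + 14) + n * 18 + 128) ?_)
    (by rw [proverTime]; omega)
  intro s₁ h₁ hF₁
  refine Run.time_mono (Run.seq (run_tableProg (l := x.c) hw (by rw [h₁, hlc])
    (hc.congr (hF₁.mem 2 (by decide))) (fun v => by rw [hF₁.mem 8 (by decide), h8]))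
    (T₂ := 3 * genTime d n + n * (n * 38 + 14) + 122) ?_) (by rw [hlc]; omega)
  intro s₂ h₂ hF₂
  rw [hlc] at h₂
  have F₂ : Frame [13, 40] [8] s s₂ := (hF₁.mono (by decide) (by decide)).trans
    (hF₂.mono (by decide) (by decide))
  have b40 : s₂.rval 40 = n := by rw [hF₂.rval 40 (by decide), h₁]
  refine Run.time_mono (Run.seq (run_searchProg hwd hw hx hn b40 (ha.congr (F₂.mem 0 (by decide)))
    (hb.congr (F₂.mem 1 (by decide))) h₂) (T₂ := 3 * genTime d n + 114) ?_) (by omega)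
  intro s₃ h₃ hF₃
  have c40 : s₃.rval 40 = n := by rw [hF₃.rval 40 (by decide), b40]
  have F₃ : Frame [13, 14, 15, 40, 41, 42, 43, 47] [8] s s₃ :=
    (F₂.mono (by decide) (by decide)).trans (hF₃.mono (by decide) (by decide))
  have cr : ∀ x', (Expr.reg x').cost = 1 := fun _ => rfl
  refine Run.time_mono (Run.ite (T := 3 * genTime d n + 100) (fun he => ?_) (fun he => ?_)) (by
    rw [cr]; omega)
  · rcases h₃ with ⟨h₃, -⟩ | ⟨-, y, hy, h41, h42, h43⟩
    · exact absurd h₃ he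
    · refine (run_messageProg hwd hx hy c40 h41 h42 h43 (ha.congr (F₃.mem 0 (by decide)))
        (hb.congr (F₃.mem 1 (by decide))) (hc.congr (F₃.mem 2 (by decide)))).mono le_rfl ?_
      rintro s' ⟨h4, h5⟩ hsol
      exact ⟨h4, h5.trans (hy.unique (Lists.isLexFirst_first hsol))⟩
  · refine (Run.skip ?_).time_mono (by omega)
    rintro ⟨y, hy⟩
    rcases h₃ with ⟨-, h₃⟩ | ⟨h₃, -⟩
    · exact absurd (Or.inl (by have := (isZeroSum_iff.1 hy).1; omega)) (h₃ y hy)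
    · exact absurd he h₃

end WordRAM

/-! ### The running times -/

namespace ThreeSum

open WordRAM

theorem le_two_pow_halfDigits (n : ℕ) : n ≤ 2 ^ (2 * halfDigits n) :=
  (lt_two_pow_digits n).le.trans
    (Nat.pow_le_pow_right (by norm_num) (halfDigits_bounds n).2.1)

/-- All running times are compared with (digits n)^6 · 2^(e·h), where e = 3 for the verifiers and e
= 4 for the prover. The exponent 6 is dictated by `certBound`; the cost of a count needs only the
third power. The constant is 7^3 · 4. -/
theorem cube_mul_le (n : ℕ) :
    (3 * halfDigits n + 4) ^ 3 * (2 ^ (3 * halfDigits n) + 3 * n) ≤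
      1372 * (digits n ^ 6 * 2 ^ (3 * halfDigits n)) := by
  obtain ⟨-, -, h2⟩ := halfDigits_bounds n
  have hD := digits_pos n
  have hn : n ≤ 2 ^ (3 * halfDigits n) := (le_two_pow_halfDigits n).trans
    (Nat.pow_le_pow_right (by norm_num) (by omega))
  calc (3 * halfDigits n + 4) ^ 3 * (2 ^ (3 * halfDigits n) + 3 * n)
      ≤ (7 * digits n) ^ 3 * (4 * 2 ^ (3 * halfDigits n)) := by gcongr <;> omega
    _ = 1372 * (digits n ^ 3 * 2 ^ (3 * halfDigits n)) := by ring
    _ ≤ _ := by gcongr; omega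

theorem certBound_le (d n : ℕ) : certBound d (digits n) (halfDigits n) ≤
    8 * (d + 2) ^ 3 * (digits n ^ 6 * 2 ^ (3 * halfDigits n)) := by
  obtain ⟨-, -, h2⟩ := halfDigits_bounds n
  have hD := digits_pos n
  calc certBound d (digits n) (halfDigits n)
      ≤ 2 ^ (3 * halfDigits n) * (2 * digits n * (d * digits n + 2 * digits n)) ^ 3 := by
        unfold certBound; gcongr <;> omega
    _ = _ := by ring

theorem exists_certTime_le (d : ℕ) :
    ∃ K, ∀ n, 3 * certTime d n + 200 ≤ K * (digits n ^ 6 * 2 ^ (3 * halfDigits n)) := by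
  refine ⟨3 * ((d + 20) * 60 + 60 + 13720000 + 8 * (d + 2) ^ 3 * 130 + 400) + 200, fun n => ?_⟩
  have h1 := cube_mul_le n
  have h2 := certBound_le d n
  have hD := digits_pos n
  have h3 : digits n ≤ digits n ^ 6 * 2 ^ (3 * halfDigits n) :=
    (Nat.le_self_pow (by norm_num) _).trans (Nat.le_mul_of_pos_right _ (by positivity))
  have h4 : n ≤ digits n ^ 6 * 2 ^ (3 * halfDigits n) :=
    ((le_two_pow_halfDigits n).trans (Nat.pow_le_pow_right (by norm_num) (by omega))).trans
      (Nat.le_mul_of_pos_left _ (by positivity))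
  have h5 : 1 ≤ digits n ^ 6 * 2 ^ (3 * halfDigits n) := hD.trans_le h3
  unfold certTime
  generalize digits n ^ 6 * 2 ^ (3 * halfDigits n) = Y at *
  nlinarith [Nat.mul_le_mul_left ((d + 20) * 60) h3]

theorem exists_proverTime_le (d : ℕ) :
    ∃ K, ∀ n, proverTime d n ≤ K * (digits n ^ 6 * 2 ^ (4 * halfDigits n)) := by
  refine ⟨3 * ((d + 20) * 60 + 60 + 3 * 13720000 + 120 + 90 + 11 + 40 + 8 * (d + 2) ^ 3 * 31 + 37
    + 200) + 52 + 18 + 130, fun n => ?_⟩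
  have hD := digits_pos n
  have hX : 0 < 2 ^ halfDigits n := by positivity
  have e1 : digits n ^ 6 * 2 ^ (4 * halfDigits n) =
      2 ^ halfDigits n * (digits n ^ 6 * 2 ^ (3 * halfDigits n)) := by ring
  have h1 := Nat.mul_le_mul_left (2 ^ halfDigits n) (cube_mul_le n)
  have h0 : digits n ^ 6 * 2 ^ (3 * halfDigits n) ≤ digits n ^ 6 * 2 ^ (4 * halfDigits n) := by
    rw [e1]; exact Nat.le_mul_of_pos_left _ hX
  have h2 : certBound d (digits n) (halfDigits n) ≤
      8 * (d + 2) ^ 3 * (digits n ^ 6 * 2 ^ (4 * halfDigits n)) :=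
    (certBound_le d n).trans (Nat.mul_le_mul_left _ h0)
  have h3 : digits n ≤ digits n ^ 6 * 2 ^ (4 * halfDigits n) :=
    (Nat.le_self_pow (by norm_num) _).trans (Nat.le_mul_of_pos_right _ (by positivity))
  have h4 : 2 ^ (4 * halfDigits n) ≤ digits n ^ 6 * 2 ^ (4 * halfDigits n) :=
    Nat.le_mul_of_pos_left _ (by positivity)
  have h5 : n ≤ digits n ^ 6 * 2 ^ (4 * halfDigits n) :=
    ((le_two_pow_halfDigits n).trans (Nat.pow_le_pow_right (by norm_num) (by omega))).trans h4
  have h6 : 1 ≤ digits n ^ 6 * 2 ^ (4 * halfDigits n) := hD.trans_le h3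
  have h7 : n * n ≤ digits n ^ 6 * 2 ^ (4 * halfDigits n) := by
    refine le_trans ?_ h4
    calc n * n ≤ 2 ^ (2 * halfDigits n) * 2 ^ (2 * halfDigits n) :=
          Nat.mul_le_mul (le_two_pow_halfDigits n) (le_two_pow_halfDigits n)
      _ = _ := by ring
  have h8 : 2 ^ halfDigits n ≤ digits n ^ 6 * 2 ^ (4 * halfDigits n) :=
    (Nat.pow_le_pow_right (by norm_num) (by omega)).trans h4
  have h9 : 2 ^ (3 * halfDigits n) ≤ digits n ^ 6 * 2 ^ (4 * halfDigits n) :=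
    (Nat.pow_le_pow_right (by norm_num) (by omega)).trans h4
  have e2 : 2 ^ halfDigits n * (1372 * (digits n ^ 6 * 2 ^ (3 * halfDigits n))) =
      1372 * (digits n ^ 6 * 2 ^ (4 * halfDigits n)) := by rw [e1]; ring
  rw [e2] at h1
  unfold proverTime genTime
  clear h0 e1 e2
  generalize digits n ^ 6 * 2 ^ (4 * halfDigits n) = Y at *
  generalize 2 ^ (3 * halfDigits n) = X₃ at *
  generalize 2 ^ halfDigits n = X at *
  generalize certBound d (digits n) (halfDigits n) = C at *
  generalize (3 * halfDigits n + 4) ^ 3 * (X₃ + 3 * n) = Z at *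
  nlinarith [Nat.mul_le_mul_left ((d + 20) * 60) h3]

theorem digits_le_log {n : ℕ} (hn : 3 ≤ n) : (digits n : ℝ) ≤ 3 * Real.log n := by
  have h1 : (0 : ℝ) < n := by positivity
  have h2 : 1 ≤ Real.log n := by
    rw [Real.le_log_iff_exp_le h1]
    exact Real.exp_one_lt_d9.le.trans (by norm_num; exact le_trans (by norm_num) (Nat.cast_le.2 hn))
  have h3 : (Nat.log 2 n : ℝ) * Real.log 2 ≤ Real.log n := by
    rw [← Real.log_pow]
    exact Real.log_le_log (by positivity) (mod_cast Nat.pow_log_le_self 2 (by omega))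
  have h4 := Real.log_two_gt_d9
  have h5 : (Nat.log 2 n : ℝ) ≤ 2 * Real.log n := by
    have : (0 : ℝ) ≤ Nat.log 2 n := by positivity
    nlinarith
  rw [digits]
  push_cast
  linarith

theorem two_pow_halfDigits_le {n : ℕ} (hn : 0 < n) :
    (2 : ℝ) ^ halfDigits n ≤ 2 * (n : ℝ) ^ (1 / 2 : ℝ) := by
  rw [← Real.sqrt_eq_rpow]
  refine abs_le_of_sq_le_sq' ?_ (by positivity) |>.2
  rw [mul_pow, Real.sq_sqrt (by positivity), ← pow_mul]
  have h1 : 2 ^ (halfDigits n * 2) ≤ 2 ^ (digits n + 1) :=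
    Nat.pow_le_pow_right (by norm_num) (by have := halfDigits_bounds n; omega)
  have h2 : 2 ^ Nat.log 2 n ≤ n := Nat.pow_log_le_self 2 hn.ne'
  have h3 : 2 ^ (digits n + 1) = 4 * 2 ^ Nat.log 2 n := by rw [digits]; ring
  have h4 : 2 ^ (halfDigits n * 2) ≤ 2 ^ 2 * n := by omega
  exact_mod_cast h4

/-- As 2^h is at most 2√n, the factor 2^(e·h) becomes n^(e/2), and the digits are absorbed by the
sixth power of the logarithm. The cases e = 3 and e = 4 are the two bounds of the theorem. -/
theorem isSoftO_of_le {f : ℕ → ℕ} {K e : ℕ}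
    (h : ∀ n, f n ≤ K * (digits n ^ 6 * 2 ^ (e * halfDigits n))) :
    IsSoftO (fun n => (f n : ℝ)) fun n => (n : ℝ) ^ (e / 2 : ℝ) := by
  refine ⟨6, IsBigO.of_bound (K * (3 ^ 6 * 2 ^ e)) ?_⟩
  filter_upwards [eventually_ge_atTop 3] with n hn
  have hl : 0 ≤ Real.log n := Real.log_natCast_nonneg n
  rw [Real.norm_of_nonneg (by positivity), Real.norm_of_nonneg (by positivity)]
  have h2 : (n : ℝ) ^ (e / 2 : ℝ) = ((n : ℝ) ^ (1 / 2 : ℝ)) ^ e := by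
    rw [← Real.rpow_mul_natCast (by positivity)]; congr 1; ring
  calc (f n : ℝ) ≤ K * ((digits n : ℝ) ^ 6 * ((2 : ℝ) ^ halfDigits n) ^ e) := by
        rw [← pow_mul, mul_comm (halfDigits n)]; exact_mod_cast h n
    _ ≤ K * ((3 * Real.log n) ^ 6 * (2 * (n : ℝ) ^ (1 / 2 : ℝ)) ^ e) := by
        gcongr
        · exact digits_le_log hn
        · exact two_pow_halfDigits_le (by omega)
    _ = _ := by rw [h2]; ring

/-! ### The theorem -/

theorem runTime_le {w T : ℕ} {ω : ℕ → Bool} {p : Prog} {s : State w} {Q : State w → Prop}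
    (h : Run ω p s T Q) : runTime p s ω ≤ T := by
  obtain ⟨s', t, h1, h2, -⟩ := h
  exact (iInf₂_le t ⟨s', h1⟩).trans (mod_cast h2)

section

variable {d n w : ℕ} {x : Lists} {m : Message w}

/-- The heart of canonical soundness: soundness of the three certificates leaves no solution before
the accepted triple. -/
theorem Lists.Accepts.isLexFirst (hx : x.IsInput n d) (h : x.Accepts d n m) :
    IsLexFirst x m.triple :=
  isLexFirst_iff.2 ⟨h.1, h.2.1.not_solvable (hx.prefix₁ _), h.2.2.1.not_solvable (hx.prefix₂ h.1),
    h.2.2.2.not_solvable (hx.prefix₃ h.1)⟩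

theorem accepts_iff (hwd : (d + 40) * digits n ≤ w) (hx : x.IsInput n d) (hm : m.Fits) :
    x.Accepts d n m ↔ IsZeroSum x m.triple ∧
      CertAccepts w (certProg d) n (x.prefix₁ m.triple) m.π₁ ∧
      CertAccepts w (certProg d) n (x.prefix₂ m.triple) m.π₂ ∧
      CertAccepts w (certProg d) n (x.prefix₃ m.triple) m.π₃ := by
  refine and_congr_right fun h => ?_
  rw [certAccepts_iff hwd (hx.prefix₁ _) hm.1, certAccepts_iff hwd (hx.prefix₂ h) hm.2.1,
    certAccepts_iff hwd (hx.prefix₃ h) hm.2.2]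

theorem outputs_some_of_accepts (hwd : (d + 40) * digits n ≤ w) (hx : x.IsInput n d) (hm : m.Fits)
    (h : x.Accepts d n m) : Outputs w (verifier d) n x m (some m.triple) := by
  obtain ⟨s, t, h1, -, h2, -⟩ := run_verifier (ω := fun _ => false) hwd hx hm
  exact ⟨s, t, h1, h2 h⟩

theorem outputs_none_of_not_accepts (hwd : (d + 40) * digits n ≤ w) (hx : x.IsInput n d)
    (hm : m.Fits) (h : ¬ x.Accepts d n m) : Outputs w (verifier d) n x m none := by
  obtain ⟨s, t, h1, -, -, h2⟩ := run_verifier (ω := fun _ => false) hwd hx hm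
  exact ⟨s, t, h1, h2 h⟩

theorem Outputs.unique {V : Prog} {o o' : Option Triple} (h : Outputs w V n x m o)
    (h' : Outputs w V n x m o') : o = o' := by
  obtain ⟨s, t, h1, rfl⟩ := h
  obtain ⟨s', t', h2, rfl⟩ := h'
  rw [(Exec.det h1 h2).1]

end

theorem checksPrefixes (d : ℕ) : ChecksPrefixes d (d + 40) (certProg d) (verifier d) := by
  intro n x hx m hm y
  by_cases h : x.Accepts d n m
  · have h1 := outputs_some_of_accepts le_rfl hx hm h
    constructor
    · intro h2
      obtain rfl : y = m.triple := Option.some_injective _ (Outputs.unique h2 h1)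
      exact ⟨rfl, (accepts_iff le_rfl hx hm).1 h⟩
    · rintro ⟨rfl, -⟩
      exact h1
  · constructor
    · intro h2
      exact absurd (Outputs.unique h2 (outputs_none_of_not_accepts le_rfl hx hm h)) (by simp)
    · rintro ⟨rfl, h2⟩
      exact absurd ((accepts_iff le_rfl hx hm).2 h2) h

theorem isPseudoDeterministicProof (d : ℕ) :
    IsPseudoDeterministicProof d (d + 40) (verifier d) (prover d) Lists.first
      (fun n => (3 * certTime d n + 200 : ℕ)) fun n => (proverTime d n : ℕ) where
  coinFree := coinFree_verifier d
  verifier_time n x hx m hm := by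
    obtain ⟨s, t, h1, h2, -⟩ := run_verifier (ω := fun _ => false) le_rfl hx hm
    exact ⟨s, t, h1, mod_cast h2⟩
  prover_time n x hx := by
    have : IsProbabilityMeasure coinTosses := by unfold coinTosses; infer_instance
    calc ∫⁻ ω, runTime (prover d) (proverStart ((d + 40) * digits n) n x) ω ∂coinTosses
        ≤ ∫⁻ _, (proverTime d n : ℝ≥0∞) ∂coinTosses :=
          lintegral_mono fun ω => runTime_le (run_prover le_rfl hx)
      _ = ENNReal.ofReal (proverTime d n : ℕ) := by simp
  canonical n x _ h := (Lists.isLexFirst_first h).1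
  completeness n x hx h := Eventually.of_forall fun ω => by
    obtain ⟨s, t, h1, -, h2⟩ := run_prover (ω := ω) le_rfl hx
    obtain ⟨h3, h4⟩ := h2 h
    refine ⟨messageOf s, ⟨s, t, h1, rfl⟩, ?_⟩
    rw [← h4]
    exact outputs_some_of_accepts le_rfl hx (fits_messageOf s) h3
  canonical_soundness n x hx h m hm := by
    by_cases h1 : x.Accepts d n m
    · rw [(Lists.isLexFirst_first h).unique (h1.isLexFirst hx)]
      exact Or.inl (outputs_some_of_accepts le_rfl hx hm h1)
    · exact Or.inr (outputs_none_of_not_accepts le_rfl hx hm h1)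
  -- Without solutions the certificates are irrelevant: acceptance would require the triple itself
  -- to be zero-sum.
  soundness n x hx h m hm :=
    outputs_none_of_not_accepts le_rfl hx hm fun h1 => h ⟨_, h1.1⟩

end ThreeSum

theorem mainTheorem3 (d : ℕ) :
    ∃ (κ : ℕ) (W V P : WordRAM.Prog) (c : ThreeSum.Lists → ThreeSum.Triple) (T₁ T₂ : ℕ → ℝ),
      d < κ ∧
      IsSoftO T₁ (fun n => (n : ℝ) ^ (3 / 2 : ℝ)) ∧
      IsSoftO T₂ (fun n => (n : ℝ) ^ 2) ∧
      (∀ x, ThreeSum.Solvable x → ThreeSum.IsLexFirst x (c x)) ∧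
      ThreeSum.IsPseudoDeterministicProof d κ V P c T₁ T₂ ∧
      ThreeSum.IsNoSolutionProof d κ W T₁ ∧
      ThreeSum.ChecksPrefixes d κ W V := by
  obtain ⟨K₁, h₁⟩ := ThreeSum.exists_certTime_le d
  obtain ⟨K₂, h₂⟩ := ThreeSum.exists_proverTime_le d
  have s₁ := ThreeSum.isSoftO_of_le h₁
  have s₂ := ThreeSum.isSoftO_of_le h₂
  norm_num at s₂
  -- Words of (d + 40)·digits n bits leave room for the shifted entries, for `certBound` and for the
  -- count times the transform factor. A single T₁ serves both verifiers, since the bound for the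
  -- full verifier is three certificate checks plus a constant.
  exact ⟨d + 40, WordRAM.certProg d, WordRAM.verifier d, WordRAM.prover d, ThreeSum.Lists.first,
    _, _, by omega, by exact_mod_cast s₁, s₂, fun _ => ThreeSum.Lists.isLexFirst_first,
    ThreeSum.isPseudoDeterministicProof d, ThreeSum.isNoSolutionProof fun n => by
      push_cast; linarith [(Nat.cast_nonneg (WordRAM.certTime d n) : (0 : ℝ) ≤ _)],
    ThreeSum.checksPrefixes d⟩
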